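/- **Setting.** For a graph $G=(V,E)$ with $n$ vertices and $x\in\mathbb R^E_{\ge 0}$ write $x(v)=\sum_{e\ni v}x_e$, $\|x\|=\sum_e x_e$, $\mathrm{supp}(x)=\{e: x_e>0\}$, and $x_{\min}=\min_{e\in \mathrm{supp}(x)}x_e$; $x$ is a *fractional matching* if $x(v)\le 1$ for all $v$. A vector $x'\in\mathbb R^E_{\ge0}$ is an $(\varepsilon,\delta)$-*coarsening* of $x$ if (C0) $\mathrm{supp}(x')\subseteq\mathrm{supp}(x)$; (C1) $|\|x\|-\|x'\||\le\varepsilon\|x\|+\varepsilon$; (C2) $\sum_v(|x(v)-x'(v)|-\varepsilon)^+\le\varepsilon\|x\|+\varepsilon$; (C3) $x'_e\in\{0\}\cup[\delta,2\delta)$ if $x_e<\delta$, and $x'_e=x_e$ otherwise. An $\eta$-*approximate rounding* of $x$ is a matching $M\subseteq\mathrm{supp}(x)$ with $|M|\ge(1-\eta)\|x\|$. A *dynamic algorithm* is a data structure with the operations $\mathrm{init}(x)$ (given the list of the support of $x$) and $\mathrm{update}(e,\nu)$ (sets $x_e\leftarrow\nu$), under the promise that $x$ is always a fractional matching in $G$;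 $\mathrm{init}$ may also be invoked again later. A *dynamic $(\varepsilon,\delta)$-coarsening algorithm* maintains, after each operation, an explicit list of the support, with values, of an $(\varepsilon,\delta)$-coarsening of the current $x$. An *$\eta$-approximate dynamic rounding algorithm* maintains an explicit list of an $\eta$-approximate rounding of the current $x$; it is one *for $x_{\min}\ge\delta$* if this is only required under the additional promise that $x_{\min}\ge\delta$ at all times. Algorithms are programs of a randomized word RAM that receive $n,\varepsilon,\delta$ as input and whose inputs and outputs are fixed-point numbers with $F$ fractional bits (so $\varepsilon$, $\delta$ and all values are multiples of $2^{-F}$), where $0<\varepsilon<1$, $0<\delta\le 1$, $2^{-F}\le\varepsilon\delta$, and words have $w\ge 8\log_2((n+2)2^F)$ bits. The operations are chosen by an adversary that may stop at any time; it is *oblivious* if its choices do not depend on the algorithm, *output-adaptive* if they may depend on the outputs so far, and *adaptive* if they may depend on the internal states so far. Correctness and termination of each operation are required almost surely. Running times are expected and amortized: $\mathrm{update}$ time $t_U$ and $\mathrm{init}$ time $|\mathrm{supp}(x)|\cdot t_I$ mean that, for every $T$, the expected number of steps in the first $T$ operations is at most the expectation of $t_U$ times the number of updates among them plus $t_I$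 times the sum of $\max(1,|\mathrm{supp}(x)|)$ over the initializations among them. (For deterministic algorithms nothing is random.) **Lemma.** There is an absolute constant $K>0$ such that for all programs $\mathcal C$ and $\mathcal R$ there is a program $\mathcal R^*$, deterministic if both $\mathcal C$ and $\mathcal R$ are, such that the following holds for all $G,\varepsilon,\delta,F,w$ as above, for each of the three kinds of adversaries (oblivious, output-adaptive, adaptive), and for all real $t_U^{\mathcal C},t_I^{\mathcal C},t_U^{\mathcal R},t_I^{\mathcal R}\ge 1$ (which may thus depend on $\varepsilon,\delta,n$). Suppose that against all adversaries of this kind $\mathcal C$ is a dynamic $(\varepsilon,\delta)$-coarsening algorithm with $\mathrm{update}$ time $t_U^{\mathcal C}$ and $\mathrm{init}$ time $|\mathrm{supp}(x)|\cdot t_I^{\mathcal C}$, and $\mathcal R$ is an $\varepsilon$-approximate dynamic rounding algorithm for $x_{\min}\ge\delta$ with $\mathrm{update}$ time $t_U^{\mathcal R}$ and $\mathrm{init}$ time $|\mathrm{supp}(x)|\cdot t_I^{\mathcal R}$. Then against all adversaries of this kind $\mathcal R^*$ is a $K(\varepsilon+\delta)$-approximate dynamic rounding algorithm (with no lower bound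 on $x_{\min}$), with $\mathrm{update}$ time $K\,(t_U^{\mathcal C}+t_U^{\mathcal R}+\varepsilon^{-1}t_I^{\mathcal R})$ and $\mathrm{init}$ time $K\,|\mathrm{supp}(x)|\,(t_I^{\mathcal C}+t_I^{\mathcal R})$. -/

import Mathlib

open MeasureTheory

namespace DynMatching

noncomputable section

/-! ## Fractional matchings, coarsenings, roundings

Vectors of `ℝ ^ E` are functions on `Sym2 V` that vanish off the edge set. -/

section Vectors

variable {V : Type} [Fintype V] [DecidableEq V]

/-- The value `x(v)`, the sum of `x_e` over the edges `e` at `v`. -/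
def degree (x : Sym2 V → ℝ) (v : V) : ℝ := ∑ u, x s(v, u)

/-- The norm `‖x‖`, the sum of `x_e` over all edges (the vectors at hand are nonnegative). -/
def norm (x : Sym2 V → ℝ) : ℝ := ∑ e, x e

/-- The distance `d_V^ε(x, y) = ∑_v (|x(v) - y(v)| - ε)⁺`. -/
def vertexDist (ε : ℝ) (x y : Sym2 V → ℝ) : ℝ :=
  ∑ v, max 0 (|degree x v - degree y v| - ε)

/-- `x` is a fractional matching of the graph `G`. -/
structure IsFracMatching (G : SimpleGraph V) (x : Sym2 V → ℝ) : Prop where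
  nonneg : ∀ e, 0 ≤ x e
  support : ∀ e, x e ≠ 0 → e ∈ G.edgeSet
  degree_le : ∀ v, degree x v ≤ 1

/-- `x'` is an `(ε, δ)`-coarsening of `x`. -/
structure IsCoarsening (ε δ : ℝ) (x x' : Sym2 V → ℝ) : Prop where
  nonneg : ∀ e, 0 ≤ x' e
  containment : ∀ e, x' e ≠ 0 → x e ≠ 0
  global_slack : |norm x - norm x'| ≤ ε * norm x + ε
  vertex_slack : vertexDist ε x x' ≤ ε * norm x + ε
  edge_small : ∀ e, x e < δ → x' e = 0 ∨ (δ ≤ x' e ∧ x' e < 2 * δ)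
  edge_large : ∀ e, δ ≤ x e → x' e = x e

/-- `M` is an `η`-approximate rounding of `x`: a matching inside the support of `x`, of size at
least `(1 - η) ‖x‖`. -/
structure IsApproxRounding (η : ℝ) (x : Sym2 V → ℝ) (M : Finset (Sym2 V)) : Prop where
  support : ∀ e ∈ M, 0 < x e
  matching : ∀ e ∈ M, ∀ f ∈ M, ∀ v, v ∈ e → v ∈ f → e = f
  size : (1 - η) * norm x ≤ (M.card : ℝ)

end Vectors

/-! ## The word RAM

Programs of a randomized word RAM with `w`-bit words, in structured form.  A program uses finitely
many registers, memory banks and sources of random words, each named by a natural number; the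
names are part of the program text, only contents and addresses are data. -/

/-- The binary machine instructions. -/
inductive BinOp
  | add | sub | mul | div | mod | lt | eq | land | lor | xor | shl | shr

/-- Their meaning on words, which are natural numbers below `2 ^ w`; subtraction stops at zero. -/
def BinOp.eval (w : ℕ) : BinOp → ℕ → ℕ → ℕ
  | .add, a, b => (a + b) % 2 ^ w
  | .sub, a, b => a - b
  | .mul, a, b => (a * b) % 2 ^ w
  | .div, a, b => a / b
  | .mod, a, b => a % b
  | .lt, a, b => if a < b then 1 else 0
  | .eq, a, b => if a = b then 1 else 0
  | .land, a, b => a &&& b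
  | .lor, a, b => a ||| b
  | .xor, a, b => a ^^^ b
  | .shl, a, b => (a <<< b) % 2 ^ w
  | .shr, a, b => a >>> b

/-- Programs.  In `load x a y` and `store a y x` the register `y` holds the address inside the
memory bank `a`; `rand x r` draws a uniformly random word from the source `r` into `x`;
`branch x p q` runs `p` if `x` is nonzero and `q` otherwise; `loop x p` runs `p` while `x` is
nonzero. -/
inductive Prog
  | skip
  | const (x c : ℕ)
  | copy (x y : ℕ)
  | binop (o : BinOp) (x y z : ℕ)
  | load (x a y : ℕ)
  | store (a y x : ℕ)
  | rand (x r : ℕ)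
  | seq (p q : Prog)
  | branch (x : ℕ) (p q : Prog)
  | loop (x : ℕ) (p : Prog)

/-- A program without random instructions. -/
def Prog.RandFree : Prog → Prop
  | .rand _ _ => False
  | .seq p q => p.RandFree ∧ q.RandFree
  | .branch _ p q => p.RandFree ∧ q.RandFree
  | .loop _ p => p.RandFree
  | _ => True

/-- The machine state: registers, memory banks, and how many words were drawn from each source. -/
@[ext] structure State where
  reg : ℕ → ℕ
  mem : ℕ → ℕ → ℕ
  drawn : ℕ → ℕ

/-- The all-zero state. -/
def State.blank : State := ⟨fun _ => 0, fun _ _ => 0, fun _ => 0⟩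

/-- Write the word `c` into register `x`. -/
def State.setReg (σ : State) (x c : ℕ) : State := { σ with reg := Function.update σ.reg x c }

/-- Write the word `c` at address `y` of bank `a`. -/
def State.setMem (σ : State) (a y c : ℕ) : State :=
  { σ with mem := Function.update σ.mem a (Function.update (σ.mem a) y c) }

/-- The random words: `ω (r, i)` is the `i`-th word of source `r`. -/
abbrev Tape (w : ℕ) : Type := ℕ × ℕ → Fin (2 ^ w)

/-- All random words are independent and uniform. -/
def tapeMeasure (w : ℕ) : Measure (Tape w) :=
  Measure.infinitePi fun _ : ℕ × ℕ => (PMF.uniformOfFintype (Fin (2 ^ w))).toMeasure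

/-- `Exec w ω p σ σ' c`: with the random words `ω`, program `p` started in state `σ` halts in
state `σ'` after `c` steps.  Every instruction and every test of a branch or a loop is one step. -/
inductive Exec (w : ℕ) (ω : Tape w) : Prog → State → State → ℕ → Prop
  | skip (σ) : Exec w ω .skip σ σ 1
  | const (σ x c) : Exec w ω (.const x c) σ (σ.setReg x (c % 2 ^ w)) 1
  | copy (σ x y) : Exec w ω (.copy x y) σ (σ.setReg x (σ.reg y)) 1
  | binop (σ o x y z) :
      Exec w ω (.binop o x y z) σ (σ.setReg x (o.eval w (σ.reg y) (σ.reg z))) 1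
  | load (σ x a y) : Exec w ω (.load x a y) σ (σ.setReg x (σ.mem a (σ.reg y))) 1
  | store (σ a y x) : Exec w ω (.store a y x) σ (σ.setMem a (σ.reg y) (σ.reg x)) 1
  | rand (σ x r) :
      Exec w ω (.rand x r) σ
        { σ.setReg x (ω (r, σ.drawn r)) with
          drawn := Function.update σ.drawn r (σ.drawn r + 1) } 1
  | seq {p q σ₁ σ₂ σ₃ c d} (hp : Exec w ω p σ₁ σ₂ c) (hq : Exec w ω q σ₂ σ₃ d) :
      Exec w ω (.seq p q) σ₁ σ₃ (c + d)
  | branch_true {x p q σ σ' c} (hx : σ.reg x ≠ 0) (hp : Exec w ω p σ σ' c) :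
      Exec w ω (.branch x p q) σ σ' (c + 1)
  | branch_false {x p q σ σ' c} (hx : σ.reg x = 0) (hq : Exec w ω q σ σ' c) :
      Exec w ω (.branch x p q) σ σ' (c + 1)
  | loop_stop {x p σ} (hx : σ.reg x = 0) : Exec w ω (.loop x p) σ σ 1
  | loop_step {x p σ₁ σ₂ σ₃ c d} (hx : σ₁.reg x ≠ 0) (hp : Exec w ω p σ₁ σ₂ c)
      (hl : Exec w ω (.loop x p) σ₂ σ₃ d) : Exec w ω (.loop x p) σ₁ σ₃ (c + d + 1)

/-! ## Dynamic algorithms -/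

/-- The parameters of a problem instance: a graph on `n` vertices, the word length `w`, and the
error parameters `ε = e / 2 ^ F` and `δ = d / 2 ^ F`.  All fractional values are fixed-point
numbers with `F` fractional bits, so a value is a word `k` that stands for `k / 2 ^ F`.  This
precision resolves `ε δ`, and the words hold a constant number of vertex names and values. -/
structure Params where
  n : ℕ
  F : ℕ
  w : ℕ
  e : ℕ
  d : ℕ
  G : SimpleGraph (Fin n)
  e_pos : 0 < e
  e_lt : e < 2 ^ F
  d_pos : 0 < d
  d_le : d ≤ 2 ^ F
  precision : 2 ^ F ≤ e * d
  wordSize : ((n + 2) * 2 ^ F) ^ 8 ≤ 2 ^ w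

/-- The error parameter `ε` of the instance. -/
def Params.eps (I : Params) : ℝ := I.e / 2 ^ I.F

/-- The weight threshold `δ` of the instance. -/
def Params.delta (I : Params) : ℝ := I.d / 2 ^ I.F

/-- A vector of words, indexed by edges. -/
abbrev WordVec (I : Params) : Type := Sym2 (Fin I.n) → ℕ

/-- The real vector that a vector of words stands for. -/
def WordVec.toReal {I : Params} (X : WordVec I) : Sym2 (Fin I.n) → ℝ :=
  fun e => (X e : ℝ) / 2 ^ I.F

/-- An entry `(u, v, k)` says that the edge `uv` has the value word `k`. -/
abbrev Entry (I : Params) : Type := Fin I.n × Fin I.n × ℕ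

/-- The list enumerates the support of a vector: distinct edges, each given by its endpoints in
increasing order, with nonzero value words. -/
def IsEntryList (I : Params) (l : List (Entry I)) : Prop :=
  (∀ a ∈ l, a.1 < a.2.1 ∧ I.G.Adj a.1 a.2.1 ∧ 0 < a.2.2) ∧
    (l.map fun a => s(a.1, a.2.1)).Nodup

/-- The vector enumerated by a list. -/
def vecOf {I : Params} (l : List (Entry I)) : WordVec I :=
  fun e => (l.map fun a => if s(a.1, a.2.1) = e then a.2.2 else 0).sum

/-- The operations of the data structures: `start l` is the initialization with the vector
enumerated by `l`, and `update u v k` sets the value word of the edge `uv` to `k`. -/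
inductive Op (I : Params)
  | start (l : List (Entry I))
  | update (u v : Fin I.n) (k : ℕ)

/-- `Legal promise x op X`: if the current vector is `x` (`none` before the first
initialization), then `op` may be invoked and makes `X` the current vector.  The promise on the
input must hold for `X`. -/
inductive Legal {I : Params} (promise : WordVec I → Prop) :
    Option (WordVec I) → Op I → WordVec I → Prop
  | start (x : Option (WordVec I)) (l : List (Entry I)) (hl : IsEntryList I l)
      (h : promise (vecOf l)) : Legal promise x (.start l) (vecOf l)
  | update (x : Option (WordVec I)) (X : WordVec I) (hx : x = some X) (u v : Fin I.n) (k : ℕ)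
      (huv : u < v) (hG : I.G.Adj u v) (h : promise (Function.update X s(u, v) k)) :
      Legal promise x (.update u v k) (Function.update X s(u, v) k)

/-- The number of update operations in a single operation. -/
def Op.updates {I : Params} : Op I → ℕ
  | .start _ => 0
  | .update _ _ _ => 1

/-- The support size of the vector in an initialization (at least one), and zero for updates. -/
def Op.startSize {I : Params} : Op I → ℕ
  | .start l => max 1 l.length
  | .update _ _ _ => 0

/-- Overwrite the first cells of bank `a` by the words of a list. -/
def State.writeList (σ : State) (a : ℕ) (l : List ℕ) : State :=
  { σ with mem := Function.update σ.mem a fun i => l.getD i (σ.mem a i) }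

/-- Calling convention.  For an initialization, registers `0, …, 4` receive `n`, `F`, the words of
`ε` and `δ`, and the number of entries, and banks `0, 1, 2` receive the endpoints and the value
words of the entries.  For an update, registers `5, 6, 7` receive the endpoints and the value
word.  Everything else is left as it is. -/
def Op.pass {I : Params} (σ : State) : Op I → State
  | .start l =>
      (((((((σ.setReg 0 I.n).setReg 1 I.F).setReg 2 I.e).setReg 3 I.d).setReg 4
        l.length).writeList 0 (l.map fun a => (a.1 : ℕ))).writeList 1
        (l.map fun a => (a.2.1 : ℕ))).writeList 2 (l.map fun a => a.2.2)
  | .update u v k => ((σ.setReg 5 u).setReg 6 v).setReg 7 k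

/-- The output convention for matchings: register `8` holds the number of edges, and banks `3`
and `4` hold their endpoints. -/
def outEdges (σ : State) : List (ℕ × ℕ) :=
  (List.range (σ.reg 8)).map fun i => (σ.mem 3 i, σ.mem 4 i)

/-- The output convention for vectors: as for matchings, with the value words in bank `5`. -/
def outEntries (σ : State) : List (ℕ × ℕ × ℕ) :=
  (List.range (σ.reg 8)).map fun i => (σ.mem 3 i, σ.mem 4 i, σ.mem 5 i)

/-- A data structure: one program for each operation. -/
structure Alg where
  start : Prog
  update : Prog

/-- The program of an operation. -/
def Alg.code (A : Alg) {I : Params} : Op I → Prog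
  | .start _ => A.start
  | .update _ _ _ => A.update

/-- A deterministic algorithm draws no random words. -/
def Alg.Deterministic (A : Alg) : Prop := A.start.RandFree ∧ A.update.RandFree

/-- An adversary chooses the next operation, or stops, given the list of the states after each of
the operations so far, most recent first. -/
abbrev Adversary (I : Params) : Type := List State → Option (Op I)

/-- The three strengths of adversaries. -/
inductive AdversaryKind
  | oblivious | outputAdaptive | adaptive

/-- What an adversary of each kind may depend on, where `out` extracts the output from the state:
an adaptive one on the internal states, an output-adaptive one on the outputs only, and an
oblivious one on nothing but the number of operations so far. -/
def AdversaryKind.Admits {β : Type} (out : State → β) {I : Params} (adv : Adversary I) :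
    AdversaryKind → Prop
  | .oblivious => ∀ h h' : List State, h.length = h'.length → adv h = adv h'
  | .outputAdaptive => ∀ h h' : List State, h.map out = h'.map out → adv h = adv h'
  | .adaptive => True

/-- A snapshot of the interaction between an algorithm and an adversary. -/
structure Snapshot (I : Params) where
  /-- the current vector -/
  vec : Option (WordVec I)
  /-- the current state of the algorithm -/
  state : State
  /-- the states after the operations so far, most recent first -/
  hist : List State
  /-- the number of steps made so far -/
  cost : ℕ
  /-- the number of updates so far -/
  updates : ℕ
  /-- the total support size of the initializations so far -/
  startSize : ℕ

/-- The snapshots of the interaction of `A` with `adv` for the random words `ω`.  It starts with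
blank memory, and it ends when the adversary stops or picks an operation that is not legal. -/
inductive Reach (I : Params) (A : Alg) (promise : WordVec I → Prop) (adv : Adversary I)
    (ω : Tape I.w) : Snapshot I → Prop
  | start : Reach I A promise adv ω ⟨none, State.blank, [], 0, 0, 0⟩
  | step {r : Snapshot I} {op : Op I} {X : WordVec I} {σ : State} {c : ℕ}
      (hr : Reach I A promise adv ω r) (hop : adv r.hist = some op)
      (hX : Legal promise r.vec op X) (hσ : Exec I.w ω (A.code op) (op.pass r.state) σ c) :
      Reach I A promise adv ω
        ⟨some X, σ, σ :: r.hist, r.cost + c, r.updates + op.updates,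
          r.startSize + op.startSize⟩

/-- `A` solves a dynamic problem, against all adversaries of the given kind, with expected
amortized update time `tU` and initialization time `tI` per element of the support.  The problem
is given by the promise on the input vector and by the relation `ok` between the current vector
and a correct output. -/
structure Solves (I : Params) (A : Alg) (kind : AdversaryKind) (promise : WordVec I → Prop)
    {β : Type} (out : State → β) (ok : WordVec I → β → Prop) (tU tI : ℝ) : Prop where
  /-- almost surely, the output is correct after every operation, and every operation halts -/
  correct : ∀ adv : Adversary I, kind.Admits out adv → ∀ᵐ ω ∂tapeMeasure I.w,
    ∀ r, Reach I A promise adv ω r →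
      (∀ X, r.vec = some X → ok X (out r.state)) ∧
      (∀ op X, adv r.hist = some op → Legal promise r.vec op X →
        ∃ σ c, Exec I.w ω (A.code op) (op.pass r.state) σ c)
  /-- the expected number of steps in the first `T` operations is at most `tU` per update plus
  `tI` times the support size per initialization -/
  time : ∀ adv : Adversary I, kind.Admits out adv → ∀ T : ℕ,
    ∫⁻ ω, (⨆ (r : Snapshot I) (_ : Reach I A promise adv ω r ∧ r.hist.length ≤ T),
        (r.cost : ENNReal)) ∂tapeMeasure I.w ≤
      ∫⁻ ω, (⨆ (r : Snapshot I) (_ : Reach I A promise adv ω r ∧ r.hist.length ≤ T),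
        ENNReal.ofReal (tU * r.updates + tI * r.startSize)) ∂tapeMeasure I.w

/-- `A` is a dynamic `(ε, δ)`-coarsening algorithm for fractional matchings. -/
def IsDynCoarsening (I : Params) (A : Alg) (kind : AdversaryKind) (ε δ tU tI : ℝ) : Prop :=
  Solves I A kind (fun X => IsFracMatching I.G X.toReal) outEntries
    (fun X o => ∃ l : List (Entry I), IsEntryList I l ∧
      o = l.map (fun a => ((a.1 : ℕ), (a.2.1 : ℕ), a.2.2)) ∧
      IsCoarsening ε δ X.toReal (vecOf l).toReal) tU tI

/-- `A` is an `η`-approximate dynamic rounding algorithm for fractional matchings all of whose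
nonzero values are at least `μ`. -/
def IsDynRounding (I : Params) (A : Alg) (kind : AdversaryKind) (η μ tU tI : ℝ) : Prop :=
  Solves I A kind
    (fun X => IsFracMatching I.G X.toReal ∧ ∀ e, X.toReal e ≠ 0 → μ ≤ X.toReal e) outEdges
    (fun X o => ∃ l : List (Fin I.n × Fin I.n),
      (∀ a ∈ l, a.1 < a.2) ∧ l.Nodup ∧ o = l.map (fun a => ((a.1 : ℕ), (a.2 : ℕ))) ∧
      IsApproxRounding η X.toReal (l.map fun a => s(a.1, a.2)).toFinset) tU tI

end

end DynMatching

namespace DynMatching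

/-! ## Execution of programs -/

section Machine

variable {w : ℕ}

/-! The combined machine runs both algorithms side by side. The coarsening algorithm is fed the part
of `x` below 2δ, and its output is read only when a phase begins. The rounding algorithm is fed a
vector `P` that is supported inside `supp x`, has all nonzero values at least δ, and has almost the
norm of `x`; its matching is then output unchanged.

At the beginning of a phase, `P` consists of static and large edges. Let s be the degree of `v` in
the small part of `x`. Static edges are taken greedily from the coarsening as long as the degree at
each `v` stays below s + 3ε(1 - s). Large edges are all taken, with values shrunk by about 1 - 4ε,
hence to a total of at most (1 - 3ε)(1 - s) at `v`. The two bounds add up to 1, so `P` is a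
fractional matching. Pruning loses only O(ε + δ)(‖x‖ + 1) in norm (`prune`): an edge is rejected
only at a vertex where the coarsening has excess degree, and (C2) bounds the total excess.

Within a phase, an update to a value below 2δ removes the edge from `P`; a larger value is shrunk
and then cut to the room left at its ends (`fitValue`). A cut occurs only at an almost full vertex,
and there the shortfall of the large edges is O(δ) per update that has touched the vertex
(`PhaseInv.update`). So k updates cost O(δk) in norm. A phase that starts with m edges continues
only while k < εm, and `P` still has at least m - k edges of value at least δ, so this cost is
O(ε‖P‖) (`PhaseInv.norm_le`). The additive error is harmless for ‖x‖ ≥ 1. For ‖x‖ < 1 a single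
matched edge is enough, so `P` only has to be nonzero when `x` is; a fallback edge of value δ
ensures this (`PhaseInv.ne_zero`, `PhaseInv.rounding`). If ε or δ is not small, K(ε + δ) ≥ 1 and the
empty matching will do (`trivial_rounding`).

For the running time, a new phase costs a call of the initialization of the rounding algorithm with
m entries, and O(m) own steps apart from the removal of old data. The updates of the phase pay for
it at a rate of 1/ε. The phase that is still running is charged to the support of `x`, which earlier
updates and initializations have created (`Ledger`). Old data are erased by walking through lists of
the cells written, never through all pairs of vertices.

For the randomness, the two algorithms draw from disjoint sources, so their random words are
independent. Fix the words of one of them: that algorithm, the own programs and the adversary then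
merge into an adversary of the same kind against the other (`Coupled.same_of_round`,
`Coupled.same_of_coarse`). The assumptions apply for each choice of the fixed words, and Tonelli's
theorem combines them (`ae_good`, `coarse_time`, `round_time`). Measurability comes from the fact
that a halting run reads finitely many words, which makes the relevant events open
(`Exec.eventually`). -/

theorem Exec.unique {ω : Tape w} {p : Prog} {σ σ₁ σ₂ : State} {c₁ c₂ : ℕ}
    (h₁ : Exec w ω p σ σ₁ c₁) (h₂ : Exec w ω p σ σ₂ c₂) : σ₁ = σ₂ ∧ c₁ = c₂ := by
  induction h₁ generalizing σ₂ c₂ with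
  | skip | const | copy | binop | load | store | rand => cases h₂; exact ⟨rfl, rfl⟩
  | seq _ _ ih₁ ih₂ =>
    cases h₂ with
    | seq hp hq =>
      obtain ⟨rfl, rfl⟩ := ih₁ hp
      obtain ⟨rfl, rfl⟩ := ih₂ hq
      exact ⟨rfl, rfl⟩
  | branch_true hx _ ih =>
    cases h₂ with
    | branch_true _ hp => obtain ⟨rfl, rfl⟩ := ih hp; exact ⟨rfl, rfl⟩
    | branch_false hx' => exact absurd hx' hx
  | branch_false hx _ ih =>
    cases h₂ with
    | branch_true hx' => exact absurd hx hx'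
    | branch_false _ hp => obtain ⟨rfl, rfl⟩ := ih hp; exact ⟨rfl, rfl⟩
  | loop_stop hx =>
    cases h₂ with
    | loop_stop => exact ⟨rfl, rfl⟩
    | loop_step hx' => exact absurd hx hx'
  | loop_step hx _ _ ih₁ ih₂ =>
    cases h₂ with
    | loop_stop hx' => exact absurd hx' hx
    | loop_step _ hp hl =>
      obtain ⟨rfl, rfl⟩ := ih₁ hp
      obtain ⟨rfl, rfl⟩ := ih₂ hl
      exact ⟨rfl, rfl⟩

/-- A halting run reads only finitely many random words. -/
theorem Exec.eventually {ω : Tape w} {p : Prog} {σ σ' : State} {c : ℕ}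
    (h : Exec w ω p σ σ' c) : ∀ᶠ ω' in nhds ω, Exec w ω' p σ σ' c := by
  induction h with
  | skip σ => exact .of_forall fun _ => .skip σ
  | const σ x c => exact .of_forall fun _ => .const σ x c
  | copy σ x y => exact .of_forall fun _ => .copy σ x y
  | binop σ o x y z => exact .of_forall fun _ => .binop σ o x y z
  | load σ x a y => exact .of_forall fun _ => .load σ x a y
  | store σ a y x => exact .of_forall fun _ => .store σ a y x
  | rand σ x r =>
    -- Each word lives in a discrete space, so fixing one coordinate is an open condition in the
    -- product topology.
    have h : ∀ᶠ ω' : Tape w in nhds ω, ω' (r, σ.drawn r) = ω (r, σ.drawn r) := by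
      have := (continuous_apply (A := fun _ : ℕ × ℕ => Fin (2 ^ w)) (r, σ.drawn r)).tendsto ω
      exact this ((isOpen_discrete {ω (r, σ.drawn r)}).mem_nhds rfl)
    filter_upwards [h] with ω' h'
    rw [← h']
    exact .rand σ x r
  | seq _ _ ih₁ ih₂ => filter_upwards [ih₁, ih₂] with ω' h₁ h₂ using .seq h₁ h₂
  | branch_true hx _ ih => filter_upwards [ih] with ω' h using .branch_true hx h
  | branch_false hx _ ih => filter_upwards [ih] with ω' h using .branch_false hx h
  | loop_stop hx => exact .of_forall fun _ => Exec.loop_stop hx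
  | loop_step hx _ _ ih₁ ih₂ => filter_upwards [ih₁, ih₂] with ω' h₁ h₂ using .loop_step hx h₁ h₂

end Machine

/-! ## Three machines in one -/

/-- The components of the combined machine: its own data, the coarsening algorithm and the
rounding algorithm. -/
inductive Part
  | own | coarse | round
  deriving DecidableEq

/-- Registers of the combined machine: the inputs belong to the own data, and the size of the
output to the rounding algorithm. -/
def regName : ℕ ≃ Part × ℕ where
  toFun y :=
    if y < 8 then (.own, y) else if y = 8 then (.round, 8)
    else if y % 3 = 0 then (.own, (y + 15) / 3)
    else if y % 3 = 1 then (.coarse, (y - 10) / 3)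
    else if y < 35 then (.round, (y - 11) / 3) else (.round, (y - 8) / 3)
  invFun
    | (.own, x) => if x < 8 then x else 3 * x - 15
    | (.coarse, x) => 3 * x + 10
    | (.round, x) => if x = 8 then 8 else if x < 8 then 3 * x + 11 else 3 * x + 8
  left_inv y := by
    dsimp only
    split_ifs <;> simp only <;> (try split_ifs) <;> (try omega)
  right_inv := by
    rintro ⟨i, x⟩
    cases i <;> dsimp only <;> (try split_ifs) <;>
      first
      | omega
      | (simp only [Prod.mk.injEq, true_and] <;> omega)

/-- Memory banks of the combined machine: the inputs belong to the own data, and the output to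
the rounding algorithm. -/
def bankName : ℕ ≃ Part × ℕ where
  toFun y :=
    if y < 3 then (.own, y) else if y < 5 then (.round, y)
    else if y % 3 = 2 then (.own, (y + 4) / 3)
    else if y % 3 = 0 then (.coarse, (y - 6) / 3)
    else if y < 16 then (.round, (y - 7) / 3) else (.round, (y - 1) / 3)
  invFun
    | (.own, x) => if x < 3 then x else 3 * x - 4
    | (.coarse, x) => 3 * x + 6
    | (.round, x) => if x < 3 then 3 * x + 7 else if x < 5 then x else 3 * x + 1
  left_inv y := by
    dsimp only
    split_ifs <;> simp only <;> (try split_ifs) <;> (try omega)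
  right_inv := by
    rintro ⟨i, x⟩
    cases i <;> dsimp only <;> (try split_ifs) <;>
      first
      | omega
      | (simp only [Prod.mk.injEq, true_and] <;> omega)

/-- Sources of random words of the combined machine. -/
def srcName : ℕ ≃ Part × ℕ where
  toFun y := if y % 3 = 0 then (.own, y / 3) else if y % 3 = 1 then (.coarse, y / 3)
    else (.round, y / 3)
  invFun
    | (.own, x) => 3 * x
    | (.coarse, x) => 3 * x + 1
    | (.round, x) => 3 * x + 2
  left_inv y := by
    dsimp only
    split_ifs <;> simp only <;> (try omega)
  right_inv := by
    rintro ⟨i, x⟩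
    cases i <;> dsimp only <;> (try split_ifs) <;>
      first
      | omega
      | (simp only [Prod.mk.injEq, true_and]; omega)

/-- The state of the combined machine. -/
def join (s : Part → State) : State where
  reg y := (s (regName y).1).reg (regName y).2
  mem y := (s (bankName y).1).mem (bankName y).2
  drawn y := (s (srcName y).1).drawn (srcName y).2

/-- A program of one of the components, as a program of the combined machine. -/
def Prog.rename (i : Part) : Prog → Prog
  | .skip => .skip
  | .const x c => .const (regName.symm (i, x)) c
  | .copy x y => .copy (regName.symm (i, x)) (regName.symm (i, y))
  | .binop o x y z => .binop o (regName.symm (i, x)) (regName.symm (i, y)) (regName.symm (i, z))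
  | .load x a y => .load (regName.symm (i, x)) (bankName.symm (i, a)) (regName.symm (i, y))
  | .store a y x => .store (bankName.symm (i, a)) (regName.symm (i, y)) (regName.symm (i, x))
  | .rand x r => .rand (regName.symm (i, x)) (srcName.symm (i, r))
  | .seq p q => .seq (p.rename i) (q.rename i)
  | .branch x p q => .branch (regName.symm (i, x)) (p.rename i) (q.rename i)
  | .loop x p => .loop (regName.symm (i, x)) (p.rename i)

theorem Prog.RandFree.rename {p : Prog} (i : Part) (h : p.RandFree) : (p.rename i).RandFree := by
  induction p with
  | rand => exact h.elim
  | seq p q hp hq => exact ⟨hp h.1, hq h.2⟩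
  | branch x p q hp hq => exact ⟨hp h.1, hq h.2⟩
  | loop x p hp => exact hp h
  | _ => trivial

/-- The random words of one of the components. -/
def subTape {w : ℕ} (i : Part) (ω : Tape w) : Tape w := fun a => ω (srcName.symm (i, a.1), a.2)

@[simp] theorem join_reg (s : Part → State) (i : Part) (x : ℕ) :
    (join s).reg (regName.symm (i, x)) = (s i).reg x := by simp [join]

@[simp] theorem join_mem (s : Part → State) (i : Part) (a : ℕ) :
    (join s).mem (bankName.symm (i, a)) = (s i).mem a := by simp [join]

@[simp] theorem join_drawn (s : Part → State) (i : Part) (r : ℕ) :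
    (join s).drawn (srcName.symm (i, r)) = (s i).drawn r := by simp [join]

@[simp] theorem join_blank : join (fun _ => State.blank) = State.blank := rfl

theorem join_setReg (s : Part → State) (i : Part) (x c : ℕ) :
    (join s).setReg (regName.symm (i, x)) c = join (Function.update s i ((s i).setReg x c)) := by
  ext y
  · obtain ⟨⟨j, x'⟩, rfl⟩ := regName.symm.surjective y
    rw [join_reg]
    by_cases h : (j, x') = (i, x)
    · cases h; simp [State.setReg]
    · have h' : regName.symm (j, x') ≠ regName.symm (i, x) := fun e => h (regName.symm.injective e)
      simp only [State.setReg, Function.update_of_ne h', join_reg]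
      by_cases hj : j = i
      · subst hj
        have : x' ≠ x := fun e => h (by rw [e])
        simp [this]
      · simp [hj]
  · by_cases hj : (bankName y).1 = i
    · subst hj; simp [State.setReg, join]
    · simp [State.setReg, join, hj]
  · by_cases hj : (srcName y).1 = i
    · subst hj; simp [State.setReg, join]
    · simp [State.setReg, join, hj]

theorem join_setBank (s : Part → State) (i : Part) (a : ℕ) (f : ℕ → ℕ) :
    ({ join s with mem := Function.update (join s).mem (bankName.symm (i, a)) f } : State) =
      join (Function.update s i { s i with mem := Function.update (s i).mem a f }) := by
  ext y
  · by_cases hj : (regName y).1 = i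
    · subst hj; simp [join]
    · simp [join, hj]
  · obtain ⟨⟨j, a'⟩, rfl⟩ := bankName.symm.surjective y
    rw [join_mem]
    by_cases h : (j, a') = (i, a)
    · cases h; simp
    · have h' : bankName.symm (j, a') ≠ bankName.symm (i, a) :=
        fun e => h (bankName.symm.injective e)
      simp only [Function.update_of_ne h', join_mem]
      by_cases hj : j = i
      · subst hj
        have : a' ≠ a := fun e => h (by rw [e])
        simp [this]
      · simp [hj]
  · by_cases hj : (srcName y).1 = i
    · subst hj; simp [join]
    · simp [join, hj]

theorem join_setMem (s : Part → State) (i : Part) (a y c : ℕ) :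
    (join s).setMem (bankName.symm (i, a)) y c =
      join (Function.update s i ((s i).setMem a y c)) := by
  rw [State.setMem, join_mem, join_setBank]; rfl

theorem join_writeList (s : Part → State) (i : Part) (a : ℕ) (l : List ℕ) :
    (join s).writeList (bankName.symm (i, a)) l =
      join (Function.update s i ((s i).writeList a l)) := by
  rw [State.writeList, join_mem, join_setBank]; rfl

theorem join_setDrawn (s : Part → State) (i : Part) (r c : ℕ) :
    ({ join s with drawn := Function.update (join s).drawn (srcName.symm (i, r)) c } : State) =
      join (Function.update s i { s i with drawn := Function.update (s i).drawn r c }) := by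
  ext y
  · by_cases hj : (regName y).1 = i
    · subst hj; simp [join]
    · simp [join, hj]
  · by_cases hj : (bankName y).1 = i
    · subst hj; simp [join]
    · simp [join, hj]
  · obtain ⟨⟨j, a'⟩, rfl⟩ := srcName.symm.surjective y
    rw [join_drawn]
    by_cases h : (j, a') = (i, r)
    · cases h; simp
    · have h' : srcName.symm (j, a') ≠ srcName.symm (i, r) :=
        fun e => h (srcName.symm.injective e)
      simp only [Function.update_of_ne h', join_drawn]
      by_cases hj : j = i
      · subst hj
        have : a' ≠ r := fun e => h (by rw [e])
        simp [this]
      · simp [hj]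

/-- Running a component inside the combined machine. -/
theorem Exec.rename {w : ℕ} {ω : Tape w} {i : Part} {p : Prog} {σ σ' : State} {c : ℕ}
    (h : Exec w (subTape i ω) p σ σ' c) (s : Part → State) (hs : s i = σ) :
    Exec w ω (p.rename i) (join s) (join (Function.update s i σ')) c := by
  induction h generalizing s with
  | skip σ => subst hs; rw [Function.update_eq_self]; exact .skip _
  | const σ x c => subst hs; rw [← join_setReg]; exact .const _ _ _
  | copy σ x y => subst hs; rw [← join_setReg, ← join_reg]; exact .copy _ _ _
  | binop σ o x y z =>
    subst hs; rw [← join_setReg, ← join_reg, ← join_reg]; exact .binop _ _ _ _ _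
  | load σ x a y => subst hs; rw [← join_setReg, ← join_mem, ← join_reg]; exact .load _ _ _ _
  | store σ a y x => subst hs; rw [← join_setMem, ← join_reg, ← join_reg]; exact .store _ _ _ _
  | rand σ x r =>
    subst hs
    have := Exec.rand (w := w) (ω := ω) (join s) (regName.symm (i, x)) (srcName.symm (i, r))
    have e : (join s).drawn = ((join s).setReg (regName.symm (i, x))
      (ω (srcName.symm (i, r), (s i).drawn r))).drawn := rfl
    rw [join_drawn, e, join_setReg, join_setDrawn] at this
    simpa [State.setReg, subTape, Prog.rename] using this
  | seq _ _ ih₁ ih₂ =>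
    refine .seq (ih₁ s hs) ?_
    have := ih₂ (Function.update s i _) (Function.update_self ..)
    rwa [Function.update_idem] at this
  | branch_true hx _ ih => exact .branch_true (by subst hs; simpa using hx) (ih s hs)
  | branch_false hx _ ih => exact .branch_false (by subst hs; simpa using hx) (ih s hs)
  | loop_stop hx =>
    subst hs
    rw [Function.update_eq_self]
    exact Exec.loop_stop (by simpa using hx)
  | loop_step hx _ _ ih₁ ih₂ =>
    refine .loop_step (by subst hs; simpa using hx) (ih₁ s hs) ?_
    have := ih₂ (Function.update s i _) (Function.update_self ..)
    rwa [Function.update_idem] at this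

/-- The renaming fixes the input registers below 8 and the input banks below 3 and assigns them to
the own data, so the calling convention touches only that component. -/
theorem Op.pass_join {I : Params} (op : Op I) (s : Part → State) :
    op.pass (join s) = join (Function.update s .own (op.pass (s .own))) := by
  have hr : ∀ x < 8, regName.symm (.own, x) = x := fun x hx => if_pos hx
  have hb : ∀ x < 3, bankName.symm (.own, x) = x := fun x hx => if_pos hx
  have h1 (s : Part → State) (x c : ℕ) (hx : x < 8) := hr x hx ▸ join_setReg s .own x c
  have h2 (s : Part → State) (a : ℕ) (l : List ℕ) (ha : a < 3) := hb a ha ▸ join_writeList s .own a l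
  cases op with
  | start l =>
    simp only [Op.pass]
    rw [h1 _ _ _ (by norm_num), h1 _ _ _ (by norm_num), h1 _ _ _ (by norm_num),
      h1 _ _ _ (by norm_num), h1 _ _ _ (by norm_num), h2 _ _ _ (by norm_num),
      h2 _ _ _ (by norm_num), h2 _ _ _ (by norm_num)]
    simp
  | update u v k =>
    simp only [Op.pass]
    rw [h1 _ _ _ (by norm_num), h1 _ _ _ (by norm_num), h1 _ _ _ (by norm_num)]
    simp

/-- The renaming leaves register 8 and banks 3 and 4 with the rounding algorithm. Its matching is
thus the output as it stands; copying it after each update would be too expensive. -/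
theorem outEdges_join (s : Part → State) : outEdges (join s) = outEdges (s .round) := by
  have h8 : (join s).reg 8 = (s .round).reg 8 := rfl
  have h3 : (join s).mem 3 = (s .round).mem 3 := rfl
  have h4 : (join s).mem 4 = (s .round).mem 4 := rfl
  rw [outEdges, outEdges, h8, h3, h4]

/-! ## Total correctness of programs that draw no random words -/

section Logic

variable {w : ℕ}

/-- Started in `σ`, the program `p` halts within `B` steps in a state that satisfies `Q`. -/
def Does (w : ℕ) (p : Prog) (σ : State) (B : ℕ) (Q : State → Prop) : Prop :=
  ∃ σ' c, (∀ ω : Tape w, Exec w ω p σ σ' c) ∧ c ≤ B ∧ Q σ'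

theorem Does.mono {p : Prog} {σ : State} {B B' : ℕ} {Q Q' : State → Prop} (h : Does w p σ B Q)
    (hB : B ≤ B') (hQ : ∀ σ', Q σ' → Q' σ') : Does w p σ B' Q' := by
  obtain ⟨σ', c, h1, h2, h3⟩ := h
  exact ⟨σ', c, h1, h2.trans hB, hQ _ h3⟩

theorem Does.seq {p q : Prog} {σ : State} {B B' : ℕ} {Q Q' : State → Prop} (h : Does w p σ B Q)
    (h' : ∀ σ', Q σ' → Does w q σ' B' Q') : Does w (.seq p q) σ (B + B') Q' := by
  obtain ⟨σ₁, c₁, h1, h2, h3⟩ := h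
  obtain ⟨σ₂, c₂, h4, h5, h6⟩ := h' _ h3
  exact ⟨σ₂, c₁ + c₂, fun ω => .seq (h1 ω) (h4 ω), by omega, h6⟩

theorem Does.branch {x : ℕ} {p q : Prog} {σ : State} {B : ℕ} {Q : State → Prop}
    (h1 : σ.reg x ≠ 0 → Does w p σ B Q) (h2 : σ.reg x = 0 → Does w q σ B Q) :
    Does w (.branch x p q) σ (B + 1) Q := by
  by_cases hx : σ.reg x = 0
  · obtain ⟨σ', c, h1, h2, h3⟩ := h2 hx
    exact ⟨σ', c + 1, fun ω => .branch_false hx (h1 ω), by omega, h3⟩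
  · obtain ⟨σ', c, h1, h2, h3⟩ := h1 hx
    exact ⟨σ', c + 1, fun ω => .branch_true hx (h1 ω), by omega, h3⟩

/-- A loop with invariant `P` whose steps are paid by the potential `f`. -/
theorem Does.loop {x : ℕ} {p : Prog} {b : ℕ} (P : State → Prop) (f : State → ℕ)
    (h : ∀ σ, P σ → σ.reg x ≠ 0 → Does w p σ b (fun σ' => P σ' ∧ f σ' < f σ))
    {σ : State} (hσ : P σ) :
    ∃ σ' c, (∀ ω : Tape w, Exec w ω (.loop x p) σ σ' c) ∧
      c ≤ (b + 1) * (f σ - f σ') + 1 ∧ P σ' ∧ σ'.reg x = 0 ∧ f σ' ≤ f σ := by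
  induction hm : f σ using Nat.strong_induction_on generalizing σ with
  | _ m ih =>
    by_cases hx : σ.reg x = 0
    · exact ⟨σ, 1, fun ω => Exec.loop_stop hx, by simp, hσ, hx, hm.le⟩
    · obtain ⟨σ₁, c₁, h1, h2, h3, h4⟩ := h σ hσ hx
      obtain ⟨σ₂, c₂, h5, h6, h7, h8, h9⟩ := ih (f σ₁) (hm ▸ h4) h3 rfl
      refine ⟨σ₂, c₁ + c₂ + 1, fun ω => .loop_step hx (h1 ω) (h5 ω), ?_, h7, h8, by omega⟩
      -- One iteration lowers the potential by at least one; `a` is what it drops beyond that.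
      obtain ⟨a, ha⟩ : ∃ a, m - f σ₂ = f σ₁ - f σ₂ + 1 + a := ⟨m - f σ₁ - 1, by omega⟩
      rw [ha, add_assoc, mul_add]
      nlinarith [Nat.zero_le a]

/-- Programs without loops and without random words. -/
def Prog.Flat : Prog → Prop
  | .rand _ _ => False
  | .seq p q => p.Flat ∧ q.Flat
  | .branch _ p q => p.Flat ∧ q.Flat
  | .loop _ _ => False
  | _ => True

/-- The effect of a program without loops. -/
def Prog.run (w : ℕ) : Prog → State → State
  | .skip, σ => σ
  | .const x c, σ => σ.setReg x (c % 2 ^ w)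
  | .copy x y, σ => σ.setReg x (σ.reg y)
  | .binop o x y z, σ => σ.setReg x (o.eval w (σ.reg y) (σ.reg z))
  | .load x a y, σ => σ.setReg x (σ.mem a (σ.reg y))
  | .store a y x, σ => σ.setMem a (σ.reg y) (σ.reg x)
  | .rand _ _, σ => σ
  | .seq p q, σ => q.run w (p.run w σ)
  | .branch x p q, σ => if σ.reg x = 0 then q.run w σ else p.run w σ
  | .loop _ _, σ => σ

/-- A bound for the number of steps of a program without loops. -/
def Prog.steps : Prog → ℕ
  | .seq p q => p.steps + q.steps
  | .branch _ p q => p.steps + q.steps + 1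
  | _ => 1

theorem Does.flat {p : Prog} (hp : p.Flat) {σ : State} {Q : State → Prop} (hQ : Q (p.run w σ)) :
    Does w p σ p.steps Q := by
  suffices h : ∀ σ, Does w p σ p.steps (· = p.run w σ) from (h σ).mono le_rfl (by rintro _ rfl; exact hQ)
  clear hQ
  induction p with
  | skip => exact fun σ => ⟨_, _, fun ω => .skip σ, le_rfl, rfl⟩
  | const x c => exact fun σ => ⟨_, _, fun ω => .const σ x c, le_rfl, rfl⟩
  | copy x y => exact fun σ => ⟨_, _, fun ω => .copy σ x y, le_rfl, rfl⟩
  | binop o x y z => exact fun σ => ⟨_, _, fun ω => .binop σ o x y z, le_rfl, rfl⟩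
  | load x a y => exact fun σ => ⟨_, _, fun ω => .load σ x a y, le_rfl, rfl⟩
  | store a y x => exact fun σ => ⟨_, _, fun ω => .store σ a y x, le_rfl, rfl⟩
  | rand => exact hp.elim
  | seq p q ihp ihq =>
    exact fun σ => (ihp hp.1 σ).seq fun σ' h => by subst h; exact ihq hp.2 _
  | branch x p q ihp ihq =>
    intro σ
    refine Does.mono (Does.branch (B := p.steps + q.steps) (Q := (· = (Prog.branch x p q).run w σ))
      (fun h => ?_) fun h => ?_) le_rfl fun _ => id
    · exact (ihp hp.1 σ).mono (by omega) (by rintro _ rfl; simp [Prog.run, h])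
    · exact (ihq hp.2 σ).mono (by omega) (by rintro _ rfl; simp [Prog.run, h])
  | loop => exact hp.elim

/-- Run a list of programs. -/
def Prog.block : List Prog → Prog
  | [] => .skip
  | [p] => p
  | p :: l => .seq p (block l)

/-- Run the program `p` for all values of register `40` below that of register `x`. -/
def Prog.forUpto (x : ℕ) (p : Prog) : Prog :=
  .block [.const 40 0, .const 42 1, .binop .lt 41 40 x,
    .loop 41 (.block [p, .const 42 1, .binop .add 40 40 42, .binop .lt 41 40 x])]

/-- The loop itself writes only registers 40, 41 and 42. Hence the invariant must not look at
registers from 40 on, and the body has to restore the counter and the bound. -/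
theorem Does.forUpto {x : ℕ} (hx : x < 40) {p : Prog} {b N : ℕ} (hN : N < 2 ^ w) (hw : 1 < 2 ^ w)
    (P : ℕ → State → Prop)
    (hP : ∀ i σ σ', σ'.mem = σ.mem → (∀ y < 40, σ'.reg y = σ.reg y) → P i σ → P i σ')
    {σ : State} (hσN : σ.reg x = N)
    (h : ∀ i < N, ∀ σ, P i σ → σ.reg 40 = i → σ.reg x = N →
      Does w p σ b (fun σ' => P (i + 1) σ' ∧ σ'.reg 40 = i ∧ σ'.reg x = N))
    (hσ : P 0 σ) : Does w (.forUpto x p) σ ((b + 4) * N + 4) (P N) := by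
  have e1 : 1 % 2 ^ w = 1 := Nat.mod_eq_of_lt hw
  have hx40 : x ≠ 40 := by omega
  have hx41 : x ≠ 41 := by omega
  have hx42 : x ≠ 42 := by omega
  let J : State → Prop := fun σ => ∃ i ≤ N, P i σ ∧ σ.reg 40 = i ∧ σ.reg x = N ∧
    σ.reg 41 = if i < N then 1 else 0
  have h40 : ∀ y < 40, y ≠ 40 ∧ y ≠ 41 ∧ y ≠ 42 := fun y hy => by omega
  let σ₀ := ((σ.setReg 40 0).setReg 42 1).setReg 41 (if 0 < N then 1 else 0)
  have hσ₀ : J σ₀ := by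
    refine ⟨0, Nat.zero_le _, hP 0 σ _ rfl ?_ hσ, ?_, ?_, ?_⟩
    · intro y hy
      simp [σ₀, State.setReg, h40 y hy]
    all_goals simp [σ₀, State.setReg, *]
  obtain ⟨σ', c, h1, h2, ⟨i, hi, hPi, hi40, hxN, h41⟩, h41', h3⟩ := Does.loop (w := w) (x := 41)
    (p := .block [p, .const 42 1, .binop .add 40 40 42, .binop .lt 41 40 x]) (b := b + 3) J
    (fun σ => N - σ.reg 40) (by
      rintro σ ⟨i, hi, hPi, hi40, hxN, h41⟩ h41'
      have hi' : i < N := by by_contra hc; exact h41' (by rw [h41, if_neg hc])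
      refine (h i hi' σ hPi hi40 hxN).seq fun σ' ⟨hP', hi40', hxN'⟩ => ?_
      have e2 : (i + 1) % 2 ^ w = i + 1 := Nat.mod_eq_of_lt (by omega)
      refine Does.flat (p := .block [.const 42 1, .binop .add 40 40 42, .binop .lt 41 40 x])
        ⟨trivial, trivial, trivial⟩ ⟨⟨i + 1, hi', hP (i + 1) σ' _ rfl ?_ hP', ?_, ?_, ?_⟩, ?_⟩
      · intro y hy
        simp [Prog.block, Prog.run, State.setReg, h40 y hy]
      all_goals simp [Prog.block, Prog.run, State.setReg, BinOp.eval, *]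
      omega) hσ₀
  have hiN : i = N := by
    by_contra hc
    rw [if_pos (by omega)] at h41
    omega
  refine ⟨σ', 1 + (1 + (1 + c)), fun ω => ?_, ?_, hiN ▸ hPi⟩
  · refine .seq (.const _ _ _) (.seq (.const _ _ _) (.seq (.binop _ _ _ _ _) ?_))
    have e : ((σ.setReg 40 (0 % 2 ^ w)).setReg 42 (1 % 2 ^ w)).setReg 41
        (BinOp.lt.eval w (((σ.setReg 40 (0 % 2 ^ w)).setReg 42 (1 % 2 ^ w)).reg 40)
          (((σ.setReg 40 (0 % 2 ^ w)).setReg 42 (1 % 2 ^ w)).reg x)) = σ₀ := by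
      simp [σ₀, State.setReg, BinOp.eval, *]
    rw [e]
    exact h1 ω
  · have h4 : (N - σ₀.reg 40 - (N - σ'.reg 40)) ≤ N := by omega
    have h5 := Nat.mul_le_mul_left (b + 3 + 1) h4
    have : (b + 4) * N = (b + 3 + 1) * N := by ring
    omega

end Logic

/-! ## The own programs of the combined machine

Registers `8`, `9` hold the words of `1` and `2δ`, `10` and `11` the lengths of the stack of
possibly supported edges and of the list of touched edges, `12` and `13` the initial support size
of the current phase and the number of its updates, and `14` tells whether `ε` and `δ` are small.
Register `15` requests a new phase, `16` and `17` hold the arguments for the coarsening algorithm,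
and `18` that for the rounding algorithm.

Banks `3`, `4`, `5` hold the initial vector for the coarsening algorithm, `6`, `7`, `8` its output,
and `9`, `10`, `11` the initial vector for the rounding algorithm.  An edge `uv` is named by
`u * n + v`.  Banks `12` and `13` hold the input vector and the degrees of its small part, `14` and
`15` the stack of edges and its characteristic function, `16` the touched edges, `17` and `18` the
vector of the rounding algorithm and its degrees, and `19` the list of large edges. -/

section Code

open Prog BinOp

/-- Set the value of the edge with ends in registers `31`, `32` to that of register `33`. -/
def setEdge : Prog := block [
  binop mul 30 31 0, binop add 30 30 32, load 34 12 30, binop lt 35 34 9,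
  branch 35 (block [load 36 13 31, binop sub 36 36 34, store 13 31 36,
    load 36 13 32, binop sub 36 36 34, store 13 32 36]) skip,
  store 12 30 33, binop lt 35 33 9,
  branch 35 (block [load 36 13 31, binop add 36 36 33, store 13 31 36,
    load 36 13 32, binop add 36 36 33, store 13 32 36]) skip,
  const 37 1, load 35 15 30,
  branch 35 skip (block [store 14 10 30, store 15 30 37, binop add 10 10 37]),
  store 16 11 30, binop add 11 11 37]

/-- Append the edge with ends in registers `31`, `32`, name in `30` and value in `33` to the
vector of the rounding algorithm. -/
def insertEdge : Prog := block [
  store 16 11 30, store 9 11 31, store 10 11 32, store 11 11 33, store 17 30 33,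
  load 34 18 31, binop add 34 34 33, store 18 31 34,
  load 34 18 32, binop add 34 34 33, store 18 32 34,
  const 34 1, binop add 11 11 34]

/-- Compute the constants of the instance. -/
def setup : Prog := block [
  const 30 1, binop shl 8 30 1, binop add 9 3 3, const 31 2000,
  binop mul 32 31 2, binop lt 33 32 8, binop mul 32 31 3, binop lt 34 32 8,
  binop land 14 33 34]

/-- Every nonzero cell of the input data belongs to an edge on the stack or to one of its ends, so
erasing along the stack erases everything in time proportional to its height. -/
def clearEdge : Prog := block [
  load 30 14 40, binop div 31 30 0, binop mod 32 30 0, const 33 0,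
  store 12 30 33, store 15 30 33, store 13 31 33, store 13 32 33]

/-- Only the entries below 2δ are handed to the coarsening algorithm. -/
def passEntry : Prog := block [
  binop lt 35 33 9,
  branch 35 (block [store 3 16 31, store 4 16 32, store 5 16 33, const 37 1,
    binop add 16 16 37]) skip]

def readEntry : Prog := block [load 31 0 40, load 32 1 40, load 33 2 40]

def loadEntry : Prog := block [readEntry, branch 14 setEdge skip, passEntry]

/-- The own part of an initialization before the call of the coarsening algorithm. -/
def startCode : Prog := block [
  setup, forUpto 10 clearEdge, block [const 10 0, const 16 0], forUpto 4 loadEntry]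

/-- One pass serves two purposes: it erases the old vector of the rounding algorithm and collects
the large edges. An edge may have been touched repeatedly, so the collected list can contain
repetitions. -/
def clearTouched : Prog := block [
  load 30 16 40, binop div 31 30 0, binop mod 32 30 0, const 33 0,
  store 17 30 33, store 18 31 33, store 18 32 33,
  load 34 12 30, binop lt 35 34 9,
  branch 35 skip (block [store 19 20 30, const 36 1, binop add 20 20 36])]

/-- Test whether the edge does not fit at one of its ends. -/
def testStatic : Prog := block [
  load 31 6 40, load 32 7 40, load 33 8 40, binop mul 30 31 0, binop add 30 30 32,
  const 37 3,
  load 34 18 31, binop add 34 34 33, load 35 13 31, binop sub 36 8 35, binop mul 36 36 2,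
  binop mul 36 36 37, binop shr 36 36 1, binop add 35 35 36, binop lt 38 35 34,
  load 34 18 32, binop add 34 34 33, load 35 13 32, binop sub 36 8 35, binop mul 36 36 2,
  binop mul 36 36 37, binop shr 36 36 1, binop add 35 35 36, binop lt 39 35 34,
  binop add 38 38 39]

def addStatic : Prog := block [testStatic, branch 38 skip insertEdge]

/-- Replace the word `k` in register `x` by that of `(1 - 4ε) k`, using register `y`. -/
def shrink (x y : ℕ) : Prog := block [
  binop mul 35 x 2, const 36 4, binop mul 35 35 36, binop shr 35 35 1, binop sub y x 35]

def largeValue : Prog := block [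
  binop div 31 30 0, binop mod 32 30 0, load 33 12 30, shrink 33 33]

/-- The list of large edges may have repetitions; a nonzero cell in bank 17 shows that the edge was
inserted before. -/
def addLarge : Prog := block [
  block [load 30 19 40, load 34 17 30], branch 34 skip (block [largeValue, insertEdge])]

def popTest : Prog := branch 10
  (block [const 30 1, binop sub 31 10 30, load 30 14 31, load 33 12 30, const 34 0,
    binop eq 29 33 34])
  (const 29 0)

/-- Pops the edges of value zero until a supported edge is on top, which then gets the value δ. It
is called only when no other edge was inserted. -/
def addFallback : Prog := block [
  popTest,
  loop 29 (block [block [const 33 0, store 15 30 33, copy 10 31], popTest]),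
  branch 10 (block [block [binop div 31 30 0, binop mod 32 30 0, copy 33 3], insertEdge]) skip]

/-- Start a new phase, given the output of the coarsening algorithm. -/
def rebuild : Prog := branch 14 (block [
    const 20 0, forUpto 11 clearTouched, const 11 0, forUpto 19 addStatic, forUpto 20 addLarge,
    branch 11 skip addFallback, block [copy 12 11, const 13 0]])
  (const 11 0)

/-- Lower register `34` to the room left at the vertex in register `x`. -/
def capRoom (x : ℕ) : Prog := block [
  load 35 18 x, binop sub 35 8 35, binop lt 36 35 34, branch 36 (copy 34 35) skip]

def patchValue : Prog := block [
  shrink 33 34, capRoom 31, capRoom 32,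
  block [binop lt 36 34 3, branch 36 skip (copy 18 34)]]

/-- The old value leaves the degrees before the room at the ends is measured, so an updated edge can
reuse its own share. -/
def removeOld : Prog := block [
  load 34 17 30,
  load 36 18 31, binop sub 36 36 34, store 18 31 36,
  load 36 18 32, binop sub 36 36 34, store 18 32 36, binop lt 35 33 9]

def putNew : Prog := block [
  store 17 30 18,
  load 36 18 31, binop add 36 36 18, store 18 31 36,
  load 36 18 32, binop add 36 36 18, store 18 32 36]

/-- Set the value of an edge in the vector of the rounding algorithm within a phase. -/
def patch : Prog := block [removeOld, branch 35 skip patchValue, putNew]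

def passUpdate : Prog := block [
  binop lt 30 7 9, branch 30 (copy 17 7) (const 17 0), const 15 0, const 18 0,
  copy 31 5, copy 32 6, copy 33 7]

/-- The integer form of k + 1 < εm for the updates k + 1 and the initial support size m of the
phase. -/
def countUpdate : Prog := block [
  const 37 1, binop add 13 13 37, binop mul 34 13 8, binop mul 35 12 2, binop lt 36 34 35]

/-- The own part of an update before the call of the coarsening algorithm. -/
def updateCode : Prog := block [
  passUpdate, branch 14 (block [setEdge, countUpdate, branch 36 patch (const 15 1)]) skip]

end Code

/-- Apply `g` to the values at `u` and at `v`. -/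
def bump (f : ℕ → ℕ) (u v : ℕ) (g : ℕ → ℕ) : ℕ → ℕ := fun a => if a = u ∨ a = v then g (f a) else f a

/-! ### Effects of the own programs on the machine state -/

section Specs

variable {w : ℕ}

/-- Straight-line code is executed symbolically, with one case for each outcome of the tests. As in
the other specifications of this kind, the size hypotheses only ensure that no reduction modulo `2 ^
w` takes effect. -/
theorem setEdge_spec {σ : State} {n u v k D : ℕ} (hw : 1 < 2 ^ w) (h0 : σ.reg 0 = n)
    (h9 : σ.reg 9 = D)
    (hu : σ.reg 31 = u) (hv : σ.reg 32 = v) (hk : σ.reg 33 = k) (huv : u ≠ v)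
    (hkey : u * n + v < 2 ^ w) (bu : σ.mem 13 u + k < 2 ^ w) (bv : σ.mem 13 v + k < 2 ^ w)
    (b10 : σ.reg 10 + 1 < 2 ^ w) (b11 : σ.reg 11 + 1 < 2 ^ w) :
    Does w setEdge σ 40 fun σ' =>
      σ'.mem 12 = Function.update (σ.mem 12) (u * n + v) k ∧
      σ'.mem 13 = bump (σ.mem 13) u v (fun a =>
        a - (if σ.mem 12 (u * n + v) < D then σ.mem 12 (u * n + v) else 0) +
          if k < D then k else 0) ∧
      (if σ.mem 15 (u * n + v) = 0 then
        σ'.mem 14 = Function.update (σ.mem 14) (σ.reg 10) (u * n + v) ∧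
        σ'.mem 15 = Function.update (σ.mem 15) (u * n + v) 1 ∧ σ'.reg 10 = σ.reg 10 + 1
      else σ'.mem 14 = σ.mem 14 ∧ σ'.mem 15 = σ.mem 15 ∧ σ'.reg 10 = σ.reg 10) ∧
      σ'.mem 16 = Function.update (σ.mem 16) (σ.reg 11) (u * n + v) ∧
      σ'.reg 11 = σ.reg 11 + 1 ∧ σ'.reg 30 = u * n + v ∧
      (∀ b, b < 12 ∨ 16 < b → σ'.mem b = σ.mem b) ∧
      ∀ y, (y < 30 ∨ 38 ≤ y ∨ y = 31 ∨ y = 32 ∨ y = 33) → y ≠ 10 → y ≠ 11 → σ'.reg y = σ.reg y := by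
  have e1 : 1 % 2 ^ w = 1 := Nat.mod_eq_of_lt hw
  have e2 : u * n % 2 ^ w = u * n := Nat.mod_eq_of_lt (by omega)
  have e3 : (u * n + v) % 2 ^ w = u * n + v := Nat.mod_eq_of_lt hkey
  have e4 := Nat.mod_eq_of_lt b10
  have e5 := Nat.mod_eq_of_lt b11
  have e6 : ∀ a, (σ.mem 13 u - a + k) % 2 ^ w = σ.mem 13 u - a + k := fun a =>
    Nat.mod_eq_of_lt (by omega)
  have e7 : ∀ a, (σ.mem 13 v - a + k) % 2 ^ w = σ.mem 13 v - a + k := fun a =>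
    Nat.mod_eq_of_lt (by omega)
  have e6' := e6 0
  have e7' := e7 0
  simp only [Nat.sub_zero] at e6' e7'
  refine (Does.flat (by simp [setEdge, Prog.block, Prog.Flat]) ?_).mono (by decide) fun _ => id
  by_cases c1 : σ.mem 12 (u * n + v) < D <;> by_cases c2 : k < D <;>
    by_cases c3 : σ.mem 15 (u * n + v) = 0 <;>
  · simp only [setEdge, Prog.block, Prog.run, BinOp.eval, State.setReg, State.setMem, h0, hu, hv, hk,
      h9, e1, e2, e3, Function.update_self, ne_eq, Function.update_of_ne,
      Nat.reduceEqDiff, not_false_eq_true, c1, c2, c3, if_true, if_false, one_ne_zero, huv, huv.symm,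
      e4, e5, e6, e7, e6', e7']
    simp only [true_and]
    refine ⟨?_, ?_, ?_⟩
    · funext a
      by_cases hau : a = u <;> by_cases hav : a = v <;> simp_all [bump]
    · intro b hb
      simp (disch := omega) only [Function.update_of_ne]
    · intro y hy hy1 hy2
      simp (disch := omega) only [Function.update_of_ne]

theorem insertEdge_spec {σ : State} {u v : ℕ} (hw : 1 < 2 ^ w)
    (hu : σ.reg 31 = u) (hv : σ.reg 32 = v) (huv : u ≠ v)
    (bu : σ.mem 18 u + σ.reg 33 < 2 ^ w) (bv : σ.mem 18 v + σ.reg 33 < 2 ^ w)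
    (b11 : σ.reg 11 + 1 < 2 ^ w) :
    Does w insertEdge σ 13 fun σ' =>
      σ'.mem 9 = Function.update (σ.mem 9) (σ.reg 11) u ∧
      σ'.mem 10 = Function.update (σ.mem 10) (σ.reg 11) v ∧
      σ'.mem 11 = Function.update (σ.mem 11) (σ.reg 11) (σ.reg 33) ∧
      σ'.mem 16 = Function.update (σ.mem 16) (σ.reg 11) (σ.reg 30) ∧
      σ'.mem 17 = Function.update (σ.mem 17) (σ.reg 30) (σ.reg 33) ∧
      σ'.mem 18 = bump (σ.mem 18) u v (· + σ.reg 33) ∧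
      σ'.reg 11 = σ.reg 11 + 1 ∧
      (∀ b, b < 9 ∨ 12 ≤ b ∧ b < 16 ∨ 18 < b → σ'.mem b = σ.mem b) ∧
      ∀ y, y ≠ 11 → y ≠ 34 → σ'.reg y = σ.reg y := by
  have e1 : 1 % 2 ^ w = 1 := Nat.mod_eq_of_lt hw
  have e4 := Nat.mod_eq_of_lt b11
  have e6 := Nat.mod_eq_of_lt bu
  have e7 := Nat.mod_eq_of_lt bv
  refine (Does.flat (by simp [insertEdge, Prog.block, Prog.Flat]) ?_).mono (by decide) fun _ => id
  simp only [insertEdge, Prog.block, Prog.run, BinOp.eval, State.setReg, State.setMem, hu, hv,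
    e1, Function.update_self, ne_eq, Function.update_of_ne,
    Nat.reduceEqDiff, not_false_eq_true, huv.symm, e4, e6, e7]
  simp only [true_and]
  refine ⟨?_, ?_, ?_⟩
  · funext a
    by_cases hau : a = u <;> by_cases hav : a = v <;> simp_all [bump]
  · intro b hb
    simp (disch := omega) only [Function.update_of_ne]
  · intro y hy hy1
    simp (disch := omega) only [Function.update_of_ne]

theorem setup_spec {σ : State} {F e d : ℕ} (h1 : σ.reg 1 = F) (h2 : σ.reg 2 = e)
    (h3 : σ.reg 3 = d) (hF : 2 ^ F < 2 ^ w) (he : 2000 * e < 2 ^ w) (hd : 2000 * d < 2 ^ w)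
    (hw : 2000 < 2 ^ w) :
    Does w setup σ 9 fun σ' =>
      σ'.reg 8 = 2 ^ F ∧ σ'.reg 9 = 2 * d ∧
      σ'.reg 14 = (if 2000 * e < 2 ^ F ∧ 2000 * d < 2 ^ F then 1 else 0) ∧ σ'.mem = σ.mem ∧
      ∀ y, y < 30 → y ≠ 8 → y ≠ 9 → y ≠ 14 → σ'.reg y = σ.reg y := by
  have e1 : 1 % 2 ^ w = 1 := Nat.mod_eq_of_lt (by omega)
  have e2 : 2000 % 2 ^ w = 2000 := Nat.mod_eq_of_lt hw
  have e3 := Nat.mod_eq_of_lt hF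
  have e4 := Nat.mod_eq_of_lt he
  have e5 := Nat.mod_eq_of_lt hd
  have e6 : (d + d) % 2 ^ w = 2 * d := by rw [← two_mul]; exact Nat.mod_eq_of_lt (by omega)
  refine (Does.flat (by simp [setup, Prog.block, Prog.Flat]) ?_).mono (by decide) fun _ => id
  simp only [setup, Prog.block, Prog.run, BinOp.eval, State.setReg, h1, h2, h3,
    e1, e2, e4, e5, e6, Function.update_self, ne_eq, Function.update_of_ne, Nat.shiftLeft_eq,
    one_mul, e3, Nat.reduceEqDiff, not_false_eq_true]
  simp only [true_and]
  refine ⟨?_, ?_⟩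
  · by_cases c1 : 2000 * e < 2 ^ F <;> by_cases c2 : 2000 * d < 2 ^ F <;> simp [c1, c2]
  · intro y hy1 hy2 hy3 hy4
    simp (disch := omega) only [Function.update_of_ne]

theorem clearEdge_spec {σ : State} :
    Does w clearEdge σ 8 fun σ' =>
      let a := σ.mem 14 (σ.reg 40)
      σ'.mem 12 = Function.update (σ.mem 12) a 0 ∧
      σ'.mem 15 = Function.update (σ.mem 15) a 0 ∧
      σ'.mem 13 = Function.update (Function.update (σ.mem 13) (a / σ.reg 0) 0) (a % σ.reg 0) 0 ∧
      (∀ b, b ≠ 12 → b ≠ 13 → b ≠ 15 → σ'.mem b = σ.mem b) ∧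
      ∀ y, (y < 30 ∨ 34 ≤ y) → σ'.reg y = σ.reg y := by
  refine (Does.flat (by simp [clearEdge, Prog.block, Prog.Flat]) ?_).mono (by decide) fun _ => id
  simp only [clearEdge, Prog.block, Prog.run, BinOp.eval, State.setReg, State.setMem,
    Function.update_self, ne_eq, Function.update_of_ne, Nat.zero_mod,
    Nat.reduceEqDiff, not_false_eq_true]
  simp only [true_and]
  refine ⟨?_, ?_⟩
  · intro b hb1 hb2 hb3
    simp (disch := omega) only [Function.update_of_ne]
  · intro y hy
    simp (disch := omega) only [Function.update_of_ne]

theorem passEntry_spec {σ : State} (hw : 1 < 2 ^ w) (b : σ.reg 16 + 1 < 2 ^ w) :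
    Does w passEntry σ 8 fun σ' =>
      (if σ.reg 33 < σ.reg 9 then
        σ'.mem 3 = Function.update (σ.mem 3) (σ.reg 16) (σ.reg 31) ∧
        σ'.mem 4 = Function.update (σ.mem 4) (σ.reg 16) (σ.reg 32) ∧
        σ'.mem 5 = Function.update (σ.mem 5) (σ.reg 16) (σ.reg 33) ∧ σ'.reg 16 = σ.reg 16 + 1
      else σ'.mem 3 = σ.mem 3 ∧ σ'.mem 4 = σ.mem 4 ∧ σ'.mem 5 = σ.mem 5 ∧
        σ'.reg 16 = σ.reg 16) ∧
      (∀ b, b < 3 ∨ 5 < b → σ'.mem b = σ.mem b) ∧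
      ∀ y, y ≠ 16 → y ≠ 35 → y ≠ 37 → σ'.reg y = σ.reg y := by
  have e1 : 1 % 2 ^ w = 1 := Nat.mod_eq_of_lt (by omega)
  have e2 := Nat.mod_eq_of_lt b
  refine (Does.flat (by simp [passEntry, Prog.block, Prog.Flat]) ?_).mono (by decide) fun _ => id
  by_cases c : σ.reg 33 < σ.reg 9 <;>
  · simp only [passEntry, Prog.block, Prog.run, BinOp.eval, State.setReg, State.setMem,
      Function.update_self, ne_eq, Function.update_of_ne, e1, e2, c, if_true, if_false,
      Nat.reduceEqDiff, not_false_eq_true, one_ne_zero]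
    simp only [true_and]
    refine ⟨?_, ?_⟩
    · intro b hb
      simp (disch := omega) only [Function.update_of_ne]
    · intro y hy1 hy2 hy3
      simp (disch := omega) only [Function.update_of_ne]

theorem clearTouched_spec {σ : State} (hw : 1 < 2 ^ w) (b : σ.reg 20 + 1 < 2 ^ w) :
    Does w clearTouched σ 14 fun σ' =>
      let a := σ.mem 16 (σ.reg 40)
      σ'.mem 17 = Function.update (σ.mem 17) a 0 ∧
      σ'.mem 18 = Function.update (Function.update (σ.mem 18) (a / σ.reg 0) 0) (a % σ.reg 0) 0 ∧
      (if σ.mem 12 a < σ.reg 9 then σ'.mem 19 = σ.mem 19 ∧ σ'.reg 20 = σ.reg 20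
      else σ'.mem 19 = Function.update (σ.mem 19) (σ.reg 20) a ∧ σ'.reg 20 = σ.reg 20 + 1) ∧
      (∀ b, b < 17 ∨ 19 < b → σ'.mem b = σ.mem b) ∧
      ∀ y, (y < 20 ∨ 20 < y ∧ y < 30 ∨ 37 ≤ y) → σ'.reg y = σ.reg y := by
  have e1 : 1 % 2 ^ w = 1 := Nat.mod_eq_of_lt (by omega)
  have e2 := Nat.mod_eq_of_lt b
  refine (Does.flat (by simp [clearTouched, Prog.block, Prog.Flat]) ?_).mono (by decide) fun _ => id
  by_cases c : σ.mem 12 (σ.mem 16 (σ.reg 40)) < σ.reg 9 <;>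
  · simp only [clearTouched, Prog.block, Prog.run, BinOp.eval, State.setReg, State.setMem,
      Function.update_self, ne_eq, Function.update_of_ne, e1, e2, c, if_true, if_false,
      Nat.reduceEqDiff, not_false_eq_true, one_ne_zero, Nat.zero_mod]
    simp only [true_and]
    refine ⟨?_, ?_⟩
    · intro b hb
      simp (disch := omega) only [Function.update_of_ne]
    · intro y hy
      simp (disch := omega) only [Function.update_of_ne]

theorem testStatic_spec {σ : State} {u v k n q e F : ℕ} (hw : 3 < 2 ^ w)
    (hu : σ.mem 6 (σ.reg 40) = u) (hv : σ.mem 7 (σ.reg 40) = v) (hk : σ.mem 8 (σ.reg 40) = k)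
    (h0 : σ.reg 0 = n) (h1 : σ.reg 1 = F) (h2 : σ.reg 2 = e) (h8 : σ.reg 8 = q)
    (hkey : u * n + v < 2 ^ w) (bu : σ.mem 18 u + k < 2 ^ w) (bv : σ.mem 18 v + k < 2 ^ w)
    (bq : q * e * 3 < 2 ^ w)
    (cu : σ.mem 13 u + (q - σ.mem 13 u) * e * 3 / 2 ^ F < 2 ^ w)
    (cv : σ.mem 13 v + (q - σ.mem 13 v) * e * 3 / 2 ^ F < 2 ^ w) :
    Does w testStatic σ 25 fun σ' =>
      σ'.reg 30 = u * n + v ∧ σ'.reg 31 = u ∧ σ'.reg 32 = v ∧ σ'.reg 33 = k ∧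
      (σ'.reg 38 = 0 ↔ σ.mem 18 u + k ≤ σ.mem 13 u + (q - σ.mem 13 u) * e * 3 / 2 ^ F ∧
        σ.mem 18 v + k ≤ σ.mem 13 v + (q - σ.mem 13 v) * e * 3 / 2 ^ F) ∧
      σ'.mem = σ.mem ∧ ∀ y, y < 30 ∨ 40 ≤ y → σ'.reg y = σ.reg y := by
  have e1 : 3 % 2 ^ w = 3 := Nat.mod_eq_of_lt hw
  have e2 : u * n % 2 ^ w = u * n := Nat.mod_eq_of_lt (by omega)
  have e3 := Nat.mod_eq_of_lt hkey
  have e4 := Nat.mod_eq_of_lt bu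
  have e5 := Nat.mod_eq_of_lt bv
  have e6 := Nat.mod_eq_of_lt cu
  have e7 := Nat.mod_eq_of_lt cv
  have e8 : ∀ a, (q - a) * e * 3 % 2 ^ w = (q - a) * e * 3 := fun a =>
    Nat.mod_eq_of_lt (lt_of_le_of_lt (by gcongr; omega) bq)
  have e9 : ∀ a, (q - a) * e % 2 ^ w = (q - a) * e := fun a =>
    Nat.mod_eq_of_lt (lt_of_le_of_lt (by nlinarith [Nat.mul_le_mul_right e (Nat.sub_le q a)]) bq)
  refine (Does.flat (by simp [testStatic, Prog.block, Prog.Flat]) ?_).mono (by decide) fun _ => id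
  simp only [testStatic, Prog.block, Prog.run, BinOp.eval, State.setReg, hu, hv, hk, h0, h1, h2, h8,
    e1, e2, e3, e4, e5, e6, e7, e8, e9, Function.update_self, ne_eq, Function.update_of_ne,
    Nat.reduceEqDiff, not_false_eq_true, Nat.shiftRight_eq_div_pow]
  simp only [true_and]
  refine ⟨?_, ?_⟩
  · have : (1 + 1) % 2 ^ w ≠ 0 := by rw [Nat.mod_eq_of_lt (by omega)]; norm_num
    have : (1 + 0) % 2 ^ w ≠ 0 := by rw [Nat.mod_eq_of_lt (by omega)]; norm_num
    have : (0 + 1) % 2 ^ w ≠ 0 := by rw [Nat.mod_eq_of_lt (by omega)]; norm_num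
    split_ifs <;> simp_all
  · intro y hy
    simp (disch := omega) only [Function.update_of_ne]

theorem largeValue_spec {σ : State} {n e F k : ℕ} (hw : 4 < 2 ^ w)
    (h0 : σ.reg 0 = n) (h1 : σ.reg 1 = F) (h2 : σ.reg 2 = e) (hk : σ.mem 12 (σ.reg 30) = k)
    (b : k * e * 4 < 2 ^ w) :
    Does w largeValue σ 8 fun σ' =>
      σ'.reg 31 = σ.reg 30 / n ∧ σ'.reg 32 = σ.reg 30 % n ∧
      σ'.reg 33 = k - k * e * 4 / 2 ^ F ∧ σ'.mem = σ.mem ∧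
      ∀ y, y ≤ 30 ∨ 37 ≤ y → σ'.reg y = σ.reg y := by
  have e1 : 4 % 2 ^ w = 4 := Nat.mod_eq_of_lt hw
  have e3 := Nat.mod_eq_of_lt b
  have e4 : k * e % 2 ^ w = k * e := Nat.mod_eq_of_lt (by omega)
  refine (Does.flat (by simp [largeValue, shrink, Prog.block, Prog.Flat]) ?_).mono (by decide) fun _ => id
  simp only [largeValue, shrink, Prog.block, Prog.run, BinOp.eval, State.setReg, h0, h1, h2, hk,
    e1, e3, e4, Function.update_self, ne_eq, Function.update_of_ne,
    Nat.reduceEqDiff, not_false_eq_true, Nat.shiftRight_eq_div_pow]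
  simp only [true_and]
  intro y hy
  simp (disch := omega) only [Function.update_of_ne]

theorem popTest_spec {σ : State} (hw : 1 < 2 ^ w) :
    Does w popTest σ 8 fun σ' =>
      (σ'.reg 29 = 0 ↔ σ.reg 10 ≠ 0 → σ.mem 12 (σ.mem 14 (σ.reg 10 - 1)) ≠ 0) ∧
      (σ.reg 10 ≠ 0 → σ'.reg 30 = σ.mem 14 (σ.reg 10 - 1) ∧ σ'.reg 31 = σ.reg 10 - 1) ∧
      σ'.mem = σ.mem ∧ ∀ y, y < 29 ∨ 35 ≤ y → σ'.reg y = σ.reg y := by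
  have e1 : 1 % 2 ^ w = 1 := Nat.mod_eq_of_lt hw
  refine (Does.flat (by simp [popTest, Prog.block, Prog.Flat]) ?_).mono (by decide) fun _ => id
  by_cases c : σ.reg 10 = 0 <;>
  · simp only [popTest, Prog.block, Prog.run, BinOp.eval, State.setReg,
      e1, c, Function.update_self, ne_eq, Function.update_of_ne, if_true, if_false,
      Nat.reduceEqDiff, not_false_eq_true, Nat.zero_mod, not_true_eq_false, false_imp_iff, true_imp_iff]
    simp only [true_and, and_self]
    try refine ⟨by split_ifs <;> simp_all, ?_⟩
    intro y hy
    simp (disch := omega) only [Function.update_of_ne]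

theorem passUpdate_spec {σ : State} :
    Does w passUpdate σ 9 fun σ' =>
      σ'.reg 17 = (if σ.reg 7 < σ.reg 9 then σ.reg 7 else 0) ∧ σ'.reg 15 = 0 ∧ σ'.reg 18 = 0 ∧
      σ'.reg 31 = σ.reg 5 ∧ σ'.reg 32 = σ.reg 6 ∧ σ'.reg 33 = σ.reg 7 ∧
      σ'.mem = σ.mem ∧
      ∀ y, y ≠ 15 → y ≠ 17 → y ≠ 18 → y < 30 ∨ 34 ≤ y → σ'.reg y = σ.reg y := by
  refine (Does.flat (by simp [passUpdate, Prog.block, Prog.Flat]) ?_).mono (by decide) fun _ => id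
  by_cases c : σ.reg 7 < σ.reg 9 <;>
  · simp only [passUpdate, Prog.block, Prog.run, BinOp.eval, State.setReg,
      c, Function.update_self, ne_eq, Function.update_of_ne, if_true, if_false, one_ne_zero,
      Nat.reduceEqDiff, not_false_eq_true, Nat.zero_mod]
    simp only [true_and]
    intro y hy1 hy2 hy3 hy4
    simp (disch := omega) only [Function.update_of_ne]

theorem countUpdate_spec {σ : State} (hw : 1 < 2 ^ w) (b1 : σ.reg 13 + 1 < 2 ^ w)
    (b2 : (σ.reg 13 + 1) * σ.reg 8 < 2 ^ w) (b3 : σ.reg 12 * σ.reg 2 < 2 ^ w) :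
    Does w countUpdate σ 5 fun σ' =>
      σ'.reg 13 = σ.reg 13 + 1 ∧
      (σ'.reg 36 = 0 ↔ ¬ (σ.reg 13 + 1) * σ.reg 8 < σ.reg 12 * σ.reg 2) ∧
      σ'.mem = σ.mem ∧ ∀ y, y ≠ 13 → y < 34 → σ'.reg y = σ.reg y := by
  have e1 : 1 % 2 ^ w = 1 := Nat.mod_eq_of_lt hw
  have e2 := Nat.mod_eq_of_lt b1
  have e3 := Nat.mod_eq_of_lt b2
  have e4 := Nat.mod_eq_of_lt b3
  refine (Does.flat (by simp [countUpdate, Prog.block, Prog.Flat]) ?_).mono (by decide) fun _ => id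
  simp only [countUpdate, Prog.block, Prog.run, BinOp.eval, State.setReg,
    e1, e2, e3, e4, Function.update_self, ne_eq, Function.update_of_ne,
    Nat.reduceEqDiff, not_false_eq_true]
  simp only [true_and]
  refine ⟨by simp, ?_⟩
  intro y hy1 hy2
  simp (disch := omega) only [Function.update_of_ne]

/-- The value of an updated large edge within a phase, for the value word `k` and the words
`a`, `b` of the degrees of the ends. -/
def fitValue (F e d k a b : ℕ) : ℕ :=
  let m := min (min (k - k * e * 4 / 2 ^ F) (2 ^ F - a)) (2 ^ F - b)
  if m < d then 0 else m

theorem fitValue_le {F e d k a b : ℕ} : fitValue F e d k a b ≤ 2 ^ F := by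
  have : 0 < 2 ^ F := by positivity
  simp only [fitValue]; split_ifs <;> omega

theorem shrink_spec {σ : State} {k e F : ℕ} (hw : 4 < 2 ^ w) (h1 : σ.reg 1 = F)
    (h2 : σ.reg 2 = e) (hk : σ.reg 33 = k) (b : k * e * 4 < 2 ^ w) :
    Does w (shrink 33 34) σ 5 fun σ' => σ'.reg 34 = k - k * e * 4 / 2 ^ F ∧ σ'.mem = σ.mem ∧
      ∀ y, y < 34 ∨ 37 ≤ y → σ'.reg y = σ.reg y := by
  have e1 : 4 % 2 ^ w = 4 := Nat.mod_eq_of_lt hw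
  have e3 := Nat.mod_eq_of_lt b
  have e4 : k * e % 2 ^ w = k * e := Nat.mod_eq_of_lt (by omega)
  refine (Does.flat (by simp [shrink, Prog.block, Prog.Flat]) ?_).mono (by decide) fun _ => id
  simp only [shrink, Prog.block, Prog.run, BinOp.eval, State.setReg, h1, h2, hk, e1, e3, e4,
    Function.update_self, ne_eq, Function.update_of_ne, Nat.reduceEqDiff, not_false_eq_true,
    Nat.shiftRight_eq_div_pow]
  simp only [true_and]
  intro y hy
  simp (disch := omega) only [Function.update_of_ne]

theorem capRoom_spec {σ : State} {x : ℕ} (hx : x < 34) :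
    Does w (capRoom x) σ 6 fun σ' =>
      σ'.reg 34 = min (σ.reg 34) (σ.reg 8 - σ.mem 18 (σ.reg x)) ∧ σ'.mem = σ.mem ∧
      ∀ y, y < 34 ∨ 37 ≤ y → σ'.reg y = σ.reg y := by
  have hx' : ∀ y ≥ 34, y ≠ x := fun y hy => by omega
  refine (Does.flat (by simp [capRoom, Prog.block, Prog.Flat]) ?_).mono
    (by simp [capRoom, Prog.block, Prog.steps]) fun _ => id
  by_cases c : σ.reg 8 - σ.mem 18 (σ.reg x) < σ.reg 34 <;>
  · simp only [capRoom, Prog.block, Prog.run, BinOp.eval, State.setReg,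
      Function.update_self, ne_eq, Function.update_of_ne, Nat.reduceEqDiff, not_false_eq_true, c,
      if_true, if_false, one_ne_zero]
    refine ⟨by omega, trivial, ?_⟩
    intro y hy
    simp (disch := omega) only [Function.update_of_ne]

theorem patchValue_spec {σ : State} {u v k e d F : ℕ} (hw : 4 < 2 ^ w) (h1 : σ.reg 1 = F)
    (h2 : σ.reg 2 = e) (h3 : σ.reg 3 = d) (h8 : σ.reg 8 = 2 ^ F) (hu : σ.reg 31 = u)
    (hv : σ.reg 32 = v) (hk : σ.reg 33 = k) (b : k * e * 4 < 2 ^ w) (h18 : σ.reg 18 = 0) :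
    Does w patchValue σ 21 fun σ' =>
      σ'.reg 18 = fitValue F e d k (σ.mem 18 u) (σ.mem 18 v) ∧ σ'.mem = σ.mem ∧
      ∀ y, y ≠ 18 → y < 34 ∨ 37 ≤ y → σ'.reg y = σ.reg y := by
  refine ((shrink_spec hw h1 h2 hk b).seq fun σ₁ ⟨a1, a2, a3⟩ =>
    (capRoom_spec (by norm_num)).seq fun σ₂ ⟨b1, b2, b3⟩ =>
    (capRoom_spec (by norm_num)).seq fun σ₃ ⟨c1, c2, c3⟩ => Does.flat ?_ ?_).mono
      (B := 5 + (6 + (6 + 4))) (by norm_num) fun _ => id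
  · simp [Prog.block, Prog.Flat]
  have d3 : σ₃.reg 3 = d := by rw [c3, b3, a3, h3] <;> norm_num
  have d18 : σ₃.reg 18 = 0 := by rw [c3, b3, a3, h18] <;> norm_num
  have d34 : σ₃.reg 34 = min (min (k - k * e * 4 / 2 ^ F) (2 ^ F - σ.mem 18 u))
      (2 ^ F - σ.mem 18 v) := by
    rw [c1, b1, a1, b2, a2, b3, a3, a3, b3, a3, h8, hu, hv] <;> norm_num
  have dy : ∀ y, y < 34 ∨ 37 ≤ y → σ₃.reg y = σ.reg y := fun y hy => by
    rw [c3 y hy, b3 y hy, a3 y hy]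
  have dm : σ₃.mem = σ.mem := by rw [c2, b2, a2]
  by_cases c : σ₃.reg 34 < σ₃.reg 3 <;>
  · have c' := c
    rw [d34, d3] at c'
    simp only [Prog.block, Prog.run, BinOp.eval, State.setReg, fitValue, c', d18, dm,
      Function.update_self, ne_eq, Function.update_of_ne, Nat.reduceEqDiff, not_false_eq_true, c,
      if_true, if_false, one_ne_zero, true_and]
    try rw [← d34]
    try simp only [true_and]
    intro y hy1 hy
    rw [← dy y hy]
    simp (disch := omega) only [Function.update_of_ne]

theorem removeOld_spec {σ : State} {u v : ℕ} (hu : σ.reg 31 = u) (hv : σ.reg 32 = v)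
    (huv : u ≠ v) :
    Does w removeOld σ 8 fun σ' =>
      σ'.mem 18 = bump (σ.mem 18) u v (fun a => a - σ.mem 17 (σ.reg 30)) ∧
      (σ'.reg 35 = 0 ↔ ¬ σ.reg 33 < σ.reg 9) ∧
      (∀ b, b ≠ 18 → σ'.mem b = σ.mem b) ∧
      ∀ y, y < 34 ∨ 37 ≤ y → σ'.reg y = σ.reg y := by
  refine (Does.flat (by simp [removeOld, Prog.block, Prog.Flat]) ?_).mono (by decide) fun _ => id
  simp only [removeOld, Prog.block, Prog.run, BinOp.eval, State.setReg, State.setMem,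
    hu, hv, Function.update_self, ne_eq, Function.update_of_ne, Nat.reduceEqDiff,
    not_false_eq_true, huv.symm]
  refine ⟨?_, by simp, ?_, ?_⟩
  · funext a
    by_cases hau : a = u <;> by_cases hav : a = v <;> simp_all [bump]
  · intro b hb
    simp (disch := omega) only [Function.update_of_ne]
  · intro y hy
    simp (disch := omega) only [Function.update_of_ne]

theorem putNew_spec {σ : State} {u v : ℕ} (hu : σ.reg 31 = u) (hv : σ.reg 32 = v)
    (huv : u ≠ v) (bu : σ.mem 18 u + σ.reg 18 < 2 ^ w) (bv : σ.mem 18 v + σ.reg 18 < 2 ^ w) :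
    Does w putNew σ 7 fun σ' =>
      σ'.mem 17 = Function.update (σ.mem 17) (σ.reg 30) (σ.reg 18) ∧
      σ'.mem 18 = bump (σ.mem 18) u v (· + σ.reg 18) ∧
      (∀ b, b < 17 ∨ 18 < b → σ'.mem b = σ.mem b) ∧
      ∀ y, y < 34 ∨ 37 ≤ y → σ'.reg y = σ.reg y := by
  have e1 := Nat.mod_eq_of_lt bu
  have e2 := Nat.mod_eq_of_lt bv
  refine (Does.flat (by simp [putNew, Prog.block, Prog.Flat]) ?_).mono (by decide) fun _ => id
  simp only [putNew, Prog.block, Prog.run, BinOp.eval, State.setReg, State.setMem,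
    hu, hv, Function.update_self, ne_eq, Function.update_of_ne, Nat.reduceEqDiff,
    not_false_eq_true, huv.symm, e1, e2, true_and]
  refine ⟨?_, ?_, ?_⟩
  · funext a
    by_cases hau : a = u <;> by_cases hav : a = v <;> simp_all [bump]
  · intro b hb
    simp (disch := omega) only [Function.update_of_ne]
  · intro y hy
    simp (disch := omega) only [Function.update_of_ne]

/-- The room is computed from the degrees without the old value, which explains the truncated
differences. A value that would fall below δ is replaced by zero, as the promise to the rounding
algorithm requires. -/
theorem patch_spec {σ : State} {u v k n e d F : ℕ} (hw : 4 < 2 ^ w) (h1 : σ.reg 1 = F)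
    (h2 : σ.reg 2 = e) (h3 : σ.reg 3 = d) (h8 : σ.reg 8 = 2 ^ F) (h9 : σ.reg 9 = 2 * d)
    (hu : σ.reg 31 = u) (h30 : σ.reg 30 = u * n + v)
    (hv : σ.reg 32 = v) (hk : σ.reg 33 = k) (b : k * e * 4 < 2 ^ w) (h18 : σ.reg 18 = 0)
    (huv : u ≠ v) (bu : σ.mem 18 u + 2 ^ F < 2 ^ w) (bv : σ.mem 18 v + 2 ^ F < 2 ^ w) :
    Does w patch σ 37 fun σ' =>
      let old := σ.mem 17 (u * n + v)
      let val := if k < 2 * d then 0 else fitValue F e d k (σ.mem 18 u - old) (σ.mem 18 v - old)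
      σ'.reg 18 = val ∧ σ'.mem 17 = Function.update (σ.mem 17) (u * n + v) val ∧
      σ'.mem 18 = bump (σ.mem 18) u v (fun a => a - old + val) ∧
      (∀ b, b < 17 ∨ 18 < b → σ'.mem b = σ.mem b) ∧
      ∀ y, y ≠ 18 → y < 34 ∨ 37 ≤ y → σ'.reg y = σ.reg y := by
  generalize hold : σ.mem 17 (u * n + v) = old
  refine ((removeOld_spec hu hv huv).seq (B' := (21 + 1) + 7) (fun σ₁ ⟨a1, a2, a3, a4⟩ =>
    (Does.branch (B := 21) (Q := fun σ' =>
      σ'.reg 18 = (if k < 2 * d then 0 else fitValue F e d k (σ.mem 18 u - old) (σ.mem 18 v - old)) ∧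
      σ'.mem = σ₁.mem ∧ ∀ y, y ≠ 18 → y < 34 ∨ 37 ≤ y → σ'.reg y = σ₁.reg y)
      ?_ ?_).seq ?_)).mono (by norm_num) fun _ => id
  · intro h
    have : k < 2 * d := by
      by_contra hc
      exact h (a2.2 (by rwa [hk, h9]))
    refine (Does.flat (p := .skip) trivial ?_).mono (by decide) fun _ => id
    rw [if_pos this]
    exact ⟨by rw [Prog.run, a4, h18]; norm_num, rfl, fun _ _ _ => rfl⟩
  · intro h
    have : ¬ k < 2 * d := by rw [← hk, ← h9]; exact a2.1 h
    rw [if_neg this]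
    have m1 : σ₁.mem 18 u = σ.mem 18 u - old := by rw [a1, bump, if_pos (.inl rfl), h30, hold]
    have m2 : σ₁.mem 18 v = σ.mem 18 v - old := by rw [a1, bump, if_pos (.inr rfl), h30, hold]
    rw [← m1, ← m2]
    apply patchValue_spec hw _ _ _ _ _ _ _ b _ <;> rw [a4] <;> first | assumption | norm_num
  · rintro σ₂ ⟨b1, b2, b3⟩
    have hr : ∀ y, y ≠ 18 → y < 34 ∨ 37 ≤ y → σ₂.reg y = σ.reg y := fun y hy hy' => by
      rw [b3 y hy hy', a4 y hy']
    have m1 : σ₂.mem 18 u = σ.mem 18 u - old := by rw [b2, a1, bump, if_pos (.inl rfl), h30, hold]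
    have m2 : σ₂.mem 18 v = σ.mem 18 v - old := by rw [b2, a1, bump, if_pos (.inr rfl), h30, hold]
    have hle : σ₂.reg 18 ≤ 2 ^ F := by rw [b1]; split_ifs <;> simp [fitValue_le]
    refine (putNew_spec (by rw [hr _ (by norm_num) (by norm_num), hu])
      (by rw [hr _ (by norm_num) (by norm_num), hv]) huv (by omega) (by omega)).mono le_rfl ?_
    rintro σ₃ ⟨c1, c2, c3, c4⟩
    refine ⟨?_, ?_, ?_, ?_, ?_⟩
    · rw [c4 18 (by norm_num), b1]
    · rw [c1, b2, a3 17 (by norm_num), b1, hr 30 (by norm_num) (by norm_num), h30]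
    · rw [c2, b2, a1, b1, h30, hold]
      funext a
      simp only [bump]
      split_ifs <;> rfl
    · intro b hb
      rw [c3 b hb, b2, a3 b (by omega)]
    · intro y hy hy'
      rw [c4 y hy', hr y hy hy']

end Specs

/-! ## Vectors of words -/

section Words

variable {I : Params}

/-- The degree of a vertex, as a word. -/
def wdeg (X : WordVec I) (v : Fin I.n) : ℕ := ∑ u, X s(v, u)

/-- The part of a vector below `2δ`. -/
def small (X : WordVec I) : WordVec I := fun e => if X e < 2 * I.d then X e else 0

/-- The word vectors that stand for fractional matchings. -/
def Frac (X : WordVec I) : Prop := (∀ e, X e ≠ 0 → e ∈ I.G.edgeSet) ∧ ∀ v, wdeg X v ≤ 2 ^ I.F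

/-- The name of an edge. -/
abbrev edgeName (I : Params) (u v : Fin I.n) : ℕ := u * I.n + v

theorem edgeName_div (u v : Fin I.n) : edgeName I u v / I.n = u := by
  have := v.2
  rw [edgeName, add_comm, Nat.add_mul_div_right _ _ (by omega), Nat.div_eq_of_lt this, zero_add]

theorem edgeName_mod (u v : Fin I.n) : edgeName I u v % I.n = v := by
  rw [edgeName, add_comm, Nat.add_mul_mod_self_right, Nat.mod_eq_of_lt v.2]

theorem edgeName_inj {u v u' v' : Fin I.n} : edgeName I u v = edgeName I u' v' ↔ u = u' ∧ v = v' := by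
  refine ⟨fun h => ⟨Fin.ext ?_, Fin.ext ?_⟩, by rintro ⟨rfl, rfl⟩; rfl⟩
  · rw [← edgeName_div u v, h, edgeName_div]
  · rw [← edgeName_mod u v, h, edgeName_mod]

theorem edgeName_lt (u v : Fin I.n) : edgeName I u v < I.n * I.n := by
  have hu := u.2
  have hv := v.2
  calc u * I.n + v < u * I.n + I.n := by omega
    _ = (u + 1) * I.n := by ring
    _ ≤ I.n * I.n := Nat.mul_le_mul_right _ hu

/-- Both `n + 2` and `2 ^ F` are at least 2, so six of the eight factors of each supply 2^12 > 2000
and two of each remain for the product. -/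
theorem Params.mul_lt_word (I : Params) {a b : ℕ} (ha : a ≤ 2000 * (I.n + 2) ^ 2)
    (hb : b ≤ (2 ^ I.F) ^ 2) : a * b < 2 ^ I.w := by
  have hF : 2 ≤ 2 ^ I.F := by have := I.e_pos; have := I.e_lt; omega
  refine lt_of_lt_of_le ?_ I.wordSize
  set q := 2 ^ I.F
  set N := I.n + 2
  have hN : 2 ≤ N := by omega
  have h1 : 2 ^ 6 ≤ N ^ 6 := Nat.pow_le_pow_left hN 6
  have h2 : 2 ^ 6 ≤ q ^ 6 := Nat.pow_le_pow_left hF 6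
  have h3 : 0 < N ^ 2 * q ^ 2 := by positivity
  calc a * b ≤ 2000 * N ^ 2 * q ^ 2 := Nat.mul_le_mul ha hb
    _ < 2 ^ 6 * 2 ^ 6 * (N ^ 2 * q ^ 2) := by rw [mul_assoc]; omega
    _ ≤ N ^ 6 * q ^ 6 * (N ^ 2 * q ^ 2) := by gcongr
    _ = (N * q) ^ 8 := by ring

theorem Params.lt_word (I : Params) {a : ℕ} (ha : a ≤ 2000 * (I.n + 2) ^ 2) : a < 2 ^ I.w := by
  simpa using I.mul_lt_word ha (b := 1) (Nat.one_le_pow _ _ (by positivity))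

theorem Params.lt_word_of_le_pow (I : Params) {a : ℕ} (ha : a ≤ 2000 * (2 ^ I.F) ^ 2) : a < 2 ^ I.w := by
  have h := I.mul_lt_word (a := 2000) (b := (2 ^ I.F) ^ 2) (by nlinarith [Nat.zero_le I.n]) le_rfl
  omega

theorem Params.pow_le_sq (I : Params) : 2 ^ I.F ≤ (2 ^ I.F) ^ 2 :=
  Nat.le_self_pow (by norm_num) _

theorem Params.two_le_pow (I : Params) : 2 ≤ 2 ^ I.F := by
  have := I.e_pos; have := I.e_lt; omega

theorem wdeg_update (X : WordVec I) {u v : Fin I.n} (huv : u ≠ v) (k : ℕ) (z : Fin I.n) :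
    wdeg (Function.update X s(u, v) k) z =
      if z = u ∨ z = v then wdeg X z - X s(u, v) + k else wdeg X z := by
  have key : ∀ a b : Fin I.n, a ≠ b →
      wdeg (Function.update X s(a, b) k) a = wdeg X a - X s(a, b) + k := by
    intro a b hab
    have h1 : (fun x => Function.update X s(a, b) k s(a, x)) =
        Function.update (fun x => X s(a, x)) b k := by
      funext x
      by_cases hx : x = b
      · subst hx; simp
      · have : s(a, x) ≠ s(a, b) := fun h => hx (Sym2.congr_right.1 h)
        simp [this, hx]
    have h2 := Finset.sum_update_of_mem (Finset.mem_univ b) (fun x => X s(a, x)) k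
    have h3 : wdeg X a = X s(a, b) + ∑ x ∈ Finset.univ \ {b}, X s(a, x) := by
      rw [wdeg, ← Finset.sum_sdiff (Finset.subset_univ {b}), Finset.sum_singleton, add_comm]
    rw [wdeg, h1, h2, h3]
    omega
  by_cases h1 : z = u
  · subst h1; rw [if_pos (.inl rfl), key _ _ huv]
  by_cases h2 : z = v
  · subst h2; rw [if_pos (.inr rfl), Sym2.eq_swap, key _ _ huv.symm]
  rw [if_neg (by tauto), wdeg, wdeg]
  refine Finset.sum_congr rfl fun x _ => ?_
  have : s(z, x) ≠ s(u, v) := by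
    intro h
    have : z ∈ s(u, v) := h ▸ Sym2.mem_mk_left z x
    rw [Sym2.mem_iff] at this
    tauto
  simp [this]

theorem le_wdeg (X : WordVec I) (u v : Fin I.n) : X s(u, v) ≤ wdeg X u :=
  Finset.single_le_sum (f := fun x => X s(u, x)) (fun _ _ => Nat.zero_le _) (Finset.mem_univ v)

theorem le_wdeg' (X : WordVec I) (u v : Fin I.n) : X s(u, v) ≤ wdeg X v :=
  Sym2.eq_swap ▸ le_wdeg X v u

theorem wdeg_mono {X Y : WordVec I} (h : X ≤ Y) (v : Fin I.n) : wdeg X v ≤ wdeg Y v :=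
  Finset.sum_le_sum fun _ _ => h _

theorem wdeg_add (X Y : WordVec I) (v : Fin I.n) : wdeg (X + Y) v = wdeg X v + wdeg Y v :=
  Finset.sum_add_distrib

theorem wdeg_zero (v : Fin I.n) : wdeg (0 : WordVec I) v = 0 := by simp [wdeg]

theorem small_le (X : WordVec I) : small X ≤ X := fun e => by simp only [small]; split_ifs <;> simp

theorem small_update (X : WordVec I) (e : Sym2 (Fin I.n)) (k : ℕ) :
    small (Function.update X e k) = Function.update (small X) e (if k < 2 * I.d then k else 0) := by
  funext a
  by_cases h : a = e
  · subst h; simp [small]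
  · simp [small, h]

theorem small_zero : small (0 : WordVec I) = 0 := by funext e; simp [small]

theorem Frac.mono {X Y : WordVec I} (h : X ≤ Y) (hY : Frac Y) : Frac X :=
  ⟨fun e he => hY.1 e fun h0 => he (Nat.le_zero.1 (h0 ▸ h e)),
    fun v => (wdeg_mono h v).trans (hY.2 v)⟩

theorem Frac.small {X : WordVec I} (h : Frac X) : Frac (small X) := h.mono (small_le X)

theorem frac_zero : Frac (0 : WordVec I) := ⟨fun _ h => absurd rfl h, fun v => by simp [wdeg_zero]⟩

theorem Frac.le {X : WordVec I} (h : Frac X) (e : Sym2 (Fin I.n)) : X e ≤ 2 ^ I.F := by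
  induction e with | _ u v => exact (le_wdeg X u v).trans (h.2 u)

theorem degree_toReal (X : WordVec I) (v : Fin I.n) :
    degree X.toReal v = (wdeg X v : ℝ) / 2 ^ I.F := by
  simp [degree, WordVec.toReal, wdeg, Finset.sum_div]

theorem isFracMatching_toReal {X : WordVec I} : IsFracMatching I.G X.toReal ↔ Frac X := by
  have hq : (0 : ℝ) < 2 ^ I.F := by positivity
  constructor
  · intro h
    refine ⟨fun e he => h.support e ?_, fun v => ?_⟩
    · simpa [WordVec.toReal] using he
    · have := h.degree_le v
      rw [degree_toReal, div_le_one hq] at this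
      exact_mod_cast this
  · intro h
    refine ⟨fun e => ?_, fun e he => h.1 e ?_, fun v => ?_⟩
    · simp only [WordVec.toReal]; positivity
    · simpa [WordVec.toReal] using he
    · rw [degree_toReal, div_le_one hq]
      exact_mod_cast h.2 v

@[simp] theorem vecOf_nil : vecOf ([] : List (Entry I)) = 0 := rfl

theorem vecOf_cons (a : Entry I) (l : List (Entry I)) (e : Sym2 (Fin I.n)) :
    vecOf (a :: l) e = (if s(a.1, a.2.1) = e then a.2.2 else 0) + vecOf l e := by simp [vecOf]

theorem vecOf_append (l l' : List (Entry I)) : vecOf (l ++ l') = vecOf l + vecOf l' := by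
  funext e; simp [vecOf]

theorem exists_of_vecOf_ne_zero {l : List (Entry I)} {e : Sym2 (Fin I.n)} (h : vecOf l e ≠ 0) :
    ∃ a ∈ l, s(a.1, a.2.1) = e := by
  by_contra hc
  push Not at hc
  refine h (List.sum_eq_zero fun x hx => ?_)
  obtain ⟨a, ha, rfl⟩ := List.mem_map.1 hx
  exact if_neg (hc a ha)

theorem vecOf_eq_zero {l : List (Entry I)} {e : Sym2 (Fin I.n)}
    (h : e ∉ l.map fun a => s(a.1, a.2.1)) : vecOf l e = 0 := by
  by_contra hc
  obtain ⟨a, ha, rfl⟩ := exists_of_vecOf_ne_zero hc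
  exact h (List.mem_map.2 ⟨a, ha, rfl⟩)

theorem vecOf_of_mem {l : List (Entry I)} (hl : (l.map fun a => s(a.1, a.2.1)).Nodup)
    {a : Entry I} (ha : a ∈ l) : vecOf l s(a.1, a.2.1) = a.2.2 := by
  induction l with
  | nil => cases ha
  | cons b l ih =>
    rw [List.map_cons, List.nodup_cons] at hl
    rw [vecOf_cons]
    rcases List.mem_cons.1 ha with rfl | ha
    · rw [if_pos rfl, vecOf_eq_zero hl.1, add_zero]
    · rw [if_neg, ih hl.2 ha, zero_add]
      exact fun h => hl.1 (List.mem_map.2 ⟨a, ha, h.symm⟩)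

theorem vecOf_concat {l : List (Entry I)} {a : Entry I}
    (h : vecOf l s(a.1, a.2.1) = 0) :
    vecOf (l ++ [a]) = Function.update (vecOf l) s(a.1, a.2.1) a.2.2 := by
  funext e
  rw [vecOf_append, Pi.add_apply, vecOf_cons]
  by_cases he : e = s(a.1, a.2.1)
  · subst he; simp [h]
  · simp [he, Ne.symm he]

theorem IsEntryList.vecOf_ne_zero {l : List (Entry I)} (hl : IsEntryList I l) {a : Entry I}
    (ha : a ∈ l) : vecOf l s(a.1, a.2.1) ≠ 0 := by
  rw [vecOf_of_mem hl.2 ha]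
  exact (hl.1 a ha).2.2.ne'

theorem IsEntryList.sublist {l l' : List (Entry I)} (hl : IsEntryList I l) (h : l'.Sublist l) :
    IsEntryList I l' :=
  ⟨fun a ha => hl.1 a (h.subset ha), (h.map _).nodup hl.2⟩

theorem IsEntryList.concat {l : List (Entry I)} (hl : IsEntryList I l) {a : Entry I}
    (h1 : a.1 < a.2.1) (h2 : I.G.Adj a.1 a.2.1) (h3 : 0 < a.2.2)
    (h4 : vecOf l s(a.1, a.2.1) = 0) : IsEntryList I (l ++ [a]) := by
  refine ⟨fun b hb => ?_, ?_⟩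
  · rcases List.mem_append.1 hb with hb | hb
    · exact hl.1 b hb
    · rw [List.mem_singleton.1 hb]; exact ⟨h1, h2, h3⟩
  · rw [List.map_append, List.nodup_append]
    refine ⟨hl.2, by simp, ?_⟩
    rintro x hx y hy rfl
    obtain ⟨b, hb, rfl⟩ := List.mem_map.1 hx
    rw [List.map_singleton, List.mem_singleton] at hy
    exact hl.vecOf_ne_zero hb (hy ▸ h4)

theorem vecOf_le_of_sublist {l l' : List (Entry I)} (h : l'.Sublist l) : vecOf l' ≤ vecOf l := by
  induction h with
  | slnil => exact le_rfl
  | cons a _ ih => exact fun e => (ih e).trans (by rw [vecOf_cons]; exact Nat.le_add_left _ _)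
  | cons_cons a _ ih => exact fun e => by rw [vecOf_cons, vecOf_cons]; exact Nat.add_le_add_left (ih e) _

/-- Shows that filtering the initial list is the same as truncating the vector, so the coarsening
algorithm starts from the right input. -/
theorem small_vecOf {l : List (Entry I)} (hl : IsEntryList I l) :
    small (vecOf l) = vecOf (l.filter fun a => a.2.2 < 2 * I.d) := by
  have hf := hl.sublist (List.filter_sublist (p := fun a => decide (a.2.2 < 2 * I.d)) (l := l))
  funext e
  by_cases h : vecOf l e = 0
  · have := vecOf_le_of_sublist (List.filter_sublist (p := fun a => decide (a.2.2 < 2 * I.d)) (l := l)) e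
    rw [h] at this
    simp only [small, h, ite_self]
    exact (Nat.le_zero.1 this).symm
  obtain ⟨a, ha, rfl⟩ := exists_of_vecOf_ne_zero h
  simp only [small, vecOf_of_mem hl.2 ha]
  split_ifs with hc
  · rw [vecOf_of_mem hf.2 (List.mem_filter.2 ⟨ha, by simpa using hc⟩)]
  · refine (vecOf_eq_zero fun hm => ?_).symm
    obtain ⟨b, hb, hab⟩ := List.mem_map.1 hm
    have hb' := List.mem_filter.1 hb
    have e1 := vecOf_of_mem hl.2 hb'.1
    have e2 := vecOf_of_mem hl.2 ha
    rw [hab, e2] at e1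
    have := hb'.2
    simp only [decide_eq_true_eq] at this
    omega

/-- An entry list has at most `n ^ 2` entries. -/
theorem IsEntryList.length_le {l : List (Entry I)} (hl : IsEntryList I l) :
    l.length ≤ I.n * I.n := by
  have h : (l.map fun a => (a.1, a.2.1)).Nodup := by
    refine List.Nodup.of_map (fun p : Fin I.n × Fin I.n => s(p.1, p.2)) ?_
    rw [List.map_map]; exact hl.2
  have := h.length_le_card
  simpa using this

/-- The number of entries is the size of the support. -/
theorem IsEntryList.length_eq {l : List (Entry I)} (hl : IsEntryList I l) :
    l.length = (Finset.univ.filter fun e => vecOf l e ≠ 0).card := by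
  have h : (l.map fun a => s(a.1, a.2.1)).toFinset = Finset.univ.filter fun e => vecOf l e ≠ 0 := by
    ext e
    rw [List.mem_toFinset, List.mem_map, Finset.mem_filter]
    refine ⟨?_, fun h => exists_of_vecOf_ne_zero h.2⟩
    rintro ⟨a, ha, rfl⟩
    exact ⟨Finset.mem_univ _, hl.vecOf_ne_zero ha⟩
  rw [← h, List.toFinset_card_of_nodup hl.2, List.length_map]

end Words

/-! ## The own data of the combined machine -/

section Data

variable {I : Params}

/-- Both `ε` and `δ` are small. -/
def Params.Fine (I : Params) : Prop := 2000 * I.e < 2 ^ I.F ∧ 2000 * I.d < 2 ^ I.F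

instance (I : Params) : Decidable I.Fine := inferInstanceAs (Decidable (_ ∧ _))

/-- The registers that hold the constants of the instance. -/
structure Consts (I : Params) (o : State) : Prop where
  r0 : o.reg 0 = I.n
  r1 : o.reg 1 = I.F
  r2 : o.reg 2 = I.e
  r3 : o.reg 3 = I.d
  r8 : o.reg 8 = 2 ^ I.F
  r9 : o.reg 9 = 2 * I.d
  r14 : o.reg 14 = if I.Fine then 1 else 0

theorem Consts.of_eq {o o' : State} (h : Consts I o)
    (h' : ∀ y < 15, y ≠ 10 → y ≠ 11 → y ≠ 12 → y ≠ 13 → o'.reg y = o.reg y) : Consts I o' where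
  r0 := by rw [h' 0, h.r0] <;> norm_num
  r1 := by rw [h' 1, h.r1] <;> norm_num
  r2 := by rw [h' 2, h.r2] <;> norm_num
  r3 := by rw [h' 3, h.r3] <;> norm_num
  r8 := by rw [h' 8, h.r8] <;> norm_num
  r9 := by rw [h' 9, h.r9] <;> norm_num
  r14 := by rw [h' 14, h.r14] <;> norm_num

/-- The input vector, the degrees of its small part, and the stack of its edges. -/
structure InputRep (X : WordVec I) (o : State) : Prop where
  val : ∀ u v, u < v → o.mem 12 (edgeName I u v) = X s(u, v)
  deg : ∀ v : Fin I.n, o.mem 13 v = wdeg (small X) v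
  stack_name : ∀ i < o.reg 10, ∃ u v, u < v ∧ o.mem 14 i = edgeName I u v ∧
    o.mem 15 (edgeName I u v) ≠ 0
  stack_inj : ∀ i < o.reg 10, ∀ j < o.reg 10, o.mem 14 i = o.mem 14 j → i = j
  marked : ∀ u v, u < v → o.mem 15 (edgeName I u v) ≠ 0 →
    ∃ i < o.reg 10, o.mem 14 i = edgeName I u v
  supp : ∀ u v, u < v → X s(u, v) ≠ 0 → o.mem 15 (edgeName I u v) ≠ 0

/-- The list of touched edges consists of edges. -/
def Touched (I : Params) (o : State) : Prop :=
  ∀ i < o.reg 11, ∃ u v, u < v ∧ o.mem 16 i = edgeName I u v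

/-- The list of touched edges contains the edges with the property `Z`. -/
def Covers (I : Params) (Z : Sym2 (Fin I.n) → Prop) (o : State) : Prop :=
  ∀ u v, u < v → Z s(u, v) → ∃ i < o.reg 11, o.mem 16 i = edgeName I u v

/-- The vector of the rounding algorithm. -/
structure RoundRep (P : WordVec I) (o : State) : Prop where
  val : ∀ u v, u < v → o.mem 17 (edgeName I u v) = P s(u, v)
  deg : ∀ v : Fin I.n, o.mem 18 v = wdeg P v

theorem InputRep.of_eq {X : WordVec I} {o o' : State} (h : InputRep X o)
    (h10 : o'.reg 10 = o.reg 10) (h' : ∀ b, 12 ≤ b → b < 16 → o'.mem b = o.mem b) :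
    InputRep X o' where
  val := by rw [h' 12 (by norm_num) (by norm_num)]; exact h.val
  deg := by rw [h' 13 (by norm_num) (by norm_num)]; exact h.deg
  stack_name := by
    rw [h10, h' 14 (by norm_num) (by norm_num), h' 15 (by norm_num) (by norm_num)]
    exact h.stack_name
  stack_inj := by rw [h10, h' 14 (by norm_num) (by norm_num)]; exact h.stack_inj
  marked := by
    rw [h10, h' 14 (by norm_num) (by norm_num), h' 15 (by norm_num) (by norm_num)]
    exact h.marked
  supp := by rw [h' 15 (by norm_num) (by norm_num)]; exact h.supp

theorem RoundRep.of_eq {P : WordVec I} {o o' : State} (h : RoundRep P o)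
    (h17 : o'.mem 17 = o.mem 17) (h18 : o'.mem 18 = o.mem 18) : RoundRep P o' where
  val := by rw [h17]; exact h.val
  deg := by rw [h18]; exact h.deg

theorem Touched.of_eq {o o' : State} (h : Touched I o) (h11 : o'.reg 11 = o.reg 11)
    (h16 : o'.mem 16 = o.mem 16) : Touched I o' := by rwa [Touched, h11, h16]

theorem Covers.of_eq {Z : Sym2 (Fin I.n) → Prop} {o o' : State} (h : Covers I Z o)
    (h11 : o'.reg 11 = o.reg 11) (h16 : o'.mem 16 = o.mem 16) : Covers I Z o' := by
  rwa [Covers, h11, h16]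

/-- The marks keep the names on the stack distinct, and there are fewer than n² names. This keeps
the height within a word however many updates occur. -/
theorem InputRep.stack_le {X : WordVec I} {o : State} (h : InputRep X o) :
    o.reg 10 ≤ I.n * I.n := by
  have : Function.Injective fun i : Fin (o.reg 10) => (⟨o.mem 14 i, by
      obtain ⟨u, v, -, h1, -⟩ := h.stack_name i i.2
      rw [h1]; exact edgeName_lt u v⟩ : Fin (I.n * I.n)) := by
    intro i j hij
    exact Fin.ext (h.stack_inj i i.2 j j.2 (Fin.mk.inj_iff.1 hij))
  simpa using Fintype.card_le_of_injective _ this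

theorem Params.one_lt_word (I : Params) : 1 < 2 ^ I.w :=
  I.lt_word (by nlinarith [Nat.zero_le I.n])

theorem Params.four_lt_word (I : Params) : 4 < 2 ^ I.w :=
  I.lt_word (by nlinarith [Nat.zero_le I.n])

theorem Params.edgeName_lt_word (I : Params) (u v : Fin I.n) : edgeName I u v < 2 ^ I.w :=
  I.lt_word ((edgeName_lt u v).le.trans (by nlinarith [Nat.zero_le I.n]))

/-- An edge is pushed only if it is unmarked, so the stack stays free of repetitions; the list of
touched edges gets the edge unconditionally. -/
theorem setEdge_rep {X : WordVec I} {o : State} {u v : Fin I.n} {k : ℕ} (hc : Consts I o)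
    (hX : InputRep X o) (ht : Touched I o) (hF : Frac X) (hk : k ≤ 2 ^ I.F) (huv : u < v)
    (h31 : o.reg 31 = u) (h32 : o.reg 32 = v) (h33 : o.reg 33 = k)
    (b11 : o.reg 11 + 1 < 2 ^ I.w) :
    Does I.w setEdge o 40 fun o' =>
      InputRep (Function.update X s(u, v) k) o' ∧ Touched I o' ∧ o'.reg 11 = o.reg 11 + 1 ∧
      o'.mem 16 = Function.update (o.mem 16) (o.reg 11) (edgeName I u v) ∧
      o'.reg 10 ≤ o.reg 10 + 1 ∧ o'.reg 30 = edgeName I u v ∧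
      (∀ b, b < 12 ∨ 16 < b → o'.mem b = o.mem b) ∧
      ∀ y, (y < 30 ∨ 38 ≤ y ∨ y = 31 ∨ y = 32 ∨ y = 33) → y ≠ 10 → y ≠ 11 →
        o'.reg y = o.reg y := by
  have hne : (u : ℕ) ≠ v := fun h => huv.ne (Fin.ext h)
  have hq := I.two_le_pow
  have hq2 := I.pow_le_sq
  have hdeg : ∀ z : Fin I.n, o.mem 13 z + k < 2 ^ I.w := fun z => by
    have := hF.small.2 z
    rw [hX.deg]
    exact I.lt_word_of_le_pow (by omega)
  have hsp := hX.stack_le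
  refine (setEdge_spec (u := u) (v := v) (n := I.n) (D := 2 * I.d) (k := k) I.one_lt_word hc.r0
    hc.r9 h31 h32 h33 hne (I.edgeName_lt_word u v) (hdeg u) (hdeg v)
    (I.lt_word (by nlinarith)) b11).mono le_rfl ?_
  rintro o' ⟨h12, h13, h1, h16, h11, h30, hb, hr⟩
  have hold : (if o.mem 12 (edgeName I u v) < 2 * I.d then o.mem 12 (edgeName I u v) else 0) =
      small X s(u, v) := by rw [hX.val u v huv]; rfl
  change _ = Function.update _ (edgeName I u v) _ at h12
  replace h16 : o'.mem 16 = Function.update (o.mem 16) (o.reg 11) (edgeName I u v) := h16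
  replace h1 : if o.mem 15 (edgeName I u v) = 0 then
      o'.mem 14 = Function.update (o.mem 14) (o.reg 10) (edgeName I u v) ∧
        o'.mem 15 = Function.update (o.mem 15) (edgeName I u v) 1 ∧ o'.reg 10 = o.reg 10 + 1
    else o'.mem 14 = o.mem 14 ∧ o'.mem 15 = o.mem 15 ∧ o'.reg 10 = o.reg 10 := h1
  change o'.mem 13 = bump _ _ _ (fun a => a - (if o.mem 12 (edgeName I u v) < 2 * I.d then
    o.mem 12 (edgeName I u v) else 0) + _) at h13
  rw [hold] at h13
  have hval : ∀ a b, a < b →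
      o'.mem 12 (edgeName I a b) = Function.update X s(u, v) k s(a, b) := by
    intro a b hab
    rw [h12]
    by_cases h : a = u ∧ b = v
    · obtain ⟨rfl, rfl⟩ := h; simp
    · rw [Function.update_of_ne (fun h' => h (edgeName_inj.1 h')), Function.update_of_ne,
        hX.val a b hab]
      intro h'
      rcases Sym2.eq_iff.1 h' with h' | ⟨rfl, rfl⟩
      · exact h h'
      · exact absurd hab huv.asymm
  have hdeg' : ∀ z : Fin I.n, o'.mem 13 z = wdeg (small (Function.update X s(u, v) k)) z := by
    intro z
    rw [h13, small_update, wdeg_update _ huv.ne]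
    simp only [bump, hX.deg, Fin.ext_iff]
  have htouch : Touched I o' := by
    intro i hi
    rw [h11] at hi
    rw [h16]
    by_cases hi' : i = o.reg 11
    · exact ⟨u, v, huv, by rw [hi', Function.update_self]⟩
    · rw [Function.update_of_ne hi']
      exact ht i (by omega)
  have hin : ∀ a b, a < b → (a, b) ≠ (u, v) → Function.update X s(u, v) k s(a, b) = X s(a, b) := by
    intro a b hab h
    rw [Function.update_of_ne]
    intro h'
    rcases Sym2.eq_iff.1 h' with ⟨rfl, rfl⟩ | ⟨rfl, rfl⟩
    · exact h rfl
    · exact absurd hab huv.asymm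
  refine ⟨?_, htouch, h11, h16, ?_, h30, hb, hr⟩
  · by_cases hm : o.mem 15 (edgeName I u v) = 0
    · rw [if_pos hm] at h1
      obtain ⟨h14, h15, h10⟩ := h1
      refine ⟨hval, hdeg', ?_, ?_, ?_, ?_⟩
      · intro i hi
        rw [h10] at hi
        by_cases hi' : i = o.reg 10
        · exact ⟨u, v, huv, by rw [h14, hi', Function.update_self], by rw [h15]; simp⟩
        · obtain ⟨a, b, hab, h2, h3⟩ := hX.stack_name i (by omega)
          refine ⟨a, b, hab, by rw [h14, Function.update_of_ne hi', h2], ?_⟩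
          rw [h15]
          by_cases h4 : edgeName I a b = edgeName I u v
          · rw [h4]; simp
          · rwa [Function.update_of_ne h4]
      -- All names on the stack are marked and the new one was not, so it does not occur there.
      · have hnew : ∀ i < o.reg 10, o.mem 14 i ≠ edgeName I u v := by
          intro i hi h
          obtain ⟨a, b, hab, h2, h3⟩ := hX.stack_name i hi
          rw [← h2, h] at h3
          exact h3 hm
        intro i hi j hj hij
        rw [h10] at hi hj
        rw [h14] at hij
        by_cases hi' : i = o.reg 10 <;> by_cases hj' : j = o.reg 10
        · omega
        · subst hi'
          rw [Function.update_self, Function.update_of_ne hj'] at hij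
          exact absurd hij.symm (hnew j (by omega))
        · subst hj'
          rw [Function.update_self, Function.update_of_ne hi'] at hij
          exact absurd hij (hnew i (by omega))
        · rw [Function.update_of_ne hi', Function.update_of_ne hj'] at hij
          exact hX.stack_inj i (by omega) j (by omega) hij
      · intro a b hab h2
        by_cases h4 : edgeName I a b = edgeName I u v
        · exact ⟨o.reg 10, by omega, by rw [h14, h4]; simp⟩
        · rw [h15, Function.update_of_ne h4] at h2
          obtain ⟨i, hi, h5⟩ := hX.marked a b hab h2
          exact ⟨i, by omega, by rw [h14, Function.update_of_ne (by omega), h5]⟩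
      · intro a b hab h2
        rw [h15]
        by_cases h4 : edgeName I a b = edgeName I u v
        · rw [h4]; simp
        · rw [Function.update_of_ne h4]
          refine hX.supp a b hab ?_
          rwa [hin a b hab (fun h => h4 (edgeName_inj.2 (Prod.mk.inj h)))] at h2
    · rw [if_neg hm] at h1
      obtain ⟨h14, h15, h10⟩ := h1
      refine ⟨hval, hdeg', by rw [h14, h15, h10]; exact hX.stack_name,
        by rw [h14, h10]; exact hX.stack_inj, by rw [h14, h15, h10]; exact hX.marked, ?_⟩
      intro a b hab h2
      rw [h15]
      by_cases h4 : (a, b) = (u, v)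
      · cases h4; exact hm
      · rw [hin a b hab h4] at h2
        exact hX.supp a b hab h2
  · split_ifs at h1 <;> omega

/-- The own data for the input vector `X` and the vector `P` of the rounding algorithm. -/
structure Data (X P : WordVec I) (o : State) : Prop where
  input : InputRep X o
  round : RoundRep P o
  touched : Touched I o
  covers : Covers I (fun e => P e ≠ 0 ∨ 2 * I.d ≤ X e) o

theorem data_blank : Data (0 : WordVec I) 0 State.blank where
  input :=
    { val := fun _ _ _ => rfl
      deg := fun v => by simp [State.blank, small_zero, wdeg_zero]
      stack_name := fun _ hi => absurd hi (Nat.not_lt_zero _)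
      stack_inj := fun _ hi => absurd hi (Nat.not_lt_zero _)
      marked := fun _ _ _ h => absurd rfl h
      supp := fun _ _ _ h => absurd rfl h }
  round :=
    { val := fun _ _ _ => rfl
      deg := fun v => by simp [State.blank, wdeg_zero] }
  touched := fun _ hi => absurd hi (Nat.not_lt_zero _)
  covers := fun u v _ h => by
    have := I.d_pos
    simp only [Pi.zero_apply, ne_eq, not_true_eq_false, false_or, nonpos_iff_eq_zero] at h
    omega

/-- The entries of a list are stored in three memory banks. -/
def ListAt (a b c : ℕ) (l : List (Entry I)) (o : State) : Prop :=
  ∀ i (h : i < l.length), o.mem a i = l[i].1 ∧ o.mem b i = l[i].2.1 ∧ o.mem c i = l[i].2.2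

theorem ListAt.of_eq {a b c : ℕ} {l : List (Entry I)} {o o' : State} (h : ListAt a b c l o)
    (ha : o'.mem a = o.mem a) (hb : o'.mem b = o.mem b) (hc : o'.mem c = o.mem c) :
    ListAt a b c l o' := by rwa [ListAt, ha, hb, hc]

theorem ListAt.concat {a b c : ℕ} {l : List (Entry I)} {o o' : State} (h : ListAt a b c l o)
    {x : Entry I} (ha : o'.mem a = Function.update (o.mem a) l.length x.1)
    (hb : o'.mem b = Function.update (o.mem b) l.length x.2.1)
    (hc : o'.mem c = Function.update (o.mem c) l.length x.2.2) :
    ListAt a b c (l ++ [x]) o' := by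
  intro i hi
  rw [ha, hb, hc]
  by_cases hi' : i = l.length
  · subst hi'; simp
  · have hi2 : i < l.length := by simp at hi; omega
    rw [Function.update_of_ne hi', Function.update_of_ne hi', Function.update_of_ne hi',
      List.getElem_append_left hi2]
    exact h i hi2

theorem listAt_pass {l : List (Entry I)} {o : State} :
    ListAt 0 1 2 l ((Op.start l).pass o) := by
  intro i hi
  simp [Op.pass, State.writeList, State.setReg, hi]

end Data

/-! ### Initialization: erasing the old input and loading the new one -/

section StartCode

/-- Composition itself takes no step, so regrouping a sequence preserves the count. This lets the
reset be specified apart from the loading loop. -/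
theorem Exec.seq_assoc {w : ℕ} {ω : Tape w} {p q r : Prog} {σ σ' : State} {c : ℕ}
    (h : Exec w ω (.seq (.seq p q) r) σ σ' c) : Exec w ω (.seq p (.seq q r)) σ σ' c := by
  cases h with
  | seq h hr => cases h with
    | seq hp hq => rw [add_assoc]; exact .seq hp (.seq hq hr)

theorem Exec.seq_assoc_right {w : ℕ} {ω : Tape w} {p q r s : Prog} {σ σ' : State} {c : ℕ}
    (h : Exec w ω (.seq p (.seq (.seq q r) s)) σ σ' c) :
    Exec w ω (.seq p (.seq q (.seq r s))) σ σ' c := by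
  cases h with
  | seq hp h => exact .seq hp h.seq_assoc

variable {I : Params}

/-- Invariant: a cell that is not yet zero belongs to an edge in the unprocessed part of the stack.
-/
theorem clearStack_spec {X : WordVec I} {o : State} (hc : Consts I o) (h : InputRep X o)
    (hF : Frac X) : Does I.w (.forUpto 10 clearEdge) o ((8 + 4) * o.reg 10 + 4) fun o' =>
      (∀ u v, u < v → o'.mem 12 (edgeName I u v) = 0 ∧ o'.mem 15 (edgeName I u v) = 0) ∧
      (∀ z : Fin I.n, o'.mem 13 z = 0) ∧
      (∀ b, b ≠ 12 → b ≠ 13 → b ≠ 15 → o'.mem b = o.mem b) ∧ ∀ y < 30, o'.reg y = o.reg y := by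
  let J : ℕ → State → Prop := fun i o' =>
    (∀ u v, u < v → (∃ j, i ≤ j ∧ j < o.reg 10 ∧ o.mem 14 j = edgeName I u v) ∨
      (o'.mem 12 (edgeName I u v) = 0 ∧ o'.mem 15 (edgeName I u v) = 0)) ∧
    (∀ z : Fin I.n, (∃ j, i ≤ j ∧ j < o.reg 10 ∧ ∃ u v, u < v ∧ o.mem 14 j = edgeName I u v ∧
      (z = u ∨ z = v)) ∨ o'.mem 13 z = 0) ∧
    (∀ b, b ≠ 12 → b ≠ 13 → b ≠ 15 → o'.mem b = o.mem b) ∧ ∀ y < 30, o'.reg y = o.reg y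
  have hsp := h.stack_le
  refine (Does.forUpto (by norm_num) (I.lt_word (by nlinarith)) I.one_lt_word J ?_ rfl ?_ ?_).mono
    le_rfl ?_
  · rintro i σ σ' h1 h2 ⟨a, b, c, d⟩
    refine ⟨by rwa [h1], by rwa [h1], by rwa [h1], fun y hy => by rw [h2 y (by omega), d y hy]⟩
  · rintro i hi σ ⟨a, b, c, d⟩ h40 h10
    refine clearEdge_spec.mono le_rfl ?_
    obtain ⟨u, v, huv, h14, -⟩ := h.stack_name i hi
    have e14 : σ.mem 14 (σ.reg 40) = edgeName I u v := by
      rw [h40, c 14 (by norm_num) (by norm_num) (by norm_num), h14]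
    have e0 : σ.reg 0 = I.n := by rw [d 0 (by norm_num), hc.r0]
    rintro σ' ⟨h12, h15, h13, hb, hr⟩
    rw [e14] at h12 h15
    rw [e14, e0, edgeName_div, edgeName_mod] at h13
    refine ⟨⟨?_, ?_, ?_, ?_⟩, ?_, ?_⟩
    · intro x y hxy
      rw [h12, h15]
      by_cases he : edgeName I x y = edgeName I u v
      · right; rw [he]; simp
      rw [Function.update_of_ne he, Function.update_of_ne he]
      rcases a x y hxy with ⟨j, hj1, hj2, hj3⟩ | h0
      · left
        refine ⟨j, ?_, hj2, hj3⟩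
        rcases hj1.eq_or_lt with rfl | hj1
        · exact absurd (hj3.symm.trans h14) he
        · exact hj1
      · right; exact h0
    · intro z
      rw [h13]
      by_cases h1 : z = v
      · right; rw [h1]; simp
      have h1' : (z : ℕ) ≠ v := fun h => h1 (Fin.ext h)
      rw [Function.update_of_ne h1']
      by_cases h2 : z = u
      · right; rw [h2]; simp
      have h2' : (z : ℕ) ≠ u := fun h => h2 (Fin.ext h)
      rw [Function.update_of_ne h2']
      rcases b z with ⟨j, hj1, hj2, x, y, hxy, hj3, hz⟩ | h0
      · left
        refine ⟨j, ?_, hj2, x, y, hxy, hj3, hz⟩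
        rcases hj1.eq_or_lt with rfl | hj1
        · obtain ⟨rfl, rfl⟩ := edgeName_inj.1 (hj3.symm.trans h14)
          exact absurd hz (by tauto)
        · exact hj1
      · right; exact h0
    · intro b h1 h2 h3
      rw [hb b h1 h2 h3, c b h1 h2 h3]
    · intro y hy
      rw [hr y (by omega), d y hy]
    · rw [hr 40 (by norm_num), h40]
    · rw [hr 10 (by norm_num), h10]
  · refine ⟨fun u v huv => ?_, fun z => ?_, fun _ _ _ _ => rfl, fun _ _ => rfl⟩
    · by_cases hm : o.mem 15 (edgeName I u v) = 0
      · right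
        refine ⟨?_, hm⟩
        rw [h.val u v huv]
        by_contra hx
        exact h.supp u v huv hx hm
      · left
        obtain ⟨i, h1, h2⟩ := h.marked u v huv hm
        exact ⟨i, Nat.zero_le _, h1, h2⟩
    · by_cases hz : o.mem 13 z = 0
      · right; exact hz
      left
      -- A vertex of nonzero degree has an incident edge of nonzero value, and that edge is on the
      -- stack. The case of a loop is excluded because the vector lives on edges of `G`.
      rw [h.deg, wdeg] at hz
      obtain ⟨y, -, hy⟩ := Finset.exists_ne_zero_of_sum_ne_zero hz
      have hy' : X s(z, y) ≠ 0 := fun h0 => hy (Nat.le_zero.1 (h0 ▸ small_le X s(z, y)))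
      rcases lt_trichotomy z y with hzy | rfl | hzy
      · obtain ⟨i, h1, h2⟩ := h.marked z y hzy (h.supp z y hzy hy')
        exact ⟨i, Nat.zero_le _, h1, z, y, hzy, h2, .inl rfl⟩
      · exact absurd (hF.1 _ hy') (SimpleGraph.irrefl I.G)
      · rw [Sym2.eq_swap] at hy'
        obtain ⟨i, h1, h2⟩ := h.marked y z hzy (h.supp y z hzy hy')
        exact ⟨i, Nat.zero_le _, h1, y, z, hzy, h2, .inr rfl⟩
  · rintro o' ⟨a, b, c, d⟩
    refine ⟨fun u v huv => ?_, fun z => ?_, c, d⟩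
    · exact (a u v huv).resolve_left fun ⟨j, h1, h2, _⟩ => by omega
    · exact (b z).resolve_left fun ⟨j, h1, h2, _⟩ => by omega

theorem inputRep_zero {o : State}
    (h : ∀ u v, u < v → o.mem 12 (edgeName I u v) = 0 ∧ o.mem 15 (edgeName I u v) = 0)
    (h' : ∀ z : Fin I.n, o.mem 13 z = 0) (h10 : o.reg 10 = 0) : InputRep (0 : WordVec I) o where
  val u v huv := (h u v huv).1
  deg z := by rw [h', small_zero, wdeg_zero]
  stack_name i hi := by omega
  stack_inj i hi := by omega
  marked u v huv hm := absurd (h u v huv).2 hm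
  supp u v _ hx := absurd rfl hx

theorem loadEntry_spec {X P : WordVec I} {o : State} {a : Entry I} {l : List (Entry I)} {i : ℕ}
    (hc : Consts I o) (hD : Data X P o) (hF : Frac X) (ha : a.1 < a.2.1) (hk : a.2.2 ≤ 2 ^ I.F)
    (h40 : o.reg 40 = i)
    (h0 : o.mem 0 i = a.1) (h1 : o.mem 1 i = a.2.1) (h2 : o.mem 2 i = a.2.2)
    (b11 : o.reg 11 + 1 < 2 ^ I.w) (b16 : o.reg 16 + 1 < 2 ^ I.w) (h16 : o.reg 16 = l.length)
    (hl : ListAt 3 4 5 l o) :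
    Does I.w loadEntry o 52 fun o' =>
      Data (if I.Fine then Function.update X s(a.1, a.2.1) a.2.2 else X) P o' ∧
      o'.reg 16 = (l ++ [a].filter fun a => a.2.2 < 2 * I.d).length ∧
      ListAt 3 4 5 (l ++ [a].filter fun a => a.2.2 < 2 * I.d) o' ∧
      o'.reg 10 ≤ o.reg 10 + (if I.Fine then 1 else 0) ∧
      o'.reg 11 = o.reg 11 + (if I.Fine then 1 else 0) ∧
      (∀ b < 3, o'.mem b = o.mem b) ∧
      ∀ y, y < 30 ∨ y = 40 → y ≠ 10 → y ≠ 11 → y ≠ 16 → o'.reg y = o.reg y := by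
  refine Does.mono (B := 3 + ((40 + 1) + 8)) (Does.seq (Q := fun σ => σ.reg 31 = a.1 ∧
    σ.reg 32 = a.2.1 ∧ σ.reg 33 = a.2.2 ∧ σ.mem = o.mem ∧
      ∀ y, y < 30 ∨ 34 ≤ y → σ.reg y = o.reg y) ?_ ?_) (by norm_num) fun _ => id
  · refine (Does.flat (p := readEntry) (by simp [readEntry, Prog.block, Prog.Flat]) ?_).mono
      (by decide) fun _ => id
    simp only [readEntry, Prog.block, Prog.run, State.setReg, Function.update_self, ne_eq,
      Function.update_of_ne, Nat.reduceEqDiff, not_false_eq_true, h40, h0, h1, h2, true_and]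
    intro y hy
    simp (disch := omega) only [Function.update_of_ne]
  rintro σ ⟨h31, h32, h33, hm, hr⟩
  have hcσ : Consts I σ := hc.of_eq fun y hy _ _ _ _ => hr y (by omega)
  have hDσ : Data X P σ := ⟨hD.input.of_eq (hr 10 (by norm_num)) (by simp [hm]),
    hD.round.of_eq (by rw [hm]) (by rw [hm]), hD.touched.of_eq (hr 11 (by norm_num)) (by rw [hm]),
    hD.covers.of_eq (hr 11 (by norm_num)) (by rw [hm])⟩
  have h11 : σ.reg 11 = o.reg 11 := hr 11 (by norm_num)
  refine Does.seq (Q := fun σ' =>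
      Data (if I.Fine then Function.update X s(a.1, a.2.1) a.2.2 else X) P σ' ∧
      σ'.reg 10 ≤ o.reg 10 + (if I.Fine then 1 else 0) ∧
      σ'.reg 11 = o.reg 11 + (if I.Fine then 1 else 0) ∧
      (∀ b < 12, σ'.mem b = o.mem b) ∧
      ∀ y, y < 30 ∨ 38 ≤ y ∨ y = 31 ∨ y = 32 ∨ y = 33 → y ≠ 10 → y ≠ 11 → σ'.reg y = σ.reg y)
    (Does.branch ?_ ?_) ?_
  · intro h14
    have hfine : I.Fine := by
      by_contra hcon
      rw [hcσ.r14, if_neg hcon] at h14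
      exact h14 rfl
    simp only [if_pos hfine]
    refine (setEdge_rep hcσ hDσ.input hDσ.touched hF hk ha h31 h32 h33 (by rwa [h11])).mono le_rfl ?_
    rintro σ' ⟨a1, a2, a3, a4, a5, a6, a7, a8⟩
    refine ⟨⟨a1, ?_, a2, ?_⟩, ?_, by rw [a3, h11], fun b hb => by rw [a7 b (.inl hb), hm], ?_⟩
    · exact hDσ.round.of_eq (a7 17 (by norm_num)) (a7 18 (by norm_num))
    · intro x y hxy hz
      by_cases he : s(x, y) = s(a.1, a.2.1)
      · refine ⟨σ.reg 11, by omega, ?_⟩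
        rw [a4, Function.update_self]
        rcases Sym2.eq_iff.1 he with ⟨rfl, rfl⟩ | ⟨rfl, rfl⟩
        · rfl
        · exact absurd hxy ha.asymm
      · rw [Function.update_of_ne he] at hz
        obtain ⟨j, hj, hj'⟩ := hDσ.covers x y hxy hz
        exact ⟨j, by omega, by rw [a4, Function.update_of_ne (by omega), hj']⟩
    · rw [← hr 10 (by norm_num)]; exact a5
    · intro y hy h1 h2
      exact a8 y hy h1 h2
  · intro h14
    have hfine : ¬ I.Fine := by
      intro hcon
      rw [hcσ.r14, if_pos hcon] at h14
      exact one_ne_zero h14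
    simp only [if_neg hfine]
    refine (Does.flat (p := .skip) trivial ?_).mono (by decide) fun _ => id
    exact ⟨hDσ, by rw [Prog.run, hr 10 (by norm_num)]; simp, by rw [Prog.run, h11, add_zero],
      fun b _ => by rw [Prog.run, hm], fun _ _ _ _ => rfl⟩
  rintro σ' ⟨b1, b2, b3, b4, b5⟩
  have g16 : σ'.reg 16 = o.reg 16 := by
    rw [b5 16 (by norm_num) (by norm_num) (by norm_num), hr 16 (by norm_num)]
  refine (passEntry_spec I.one_lt_word (by rwa [g16])).mono le_rfl ?_
  rintro σ'' ⟨c1, c2, c3⟩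
  have g9 : σ'.reg 9 = 2 * I.d := by
    rw [b5 9 (by norm_num) (by norm_num) (by norm_num), hcσ.r9]
  have g31 : σ'.reg 31 = a.1 := by
    rw [b5 31 (by norm_num) (by norm_num) (by norm_num), h31]
  have g32 : σ'.reg 32 = a.2.1 := by
    rw [b5 32 (by norm_num) (by norm_num) (by norm_num), h32]
  have g33 : σ'.reg 33 = a.2.2 := by
    rw [b5 33 (by norm_num) (by norm_num) (by norm_num), h33]
  rw [g33, g9, g31, g32, g16, b4 3 (by norm_num), b4 4 (by norm_num), b4 5 (by norm_num)] at c1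
  refine ⟨⟨?_, ?_, ?_, ?_⟩, ?_, ?_, ?_, ?_, ?_, ?_⟩
  · exact b1.input.of_eq (c3 10 (by norm_num) (by norm_num) (by norm_num))
      fun b h1 h2 => c2 b (.inr (by omega))
  · exact b1.round.of_eq (c2 17 (by norm_num)) (c2 18 (by norm_num))
  · exact b1.touched.of_eq (c3 11 (by norm_num) (by norm_num) (by norm_num)) (c2 16 (by norm_num))
  · exact b1.covers.of_eq (c3 11 (by norm_num) (by norm_num) (by norm_num)) (c2 16 (by norm_num))
  · by_cases hs : a.2.2 < 2 * I.d
    · rw [if_pos hs] at c1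
      simp [hs, c1.2.2.2, h16]
    · rw [if_neg hs] at c1
      simp [hs, c1.2.2.2, h16]
  · by_cases hs : a.2.2 < 2 * I.d
    · rw [if_pos hs, h16] at c1
      simp only [hs, decide_true, List.filter_cons_of_pos, List.filter_nil]
      exact hl.concat c1.1 c1.2.1 c1.2.2.1
    · rw [if_neg hs] at c1
      simp only [hs, decide_false, List.filter_cons, List.filter_nil]
      simpa using hl.of_eq c1.1 c1.2.1 c1.2.2.1
  · rw [c3 10 (by norm_num) (by norm_num) (by norm_num)]; exact b2
  · rw [c3 11 (by norm_num) (by norm_num) (by norm_num)]; exact b3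
  · intro b hb
    rw [c2 b (.inl hb), b4 b (by omega)]
  · intro y hy h1 h2 h3
    rw [c3 y h3 (by omega) (by omega), b5 y (by omega) h1 h2, hr y (by omega)]

theorem Params.fine_word (I : Params) : 2000 * I.e < 2 ^ I.w ∧ 2000 * I.d < 2 ^ I.w := by
  have h1 := I.e_lt
  have h2 := I.d_le
  have h3 := I.pow_le_sq
  exact ⟨I.lt_word_of_le_pow (by omega), I.lt_word_of_le_pow (by omega)⟩

theorem Data.of_eq {X P : WordVec I} {o o' : State} (h : Data X P o)
    (h10 : o'.reg 10 = o.reg 10) (h11 : o'.reg 11 = o.reg 11)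
    (h' : ∀ b, 12 ≤ b → b < 19 → o'.mem b = o.mem b) : Data X P o' :=
  ⟨h.input.of_eq h10 fun b h1 h2 => h' b h1 (by omega),
    h.round.of_eq (h' 17 (by norm_num) (by norm_num)) (h' 18 (by norm_num) (by norm_num)),
    h.touched.of_eq h11 (h' 16 (by norm_num) (by norm_num)),
    h.covers.of_eq h11 (h' 16 (by norm_num) (by norm_num))⟩

/-- The beginning of an initialization: the constants are set and the old input is removed. -/
theorem resetCode_spec {X P : WordVec I} {o : State} (h : Data X P o) (hFX : Frac X)
    (l : List (Entry I)) :
    Does I.w (.block [setup, .forUpto 10 clearEdge, .block [.const 10 0, .const 16 0]])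
      ((Op.start l).pass o) (12 * o.reg 10 + 15) fun o' =>
      Consts I o' ∧ Data 0 P o' ∧ ListAt 0 1 2 l o' ∧ o'.reg 4 = l.length ∧ o'.reg 16 = 0 ∧
      o'.reg 10 = 0 ∧ o'.reg 11 = o.reg 11 ∧ o'.reg 12 = o.reg 12 ∧ o'.reg 13 = o.reg 13 := by
  have hp : ∀ y, 4 < y → ((Op.start l).pass o).reg y = o.reg y := fun y hy => by
    simp (disch := omega) [Op.pass, State.writeList, State.setReg]
  have hpm : ∀ b, 2 < b → ((Op.start l).pass o).mem b = o.mem b := fun b hb => by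
    simp (disch := omega) [Op.pass, State.writeList, State.setReg]
  have hq := I.pow_le_sq
  refine ((setup_spec (F := I.F) (e := I.e) (d := I.d) (by rfl) (by rfl) (by rfl)
    (I.lt_word_of_le_pow (by omega)) I.fine_word.1 I.fine_word.2
    (I.lt_word (by nlinarith [Nat.zero_le I.n]))).seq
    (B' := ((8 + 4) * o.reg 10 + 4) + 2) ?_).mono (by omega) fun _ => id
  rintro σ ⟨h8, h9, h14, hm, hr⟩
  have hc : Consts I σ := by
    refine ⟨?_, ?_, ?_, ?_, h8, h9, h14⟩ <;> rw [hr _ (by norm_num) (by norm_num) (by norm_num)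
      (by norm_num)] <;> rfl
  have hD : Data X P σ := h.of_eq (by rw [hr 10, hp] <;> norm_num) (by rw [hr 11, hp] <;> norm_num)
    fun b h1 _ => by rw [hm, hpm b (by omega)]
  have h10 : σ.reg 10 = o.reg 10 := by rw [hr 10, hp] <;> norm_num
  rw [← h10]
  refine (clearStack_spec hc hD.input hFX).seq ?_
  rintro σ₁ ⟨a1, a2, a3, a4⟩
  refine (Does.flat (p := .block [.const 10 0, .const 16 0])
    (by simp [Prog.block, Prog.Flat]) ?_).mono (by decide) fun _ => id
  have hr2 : ∀ y < 30, y ≠ 10 → y ≠ 16 → (Prog.run I.w (.block [.const 10 0, .const 16 0]) σ₁).reg y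
      = σ.reg y := by
    intro y hy h1 h2
    simp [Prog.block, Prog.run, State.setReg, h1, h2, a4 y hy]
  refine ⟨hc.of_eq fun y hy h1 _ _ _ => hr2 y (by omega) h1 (by omega), ⟨?_, ?_, ?_, ?_⟩, ?_, ?_, ?_,
    ?_, ?_, ?_, ?_⟩
  · exact inputRep_zero a1 a2 (by simp [Prog.block, Prog.run, State.setReg])
  · exact hD.round.of_eq (a3 17 (by norm_num) (by norm_num) (by norm_num))
      (a3 18 (by norm_num) (by norm_num) (by norm_num))
  · exact hD.touched.of_eq (hr2 11 (by norm_num) (by norm_num) (by norm_num))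
      (a3 16 (by norm_num) (by norm_num) (by norm_num))
  · intro u v huv hz
    obtain ⟨i, hi, hi'⟩ := hD.covers u v huv (hz.imp id fun h0 => by
      have := I.d_pos
      simp only [Pi.zero_apply] at h0
      omega)
    refine ⟨i, by rwa [hr2 11 (by norm_num) (by norm_num) (by norm_num)], ?_⟩
    rw [← hi', ← a3 16 (by norm_num) (by norm_num) (by norm_num)]; rfl
  · refine (listAt_pass (o := o)).of_eq ?_ ?_ ?_ <;>
    · rw [← hm, ← a3 _ (by norm_num) (by norm_num) (by norm_num)]; rfl
  · rw [hr2 4 (by norm_num) (by norm_num) (by norm_num), hr 4 (by norm_num) (by norm_num)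
      (by norm_num) (by norm_num)]
    rfl
  · simp [Prog.block, Prog.run, State.setReg]
  · simp [Prog.block, Prog.run, State.setReg]
  all_goals
    rw [hr2 _ (by norm_num) (by norm_num) (by norm_num), hr _ (by norm_num) (by norm_num)
      (by norm_num) (by norm_num), hp _ (by norm_num)]

/-- The vector `P` of the previous phase and its list of touched edges survive; the new phase that
follows erases them. For coarse parameters the input is not recorded, but it still goes to the
coarsening algorithm. -/
theorem startCode_spec {X P : WordVec I} {o : State} (h : Data X P o) (hFX : Frac X)
    (b : o.reg 11 ≤ 4 * (I.n + 2) ^ 2) {l : List (Entry I)} (hl : IsEntryList I l)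
    (hF : Frac (vecOf l)) :
    Does I.w startCode ((Op.start l).pass o) (60 * (o.reg 10 + l.length + 1)) fun o' =>
      Consts I o' ∧ Data (if I.Fine then vecOf l else 0) P o' ∧
      o'.reg 16 = (l.filter fun a => a.2.2 < 2 * I.d).length ∧
      ListAt 3 4 5 (l.filter fun a => a.2.2 < 2 * I.d) o' ∧
      o'.reg 10 ≤ l.length ∧ o'.reg 11 ≤ o.reg 11 + l.length ∧
      (¬ I.Fine → o'.reg 10 = 0 ∧ o'.reg 11 = o.reg 11) ∧
      o'.reg 12 = o.reg 12 ∧ o'.reg 13 = o.reg 13 := by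
  have hlen := hl.length_le
  let J : ℕ → State → Prop := fun i o' =>
    Consts I o' ∧ Data (if I.Fine then vecOf (l.take i) else 0) P o' ∧
      o'.reg 16 = ((l.take i).filter fun a => a.2.2 < 2 * I.d).length ∧
      ListAt 3 4 5 ((l.take i).filter fun a => a.2.2 < 2 * I.d) o' ∧ ListAt 0 1 2 l o' ∧
      o'.reg 10 ≤ (if I.Fine then i else 0) ∧
      o'.reg 11 = o.reg 11 + (if I.Fine then i else 0) ∧
      o'.reg 12 = o.reg 12 ∧ o'.reg 13 = o.reg 13
  have key : ∀ σ, Consts I σ ∧ Data 0 P σ ∧ ListAt 0 1 2 l σ ∧ σ.reg 4 = l.length ∧ σ.reg 16 = 0 ∧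
      σ.reg 10 = 0 ∧ σ.reg 11 = o.reg 11 ∧ σ.reg 12 = o.reg 12 ∧ σ.reg 13 = o.reg 13 →
      Does I.w (.forUpto 4 loadEntry) σ ((52 + 4) * l.length + 4) (J l.length) := by
    rintro σ ⟨a1, a2, a3, a4, a5, a6, a7, a8, a9⟩
    refine Does.forUpto (by norm_num) (I.lt_word (by nlinarith)) I.one_lt_word J ?_ a4 ?_ ?_
    · rintro i σ σ' hm hr ⟨b1, b2, b3, b4, b5, b6, b7, b8, b9⟩
      refine ⟨b1.of_eq fun y hy _ _ _ _ => hr y (by omega), b2.of_eq (hr 10 (by norm_num))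
        (hr 11 (by norm_num)) fun b _ _ => by rw [hm], by rwa [hr 16 (by norm_num)], ?_, ?_, ?_, ?_,
        ?_, ?_⟩
      · exact b4.of_eq (by rw [hm]) (by rw [hm]) (by rw [hm])
      · exact b5.of_eq (by rw [hm]) (by rw [hm]) (by rw [hm])
      · rwa [hr 10 (by norm_num)]
      · rwa [hr 11 (by norm_num)]
      · rwa [hr 12 (by norm_num)]
      · rwa [hr 13 (by norm_num)]
    · rintro i hi σ ⟨b1, b2, b3, b4, b5, b6, b7, b8, b9⟩ h40 h4
      have hmem : l[i] ∈ l := List.getElem_mem hi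
      have hlt := (hl.1 _ hmem).1
      have htake : l.take (i + 1) = l.take i ++ [l[i]] := List.take_succ_eq_append_getElem hi
      have hk : l[i].2.2 ≤ 2 ^ I.F := by rw [← vecOf_of_mem hl.2 hmem]; exact hF.le _
      have hF' : Frac (if I.Fine then vecOf (l.take i) else 0) := by
        split_ifs
        · exact hF.mono (vecOf_le_of_sublist (List.take_sublist _ _))
        · exact frac_zero
      have hfl : ((l.take i).filter fun a => decide (a.2.2 < 2 * I.d)).length ≤ i :=
        (List.length_filter_le _ _).trans (by simp)
      have h16 := b3
      have hif : (if I.Fine then i else 0) ≤ i := by split_ifs <;> omega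
      -- The entries are distinct edges, so the current one does not occur in the prefix; appending
      -- it is then a pointwise update.
      have hX0 : vecOf (l.take i) s(l[i].1, l[i].2.1) = 0 := by
        refine vecOf_eq_zero fun hm => ?_
        have hnd := (hl.sublist (List.take_sublist (i + 1) l)).2
        rw [htake, List.map_append, List.nodup_append] at hnd
        exact hnd.2.2 _ hm _ (by simp) rfl
      refine (loadEntry_spec (a := l[i]) b1 b2 hF' hlt hk h40 (b5 i hi).1 (b5 i hi).2.1 (b5 i hi).2.2
        (I.lt_word ?_) (I.lt_word ?_) b3 b4).mono le_rfl ?_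
      · nlinarith
      · nlinarith
      rintro σ' ⟨c1, c2, c3, c4, c5, c6, c7⟩
      refine ⟨⟨?_, ?_, ?_, ?_, ?_, ?_, ?_, ?_, ?_⟩, ?_, ?_⟩
      · exact b1.of_eq fun y hy h1 h2 _ _ => c7 y (by omega) h1 h2 (by omega)
      · by_cases hf : I.Fine
        · simp only [if_pos hf] at c1 ⊢
          rwa [htake, vecOf_concat hX0]
        · simp only [if_neg hf] at c1 ⊢
          exact c1
      · rw [c2, htake, List.filter_append]
      · rw [htake, List.filter_append]; exact c3
      · exact b5.of_eq (c6 0 (by norm_num)) (c6 1 (by norm_num)) (c6 2 (by norm_num))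
      · split_ifs at b6 c4 ⊢ <;> omega
      · split_ifs at b7 c5 ⊢ <;> omega
      · rw [c7 12 (by norm_num) (by norm_num) (by norm_num) (by norm_num), b8]
      · rw [c7 13 (by norm_num) (by norm_num) (by norm_num) (by norm_num), b9]
      · rw [c7 40 (by norm_num) (by norm_num) (by norm_num) (by norm_num), h40]
      · rw [c7 4 (by norm_num) (by norm_num) (by norm_num) (by norm_num), h4]
    · refine ⟨a1, ?_, by simpa using a5, ?_, a3, by simp [a6], by simp [a7], a8, a9⟩
      · simpa using a2
      · intro j hj; simp at hj
  obtain ⟨σ₃, c, h1, h2, h3⟩ := (resetCode_spec h hFX l).seq key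
  obtain ⟨b1, b2, b3, b4, b5, b6, b7, b8, b9⟩ := h3
  refine ⟨σ₃, c, fun ω => ?_, by omega, ?_⟩
  · exact (Exec.seq_assoc (h1 ω)).seq_assoc_right
  · rw [List.take_length] at b2 b3 b4
    refine ⟨b1, b2, b3, b4, ?_, ?_, fun hf => ?_, b8, b9⟩
    · split_ifs at b6 <;> omega
    · split_ifs at b7 <;> omega
    · rw [if_neg hf] at b6 b7
      omega

end StartCode

/-! ### The new phase: erasing, greedy choice of static edges -/

section Rebuild

variable {I : Params}

/-- The largest degree that the static edges may have at `v`. -/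
def staticCap (X : WordVec I) (v : Fin I.n) : ℕ :=
  wdeg (small X) v + (2 ^ I.F - wdeg (small X) v) * I.e * 3 / 2 ^ I.F

/-- The value of a large edge with the value word `k` in the vector of the rounding algorithm. -/
def largeWord (I : Params) (k : ℕ) : ℕ := k - k * I.e * 4 / 2 ^ I.F

/-- The static edges are chosen greedily. -/
structure Greedy (X : WordVec I) (lC Ls : List (Entry I)) : Prop where
  sublist : Ls.Sublist lC
  fits : ∀ v, wdeg (vecOf Ls) v ≤ staticCap X v
  rejected : ∀ a ∈ lC, a ∈ Ls ∨ ∃ z, (z = a.1 ∨ z = a.2.1) ∧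
    staticCap X z < wdeg (vecOf Ls) z + a.2.2

/-- All large edges are taken. -/
structure LargeEntries (X : WordVec I) (Lb : List (Entry I)) : Prop where
  val : ∀ a ∈ Lb, 2 * I.d ≤ X s(a.1, a.2.1) ∧ a.2.2 = largeWord I (X s(a.1, a.2.1))
  mem : ∀ u v, u < v → 2 * I.d ≤ X s(u, v) → ∃ a ∈ Lb, a.1 = u ∧ a.2.1 = v

/-- The initial vector of a phase for the rounding algorithm. -/
structure Rebuilt (X : WordVec I) (lC L : List (Entry I)) : Prop where
  entries : IsEntryList I L
  parts : ∃ Ls Lb, Greedy X lC Ls ∧ LargeEntries X Lb ∧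
    (L = Ls ++ Lb ∧ L ≠ [] ∨
      Ls = [] ∧ Lb = [] ∧ (L = [] ∧ X = 0 ∨ ∃ u v, u < v ∧ X s(u, v) ≠ 0 ∧ L = [(u, v, I.d)]))

/-- The list `L` is the current vector of the rounding algorithm. -/
structure Built (L : List (Entry I)) (o : State) : Prop where
  round : RoundRep (vecOf L) o
  list : ListAt 9 10 11 L o
  len : o.reg 11 = L.length
  touched : ∀ i (h : i < L.length), o.mem 16 i = edgeName I L[i].1 L[i].2.1

theorem Built.of_eq {L : List (Entry I)} {o o' : State} (h : Built L o)
    (h11 : o'.reg 11 = o.reg 11) (hb : ∀ b, 9 ≤ b → b < 12 ∨ 16 ≤ b → b < 19 → o'.mem b = o.mem b) :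
    Built L o' :=
  ⟨h.round.of_eq (hb 17 (by norm_num) (by norm_num) (by norm_num))
    (hb 18 (by norm_num) (by norm_num) (by norm_num)),
  h.list.of_eq (hb 9 (by norm_num) (by norm_num) (by norm_num))
    (hb 10 (by norm_num) (by norm_num) (by norm_num))
    (hb 11 (by norm_num) (by norm_num) (by norm_num)), by rw [h11, h.len],
  by rw [hb 16 (by norm_num) (by norm_num) (by norm_num)]; exact h.touched⟩

theorem sym2_ne_of_name {a b u v : Fin I.n} (hab : a < b) (huv : u < v)
    (h : edgeName I a b ≠ edgeName I u v) : s(a, b) ≠ s(u, v) := by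
  intro h'
  rcases Sym2.eq_iff.1 h' with ⟨rfl, rfl⟩ | ⟨rfl, rfl⟩
  · exact h rfl
  · exact absurd hab huv.asymm

theorem insertEdge_rep {L : List (Entry I)} {o : State} {u v : Fin I.n} {k : ℕ} (h : Built L o)
    (huv : u < v) (h30 : o.reg 30 = edgeName I u v) (h31 : o.reg 31 = u) (h32 : o.reg 32 = v)
    (h33 : o.reg 33 = k) (h0 : vecOf L s(u, v) = 0)
    (bd : ∀ z, wdeg (vecOf L) z + k < 2 ^ I.w) (b : L.length + 1 < 2 ^ I.w) :
    Does I.w insertEdge o 13 fun o' => Built (L ++ [(u, v, k)]) o' ∧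
      (∀ b, b < 9 ∨ 12 ≤ b ∧ b < 16 ∨ 18 < b → o'.mem b = o.mem b) ∧
      ∀ y, y ≠ 11 → y ≠ 34 → o'.reg y = o.reg y := by
  have hne : (u : ℕ) ≠ v := fun h => huv.ne (Fin.ext h)
  refine (insertEdge_spec (u := u) (v := v) I.one_lt_word h31 h32 hne (by rw [h.round.deg, h33]; exact bd u)
    (by rw [h.round.deg, h33]; exact bd v) (by rw [h.len]; exact b)).mono le_rfl ?_
  rintro o' ⟨h9, h10, h11, h16, h17, h18, hr11, hb, hr⟩
  have hV : vecOf (L ++ [(u, v, k)]) = Function.update (vecOf L) s(u, v) k :=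
    vecOf_concat (a := (u, v, k)) h0
  rw [h.len] at h9 h10 h11 h16 hr11
  rw [h33] at h11 h17 h18
  rw [h30] at h16 h17
  refine ⟨⟨⟨?_, ?_⟩, ?_, ?_, ?_⟩, hb, hr⟩
  · intro a b hab
    rw [h17, hV]
    by_cases he : edgeName I a b = edgeName I u v
    · obtain ⟨rfl, rfl⟩ := edgeName_inj.1 he; simp
    · rw [Function.update_of_ne he, Function.update_of_ne (sym2_ne_of_name hab huv he),
        h.round.val a b hab]
  · intro z
    rw [h18, hV, wdeg_update _ huv.ne, h0]
    simp only [bump, h.round.deg, Fin.ext_iff, Nat.sub_zero]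
  · exact h.list.concat (x := (u, v, k)) h9 h10 h11
  · rw [hr11]; simp
  · intro i hi
    rw [h16]
    by_cases hi' : i = L.length
    · subst hi'; simp
    · have hi2 : i < L.length := by simp at hi; omega
      rw [Function.update_of_ne hi', List.getElem_append_left hi2]
      exact h.touched i hi2

/-- Bank `19` lists the large edges. -/
structure LargeList (X : WordVec I) (o : State) : Prop where
  large : ∀ j < o.reg 20, ∃ u v, u < v ∧ o.mem 19 j = edgeName I u v ∧ 2 * I.d ≤ X s(u, v)
  all : ∀ u v, u < v → 2 * I.d ≤ X s(u, v) → ∃ j < o.reg 20, o.mem 19 j = edgeName I u v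

/-- All edges that are large or carry weight in `P` are on the touched list, by `Covers`. Hence the
pass misses neither a nonzero cell nor a large edge. -/
theorem clearTouched_loop {X P : WordVec I} {o : State} (hc : Consts I o) (hD : Data X P o)
    (hP : ∀ e, P e ≠ 0 → e ∈ I.G.edgeSet) (b : o.reg 11 ≤ 8 * (I.n + 2) ^ 2) (h20 : o.reg 20 = 0) :
    Does I.w (.forUpto 11 clearTouched) o (18 * o.reg 11 + 4) fun o' =>
      RoundRep (0 : WordVec I) o' ∧ LargeList X o' ∧ o'.reg 20 ≤ o.reg 11 ∧
      (∀ b, b < 17 ∨ 19 < b → o'.mem b = o.mem b) ∧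
      ∀ y, y ≠ 20 → y < 30 → o'.reg y = o.reg y := by
  let J : ℕ → State → Prop := fun i o' =>
    (∀ u v, u < v → (∃ j, i ≤ j ∧ j < o.reg 11 ∧ o.mem 16 j = edgeName I u v) ∨
      o'.mem 17 (edgeName I u v) = 0) ∧
    (∀ z : Fin I.n, (∃ j, i ≤ j ∧ j < o.reg 11 ∧ ∃ u v, u < v ∧ o.mem 16 j = edgeName I u v ∧
      (z = u ∨ z = v)) ∨ o'.mem 18 z = 0) ∧
    (∀ j < o'.reg 20, ∃ u v, u < v ∧ o'.mem 19 j = edgeName I u v ∧ 2 * I.d ≤ X s(u, v)) ∧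
    (∀ j < i, ∀ u v, u < v → o.mem 16 j = edgeName I u v → 2 * I.d ≤ X s(u, v) →
      ∃ j' < o'.reg 20, o'.mem 19 j' = edgeName I u v) ∧
    o'.reg 20 ≤ i ∧
    (∀ b, b < 17 ∨ 19 < b → o'.mem b = o.mem b) ∧ ∀ y, y ≠ 20 → y < 30 → o'.reg y = o.reg y
  refine (Does.forUpto (b := 14) (by norm_num) (I.lt_word (by nlinarith)) I.one_lt_word J ?_ rfl
    ?_ ?_).mono le_rfl ?_
  · rintro i σ σ' h1 h2 ⟨a, b, c, d, e, f, g⟩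
    have h20 := h2 20 (by norm_num)
    refine ⟨by rwa [h1], by rwa [h1], by rwa [h1, h20], by rwa [h1, h20], by rwa [h20],
      by rwa [h1], fun y hy hy' => by rw [h2 y (by omega), g y hy hy']⟩
  · rintro i hi σ ⟨a1, a2, a3, a4, a5, a6, a7⟩ h40 h11
    obtain ⟨u, v, huv, h16⟩ := hD.touched i hi
    have e16 : σ.mem 16 (σ.reg 40) = edgeName I u v := by rw [h40, a6 16 (by norm_num), h16]
    have e0 : σ.reg 0 = I.n := by rw [a7 0 (by norm_num) (by norm_num), hc.r0]
    have e9 : σ.reg 9 = 2 * I.d := by rw [a7 9 (by norm_num) (by norm_num), hc.r9]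
    have e12 : σ.mem 12 (edgeName I u v) = X s(u, v) := by
      rw [a6 12 (by norm_num), hD.input.val u v huv]
    refine (clearTouched_spec I.one_lt_word (I.lt_word (by nlinarith))).mono le_rfl ?_
    rintro σ' ⟨h17, h18, h19, hb, hr⟩
    rw [e16] at h17 h19
    rw [e16, e0, edgeName_div, edgeName_mod] at h18
    rw [e12, e9] at h19
    refine ⟨⟨?_, ?_, ?_, ?_, ?_, ?_, ?_⟩, ?_, ?_⟩
    · intro x y hxy
      rw [h17]
      by_cases he : edgeName I x y = edgeName I u v
      · right; rw [he]; simp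
      rw [Function.update_of_ne he]
      rcases a1 x y hxy with ⟨j, hj1, hj2, hj3⟩ | h0
      · left
        refine ⟨j, ?_, hj2, hj3⟩
        rcases hj1.eq_or_lt with rfl | hj1
        · exact absurd (hj3.symm.trans h16) he
        · exact hj1
      · right; exact h0
    · intro z
      rw [h18]
      by_cases h1 : z = v
      · right; rw [h1]; simp
      have h1' : (z : ℕ) ≠ v := fun h => h1 (Fin.ext h)
      rw [Function.update_of_ne h1']
      by_cases h2 : z = u
      · right; rw [h2]; simp
      have h2' : (z : ℕ) ≠ u := fun h => h2 (Fin.ext h)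
      rw [Function.update_of_ne h2']
      rcases a2 z with ⟨j, hj1, hj2, x, y, hxy, hj3, hz⟩ | h0
      · left
        refine ⟨j, ?_, hj2, x, y, hxy, hj3, hz⟩
        rcases hj1.eq_or_lt with rfl | hj1
        · obtain ⟨rfl, rfl⟩ := edgeName_inj.1 (hj3.symm.trans h16)
          exact absurd hz (by tauto)
        · exact hj1
      · right; exact h0
    · split_ifs at h19 with hs
      · rw [h19.1, h19.2]; exact a3
      · intro j hj
        rw [h19.2] at hj
        rw [h19.1]
        by_cases hj' : j = σ.reg 20
        · exact ⟨u, v, huv, by rw [hj', Function.update_self], by omega⟩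
        · rw [Function.update_of_ne hj']; exact a3 j (by omega)
    · intro j hj x y hxy hj1 hj2
      by_cases hji : j = i
      · subst hji
        obtain ⟨rfl, rfl⟩ := edgeName_inj.1 (hj1.symm.trans h16)
        rw [if_neg (by omega)] at h19
        exact ⟨σ.reg 20, by omega, by rw [h19.1, Function.update_self]⟩
      · obtain ⟨j', h1, h2⟩ := a4 j (by omega) x y hxy hj1 hj2
        split_ifs at h19 with hs
        · exact ⟨j', by omega, by rw [h19.1, h2]⟩
        · exact ⟨j', by omega, by rw [h19.1, Function.update_of_ne (by omega), h2]⟩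
    · split_ifs at h19 <;> omega
    · intro b hb'
      rw [hb b hb', a6 b hb']
    · intro y hy hy'
      rw [hr y (by omega), a7 y hy hy']
    · rw [hr 40 (by norm_num), h40]
    · rw [hr 11 (by norm_num), h11]
  · refine ⟨fun u v huv => ?_, fun z => ?_, fun j hj => by omega, fun j hj => by omega, by omega,
      fun _ _ => rfl, fun _ _ _ => rfl⟩
    · by_cases hm : o.mem 17 (edgeName I u v) = 0
      · right; exact hm
      · left
        rw [hD.round.val u v huv] at hm
        obtain ⟨i, h1, h2⟩ := hD.covers u v huv (.inl hm)
        exact ⟨i, Nat.zero_le _, h1, h2⟩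
    · by_cases hz : o.mem 18 z = 0
      · right; exact hz
      left
      rw [hD.round.deg, wdeg] at hz
      obtain ⟨y, -, hy⟩ := Finset.exists_ne_zero_of_sum_ne_zero hz
      rcases lt_trichotomy z y with hzy | rfl | hzy
      · obtain ⟨i, h1, h2⟩ := hD.covers z y hzy (.inl hy)
        exact ⟨i, Nat.zero_le _, h1, z, y, hzy, h2, .inl rfl⟩
      · exact absurd (hP _ hy) (SimpleGraph.irrefl I.G)
      · rw [Sym2.eq_swap] at hy
        obtain ⟨i, h1, h2⟩ := hD.covers y z hzy (.inl hy)
        exact ⟨i, Nat.zero_le _, h1, y, z, hzy, h2, .inr rfl⟩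
  · rintro o' ⟨a1, a2, a3, a4, a5, a6, a7⟩
    refine ⟨⟨fun u v huv => ?_, fun z => ?_⟩, ⟨a3, fun u v huv hx => ?_⟩, a5, a6, a7⟩
    · exact (a1 u v huv).resolve_left fun ⟨j, h1, h2, _⟩ => by omega
    · rw [wdeg_zero]
      exact (a2 z).resolve_left fun ⟨j, h1, h2, _⟩ => by omega
    · obtain ⟨i, h1, h2⟩ := hD.covers u v huv (.inr hx)
      exact a4 i h1 u v huv h2 hx

/-- For small ε the factor 3ε is below 1, so the cap adds at most the room left by the small part.
-/
theorem staticCap_le (hf : I.Fine) {X : WordVec I} (hX : Frac X) (v : Fin I.n) :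
    staticCap X v ≤ 2 ^ I.F := by
  have h1 := hX.small.2 v
  have h2 : (2 ^ I.F - wdeg (small X) v) * I.e * 3 / 2 ^ I.F ≤ 2 ^ I.F - wdeg (small X) v := by
    refine Nat.div_le_of_le_mul ?_
    have := hf.1
    calc (2 ^ I.F - wdeg (small X) v) * I.e * 3 = (I.e * 3) * (2 ^ I.F - wdeg (small X) v) := by ring
      _ ≤ 2 ^ I.F * (2 ^ I.F - wdeg (small X) v) := Nat.mul_le_mul_right _ (by omega)
  unfold staticCap
  omega

/-- What the rebuilding needs to know about the output of the coarsening algorithm. -/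
structure SmallEntries (X : WordVec I) (lC : List (Entry I)) : Prop where
  entries : IsEntryList I lC
  supp : ∀ a ∈ lC, X s(a.1, a.2.1) ≠ 0 ∧ X s(a.1, a.2.1) < 2 * I.d
  le : ∀ a ∈ lC, a.2.2 ≤ 2 ^ I.F

theorem wdeg_concat {L : List (Entry I)} {a : Entry I} (ha : a.1 < a.2.1) (z : Fin I.n) :
    wdeg (vecOf (L ++ [a])) z = wdeg (vecOf L) z + if z = a.1 ∨ z = a.2.1 then a.2.2 else 0 := by
  rw [vecOf_append, wdeg_add]
  congr 1
  have : vecOf [a] = Function.update (0 : WordVec I) s(a.1, a.2.1) a.2.2 :=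
    vecOf_concat (l := []) (a := a) rfl
  rw [this, wdeg_update _ ha.ne, wdeg_zero]
  simp

/-- The greedy choice is monotone: degrees only grow during the scan, so the reason for which an
entry was rejected persists to the end. -/
theorem addStatic_loop {X : WordVec I} {o : State} (hf : I.Fine) (hc : Consts I o)
    (hX : InputRep X o) (hF : Frac X) {lC : List (Entry I)} (hl : SmallEntries X lC)
    (hL : ListAt 6 7 8 lC o) (h19 : o.reg 19 = lC.length) (hB : Built ([] : List (Entry I)) o) :
    Does I.w (.forUpto 19 addStatic) o (43 * lC.length + 4) fun o' =>
      (∃ Ls, Greedy X lC Ls ∧ Built Ls o') ∧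
      (∀ b, b < 9 ∨ 12 ≤ b ∧ b < 16 ∨ 18 < b → o'.mem b = o.mem b) ∧
      ∀ y, y ≠ 11 → y < 30 → o'.reg y = o.reg y := by
  have hlen := hl.entries.length_le
  let J : ℕ → State → Prop := fun i o' =>
    (∃ Ls, Greedy X (lC.take i) Ls ∧ Built Ls o') ∧
      (∀ b, b < 9 ∨ 12 ≤ b ∧ b < 16 ∨ 18 < b → o'.mem b = o.mem b) ∧
      ∀ y, y ≠ 11 → y < 30 → o'.reg y = o.reg y
  refine (Does.forUpto (b := 39) (by norm_num) (I.lt_word (by nlinarith)) I.one_lt_word J ?_ h19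
    ?_ ?_).mono le_rfl ?_
  · rintro i σ σ' hm hr ⟨⟨Ls, a1, a2⟩, a3, a4⟩
    exact ⟨⟨Ls, a1, a2.of_eq (hr 11 (by norm_num)) fun b _ _ _ => by rw [hm]⟩, by rwa [hm],
      fun y h1 h2 => by rw [hr y (by omega), a4 y h1 h2]⟩
  · rintro i hi σ ⟨⟨Ls, a1, a2⟩, a3, a4⟩ h40 h19'
    have hmem : lC[i] ∈ lC := List.getElem_mem hi
    generalize ha : lC[i] = a at hmem
    have hlt := (hl.entries.1 _ hmem).1
    have htake : lC.take (i + 1) = lC.take i ++ [a] := by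
      rw [← ha]; exact List.take_succ_eq_append_getElem hi
    have hk := hl.le a hmem
    have hLi := hL i hi
    rw [ha] at hLi
    have hq := I.pow_le_sq
    have hwd : ∀ z, wdeg (vecOf Ls) z ≤ 2 ^ I.F := fun z => (a1.fits z).trans (staticCap_le hf hF z)
    have hsub : Ls.length ≤ i := a1.sublist.length_le.trans (by simp)
    have hdeg : ∀ z : Fin I.n, σ.mem 13 z = wdeg (small X) z := fun z => by
      rw [a3 13 (by norm_num), hX.deg]
    have e8 : σ.reg 8 = 2 ^ I.F := by rw [a4 8 (by norm_num) (by norm_num), hc.r8]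
    have heF : I.e * 3 ≤ 2 ^ I.F := by have := hf.1; omega
    have hcapσ : ∀ z : Fin I.n, σ.mem 13 z + (2 ^ I.F - σ.mem 13 z) * I.e * 3 / 2 ^ I.F
        = staticCap X z := fun z => by rw [hdeg]; rfl
    have hnew : vecOf Ls s(a.1, a.2.1) = 0 := by
      refine vecOf_eq_zero fun hm => ?_
      have hnd := (hl.entries.sublist (List.take_sublist (i + 1) lC)).2
      rw [htake, List.map_append, List.nodup_append] at hnd
      exact hnd.2.2 _ ((a1.sublist.map _).subset hm) _ (by simp) rfl
    refine (Does.seq (B := 25) (B' := 13 + 1) (testStatic_spec (u := a.1) (v := a.2.1) (k := a.2.2)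
      (n := I.n) (q := 2 ^ I.F) (e := I.e) (F := I.F) (lt_trans (by norm_num) I.four_lt_word)
      ?_ ?_ ?_ ?_ ?_ ?_ e8 (I.edgeName_lt_word _ _) ?_ ?_ ?_ ?_ ?_) ?_).mono le_rfl fun _ => id
    · rw [h40, a3 6 (by norm_num)]; exact hLi.1
    · rw [h40, a3 7 (by norm_num)]; exact hLi.2.1
    · rw [h40, a3 8 (by norm_num)]; exact hLi.2.2
    · rw [a4 0 (by norm_num) (by norm_num), hc.r0]
    · rw [a4 1 (by norm_num) (by norm_num), hc.r1]
    · rw [a4 2 (by norm_num) (by norm_num), hc.r2]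
    · rw [a2.round.deg]; have := hwd a.1; exact I.lt_word_of_le_pow (by omega)
    · rw [a2.round.deg]; have := hwd a.2.1; exact I.lt_word_of_le_pow (by omega)
    · refine I.lt_word_of_le_pow ?_
      rw [mul_assoc, sq]
      have := Nat.mul_le_mul_left (2 ^ I.F) heF
      omega
    · rw [hcapσ]; have := staticCap_le hf hF a.1; exact I.lt_word_of_le_pow (by omega)
    · rw [hcapσ]; have := staticCap_le hf hF a.2.1; exact I.lt_word_of_le_pow (by omega)
    rintro σ₁ ⟨b30, b31, b32, b33, b38, bm, br⟩
    rw [hcapσ, hcapσ, a2.round.deg, a2.round.deg] at b38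
    have hB1 : Built Ls σ₁ := a2.of_eq (br 11 (by norm_num)) fun b _ _ _ => by rw [bm]
    refine Does.branch ?_ ?_
    · intro h38
      refine (Does.flat (p := .skip) trivial ?_).mono (by decide) fun _ => id
      refine ⟨⟨⟨Ls, ⟨a1.sublist.trans (by rw [htake]; exact List.sublist_append_left _ _), a1.fits,
        ?_⟩, hB1⟩, by rw [Prog.run, bm]; exact a3, fun y h1 h2 => by
          rw [Prog.run, br y (.inl h2), a4 y h1 h2]⟩, ?_, ?_⟩
      · intro x hx
        rw [htake, List.mem_append, List.mem_singleton] at hx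
        rcases hx with hx | rfl
        · exact a1.rejected x hx
        · right
          by_contra hcon
          push Not at hcon
          exact h38 (b38.2 ⟨hcon _ (.inl rfl), hcon _ (.inr rfl)⟩)
      · rw [Prog.run, br 40 (by norm_num), h40]
      · rw [Prog.run, br 19 (by norm_num), h19']
    · intro h38
      have hfit := b38.1 h38
      refine (insertEdge_rep hB1 hlt b30 b31 b32 b33 hnew (fun z => ?_) (I.lt_word (by nlinarith))).mono
        le_rfl ?_
      · have := hwd z; exact I.lt_word_of_le_pow (by omega)
      rintro σ₂ ⟨c1, c2, c3⟩
      refine ⟨⟨⟨Ls ++ [a], ⟨?_, fun z => ?_, ?_⟩, c1⟩, fun b hb => ?_, fun y h1 h2 => ?_⟩, ?_, ?_⟩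
      · rw [htake]; exact a1.sublist.append_right _
      · rw [wdeg_concat hlt]
        split_ifs with hz
        · rcases hz with rfl | rfl
          · exact hfit.1
          · exact hfit.2
        · exact a1.fits z
      · intro x hx
        rw [htake, List.mem_append, List.mem_singleton] at hx
        rcases hx with hx | rfl
        · rcases a1.rejected x hx with h | ⟨z, hz, hz'⟩
          · exact .inl (List.mem_append_left _ h)
          -- The degree at the blocking vertex has not decreased since the rejection.
          · exact .inr ⟨z, hz, hz'.trans_le (by rw [wdeg_concat hlt]; omega)⟩
        · exact .inl (List.mem_append_right _ (by simp))
      · rw [c2 b hb, bm, a3 b hb]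
      · rw [c3 y h1 (by omega), br y (.inl h2), a4 y h1 h2]
      · rw [c3 40 (by norm_num) (by norm_num), br 40 (by norm_num), h40]
      · rw [c3 19 (by norm_num) (by norm_num), br 19 (by norm_num), h19']
  · exact ⟨⟨[], ⟨by simp, fun v => by simp [wdeg_zero], by simp⟩, hB⟩, fun _ _ => rfl,
      fun _ _ _ => rfl⟩
  · rintro o' ⟨⟨Ls, a1, a2⟩, a3, a4⟩
    rw [List.take_length] at a1
    exact ⟨⟨Ls, a1, a2⟩, a3, a4⟩

end Rebuild

/-! ### The new phase: large edges and the fallback edge -/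

section Rebuild

variable {I : Params}

theorem largeWord_pos (hf : I.Fine) {k : ℕ} (hk : 0 < k) : 0 < largeWord I k := by
  have h : k * I.e * 4 / 2 ^ I.F < k := by
    refine Nat.div_lt_of_lt_mul ?_
    calc k * I.e * 4 = (I.e * 4) * k := by ring
      _ < 2 ^ I.F * k := Nat.mul_lt_mul_of_pos_right (by have := hf.1; omega) hk
  unfold largeWord
  omega

theorem largeWord_le (k : ℕ) : largeWord I k ≤ k := Nat.sub_le _ _

theorem LargeEntries.vecOf_le {X : WordVec I} {Lb : List (Entry I)}
    (h : ∀ a ∈ Lb, a.2.2 = largeWord I (X s(a.1, a.2.1)))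
    (hn : (Lb.map fun a => s(a.1, a.2.1)).Nodup) : vecOf Lb ≤ X := by
  intro e
  by_cases h0 : vecOf Lb e = 0
  · rw [h0]; exact Nat.zero_le _
  · obtain ⟨a, ha, rfl⟩ := exists_of_vecOf_ne_zero h0
    rw [vecOf_of_mem hn ha, h a ha]
    exact largeWord_le _

/-- Static edges are small, so a large edge that already carries weight must be a repetition and is
skipped. Shrunk values stay positive, which makes this test reliable. -/
theorem addLarge_loop {X : WordVec I} {o : State} (hf : I.Fine) (hc : Consts I o)
    (hX : InputRep X o) (hF : Frac X) (hL : LargeList X o) (b20 : o.reg 20 ≤ 8 * (I.n + 2) ^ 2)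
    {Ls : List (Entry I)} (hB : Built Ls o) (hLs : IsEntryList I Ls)
    (hLs' : ∀ a ∈ Ls, X s(a.1, a.2.1) < 2 * I.d) (hfit : ∀ z, wdeg (vecOf Ls) z ≤ 2 ^ I.F) :
    Does I.w (.forUpto 20 addLarge) o (28 * o.reg 20 + 4) fun o' =>
      (∃ Lb, LargeEntries X Lb ∧ IsEntryList I (Ls ++ Lb) ∧ Built (Ls ++ Lb) o') ∧
      (∀ b, b < 9 ∨ 12 ≤ b ∧ b < 16 ∨ 18 < b → o'.mem b = o.mem b) ∧
      ∀ y, y ≠ 11 → y < 30 → o'.reg y = o.reg y := by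
  let J : ℕ → State → Prop := fun i o' =>
    (∃ Lb, (∀ a ∈ Lb, 2 * I.d ≤ X s(a.1, a.2.1) ∧ a.2.2 = largeWord I (X s(a.1, a.2.1))) ∧
      (∀ j < i, ∀ u v, u < v → o.mem 19 j = edgeName I u v → ∃ a ∈ Lb, a.1 = u ∧ a.2.1 = v) ∧
      IsEntryList I (Ls ++ Lb) ∧ Built (Ls ++ Lb) o') ∧
      (∀ b, b < 9 ∨ 12 ≤ b ∧ b < 16 ∨ 18 < b → o'.mem b = o.mem b) ∧
      ∀ y, y ≠ 11 → y < 30 → o'.reg y = o.reg y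
  refine (Does.forUpto (b := 24) (by norm_num) (I.lt_word (by nlinarith)) I.one_lt_word J ?_ rfl
    ?_ ?_).mono le_rfl ?_
  · rintro i σ σ' hm hr ⟨⟨Lb, a1, a2, a2', a3⟩, a4, a5⟩
    exact ⟨⟨Lb, a1, a2, a2', a3.of_eq (hr 11 (by norm_num)) fun b _ _ _ => by rw [hm]⟩, by rwa [hm],
      fun y h1 h2 => by rw [hr y (by omega), a5 y h1 h2]⟩
  · rintro i hi σ ⟨⟨Lb, a1, a2, a2', a3⟩, a4, a5⟩ h40 h20
    obtain ⟨u, v, huv, h19, hbig⟩ := hL.large i hi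
    refine (Does.seq (B := 2) (B' := 21 + 1) (Q := fun σ' => σ'.reg 30 = edgeName I u v ∧
      σ'.reg 34 = vecOf (Ls ++ Lb) s(u, v) ∧ σ'.mem = σ.mem ∧
      ∀ y, y ≠ 30 → y ≠ 34 → σ'.reg y = σ.reg y) ?_ ?_).mono le_rfl fun _ => id
    · refine (Does.flat (p := .block [.load 30 19 40, .load 34 17 30])
        (by simp [Prog.block, Prog.Flat]) ?_).mono (by decide) fun _ => id
      have e1 : σ.mem 19 i = edgeName I u v := by rw [a4 19 (by norm_num), h19]
      simp only [Prog.block, Prog.run, State.setReg, Function.update_self, ne_eq,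
        Function.update_of_ne, Nat.reduceEqDiff, not_false_eq_true, h40, e1, true_and]
      refine ⟨a3.round.val u v huv, ?_⟩
      intro y h1 h2
      simp (disch := omega) only [Function.update_of_ne]
    rintro σ₁ ⟨b30, b34, bm, br⟩
    have hB1 : Built (Ls ++ Lb) σ₁ :=
      a3.of_eq (br 11 (by norm_num) (by norm_num)) fun b _ _ _ => by rw [bm]
    refine Does.branch ?_ ?_
    · intro h34
      rw [b34] at h34
      refine (Does.flat (p := .skip) trivial ?_).mono (by decide) fun _ => id
      refine ⟨⟨⟨Lb, a1, ?_, a2', hB1⟩, by rw [Prog.run, bm]; exact a4, fun y h1 h2 => by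
          rw [Prog.run, br y (by omega) (by omega), a5 y h1 h2]⟩, ?_, ?_⟩
      · intro j hj x y hxy hj'
        by_cases hji : j = i
        · subst hji
          obtain ⟨rfl, rfl⟩ := edgeName_inj.1 (hj'.symm.trans h19)
          obtain ⟨a, ha, hae⟩ := exists_of_vecOf_ne_zero h34
          rcases List.mem_append.1 ha with ha | ha
          · have := hLs' a ha
            rw [hae] at this
            omega
          · refine ⟨a, ha, ?_⟩
            have hlt := (a2'.1 a (List.mem_append_right _ ha)).1
            rcases Sym2.eq_iff.1 hae with h | ⟨h1, h2⟩
            · exact h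
            · exact absurd hlt (by rw [h1, h2]; exact hxy.asymm)
        · exact a2 j (by omega) x y hxy hj'
      · rw [Prog.run, br 40 (by norm_num) (by norm_num), h40]
      · rw [Prog.run, br 20 (by norm_num) (by norm_num), h20]
    · intro h34
      rw [b34] at h34
      have e12 : σ₁.mem 12 (σ₁.reg 30) = X s(u, v) := by
        rw [b30, bm, a4 12 (by norm_num), hX.val u v huv]
      have hXle := hF.le s(u, v)
      refine (Does.seq (B := 8) (B' := 13) (largeValue_spec (n := I.n) (e := I.e) (F := I.F)
        I.four_lt_word ?_ ?_ ?_ e12 ?_) ?_).mono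
        le_rfl fun _ => id
      · rw [br 0 (by norm_num) (by norm_num), a5 0 (by norm_num) (by norm_num), hc.r0]
      · rw [br 1 (by norm_num) (by norm_num), a5 1 (by norm_num) (by norm_num), hc.r1]
      · rw [br 2 (by norm_num) (by norm_num), a5 2 (by norm_num) (by norm_num), hc.r2]
      · refine I.lt_word_of_le_pow ?_
        have h1 : X s(u, v) * I.e ≤ 2 ^ I.F * 2 ^ I.F := Nat.mul_le_mul hXle I.e_lt.le
        rw [← sq] at h1
        omega
      rintro σ₂ ⟨c31, c32, c33, cm, cr⟩
      rw [b30, edgeName_div] at c31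
      rw [b30, edgeName_mod] at c32
      have hpos := largeWord_pos hf (k := X s(u, v)) (by have := I.d_pos; omega)
      have hB2 : Built (Ls ++ Lb) σ₂ := hB1.of_eq (cr 11 (by norm_num)) fun b _ _ _ => by rw [cm]
      -- A crude bound that only rules out overflow; `Rebuilt.phaseInv` gives the sharp one.
      have hwd : ∀ z, wdeg (vecOf (Ls ++ Lb)) z ≤ 2 * 2 ^ I.F := fun z => by
        rw [vecOf_append, wdeg_add]
        have h1 := hfit z
        have h2 := (wdeg_mono (LargeEntries.vecOf_le (fun a ha => (a1 a ha).2)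
          (a2'.sublist (List.sublist_append_right _ _)).2) z).trans (hF.2 z)
        omega
      have hadj : I.G.Adj u v := hF.1 s(u, v) (by have := I.d_pos; omega)
      have hlen := a2'.length_le
      have hq := I.pow_le_sq
      refine (insertEdge_rep hB2 huv (by rw [cr 30 (by norm_num), b30]) c31 c32 c33 h34 (fun z => ?_)
        (I.lt_word (by nlinarith))).mono le_rfl ?_
      · have h1 := hwd z
        have h2 := largeWord_le (I := I) (X s(u, v))
        exact I.lt_word_of_le_pow (a := _ + largeWord I _) (by omega)
      rintro σ₃ ⟨d1, d2, d3⟩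
      rw [List.append_assoc] at d1
      refine ⟨⟨⟨Lb ++ [(u, v, largeWord I (X s(u, v)))], ?_, ?_, ?_, d1⟩, fun b hb => ?_,
        fun y h1 h2 => ?_⟩, ?_, ?_⟩
      · intro a ha
        rcases List.mem_append.1 ha with ha | ha
        · exact a1 a ha
        · rw [List.mem_singleton.1 ha]; exact ⟨hbig, rfl⟩
      · intro j hj x y hxy hj'
        by_cases hji : j = i
        · subst hji
          obtain ⟨rfl, rfl⟩ := edgeName_inj.1 (hj'.symm.trans h19)
          exact ⟨_, List.mem_append_right _ (List.mem_singleton.2 rfl), rfl, rfl⟩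
        · obtain ⟨a, ha, h⟩ := a2 j (by omega) x y hxy hj'
          exact ⟨a, List.mem_append_left _ ha, h⟩
      · rw [← List.append_assoc]
        exact a2'.concat huv hadj hpos h34
      · rw [d2 b hb, cm, bm, a4 b hb]
      · rw [d3 y h1 (by omega), cr y (by omega), br y (by omega) (by omega), a5 y h1 h2]
      · rw [d3 40 (by norm_num) (by norm_num), cr 40 (by norm_num), br 40 (by norm_num) (by norm_num),
          h40]
      · rw [d3 20 (by norm_num) (by norm_num), cr 20 (by norm_num), br 20 (by norm_num) (by norm_num),
          h20]
  · exact ⟨⟨[], by simp, fun j hj => by omega, by simpa using hLs, by simpa using hB⟩, fun _ _ => rfl,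
      fun _ _ _ => rfl⟩
  · rintro o' ⟨⟨Lb, a1, a2, a2', a3⟩, a4, a5⟩
    refine ⟨⟨Lb, ⟨a1, fun u v huv hx => ?_⟩, a2', a3⟩, a4, a5⟩
    obtain ⟨j, hj, hj'⟩ := hL.all u v huv hx
    exact a2 j hj u v huv hj'

/-- The popped edge has value zero, so it need not stay on the stack to cover the support. -/
theorem InputRep.pop {X : WordVec I} {o o' : State} (h : InputRep X o)
    (h0 : o.mem 12 (o.mem 14 (o.reg 10 - 1)) = 0) (hr : o'.reg 10 = o.reg 10 - 1)
    (h15 : o'.mem 15 = Function.update (o.mem 15) (o.mem 14 (o.reg 10 - 1)) 0)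
    (hb : ∀ b, b ≠ 15 → o'.mem b = o.mem b) : InputRep X o' where
  val := by rw [hb 12 (by norm_num)]; exact h.val
  deg := by rw [hb 13 (by norm_num)]; exact h.deg
  stack_name i hi := by
    rw [hr] at hi
    rw [hb 14 (by norm_num), h15]
    obtain ⟨u, v, huv, h1, h2⟩ := h.stack_name i (by omega)
    refine ⟨u, v, huv, h1, ?_⟩
    rwa [Function.update_of_ne]
    intro he
    have := h.stack_inj i (by omega) (o.reg 10 - 1) (by omega) (h1.trans he)
    omega
  stack_inj i hi j hj := by
    rw [hb 14 (by norm_num)]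
    exact h.stack_inj i (by omega) j (by omega)
  marked u v huv hm := by
    rw [h15] at hm
    have hne : edgeName I u v ≠ o.mem 14 (o.reg 10 - 1) := by
      rintro he
      rw [he, Function.update_self] at hm
      exact hm rfl
    rw [Function.update_of_ne hne] at hm
    obtain ⟨i, hi, hi'⟩ := h.marked u v huv hm
    refine ⟨i, ?_, by rw [hb 14 (by norm_num), hi']⟩
    have : i ≠ o.reg 10 - 1 := by rintro rfl; exact hne hi'.symm
    omega
  supp u v huv hx := by
    rw [h15, Function.update_of_ne]
    · exact h.supp u v huv hx
    · intro he
      rw [← he, h.val u v huv] at h0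
      exact hx h0

/-- The stack height is the potential: each iteration pops one edge and was paid when that edge was
pushed. If the stack runs empty, the input vector is zero, because every supported edge lies on it.
-/
theorem addFallback_spec {X : WordVec I} {o : State} (hc : Consts I o) (hX : InputRep X o)
    (hF : Frac X) (hB : Built ([] : List (Entry I)) o) :
    ∃ o' c, (∀ ω : Tape I.w, Exec I.w ω addFallback o o' c) ∧ c ≤ 12 * (o.reg 10 - o'.reg 10) + 30 ∧
      o'.reg 10 ≤ o.reg 10 ∧ InputRep X o' ∧
      (∃ L, Built L o' ∧ (L = [] ∧ X = 0 ∨ ∃ u v, u < v ∧ X s(u, v) ≠ 0 ∧ L = [(u, v, I.d)])) ∧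
      ∀ y, y ≠ 10 → y ≠ 11 → y < 29 → o'.reg y = o.reg y := by
  let J : State → Prop := fun σ => InputRep X σ ∧ Built ([] : List (Entry I)) σ ∧
    (σ.reg 29 = 0 ↔ σ.reg 10 ≠ 0 → σ.mem 12 (σ.mem 14 (σ.reg 10 - 1)) ≠ 0) ∧
    (σ.reg 10 ≠ 0 → σ.reg 30 = σ.mem 14 (σ.reg 10 - 1) ∧ σ.reg 31 = σ.reg 10 - 1) ∧
    ∀ y, y ≠ 10 → y < 29 → σ.reg y = o.reg y
  have hJ : ∀ σ, InputRep X σ → Built ([] : List (Entry I)) σ → (∀ y, y ≠ 10 → y < 29 →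
      σ.reg y = o.reg y) → Does I.w popTest σ 8 fun σ' => J σ' ∧ σ'.reg 10 = σ.reg 10 := by
    intro σ h1 h2 h3
    refine (popTest_spec I.one_lt_word).mono le_rfl ?_
    rintro σ' ⟨a1, a2, a3, a4⟩
    have h10 := a4 10 (by norm_num)
    refine ⟨⟨h1.of_eq h10 fun b _ _ => by rw [a3], h2.of_eq (a4 11 (by norm_num))
      fun b _ _ _ => by rw [a3], ?_, ?_, ?_⟩, h10⟩
    · rw [h10, a3]; exact a1
    · rw [h10, a3]; exact a2
    · intro y hy hy'
      rw [a4 y (.inl hy'), h3 y hy hy']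
  obtain ⟨σ₁, c₁, e1, l1, j1, t1⟩ := hJ o hX hB fun _ _ _ => rfl
  obtain ⟨σ₂, c₂, e2, l2, ⟨k1, k2, k3, k4, k5⟩, h29, l3⟩ := Does.loop (w := I.w) (x := 29)
    (p := .block [.block [.const 33 0, .store 15 30 33, .copy 10 31], popTest]) (b := 3 + 8) J
    (fun σ => σ.reg 10) (by
      rintro σ ⟨g1, g2, g3, g4, g5⟩ hx
      have hcon := g3.not.1 hx
      push Not at hcon
      obtain ⟨h10, htop⟩ := hcon
      refine Does.seq (Q := fun σ' => InputRep X σ' ∧ Built ([] : List (Entry I)) σ' ∧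
        (∀ y, y ≠ 10 → y < 29 → σ'.reg y = o.reg y) ∧ σ'.reg 10 < σ.reg 10) ?_ ?_
      · refine (Does.flat (p := .block [.const 33 0, .store 15 30 33, .copy 10 31])
          (by simp [Prog.block, Prog.Flat]) ?_).mono (by decide) fun _ => id
        obtain ⟨h30, h31⟩ := g4 h10
        refine ⟨g1.pop htop ?_ ?_ ?_, g2.of_eq ?_ ?_, ?_, ?_⟩
        · simp [Prog.block, Prog.run, State.setReg, State.setMem, h31]
        · simp [Prog.block, Prog.run, State.setReg, State.setMem, h30]
        · intro b hb
          simp [Prog.block, Prog.run, State.setReg, State.setMem, hb]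
        · simp [Prog.block, Prog.run, State.setReg, State.setMem]
        · intro b hb hb' hb''
          have : b ≠ 15 := by omega
          simp [Prog.block, Prog.run, State.setReg, State.setMem, this]
        · intro y hy hy'
          rw [← g5 y hy hy']
          have h1 : y ≠ 33 := by omega
          simp [Prog.block, Prog.run, State.setReg, State.setMem, h1, hy]
        · simp [Prog.block, Prog.run, State.setReg, State.setMem, h31]
          omega
      · rintro σ' ⟨m1, m2, m3, m4⟩
        exact (hJ σ' m1 m2 m3).mono le_rfl fun σ'' ⟨n1, n2⟩ => ⟨n1, by omega⟩) j1
  have hrest : Does I.w (.branch 10 (.block [.block [.binop .div 31 30 0, .binop .mod 32 30 0,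
      .copy 33 3], insertEdge]) .skip) σ₂ (16 + 1) fun o' => o'.reg 10 = σ₂.reg 10 ∧ InputRep X o' ∧
      (∃ L, Built L o' ∧ (L = [] ∧ X = 0 ∨ ∃ u v, u < v ∧ X s(u, v) ≠ 0 ∧ L = [(u, v, I.d)])) ∧
      ∀ y, y ≠ 10 → y ≠ 11 → y < 29 → o'.reg y = o.reg y := by
    refine Does.branch ?_ ?_
    · intro h10
      obtain ⟨u, v, huv, h14, -⟩ := k1.stack_name (σ₂.reg 10 - 1) (by omega)
      have htop := k3.1 h29 h10
      rw [h14, k1.val u v huv] at htop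
      have h30 := (k4 h10).1
      rw [h14] at h30
      refine Does.seq (B := 3) (B' := 13) (Q := fun σ' => σ'.reg 30 = edgeName I u v ∧
        σ'.reg 31 = u ∧ σ'.reg 32 = v ∧ σ'.reg 33 = I.d ∧ σ'.mem = σ₂.mem ∧
        ∀ y < 29, σ'.reg y = σ₂.reg y) ?_ ?_
      · refine (Does.flat (p := .block [.binop .div 31 30 0, .binop .mod 32 30 0, .copy 33 3])
          (by simp [Prog.block, Prog.Flat]) ?_).mono (by decide) fun _ => id
        have e0 : σ₂.reg 0 = I.n := by rw [k5 0 (by norm_num) (by norm_num), hc.r0]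
        have e3 : σ₂.reg 3 = I.d := by rw [k5 3 (by norm_num) (by norm_num), hc.r3]
        have f1 := edgeName_div u v
        have f2 := edgeName_mod u v
        refine ⟨?_, ?_, ?_, ?_, rfl, ?_⟩
        · simp [Prog.block, Prog.run, State.setReg, h30]
        · simp only [Prog.block, Prog.run, State.setReg, BinOp.eval, h30, e0, ne_eq,
            Nat.reduceEqDiff, not_false_eq_true, Function.update_of_ne, Function.update_self, f1]
        · simp only [Prog.block, Prog.run, State.setReg, BinOp.eval, h30, e0, ne_eq,
            Nat.reduceEqDiff, not_false_eq_true, Function.update_of_ne, Function.update_self, f2]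
        · simp [Prog.block, Prog.run, State.setReg, e3]
        · intro y hy
          simp (disch := omega) only [Prog.block, Prog.run, State.setReg, Function.update_of_ne]
      rintro σ₃ ⟨m1, m2, m3, m4, m5, m6⟩
      have hB3 : Built ([] : List (Entry I)) σ₃ := k2.of_eq (m6 11 (by norm_num))
        fun b _ _ _ => by rw [m5]
      have hd : I.d < 2 ^ I.w := by have := I.fine_word.2; omega
      refine (insertEdge_rep hB3 huv m1 m2 m3 m4 rfl (fun z => by simpa [wdeg_zero] using hd)
        I.one_lt_word).mono le_rfl ?_
      rintro σ₄ ⟨n1, n2, n3⟩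
      refine ⟨?_, k1.of_eq ?_ fun b h1 h2 => ?_, ⟨_, n1, .inr ⟨u, v, huv, htop, rfl⟩⟩, ?_⟩
      · rw [n3 10 (by norm_num) (by norm_num), m6 10 (by norm_num)]
      · rw [n3 10 (by norm_num) (by norm_num), m6 10 (by norm_num)]
      · rw [n2 b (by omega), m5]
      · intro y h1 h2 h3
        rw [n3 y h2 (by omega), m6 y h3, k5 y h1 h3]
    · intro h10
      refine (Does.flat (p := .skip) trivial ?_).mono (by decide) fun _ => id
      refine ⟨rfl, k1, ⟨[], k2, .inl ⟨rfl, ?_⟩⟩, fun y h1 _ h3 => k5 y h1 h3⟩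
      funext e
      induction e with | _ u v =>
      by_contra hx
      have key : ∀ a b : Fin I.n, a < b → X s(a, b) = 0 := by
        intro a b hab
        by_contra hx
        obtain ⟨i, hi, -⟩ := k1.marked a b hab (k1.supp a b hab hx)
        omega
      rcases lt_trichotomy u v with h | rfl | h
      · exact hx (key u v h)
      · exact absurd (hF.1 _ hx) (SimpleGraph.irrefl I.G)
      · rw [Sym2.eq_swap] at hx
        exact hx (key v u h)
  obtain ⟨σ₃, c₃, e3, l4, h10, r1, r2, r3⟩ := hrest
  refine ⟨σ₃, c₁ + (c₂ + c₃), fun ω => .seq (e1 ω) (.seq (e2 ω) (e3 ω)), ?_, by omega, r1, r2, r3⟩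
  rw [h10]
  have := t1
  rw [t1] at l2
  omega

theorem Built.data {X : WordVec I} {L : List (Entry I)} {o : State} (h : Built L o)
    (hX : InputRep X o) (hL : IsEntryList I L)
    (hbig : ∀ u v, u < v → 2 * I.d ≤ X s(u, v) → ∃ a ∈ L, a.1 = u ∧ a.2.1 = v) :
    Data X (vecOf L) o where
  input := hX
  round := h.round
  touched i hi := by
    rw [h.len] at hi
    exact ⟨_, _, (hL.1 _ (List.getElem_mem hi)).1, h.touched i hi⟩
  covers u v huv hz := by
    have : ∃ a ∈ L, a.1 = u ∧ a.2.1 = v := by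
      rcases hz with hz | hz
      · obtain ⟨a, ha, hae⟩ := exists_of_vecOf_ne_zero hz
        have hlt := (hL.1 a ha).1
        refine ⟨a, ha, ?_⟩
        rcases Sym2.eq_iff.1 hae with h | ⟨h1, h2⟩
        · exact h
        · exact absurd hlt (by rw [h1, h2]; exact huv.asymm)
      · exact hbig u v huv hz
    obtain ⟨a, ha, rfl, rfl⟩ := this
    obtain ⟨i, hi, rfl⟩ := List.getElem_of_mem ha
    exact ⟨i, by rw [h.len]; exact hi, h.touched i hi⟩

/-- The cost is linear in the old touched list, the output of the coarsening algorithm and the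
number of pops. The cost of inserting large edges is also covered, since they all come from the
touched list. -/
theorem rebuild_spec {X P : WordVec I} {o : State} (hf : I.Fine) (hc : Consts I o)
    (hD : Data X P o) (hF : Frac X) (hP : ∀ e, P e ≠ 0 → e ∈ I.G.edgeSet)
    (b : o.reg 11 ≤ 8 * (I.n + 2) ^ 2) {lC : List (Entry I)} (hl : SmallEntries X lC)
    (hL : ListAt 6 7 8 lC o) (h19 : o.reg 19 = lC.length) :
    ∃ o' c L, (∀ ω : Tape I.w, Exec I.w ω rebuild o o' c) ∧
      c ≤ 60 * (o.reg 11 + lC.length + (o.reg 10 - o'.reg 10) + 1) ∧ o'.reg 10 ≤ o.reg 10 ∧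
      Rebuilt X lC L ∧ Consts I o' ∧ Data X (vecOf L) o' ∧ ListAt 9 10 11 L o' ∧
      o'.reg 11 = L.length ∧ o'.reg 12 = L.length ∧ o'.reg 13 = 0 := by
  have h14 : o.reg 14 ≠ 0 := by rw [hc.r14, if_pos hf]; exact one_ne_zero
  have e0 : 0 % 2 ^ I.w = 0 := Nat.zero_mod _
  let o₁ := o.setReg 20 (0 % 2 ^ I.w)
  have r1 : ∀ y, y ≠ 20 → o₁.reg y = o.reg y := fun y hy => by simp [o₁, State.setReg, hy]
  have hc₁ : Consts I o₁ := hc.of_eq fun y hy _ _ _ _ => r1 y (by omega)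
  have hD₁ : Data X P o₁ := hD.of_eq (r1 10 (by norm_num)) (r1 11 (by norm_num)) fun _ _ _ => rfl
  obtain ⟨o₂, c₂, x₂, l₂, p1, p2, p3, p4, p5⟩ := clearTouched_loop hc₁ hD₁ hP
    (by rwa [r1 11 (by norm_num)]) (by simp [o₁, State.setReg])
  rw [r1 11 (by norm_num)] at l₂ p3
  let o₃ := o₂.setReg 11 (0 % 2 ^ I.w)
  have r3 : ∀ y, y ≠ 11 → o₃.reg y = o₂.reg y := fun y hy => by simp [o₃, State.setReg, hy]
  have r3' : ∀ y, y ≠ 11 → y ≠ 20 → y < 30 → o₃.reg y = o.reg y := fun y h1 h2 h3 => by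
    rw [r3 y h1, p5 y h2 h3, r1 y h2]
  have hc₃ : Consts I o₃ := hc.of_eq fun y hy _ h2 _ _ => r3' y h2 (by omega) (by omega)
  have hX₃ : InputRep X o₃ := hD.input.of_eq (r3' 10 (by norm_num) (by norm_num) (by norm_num))
    fun b h1 h2 => p4 b (by omega)
  have hB₃ : Built ([] : List (Entry I)) o₃ :=
    ⟨p1.of_eq rfl rfl, fun i hi => by simp at hi, by simp [o₃, State.setReg],
      fun i hi => by simp at hi⟩
  obtain ⟨o₄, c₄, x₄, l₄, ⟨Ls, hG, hB₄⟩, q2, q3⟩ := addStatic_loop hf hc₃ hX₃ hF hl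
    (hL.of_eq (p4 6 (by norm_num)) (p4 7 (by norm_num)) (p4 8 (by norm_num)))
    (by rw [r3' 19 (by norm_num) (by norm_num) (by norm_num), h19]) hB₃
  have hc₄ : Consts I o₄ := hc₃.of_eq fun y hy _ h2 _ _ => q3 y h2 (by omega)
  have hX₄ : InputRep X o₄ := hX₃.of_eq (q3 10 (by norm_num) (by norm_num)) fun b h1 h2 =>
    q2 b (by omega)
  have h20 : o₄.reg 20 = o₂.reg 20 := by
    rw [q3 20 (by norm_num) (by norm_num), r3 20 (by norm_num)]
  have hLL : LargeList X o₄ := by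
    refine ⟨?_, ?_⟩ <;> rw [h20, q2 19 (by norm_num)]
    · exact p2.large
    · exact p2.all
  obtain ⟨o₅, c₅, x₅, l₅, ⟨Lb, hLb, hE, hB₅⟩, s2, s3⟩ := addLarge_loop hf hc₄ hX₄ hF hLL
    (by rw [h20]; omega) hB₄ (hl.entries.sublist hG.sublist)
    (fun a ha => (hl.supp a (hG.sublist.subset ha)).2)
    (fun z => (hG.fits z).trans (staticCap_le hf hF z))
  have hc₅ : Consts I o₅ := hc₄.of_eq fun y hy _ h2 _ _ => s3 y h2 (by omega)
  have hX₅ : InputRep X o₅ := hX₄.of_eq (s3 10 (by norm_num) (by norm_num)) fun b h1 h2 =>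
    s2 b (by omega)
  have h10 : o₅.reg 10 = o.reg 10 := by
    rw [s3 10 (by norm_num) (by norm_num), q3 10 (by norm_num) (by norm_num),
      r3' 10 (by norm_num) (by norm_num) (by norm_num)]
  have hlast : ∃ o₆ c₆ L, (∀ ω : Tape I.w, Exec I.w ω (.branch 11 .skip addFallback) o₅ o₆ c₆) ∧
      c₆ ≤ 12 * (o₅.reg 10 - o₆.reg 10) + 31 ∧ o₆.reg 10 ≤ o₅.reg 10 ∧ Rebuilt X lC L ∧
      Consts I o₆ ∧ InputRep X o₆ ∧ Built L o₆ ∧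
      (∀ u v, u < v → 2 * I.d ≤ X s(u, v) → ∃ a ∈ L, a.1 = u ∧ a.2.1 = v) := by
    -- Length zero means that neither static nor large edges were inserted, the only case that needs
    -- the fallback.
    by_cases h11 : o₅.reg 11 = 0
    · have hnil : Ls ++ Lb = [] := by rw [hB₅.len] at h11; exact List.length_eq_zero_iff.1 h11
      obtain ⟨rfl, rfl⟩ := List.append_eq_nil_iff.1 hnil
      obtain ⟨o₆, c₆, x₆, l₆, t1, t2, ⟨L, t3, t4⟩, t5⟩ := addFallback_spec hc₅ hX₅ hF hB₅
      refine ⟨o₆, c₆ + 1, L, fun ω => .branch_false h11 (x₆ ω), by omega, t1, ⟨?_, [], [], hG, hLb,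
        .inr ⟨rfl, rfl, t4⟩⟩, hc₅.of_eq fun y hy h1 h2 _ _ => t5 y h1 h2 (by omega), t2, t3, ?_⟩
      · rcases t4 with ⟨rfl, -⟩ | ⟨u, v, huv, hx, rfl⟩
        · exact hE
        · exact hE.concat huv (hF.1 s(u, v) hx) I.d_pos rfl
      · intro u v huv hx
        obtain ⟨a, ha, -⟩ := hLb.mem u v huv hx
        simp at ha
    · refine ⟨o₅, 2, Ls ++ Lb, fun ω => .branch_true h11 (.skip _), by omega, le_rfl, ⟨hE, Ls, Lb, hG,
        hLb, .inl ⟨rfl, ?_⟩⟩, hc₅, hX₅, hB₅, ?_⟩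
      · intro h
        rw [hB₅.len, h] at h11
        exact h11 rfl
      · intro u v huv hx
        obtain ⟨a, ha, h⟩ := hLb.mem u v huv hx
        exact ⟨a, List.mem_append_right _ ha, h⟩
  obtain ⟨o₆, c₆, L, x₆, l₆, t1, hR, hc₆, hX₆, hB₆, hbig⟩ := hlast
  let o₇ := (o₆.setReg 12 (o₆.reg 11)).setReg 13 (0 % 2 ^ I.w)
  have r7 : ∀ y, y ≠ 12 → y ≠ 13 → o₇.reg y = o₆.reg y := fun y h1 h2 => by
    simp [o₇, State.setReg, h1, h2]
  refine ⟨o₇, _, L, fun ω => .branch_true h14 (.seq (.const _ _ _) (.seq (x₂ ω) (.seq (.const _ _ _)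
    (.seq (x₄ ω) (.seq (x₅ ω) (.seq (x₆ ω) (.seq (.copy _ _ _) (.const _ _ _)))))))), ?_, ?_, hR,
    hc₆.of_eq fun y _ _ _ h1 h2 => r7 y h1 h2,
    (hB₆.data hX₆ hR.entries hbig).of_eq (r7 10 (by norm_num) (by norm_num))
      (r7 11 (by norm_num) (by norm_num)) fun _ _ _ => rfl, hB₆.list.of_eq rfl rfl rfl, ?_, ?_, ?_⟩
  · rw [r7 10 (by norm_num) (by norm_num)]
    omega
  · rw [r7 10 (by norm_num) (by norm_num)]
    omega
  · rw [r7 11 (by norm_num) (by norm_num), hB₆.len]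
  · simp [o₇, State.setReg, hB₆.len]
  · simp [o₇, State.setReg]

end Rebuild

/-! ### Updates within a phase -/

section Update

variable {I : Params}

/-- The value of an updated edge in the vector of the rounding algorithm within a phase. -/
def patchWord (P : WordVec I) (u v : Fin I.n) (k : ℕ) : ℕ :=
  if k < 2 * I.d then 0
  else fitValue I.F I.e I.d k (wdeg P u - P s(u, v)) (wdeg P v - P s(u, v))

/-- The request of a new phase. -/
def PhaseEnds (I : Params) (k m0 : ℕ) : Prop := ¬ (k + 1) * 2 ^ I.F < m0 * I.e

theorem mul_e_lt_word (I : Params) {k : ℕ} (hk : k ≤ 2 ^ I.F) : k * I.e * 4 < 2 ^ I.w := by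
  refine I.lt_word_of_le_pow ?_
  have h1 : k * I.e ≤ 2 ^ I.F * 2 ^ I.F := Nat.mul_le_mul hk I.e_lt.le
  rw [← sq] at h1
  omega

/-- The edge just updated is already on the touched list, so changing its weight in `P` to any value
keeps the list complete. -/
theorem Data.putRound {X P : WordVec I} {o o' : State} {u v : Fin I.n} {val : ℕ} (huv : u < v)
    (hX : InputRep X o) (hP : RoundRep P o) (ht : Touched I o)
    (hcov : Covers I (fun e => e = s(u, v) ∨ P e ≠ 0 ∨ 2 * I.d ≤ X e) o)
    (h17 : o'.mem 17 = Function.update (o.mem 17) (edgeName I u v) val)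
    (h18 : o'.mem 18 = bump (o.mem 18) u v (fun a => a - P s(u, v) + val))
    (hb : ∀ b, b < 17 ∨ 18 < b → o'.mem b = o.mem b) (h10 : o'.reg 10 = o.reg 10)
    (h11 : o'.reg 11 = o.reg 11) : Data X (Function.update P s(u, v) val) o' where
  input := hX.of_eq h10 fun b _ h2 => hb b (by omega)
  round := by
    refine ⟨fun a b hab => ?_, fun z => ?_⟩
    · rw [h17]
      by_cases he : edgeName I a b = edgeName I u v
      · obtain ⟨rfl, rfl⟩ := edgeName_inj.1 he; simp
      · rw [Function.update_of_ne he, Function.update_of_ne (sym2_ne_of_name hab huv he),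
          hP.val a b hab]
    · rw [h18, wdeg_update _ huv.ne]
      simp only [bump, hP.deg, Fin.ext_iff]
  touched := ht.of_eq h11 (hb 16 (by norm_num))
  covers := by
    refine (Covers.of_eq (o := o) ?_ h11 (hb 16 (by norm_num)))
    intro a b hab hz
    refine hcov a b hab ?_
    by_cases he : s(a, b) = s(u, v)
    · exact .inl he
    · rw [Function.update_of_ne he] at hz
      exact .inr hz

-- When the phase ends with this update, `P` is left alone, since it is about to be rebuilt;
-- otherwise only the one edge is patched. The touched list and the counter grow by one in either
-- case, which bounds the list by the initial support size plus the number of updates.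
set_option maxHeartbeats 1000000 in
theorem updateCode_spec {X P : WordVec I} {o : State} {u v : Fin I.n} {k : ℕ} (hc : Consts I o)
    (hD : Data X P o) (hF : Frac X) (hFP : Frac P) (huv : u < v) (hk : k ≤ 2 ^ I.F)
    (b11 : o.reg 11 ≤ 4 * (I.n + 2) ^ 2) (b12 : o.reg 12 ≤ (I.n + 2) ^ 2)
    (b13 : o.reg 13 ≤ (I.n + 2) ^ 2) :
    Does I.w updateCode ((Op.update u v k).pass o) 100 fun o' =>
      Consts I o' ∧ o'.reg 5 = u ∧ o'.reg 6 = v ∧ o'.reg 17 = (if k < 2 * I.d then k else 0) ∧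
      o'.reg 12 = o.reg 12 ∧
      (¬ I.Fine → Data X P o' ∧ o'.reg 15 = 0 ∧ o'.reg 18 = 0 ∧ o'.reg 10 = o.reg 10 ∧
        o'.reg 11 = o.reg 11 ∧ o'.reg 13 = o.reg 13) ∧
      (I.Fine → o'.reg 10 ≤ o.reg 10 + 1 ∧ o'.reg 11 = o.reg 11 + 1 ∧ o'.reg 13 = o.reg 13 + 1 ∧
        (PhaseEnds I (o.reg 13) (o.reg 12) → o'.reg 15 = 1 ∧
          Data (Function.update X s(u, v) k) P o') ∧
        (¬ PhaseEnds I (o.reg 13) (o.reg 12) → o'.reg 15 = 0 ∧ o'.reg 18 = patchWord P u v k ∧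
          Data (Function.update X s(u, v) k) (Function.update P s(u, v) (patchWord P u v k)) o')) := by
  have hne : (u : ℕ) ≠ v := fun h => huv.ne (Fin.ext h)
  have hq := I.pow_le_sq
  have hn2 : 0 < (I.n + 2) ^ 2 := by positivity
  have hp : ∀ y, y < 5 ∨ 7 < y → ((Op.update u v k).pass o).reg y = o.reg y := fun y hy => by
    simp (disch := omega) [Op.pass, State.setReg]
  have hpm : ((Op.update u v k).pass o).mem = o.mem := rfl
  have hp5 : ((Op.update u v k).pass o).reg 5 = u := by simp [Op.pass, State.setReg]
  have hp6 : ((Op.update u v k).pass o).reg 6 = v := by simp [Op.pass, State.setReg]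
  have hp7 : ((Op.update u v k).pass o).reg 7 = k := by simp [Op.pass, State.setReg]
  refine (passUpdate_spec.seq (B' := (40 + (5 + (37 + 1))) + 1) ?_).mono (by norm_num) fun _ => id
  rintro σ ⟨a17, a15, a18, a31, a32, a33, am, ar⟩
  rw [hp7, hp 9 (by norm_num), hc.r9] at a17
  rw [hp5] at a31
  rw [hp6] at a32
  rw [hp7] at a33
  rw [hpm] at am
  have ar' : ∀ y, y < 5 ∨ 7 < y → y ≠ 15 → y ≠ 17 → y ≠ 18 → y < 30 → σ.reg y = o.reg y :=
    fun y h1 h2 h3 h4 h5 => by rw [ar y h2 h3 h4 (.inl h5), hp y h1]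
  have hcσ : Consts I σ := by
    refine ⟨?_, ?_, ?_, ?_, ?_, ?_, ?_⟩ <;> rw [ar' _ (by norm_num) (by norm_num) (by norm_num)
      (by norm_num) (by norm_num)]
    exacts [hc.r0, hc.r1, hc.r2, hc.r3, hc.r8, hc.r9, hc.r14]
  have g5 : σ.reg 5 = u := by
    rw [ar 5 (by norm_num) (by norm_num) (by norm_num) (by norm_num), hp5]
  have g6 : σ.reg 6 = v := by
    rw [ar 6 (by norm_num) (by norm_num) (by norm_num) (by norm_num), hp6]
  have hDσ : Data X P σ := hD.of_eq (ar' 10 (by norm_num) (by norm_num) (by norm_num)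
    (by norm_num) (by norm_num)) (ar' 11 (by norm_num) (by norm_num) (by norm_num)
    (by norm_num) (by norm_num)) fun b _ _ => by rw [am]
  have h10 := ar' 10 (by norm_num) (by norm_num) (by norm_num) (by norm_num) (by norm_num)
  have h11 := ar' 11 (by norm_num) (by norm_num) (by norm_num) (by norm_num) (by norm_num)
  have h12 := ar' 12 (by norm_num) (by norm_num) (by norm_num) (by norm_num) (by norm_num)
  have h13 := ar' 13 (by norm_num) (by norm_num) (by norm_num) (by norm_num) (by norm_num)
  refine Does.branch ?_ ?_
  swap
  · intro h14
    have hfine : ¬ I.Fine := by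
      intro hcon
      rw [hcσ.r14, if_pos hcon] at h14
      exact one_ne_zero h14
    refine (Does.flat (p := .skip) trivial ?_).mono (by decide) fun _ => id
    exact ⟨hcσ, g5, g6, a17, h12, fun _ => ⟨hDσ, a15, a18, h10, h11, h13⟩, fun h => absurd h hfine⟩
  intro h14
  have hfine : I.Fine := by
    by_contra hcon
    rw [hcσ.r14, if_neg hcon] at h14
    exact h14 rfl
  refine (setEdge_rep hcσ hDσ.input hDσ.touched hF hk huv a31 a32 a33
    (by rw [h11]; exact I.lt_word (by linarith [hn2]))).seq ?_
  rintro σ₁ ⟨b1, b2, b3, b4, b5, b6, b7, b8⟩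
  have hc₁ : Consts I σ₁ := hcσ.of_eq fun y hy h1 h2 _ _ => b8 y (by omega) h1 h2
  have f12 : σ₁.reg 12 = o.reg 12 := by
    rw [b8 12 (by norm_num) (by norm_num) (by norm_num), h12]
  have f13 : σ₁.reg 13 = o.reg 13 := by
    rw [b8 13 (by norm_num) (by norm_num) (by norm_num), h13]
  have hP₁ : RoundRep P σ₁ := hDσ.round.of_eq (b7 17 (by norm_num)) (b7 18 (by norm_num))
  have hcov : Covers I (fun e => e = s(u, v) ∨ P e ≠ 0 ∨ 2 * I.d ≤ Function.update X s(u, v) k e)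
      σ₁ := by
    intro a b hab hz
    by_cases he : s(a, b) = s(u, v)
    · refine ⟨σ.reg 11, by omega, ?_⟩
      rw [b4, Function.update_self]
      by_contra hcon
      exact sym2_ne_of_name hab huv (Ne.symm hcon) he
    · rw [Function.update_of_ne he] at hz
      obtain ⟨j, hj, hj'⟩ := hDσ.covers a b hab (hz.resolve_left he)
      exact ⟨j, by omega, by rw [b4, Function.update_of_ne (by omega), hj']⟩
  refine Does.seq (B := 5) (B' := 37 + 1) (countUpdate_spec I.one_lt_word
    (by rw [f13]; exact I.lt_word (by linarith)) ?_ ?_) ?_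
  · rw [f13, hc₁.r8]
    exact I.mul_lt_word (by linarith) (by omega)
  · rw [f12, hc₁.r2]
    exact I.mul_lt_word (by linarith) (by have := I.e_lt; omega)
  rintro σ₂ ⟨c1, c2, c3, c4⟩
  rw [f13, hc₁.r8, f12, hc₁.r2] at c2
  rw [f13] at c1
  have hr2 : ∀ y, y ≠ 10 → y ≠ 11 → y ≠ 13 → y < 30 → σ₂.reg y = σ.reg y := fun y h1 h2 h3 h4 => by
    rw [c4 y h3 (by omega), b8 y (by omega) h1 h2]
  have hc₂ : Consts I σ₂ := hcσ.of_eq fun y hy h1 h2 _ h3 => hr2 y h1 h2 h3 (by omega)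
  have hX₂ : InputRep (Function.update X s(u, v) k) σ₂ :=
    b1.of_eq (c4 10 (by norm_num) (by norm_num)) fun b _ _ => by rw [c3]
  have hP₂ : RoundRep P σ₂ := hP₁.of_eq (by rw [c3]) (by rw [c3])
  have ht₂ : Touched I σ₂ := b2.of_eq (c4 11 (by norm_num) (by norm_num)) (by rw [c3])
  have hcov₂ := hcov.of_eq (o' := σ₂) (c4 11 (by norm_num) (by norm_num)) (by rw [c3])
  have l10 : σ₂.reg 10 ≤ o.reg 10 + 1 := by
    rw [c4 10 (by norm_num) (by norm_num), ← h10]; exact b5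
  have l11 : σ₂.reg 11 = o.reg 11 + 1 := by
    rw [c4 11 (by norm_num) (by norm_num), b3, h11]
  refine Does.branch ?_ ?_
  · intro h36
    have hend : ¬ PhaseEnds I (o.reg 13) (o.reg 12) := by
      have := c2.not.1 h36
      exact this
    have hdeg : ∀ z : Fin I.n, σ₂.mem 18 z + 2 ^ I.F < 2 ^ I.w := fun z => by
      rw [hP₂.deg]
      have := hFP.2 z
      exact I.lt_word_of_le_pow (by omega)
    refine (patch_spec (u := u) (v := v) (k := k) (n := I.n) (e := I.e) (d := I.d) (F := I.F)
      I.four_lt_word hc₂.r1 hc₂.r2 hc₂.r3 hc₂.r8 hc₂.r9 ?_ ?_ ?_ ?_ (mul_e_lt_word I hk) ?_ hne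
      (hdeg u) (hdeg v)).mono le_rfl ?_
    · rw [c4 31 (by norm_num) (by norm_num), b8 31 (by norm_num) (by norm_num) (by norm_num), a31]
    · rw [c4 30 (by norm_num) (by norm_num), b6]
    · rw [c4 32 (by norm_num) (by norm_num), b8 32 (by norm_num) (by norm_num) (by norm_num), a32]
    · rw [c4 33 (by norm_num) (by norm_num), b8 33 (by norm_num) (by norm_num) (by norm_num), a33]
    · rw [hr2 18 (by norm_num) (by norm_num) (by norm_num) (by norm_num), a18]
    rintro σ₃ ⟨d1, d2, d3, d4, d5⟩
    change _ = Function.update _ (edgeName I u v) _ at d2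
    rw [show σ₂.mem 17 (u * I.n + v) = P s(u, v) from hP₂.val u v huv, hP₂.deg, hP₂.deg] at d1 d2 d3
    rw [show (if k < 2 * I.d then 0 else fitValue I.F I.e I.d k (wdeg P u - P s(u, v))
      (wdeg P v - P s(u, v))) = patchWord P u v k from rfl] at d1 d2 d3
    have e5 : ∀ y, y ≠ 10 → y ≠ 11 → y ≠ 13 → y ≠ 18 → y < 30 → σ₃.reg y = σ.reg y :=
      fun y h1 h2 h3 h4 h5 => by rw [d5 y h4 (by omega), hr2 y h1 h2 h3 h5]
    refine ⟨hc₂.of_eq fun y hy _ _ _ _ => d5 y (by omega) (by omega), ?_, ?_, ?_, ?_,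
      fun h => absurd hfine h, fun _ => ⟨?_, ?_, ?_, fun h => absurd h hend, fun _ => ⟨?_, d1, ?_⟩⟩⟩
    · rw [e5 5 (by norm_num) (by norm_num) (by norm_num) (by norm_num) (by norm_num), g5]
    · rw [e5 6 (by norm_num) (by norm_num) (by norm_num) (by norm_num) (by norm_num), g6]
    · rw [e5 17 (by norm_num) (by norm_num) (by norm_num) (by norm_num) (by norm_num), a17]
    · rw [e5 12 (by norm_num) (by norm_num) (by norm_num) (by norm_num) (by norm_num), h12]
    · rw [d5 10 (by norm_num) (by norm_num)]; exact l10
    · rw [d5 11 (by norm_num) (by norm_num)]; exact l11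
    · rw [d5 13 (by norm_num) (by norm_num)]; exact c1
    · rw [e5 15 (by norm_num) (by norm_num) (by norm_num) (by norm_num) (by norm_num), a15]
    · exact Data.putRound huv hX₂ hP₂ ht₂ hcov₂ d2 d3 d4 (d5 10 (by norm_num) (by norm_num))
        (d5 11 (by norm_num) (by norm_num))
  · intro h36
    have hend : PhaseEnds I (o.reg 13) (o.reg 12) := c2.1 h36
    refine (Does.flat (p := .const 15 1) trivial ?_).mono (by decide) fun _ => id
    have e1 : 1 % 2 ^ I.w = 1 := Nat.mod_eq_of_lt I.one_lt_word
    have hr3 : ∀ y, y ≠ 15 → (Prog.run I.w (.const 15 1) σ₂).reg y = σ₂.reg y := fun y hy => by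
      simp [Prog.run, State.setReg, hy]
    have e5 : ∀ y, y ≠ 10 → y ≠ 11 → y ≠ 13 → y ≠ 15 → y < 30 →
        (Prog.run I.w (.const 15 1) σ₂).reg y = σ.reg y :=
      fun y h1 h2 h3 h4 h5 => by rw [hr3 y h4, hr2 y h1 h2 h3 h5]
    refine ⟨hc₂.of_eq fun y hy _ _ _ _ => hr3 y (by omega), ?_, ?_, ?_, ?_,
      fun h => absurd hfine h, fun _ => ⟨?_, ?_, ?_, fun _ => ⟨?_, ?_, ?_, ?_, ?_⟩,
        fun h => absurd hend h⟩⟩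
    · rw [e5 5 (by norm_num) (by norm_num) (by norm_num) (by norm_num) (by norm_num), g5]
    · rw [e5 6 (by norm_num) (by norm_num) (by norm_num) (by norm_num) (by norm_num), g6]
    · rw [e5 17 (by norm_num) (by norm_num) (by norm_num) (by norm_num) (by norm_num), a17]
    · rw [e5 12 (by norm_num) (by norm_num) (by norm_num) (by norm_num) (by norm_num), h12]
    · rw [hr3 10 (by norm_num)]; exact l10
    · rw [hr3 11 (by norm_num)]; exact l11
    · rw [hr3 13 (by norm_num)]; exact c1
    · simp [Prog.run, State.setReg, e1]
    · exact hX₂.of_eq (hr3 10 (by norm_num)) fun _ _ _ => rfl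
    · exact hP₂.of_eq rfl rfl
    · exact ht₂.of_eq (hr3 11 (by norm_num)) rfl
    · exact Covers.of_eq (o := σ₂) (fun a b hab hz => hcov₂ a b hab (.inr hz))
        (hr3 11 (by norm_num)) rfl

end Update

/-! ## The combined machine -/

section Glue

open Prog BinOp DynMatching.Part

/-- The name of a register of a component. -/
abbrev Part.reg (i : Part) (x : ℕ) : ℕ := regName.symm (i, x)

/-- The name of a memory bank of a component. -/
abbrev Part.bank (i : Part) (a : ℕ) : ℕ := bankName.symm (i, a)

/-- Copy the beginning of a memory bank; its length is in register `x` of the own data. -/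
def copyBank (i : Part) (a : ℕ) (j : Part) (b x : ℕ) : Prog := block [
  const (own.reg 50) 0, const (own.reg 52) 1, binop lt (own.reg 51) (own.reg 50) (own.reg x),
  loop (own.reg 51) (block [load (own.reg 53) (i.bank a) (own.reg 50),
    store (j.bank b) (own.reg 50) (own.reg 53), binop add (own.reg 50) (own.reg 50) (own.reg 52),
    binop lt (own.reg 51) (own.reg 50) (own.reg x)]),
  const (own.reg 50) 0, const (own.reg 51) 0, const (own.reg 52) 0, const (own.reg 53) 0]

def copyBanks (i : Part) (a : ℕ) (j : Part) (b x : ℕ) : Prog := block [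
  copyBank i a j b x, copyBank i (a + 1) j (b + 1) x, copyBank i (a + 2) j (b + 2) x]

/-- Pass the vector in banks `a`, `a + 1`, `a + 2` to the initialization of a component. -/
def passStart (j : Part) (a x : ℕ) : Prog := block [
  copy (j.reg 0) (own.reg 0), copy (j.reg 1) (own.reg 1), copy (j.reg 2) (own.reg 2),
  copy (j.reg 3) (own.reg 3), copy (j.reg 4) (own.reg x), copyBanks own a j 0 x]

/-- Pass the edge in registers `5`, `6` and the value in register `x` to the update program of a
component. -/
def passEdge (j : Part) (x : ℕ) : Prog := block [
  copy (j.reg 5) (own.reg 5), copy (j.reg 6) (own.reg 6), copy (j.reg 7) (own.reg x)]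

/-- Read the output of the coarsening algorithm. -/
def readCoarse : Prog := block [copy (own.reg 19) (coarse.reg 8), copyBanks coarse 3 own 6 19]

def newPhase (R : Alg) : Prog := block [
  readCoarse, rebuild.rename own, passStart round 9 11, R.start.rename round]

/-- The combination of a coarsening algorithm and a rounding algorithm. -/
def combine (C R : Alg) : Alg where
  start := block [startCode.rename own, passStart coarse 3 16, C.start.rename coarse, newPhase R]
  update := block [updateCode.rename own, passEdge coarse 17, C.update.rename coarse,
    branch (own.reg 15) (newPhase R) (block [passEdge round 18, R.update.rename round])]

theorem combine_deterministic {C R : Alg} (hC : C.Deterministic) (hR : R.Deterministic) :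
    (combine C R).Deterministic := by
  have h1 : startCode.RandFree := by
    simp [startCode, setup, clearEdge, loadEntry, readEntry, setEdge, passEntry, forUpto, block,
      RandFree]
  have h2 : updateCode.RandFree := by
    simp [updateCode, passUpdate, setEdge, countUpdate, patch, patchValue, removeOld, putNew,
      shrink, capRoom, block, RandFree]
  have h3 : rebuild.RandFree := by
    simp [rebuild, clearTouched, addStatic, testStatic, insertEdge, addLarge, largeValue, shrink,
      addFallback, popTest, forUpto, block, RandFree]
  have h4 : ∀ i a j b x, (copyBanks i a j b x).RandFree := by
    simp [copyBanks, copyBank, block, RandFree]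
  have h5 : (newPhase R).RandFree := by
    simp [newPhase, readCoarse, passStart, block, RandFree, h4, h3.rename, hR.1.rename]
  constructor
  · simp [combine, passStart, block, RandFree, h4, h5, h1.rename, hC.1.rename]
  · simp [combine, passEdge, block, RandFree, h5, h2.rename, hC.2.rename, hR.2.rename]

/-- Set the auxiliary registers. -/
def State.temps (o : State) (a b c d : ℕ) : State :=
  { o with reg := fun y => if y = 50 then a else if y = 51 then b else if y = 52 then c
      else if y = 53 then d else o.reg y }

/-- Clear the auxiliary registers. -/
def State.scrub (o : State) : State := o.temps 0 0 0 0

theorem State.temps_self (o : State) :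
    o.temps (o.reg 50) (o.reg 51) (o.reg 52) (o.reg 53) = o := by
  ext y <;> simp only [State.temps]
  split_ifs <;> simp_all

theorem State.temps_set50 (o : State) (a b c d k : ℕ) :
    (o.temps a b c d).setReg 50 k = o.temps k b c d := by
  ext y <;> simp only [State.temps, State.setReg, Function.update_apply]
  split_ifs <;> simp_all

theorem State.temps_set51 (o : State) (a b c d k : ℕ) :
    (o.temps a b c d).setReg 51 k = o.temps a k c d := by
  ext y <;> simp only [State.temps, State.setReg, Function.update_apply]
  split_ifs <;> simp_all

theorem State.temps_set52 (o : State) (a b c d k : ℕ) :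
    (o.temps a b c d).setReg 52 k = o.temps a b k d := by
  ext y <;> simp only [State.temps, State.setReg, Function.update_apply]
  split_ifs <;> simp_all

theorem State.temps_set53 (o : State) (a b c d k : ℕ) :
    (o.temps a b c d).setReg 53 k = o.temps a b c k := by
  ext y <;> simp only [State.temps, State.setReg, Function.update_apply]
  split_ifs <;> simp_all

/-- Set the auxiliary registers of the own data. -/
def setTemps (s : Part → State) (a b c d : ℕ) : Part → State :=
  Function.update s own ((s own).temps a b c d)

/-- Clear the auxiliary registers of the own data. -/
def clean (s : Part → State) : Part → State := Function.update s own (s own).scrub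

theorem setTemps_mem (s : Part → State) (a b c d : ℕ) (i : Part) :
    (setTemps s a b c d i).mem = (s i).mem := by
  cases i <;> simp [setTemps, State.temps]

theorem setTemps_reg (s : Part → State) (a b c d : ℕ) {x : ℕ} (hx : x < 50) :
    (setTemps s a b c d own).reg x = (s own).reg x := by
  rw [setTemps, Function.update_self]
  simp only [State.temps]
  rw [if_neg (by omega), if_neg (by omega), if_neg (by omega), if_neg (by omega)]

variable {w : ℕ} {ω : Tape w}

theorem exec_load (s : Part → State) (i j k : Part) (x a y : ℕ) :
    Exec w ω (.load (i.reg x) (j.bank a) (k.reg y)) (join s)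
      (join (Function.update s i ((s i).setReg x ((s j).mem a ((s k).reg y))))) 1 := by
  rw [← join_setReg, ← join_mem s j a, ← join_reg s k y]; exact .load _ _ _ _

theorem exec_store (s : Part → State) (i j k : Part) (a y x : ℕ) :
    Exec w ω (.store (i.bank a) (j.reg y) (k.reg x)) (join s)
      (join (Function.update s i ((s i).setMem a ((s j).reg y) ((s k).reg x)))) 1 := by
  rw [← join_setMem, ← join_reg s j y, ← join_reg s k x]; exact .store _ _ _ _

theorem exec_copy (s : Part → State) (i j : Part) (x y : ℕ) :
    Exec w ω (.copy (i.reg x) (j.reg y)) (join s)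
      (join (Function.update s i ((s i).setReg x ((s j).reg y)))) 1 := by
  rw [← join_setReg, ← join_reg s j y]; exact .copy _ _ _

theorem exec_const (s : Part → State) (i : Part) (x c : ℕ) :
    Exec w ω (.const (i.reg x) c) (join s)
      (join (Function.update s i ((s i).setReg x (c % 2 ^ w)))) 1 := by
  rw [← join_setReg]; exact .const _ _ _

theorem exec_binop (s : Part → State) (o : BinOp) (i j k : Part) (x y z : ℕ) :
    Exec w ω (.binop o (i.reg x) (j.reg y) (k.reg z)) (join s)
      (join (Function.update s i ((s i).setReg x (o.eval w ((s j).reg y) ((s k).reg z))))) 1 := by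
  rw [← join_setReg, ← join_reg s j y, ← join_reg s k z]; exact .binop _ _ _ _ _

theorem setTemps_set50 (s : Part → State) (a b c d k : ℕ) :
    Function.update (setTemps s a b c d) own ((setTemps s a b c d own).setReg 50 k) =
      setTemps s k b c d := by
  simp [setTemps, State.temps_set50]

theorem setTemps_set51 (s : Part → State) (a b c d k : ℕ) :
    Function.update (setTemps s a b c d) own ((setTemps s a b c d own).setReg 51 k) =
      setTemps s a k c d := by
  simp [setTemps, State.temps_set51]

theorem setTemps_set52 (s : Part → State) (a b c d k : ℕ) :
    Function.update (setTemps s a b c d) own ((setTemps s a b c d own).setReg 52 k) =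
      setTemps s a b k d := by
  simp [setTemps, State.temps_set52]

theorem setTemps_set53 (s : Part → State) (a b c d k : ℕ) :
    Function.update (setTemps s a b c d) own ((setTemps s a b c d own).setReg 53 k) =
      setTemps s a b c k := by
  simp [setTemps, State.temps_set53]

theorem setTemps_setMem (s : Part → State) (a b c d : ℕ) (j : Part) (x y k : ℕ) :
    Function.update (setTemps s a b c d) j ((setTemps s a b c d j).setMem x y k) =
      setTemps (Function.update s j ((s j).setMem x y k)) a b c d := by
  by_cases hj : j = own
  · subst hj
    simp only [setTemps, Function.update_self, Function.update_idem]
    rfl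
  · have hj' : own ≠ j := Ne.symm hj
    simp only [setTemps, Function.update_of_ne hj, Function.update_of_ne hj']
    exact Function.update_comm hj' _ _ _

theorem setTemps_own (s : Part → State) (a b c d : ℕ) :
    setTemps s a b c d own = (s own).temps a b c d := Function.update_self ..

theorem State.writeList_nil (σ : State) (b : ℕ) : σ.writeList b [] = σ := by
  simp [State.writeList]

theorem State.writeList_take_succ (σ : State) (b : ℕ) (l : List ℕ) {k : ℕ} (hk : k < l.length) :
    (σ.writeList b (l.take k)).setMem b k l[k] = σ.writeList b (l.take (k + 1)) := by
  simp only [State.writeList, State.setMem, Function.update_self, Function.update_idem]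
  congr 2
  funext y
  have hk' : min k l.length = k := by omega
  by_cases h : y = k
  · subst h
    simp [List.getD, hk]
  · rw [Function.update_of_ne h]
    by_cases h' : y < k
    · have h2 : y < l.length := by omega
      have h3 : y < k + 1 := by omega
      simp [List.getD, h', h2, h3]
    · have h3 : ¬ y < k + 1 := by omega
      simp [List.getD, h', h3]

/-- The four auxiliary registers are zeroed at the end, so that the final state has a closed form
that does not mention the word copied last. -/
theorem copyBank_exec (s : Part → State) {i j : Part} {a b x : ℕ} (hij : (i, a) ≠ (j, b))
    (hx : x < 50) {l : List ℕ} (hN : (s own).reg x = l.length) (hlen : l.length < 2 ^ w)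
    (hw : 1 < 2 ^ w) (hl : ∀ k (h : k < l.length), (s i).mem a k = l[k]) :
    Exec w ω (copyBank i a j b x) (join s)
      (join (clean (Function.update s j ((s j).writeList b l)))) (5 * l.length + 8) := by
  let S : ℕ → Part → State := fun k => Function.update s j ((s j).writeList b (l.take k))
  have e1 : 1 % 2 ^ w = 1 := Nat.mod_eq_of_lt hw
  have hSi : ∀ k, (S k i).mem a = (s i).mem a := by
    intro k
    by_cases h : i = j
    · subst h
      have : a ≠ b := fun h => hij (by rw [h])
      simp [S, State.writeList, this]
    · simp [S, h]
  have hSx : ∀ k y, (S k own).reg y = (s own).reg y := by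
    intro k y
    by_cases h : own = j
    · subst h; simp [S, State.writeList]
    · simp [S, h]
  have hstep : ∀ k (h : k < l.length), Function.update (S k) j ((S k j).setMem b k l[k]) = S (k + 1) := by
    intro k h
    simp only [S, Function.update_self, Function.update_idem]
    rw [State.writeList_take_succ _ _ _ h]
  -- The outcome of the loop test before the word number `k` is copied.
  let f : ℕ → ℕ := fun k => if k < l.length then 1 else 0
  have hloop : ∀ m k, k + m = l.length → ∀ t, ∃ t', Exec w ω
      (loop (own.reg 51) (block [load (own.reg 53) (i.bank a) (own.reg 50),
        store (j.bank b) (own.reg 50) (own.reg 53),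
        binop add (own.reg 50) (own.reg 50) (own.reg 52),
        binop lt (own.reg 51) (own.reg 50) (own.reg x)]))
      (join (setTemps (S k) k (f k) 1 t)) (join (setTemps (S l.length) l.length 0 1 t')) (5 * m + 1) := by
    intro m
    induction m with
    | zero =>
      rintro k hk t
      have hk : k = l.length := by omega
      subst hk
      have hf : f l.length = 0 := if_neg (lt_irrefl _)
      refine ⟨t, ?_⟩
      rw [hf]
      refine Exec.loop_stop ?_
      rw [join_reg, setTemps_own]; rfl
    | succ m ih =>
      intro k hk t
      have hk' : k < l.length := by omega
      have hf : f k = 1 := if_pos hk'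
      obtain ⟨t', h⟩ := ih (k + 1) (by omega) l[k]
      refine ⟨t', ?_⟩
      have hb : Exec w ω (block [load (own.reg 53) (i.bank a) (own.reg 50),
          store (j.bank b) (own.reg 50) (own.reg 53),
          binop add (own.reg 50) (own.reg 50) (own.reg 52),
          binop lt (own.reg 51) (own.reg 50) (own.reg x)])
          (join (setTemps (S k) k (f k) 1 t)) (join (setTemps (S (k + 1)) (k + 1) (f (k + 1)) 1 l[k]))
          (1 + (1 + (1 + 1))) := by
        have h50 : ∀ (s : Part → State) a b c d, (setTemps s a b c d own).reg 50 = a := fun s a b c d => by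
          rw [setTemps_own]; rfl
        have h52 : ∀ (s : Part → State) a b c d, (setTemps s a b c d own).reg 52 = c := fun s a b c d => by
          rw [setTemps_own]; rfl
        have h53 : ∀ (s : Part → State) a b c d, (setTemps s a b c d own).reg 53 = d := fun s a b c d => by
          rw [setTemps_own]; rfl
        have x1 := exec_load (ω := ω) (setTemps (S k) k (f k) 1 t) own i own 53 a 50
        rw [h50, setTemps_mem, hSi, hl k hk', setTemps_set53] at x1
        have x2 := exec_store (ω := ω) (setTemps (S k) k (f k) 1 l[k]) j own own b 50 53
        rw [h50, h53, setTemps_setMem, hstep k hk'] at x2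
        have x3 := exec_binop (ω := ω) (setTemps (S (k + 1)) k (f k) 1 l[k]) .add own own own 50 50 52
        rw [h50, h52, setTemps_set50, BinOp.eval, Nat.mod_eq_of_lt (by omega)] at x3
        have x4 := exec_binop (ω := ω) (setTemps (S (k + 1)) (k + 1) (f k) 1 l[k]) .lt own own own 51 50 x
        rw [h50, setTemps_reg _ _ _ _ _ hx, hSx, hN, setTemps_set51] at x4
        exact .seq x1 (.seq x2 (.seq x3 x4))
      have := Exec.loop_step (x := own.reg 51) (by
        rw [join_reg, setTemps_own, hf]; exact one_ne_zero) hb h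
      convert this using 1
      ring
  obtain ⟨t', h⟩ := hloop l.length 0 (by omega) ((s own).reg 53)
  have hS0 : S 0 = s := by
    simp only [S, List.take_zero, State.writeList_nil, Function.update_eq_self]
  have hself : setTemps s ((s own).reg 50) ((s own).reg 51) ((s own).reg 52) ((s own).reg 53) = s := by
    rw [setTemps, State.temps_self, Function.update_eq_self]
  have y1 := exec_const (ω := ω) s own 50 0
  rw [← hself, setTemps_set50, hself, Nat.zero_mod] at y1
  have y2 := exec_const (ω := ω) (setTemps s 0 ((s own).reg 51) ((s own).reg 52) ((s own).reg 53)) own 52 1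
  rw [setTemps_set52, e1] at y2
  have y3 := exec_binop (ω := ω) (setTemps s 0 ((s own).reg 51) 1 ((s own).reg 53)) .lt own own own 51 50 x
  rw [setTemps_set51, setTemps_reg _ _ _ _ _ hx, hN,
    show (setTemps s 0 ((s own).reg 51) 1 ((s own).reg 53) own).reg 50 = 0 by
      rw [setTemps_own]; rfl] at y3
  rw [hS0] at h
  have y4 := exec_const (ω := ω) (setTemps (S l.length) l.length 0 1 t') own 50 0
  rw [setTemps_set50, Nat.zero_mod] at y4
  have y5 := exec_const (ω := ω) (setTemps (S l.length) 0 0 1 t') own 51 0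
  rw [setTemps_set51, Nat.zero_mod] at y5
  have y6 := exec_const (ω := ω) (setTemps (S l.length) 0 0 1 t') own 52 0
  rw [setTemps_set52, Nat.zero_mod] at y6
  have y7 := exec_const (ω := ω) (setTemps (S l.length) 0 0 0 t') own 53 0
  rw [setTemps_set53, Nat.zero_mod] at y7
  have := Exec.seq y1 (.seq y2 (.seq y3 (.seq h (.seq y4 (.seq y5 (.seq y6 y7))))))
  have hSl : S l.length = Function.update s j ((s j).writeList b l) := by simp [S]
  rw [hSl] at this
  have e : 1 + (1 + (1 + (5 * l.length + 1 + (1 + (1 + (1 + 1)))))) = 5 * l.length + 8 := by ring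
  rw [← e]
  exact this

theorem State.scrub_scrub (o : State) : o.scrub.scrub = o.scrub := by
  ext y <;> simp only [State.scrub, State.temps]
  split_ifs <;> rfl

theorem State.scrub_reg (o : State) {x : ℕ} (hx : x < 50) : o.scrub.reg x = o.reg x := by
  simp only [State.scrub, State.temps]
  rw [if_neg (by omega), if_neg (by omega), if_neg (by omega), if_neg (by omega)]

theorem clean_write (s : Part → State) (j : Part) (b : ℕ) (l : List ℕ) :
    clean (Function.update (clean s) j ((clean s j).writeList b l)) =
      clean (Function.update s j ((s j).writeList b l)) := by
  by_cases hj : j = own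
  · subst hj
    simp only [clean, Function.update_self, Function.update_idem]
    congr 1
    exact State.scrub_scrub ((s own).writeList b l)
  · have hj' : own ≠ j := Ne.symm hj
    simp only [clean, Function.update_of_ne hj, Function.update_of_ne hj', Function.update_self,
      State.scrub_scrub]
    rw [Function.update_comm hj', Function.update_idem]

theorem clean_mem (s : Part → State) (i : Part) : (clean s i).mem = (s i).mem := by
  cases i <;> simp [clean, State.scrub, State.temps]

theorem clean_reg (s : Part → State) {x : ℕ} (hx : x < 50) :
    (clean s own).reg x = (s own).reg x := by
  rw [clean, Function.update_self, State.scrub_reg _ hx]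

variable {I : Params}

/-- Write the entries of a list to three memory banks. -/
def State.writeEntries (σ : State) (b : ℕ) (L : List (Entry I)) : State :=
  ((σ.writeList b (L.map fun a => (a.1 : ℕ))).writeList (b + 1)
    (L.map fun a => (a.2.1 : ℕ))).writeList (b + 2) (L.map fun a => a.2.2)

theorem copyBanks_exec (s : Part → State) {i j : Part} {a b x : ℕ} (hij : i ≠ j) (hx : x < 50)
    {L : List (Entry I)} (hN : (s own).reg x = L.length) (hlen : L.length < 2 ^ w)
    (hw : 1 < 2 ^ w) (hL : ListAt a (a + 1) (a + 2) L (s i)) :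
    Exec w ω (copyBanks i a j b x) (join s)
      (join (clean (Function.update s j ((s j).writeEntries b L)))) (15 * L.length + 24) := by
  have hij' : ∀ x y : ℕ, (i, x) ≠ (j, y) := fun x y h => hij (Prod.mk.inj h).1
  have hreg : ∀ (t : Part → State) (l : List ℕ) b', (Function.update t j ((t j).writeList b' l) own).reg x
      = (t own).reg x := by
    intro t l b'
    by_cases h : own = j
    · subst h; simp [State.writeList]
    · simp [h]
  have x1 := copyBank_exec (ω := ω) s (hij' a b) hx (l := L.map fun a => (a.1 : ℕ)) (by simpa using hN)
    (by simpa using hlen) hw (fun k hk => by simp at hk; simpa using (hL k hk).1)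
  have x2 := copyBank_exec (ω := ω) (clean (Function.update s j ((s j).writeList b
    (L.map fun a => (a.1 : ℕ))))) (hij' (a + 1) (b + 1)) hx (l := L.map fun a => (a.2.1 : ℕ))
    (by rw [clean_reg _ hx, hreg]; simpa using hN) (by simpa using hlen) hw (fun k hk => by
      rw [clean_mem, Function.update_of_ne hij]
      simp at hk; simpa using (hL k hk).2.1)
  rw [clean_write, Function.update_self, Function.update_idem] at x2
  have x3 := copyBank_exec (ω := ω) (clean (Function.update s j (((s j).writeList b
    (L.map fun a => (a.1 : ℕ))).writeList (b + 1) (L.map fun a => (a.2.1 : ℕ)))))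
    (hij' (a + 2) (b + 2)) hx (l := L.map fun a => a.2.2)
    (by
      rw [clean_reg _ hx]
      have h1 := hreg (Function.update s j ((s j).writeList b (L.map fun a => (a.1 : ℕ))))
        (L.map fun a => (a.2.1 : ℕ)) (b + 1)
      rw [Function.update_self, Function.update_idem, hreg] at h1
      rw [h1]; simpa using hN) (by simpa using hlen) hw (fun k hk => by
      rw [clean_mem, Function.update_of_ne hij]
      simp at hk; simpa using (hL k hk).2.2)
  rw [clean_write, Function.update_self, Function.update_idem] at x3
  have e : (5 * (L.map fun a => (a.1 : ℕ)).length + 8) + ((5 * (L.map fun a => (a.2.1 : ℕ)).length + 8)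
      + (5 * (L.map fun a => a.2.2).length + 8)) = 15 * L.length + 24 := by
    simp only [List.length_map]; ring
  rw [← e]
  exact .seq x1 (.seq x2 x3)

theorem passStart_exec (s : Part → State) {j : Part} {a x : ℕ} (hj : j ≠ own) (hx : x < 50)
    (hc : Consts I (s own)) {L : List (Entry I)} (hN : (s own).reg x = L.length)
    (hlen : L.length < 2 ^ w) (hw : 1 < 2 ^ w) (hL : ListAt a (a + 1) (a + 2) L (s own)) :
    Exec w ω (passStart j a x) (join s)
      (join (clean (Function.update s j ((Op.start L).pass (s j))))) (15 * L.length + 29) := by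
  have hj' : own ≠ j := hj.symm
  have hcopy : ∀ (A : State) (y z : ℕ), Exec w ω (.copy (j.reg y) (own.reg z))
      (join (Function.update s j A)) (join (Function.update s j (A.setReg y ((s own).reg z)))) 1 := by
    intro A y z
    have := exec_copy (w := w) (ω := ω) (Function.update s j A) j own y z
    rwa [Function.update_self, Function.update_idem, Function.update_of_ne hj'] at this
  have x0 := hcopy (s j) 0 0
  rw [Function.update_eq_self] at x0
  have x5 := copyBanks_exec (ω := ω) (Function.update s j (((((s j).setReg 0 I.n).setReg 1 I.F).setReg 2
    I.e).setReg 3 I.d |>.setReg 4 L.length)) (i := own) (j := j) (b := 0) hj' hx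
    (L := L) (by rw [Function.update_of_ne hj', hN]) hlen hw (by rwa [Function.update_of_ne hj'])
  rw [Function.update_self, Function.update_idem] at x5
  have x1 := hcopy ((s j).setReg 0 I.n) 1 1
  have x2 := hcopy (((s j).setReg 0 I.n).setReg 1 I.F) 2 2
  have x3 := hcopy ((((s j).setReg 0 I.n).setReg 1 I.F).setReg 2 I.e) 3 3
  have x4 := hcopy (((((s j).setReg 0 I.n).setReg 1 I.F).setReg 2 I.e).setReg 3 I.d) 4 x
  rw [hc.r0] at x0
  rw [hc.r1] at x1
  rw [hc.r2] at x2
  rw [hc.r3] at x3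
  rw [hN] at x4
  have := Exec.seq x0 (.seq x1 (.seq x2 (.seq x3 (.seq x4 x5))))
  have e : 1 + (1 + (1 + (1 + (1 + (15 * L.length + 24))))) = 15 * L.length + 29 := by ring
  rw [← e]
  exact this

theorem passEdge_exec (s : Part → State) {j : Part} {x : ℕ} (hj : j ≠ own) {u v : Fin I.n} {k : ℕ}
    (h5 : (s own).reg 5 = u) (h6 : (s own).reg 6 = v) (hx : (s own).reg x = k) :
    Exec w ω (passEdge j x) (join s)
      (join (Function.update s j ((Op.update u v k).pass (s j)))) 3 := by
  have hj' : own ≠ j := hj.symm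
  have hcopy : ∀ (A : State) (y z : ℕ), Exec w ω (.copy (j.reg y) (own.reg z))
      (join (Function.update s j A)) (join (Function.update s j (A.setReg y ((s own).reg z)))) 1 := by
    intro A y z
    have := exec_copy (w := w) (ω := ω) (Function.update s j A) j own y z
    rwa [Function.update_self, Function.update_idem, Function.update_of_ne hj'] at this
  have x0 := hcopy (s j) 5 5
  rw [Function.update_eq_self] at x0
  have x1 := hcopy ((s j).setReg 5 u) 6 6
  have x2 := hcopy (((s j).setReg 5 u).setReg 6 v) 7 x
  rw [h5] at x0
  rw [h6] at x1
  rw [hx] at x2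
  exact .seq x0 (.seq x1 x2)

/-- The own data after the output of the coarsening algorithm was read. -/
def State.readOutput (o : State) (L : List (Entry I)) : State :=
  ((o.setReg 19 L.length).writeEntries 6 L).scrub

theorem readCoarse_exec (s : Part → State) {L : List (Entry I)} (hN : (s coarse).reg 8 = L.length)
    (hlen : L.length < 2 ^ w) (hw : 1 < 2 ^ w) (hL : ListAt 3 4 5 L (s coarse)) :
    Exec w ω readCoarse (join s) (join (Function.update s own ((s own).readOutput L)))
      (15 * L.length + 25) := by
  have x0 := exec_copy (w := w) (ω := ω) s own coarse 19 8
  rw [hN] at x0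
  have x1 := copyBanks_exec (w := w) (ω := ω) (Function.update s own ((s own).setReg 19 L.length))
    (i := coarse) (j := own) (a := 3) (b := 6) (x := 19) (by decide) (by norm_num) (L := L)
    (by simp [State.setReg]) hlen hw (by simpa using hL)
  rw [Function.update_self, Function.update_idem, clean, Function.update_self,
    Function.update_idem] at x1
  have e : 1 + (15 * L.length + 24) = 15 * L.length + 25 := by ring
  rw [← e]
  exact .seq x0 x1

theorem listAt_of_outEntries {σ : State} {L : List (Entry I)}
    (h : outEntries σ = L.map fun a => ((a.1 : ℕ), (a.2.1 : ℕ), a.2.2)) :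
    σ.reg 8 = L.length ∧ ListAt 3 4 5 L σ := by
  have h8 : σ.reg 8 = L.length := by simpa [outEntries] using congrArg List.length h
  refine ⟨h8, fun i hi => ?_⟩
  have := congrArg (fun l => l[i]?) h
  simpa [outEntries, h8, hi] using this

/-- The three components of the combined machine. -/
def parts (o c r : State) : Part → State
  | own => o
  | coarse => c
  | Part.round => r

theorem parts_own (o c r o' : State) : Function.update (parts o c r) own o' = parts o' c r := by
  funext i; cases i <;> simp [parts]

theorem parts_coarse (o c r c' : State) :
    Function.update (parts o c r) coarse c' = parts o c' r := by
  funext i; cases i <;> simp [parts]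

theorem parts_round (o c r r' : State) : Function.update (parts o c r) round r' = parts o c r' := by
  funext i; cases i <;> simp [parts]

theorem clean_parts (o c r : State) : clean (parts o c r) = parts o.scrub c r := parts_own ..

/-- The step count is the sum of reading the coarsening (15 per entry), rebuilding, passing the new
vector (15 per entry) and the call itself; 54 = 25 + 29 collects the constants of the two transfers.
-/
theorem newPhase_exec {R : Alg} {o c r o' r' : State} {L M : List (Entry I)} {k kr : ℕ}
    (hout : outEntries c = L.map fun a => ((a.1 : ℕ), (a.2.1 : ℕ), a.2.2))
    (hlen : L.length < 2 ^ w) (hw : 1 < 2 ^ w)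
    (hreb : ∀ ω : Tape w, Exec w ω rebuild (o.readOutput L) o' k) (hc : Consts I o')
    (h11 : o'.reg 11 = M.length) (hM : ListAt 9 10 11 M o') (hlen' : M.length < 2 ^ w)
    (hR : Exec w (subTape round ω) R.start ((Op.start M).pass r) r' kr) :
    Exec w ω (newPhase R) (join (parts o c r)) (join (parts o'.scrub c r'))
      (15 * L.length + k + 15 * M.length + 54 + kr) := by
  obtain ⟨h8, hL⟩ := listAt_of_outEntries hout
  have x0 := readCoarse_exec (w := w) (ω := ω) (parts o c r) h8 hlen hw hL
  rw [parts_own] at x0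
  have x1 := (hreb (subTape own ω)).rename (parts (State.readOutput o L) c r) rfl
  rw [parts_own] at x1
  have x2 := passStart_exec (w := w) (ω := ω) (parts o' c r) (j := round) (a := 9) (x := 11)
    (by decide) (by norm_num) hc h11 hlen' hw hM
  rw [parts_round, clean_parts] at x2
  have x3 := hR.rename (parts o'.scrub c ((Op.start M).pass r)) rfl
  rw [parts_round] at x3
  have e : 15 * L.length + 25 + (k + (15 * M.length + 29 + kr)) =
      15 * L.length + k + 15 * M.length + 54 + kr := by ring
  rw [← e]
  exact .seq x0 (.seq x1 (.seq x2 x3))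

end Glue

/-! ## Degrees and norms -/

section Graph

variable {V : Type} [Fintype V]

theorem degree_nonneg {f : Sym2 V → ℝ} (hf : ∀ e, 0 ≤ f e) (v : V) : 0 ≤ degree f v :=
  Finset.sum_nonneg fun _ _ => hf _

theorem norm_add' [DecidableEq V] (f g : Sym2 V → ℝ) : norm (f + g) = norm f + norm g :=
  Finset.sum_add_distrib

theorem degree_add' (f g : Sym2 V → ℝ) (v : V) : degree (f + g) v = degree f v + degree g v :=
  Finset.sum_add_distrib

theorem degree_mono {f g : Sym2 V → ℝ} (h : ∀ e, f e ≤ g e) (v : V) : degree f v ≤ degree g v :=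
  Finset.sum_le_sum fun _ _ => h _

theorem norm_nonneg' {f : Sym2 V → ℝ} (hf : ∀ e, 0 ≤ f e) : 0 ≤ norm f :=
  Finset.sum_nonneg fun _ _ => hf _

variable [DecidableEq V]

/-- The other end determines an edge at `z`, so each edge containing `z` is counted exactly once. -/
theorem degree_eq_sum (f : Sym2 V → ℝ) (z : V) : degree f z = ∑ e with z ∈ e, f e := by
  have h : (Finset.univ.filter fun e : Sym2 V => z ∈ e) = Finset.univ.image fun u => s(z, u) := by
    ext e
    simp only [Finset.mem_filter, Finset.mem_univ, true_and, Finset.mem_image]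
    exact ⟨fun ⟨y, hy⟩ => ⟨y, hy.symm⟩, fun ⟨y, hy⟩ => ⟨y, hy.symm⟩⟩
  rw [h, Finset.sum_image]
  · rfl
  · intro a _ b _ hab
    exact Sym2.congr_right.1 hab

/-- An edge has at most two ends; the inequality allows for loops in `Sym2`, which have one. -/
theorem sum_degree_le {f : Sym2 V → ℝ} (hf : ∀ e, 0 ≤ f e) : ∑ v, degree f v ≤ 2 * norm f := by
  simp only [degree_eq_sum, Finset.sum_filter]
  rw [Finset.sum_comm, norm, Finset.mul_sum]
  refine Finset.sum_le_sum fun e _ => ?_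
  rw [← Finset.sum_filter, Finset.sum_const, nsmul_eq_mul]
  refine mul_le_mul_of_nonneg_right ?_ (hf e)
  have h : (Finset.univ.filter fun v : V => v ∈ e).card ≤ 2 := by
    induction e with | _ a b =>
    refine (Finset.card_le_card (t := {a, b}) fun v hv => ?_).trans Finset.card_le_two
    simpa using hv
  exact_mod_cast h

theorem degree_le_norm {f : Sym2 V → ℝ} (hf : ∀ e, 0 ≤ f e) (v : V) : degree f v ≤ norm f := by
  rw [degree_eq_sum]
  exact Finset.sum_le_sum_of_subset_of_nonneg (Finset.filter_subset _ _) fun e _ _ => hf e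

theorem norm_update (f : Sym2 V → ℝ) (e : Sym2 V) (c : ℝ) :
    norm (Function.update f e c) = norm f - f e + c := by
  have h := Finset.sum_update_of_mem (Finset.mem_univ e) f c
  have h3 : norm f = f e + ∑ x ∈ Finset.univ \ {e}, f x := by
    rw [norm, ← Finset.sum_sdiff (Finset.subset_univ {e}), Finset.sum_singleton, add_comm]
  rw [norm, h, h3]
  ring

/-- If every edge in the support of `f` has an end in `B`, then the norm of `f` is at most the sum
of its degrees in `B`. -/
theorem norm_le_sum_degree {f : Sym2 V → ℝ} (hf : ∀ e, 0 ≤ f e) (B : Finset V)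
    (h : ∀ e, f e ≠ 0 → ∃ z ∈ B, z ∈ e) : norm f ≤ ∑ v ∈ B, degree f v := by
  simp only [degree_eq_sum, Finset.sum_filter]
  rw [Finset.sum_comm, norm]
  refine Finset.sum_le_sum fun e _ => ?_
  by_cases h0 : f e = 0
  · simp [h0]
  · obtain ⟨z, hz, hze⟩ := h e h0
    refine le_trans ?_ (Finset.single_le_sum (f := fun v => if v ∈ e then f e else 0) (fun v _ => ?_) hz)
    · rw [if_pos hze]
    · split_ifs
      · exact hf e
      · exact le_rfl

end Graph

/-! ### Coarsenings and the entries rejected by the greedy choice -/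

section Prune

variable {I : Params}

theorem eps_pos (I : Params) : 0 < I.eps := by
  have := I.e_pos
  unfold Params.eps; positivity

theorem delta_pos (I : Params) : 0 < I.delta := by
  have := I.d_pos
  unfold Params.delta; positivity

theorem Params.Fine.eps_lt (h : I.Fine) : 2000 * I.eps < 1 := by
  unfold Params.eps
  rw [← mul_div_assoc, div_lt_one (by positivity)]
  exact_mod_cast h.1

theorem Params.Fine.delta_lt (h : I.Fine) : 2000 * I.delta < 1 := by
  unfold Params.delta
  rw [← mul_div_assoc, div_lt_one (by positivity)]
  exact_mod_cast h.2

theorem resolution (I : Params) : 1 / 2 ^ I.F ≤ I.eps * I.delta := by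
  unfold Params.eps Params.delta
  rw [div_mul_div_comm, div_le_div_iff₀ (by positivity) (by positivity), one_mul]
  have : ((2 ^ I.F : ℕ) : ℝ) ≤ (I.e * I.d : ℕ) := by exact_mod_cast I.precision
  push_cast at this
  nlinarith [show (0 : ℝ) < 2 ^ I.F by positivity]

theorem toReal_nonneg (X : WordVec I) (e : Sym2 (Fin I.n)) : 0 ≤ X.toReal e := by
  unfold WordVec.toReal; positivity

theorem toReal_add (X Y : WordVec I) : WordVec.toReal (X + Y) = X.toReal + Y.toReal := by
  funext e; simp [WordVec.toReal, add_div]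

theorem toReal_mono {X Y : WordVec I} (h : X ≤ Y) (e : Sym2 (Fin I.n)) : X.toReal e ≤ Y.toReal e := by
  unfold WordVec.toReal
  have : (X e : ℝ) ≤ Y e := by exact_mod_cast h e
  gcongr

theorem toReal_eq_zero {X : WordVec I} {e : Sym2 (Fin I.n)} : X.toReal e = 0 ↔ X e = 0 := by
  simp [WordVec.toReal]

theorem toReal_lt_delta {X : WordVec I} {e : Sym2 (Fin I.n)} (c : ℕ) :
    X.toReal e < c * I.delta ↔ X e < c * I.d := by
  unfold WordVec.toReal Params.delta
  rw [← mul_div_assoc, div_lt_div_iff_of_pos_right (by positivity)]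
  exact_mod_cast Iff.rfl

/-- Rounding down costs less than one unit 2^(-F), and the assumed precision makes this at most εδ.
-/
theorem staticCap_real (X : WordVec I) (hX : Frac X) (v : Fin I.n) :
    (staticCap X v : ℝ) / 2 ^ I.F ≤
        degree (small X).toReal v + 3 * I.eps * (1 - degree (small X).toReal v) ∧
      degree (small X).toReal v + 3 * I.eps * (1 - degree (small X).toReal v) - I.eps * I.delta ≤
        (staticCap X v : ℝ) / 2 ^ I.F := by
  have hS := hX.small.2 v
  rw [degree_toReal]
  have hq : (0 : ℝ) < 2 ^ I.F := by positivity
  set S := wdeg (small X) v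
  obtain ⟨T, hT⟩ := Nat.exists_eq_add_of_le hS
  have hc : staticCap X v = S + T * I.e * 3 / 2 ^ I.F := by
    unfold staticCap
    rw [show (2 : ℕ) ^ I.F - wdeg (small X) v = T by omega]
  have hqT : (2 : ℝ) ^ I.F = S + T := by exact_mod_cast hT
  have h1 : ((T * I.e * 3 / 2 ^ I.F : ℕ) : ℝ) * 2 ^ I.F ≤ T * I.e * 3 := by
    exact_mod_cast Nat.div_mul_le_self _ _
  have h2 : (T * I.e * 3 : ℝ) < ((T * I.e * 3 / 2 ^ I.F : ℕ) + 1) * 2 ^ I.F := by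
    have := Nat.lt_mul_div_succ (T * I.e * 3) (show 0 < 2 ^ I.F by positivity)
    rw [mul_comm (2 ^ I.F)] at this
    exact_mod_cast this
  have h3 : 3 * I.eps * (1 - (S : ℝ) / 2 ^ I.F) = T * I.e * 3 / 2 ^ I.F / 2 ^ I.F := by
    unfold Params.eps
    field_simp
    rw [hqT]; ring
  have hr := resolution I
  rw [h3, hc]
  push_cast
  rw [add_div]
  constructor
  · gcongr
    rwa [le_div_iff₀ hq]
  · have h4 : (T * I.e * 3 : ℝ) / 2 ^ I.F / 2 ^ I.F ≤ (((T * I.e * 3 / 2 ^ I.F : ℕ) : ℝ) + 1) / 2 ^ I.F := by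
      gcongr
      rw [div_le_iff₀ hq]
      exact h2.le
    rw [add_div] at h4
    linarith

/-- The list `lC` is a coarsening of the small part of `X`. -/
structure Coarse (X : WordVec I) (lC : List (Entry I)) : Prop where
  entries : IsEntryList I lC
  coarsening : IsCoarsening I.eps I.delta (small X).toReal (vecOf lC).toReal

/-- By (C3) a value of the coarsening lies in [δ, 2δ) or equals a value of the small part that is at
least δ; the latter is also below 2δ by truncation. -/
theorem Coarse.bounds {X : WordVec I} {lC : List (Entry I)} (h : Coarse X lC) {a : Entry I}
    (ha : a ∈ lC) : small X s(a.1, a.2.1) ≠ 0 ∧ I.d ≤ a.2.2 ∧ a.2.2 < 2 * I.d := by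
  have hv := vecOf_of_mem h.entries.2 ha
  have h0 := h.entries.vecOf_ne_zero ha
  have hr : (vecOf lC).toReal s(a.1, a.2.1) ≠ 0 := fun h => h0 (toReal_eq_zero.1 h)
  have hs := h.coarsening.containment _ hr
  have hs' : small X s(a.1, a.2.1) ≠ 0 := fun h => hs (toReal_eq_zero.2 h)
  have h1 := toReal_lt_delta (X := vecOf lC) (e := s(a.1, a.2.1)) 1
  have h2 := toReal_lt_delta (X := vecOf lC) (e := s(a.1, a.2.1)) 2
  have h3 := toReal_lt_delta (X := small X) (e := s(a.1, a.2.1)) 1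
  rw [hv] at h1 h2
  simp only [Nat.cast_one, one_mul, Nat.cast_ofNat] at h1 h2 h3
  refine ⟨hs', ?_⟩
  by_cases hc : (small X).toReal s(a.1, a.2.1) < I.delta
  · obtain ⟨h4, h5⟩ := (h.coarsening.edge_small _ hc).resolve_left hr
    exact ⟨not_lt.1 (h1.not.1 (not_lt.2 h4)), h2.1 h5⟩
  · have h4 := h.coarsening.edge_large _ (not_lt.1 hc)
    rw [h3] at hc
    have h5 : vecOf lC s(a.1, a.2.1) = small X s(a.1, a.2.1) := by
      unfold WordVec.toReal at h4
      have hq : (2 : ℝ) ^ I.F ≠ 0 := by positivity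
      field_simp at h4
      exact_mod_cast h4
    rw [hv] at h5
    have h6 : small X s(a.1, a.2.1) < 2 * I.d := by
      unfold small
      split_ifs with h7
      · exact h7
      · have := I.d_pos; omega
    omega

theorem Coarse.smallEntries {X : WordVec I} {lC : List (Entry I)} (hf : I.Fine) (h : Coarse X lC) :
    SmallEntries X lC where
  entries := h.entries
  supp a ha := by
    have := (h.bounds ha).1
    unfold small at this
    split_ifs at this with h1
    · exact ⟨this, h1⟩
    · exact absurd rfl this
  le a ha := by
    have := (h.bounds ha).2.2
    have := hf.2
    omega

/-- The entries that are not chosen. -/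
theorem Greedy.rest {X : WordVec I} {lC Ls : List (Entry I)} (hl : IsEntryList I lC)
    (h : Greedy X lC Ls) :
    ∃ Z : WordVec I, vecOf lC = vecOf Ls + Z ∧ (∀ e, Z e ≠ 0 → ∃ a ∈ lC, s(a.1, a.2.1) = e ∧
      Z e = a.2.2 ∧ vecOf Ls e = 0 ∧
      ∃ z ∈ e, staticCap X z < wdeg (vecOf Ls) z + a.2.2) ∧
      lC.length = Ls.length + (Finset.univ.filter fun e => Z e ≠ 0).card := by
  have hls := hl.sublist h.sublist
  have hle : ∀ e, vecOf Ls e ≤ vecOf lC e := vecOf_le_of_sublist h.sublist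
  have hZ : ∀ e, vecOf lC e - vecOf Ls e ≠ 0 → ∃ a ∈ lC, s(a.1, a.2.1) = e ∧
      vecOf lC e = a.2.2 ∧ vecOf Ls e = 0 ∧ a ∉ Ls := by
    intro e he
    obtain ⟨a, ha, rfl⟩ := exists_of_vecOf_ne_zero (l := lC) (e := e) (by omega)
    refine ⟨a, ha, rfl, vecOf_of_mem hl.2 ha, ?_, ?_⟩
    · by_contra hc
      obtain ⟨b, hb, hba⟩ := exists_of_vecOf_ne_zero hc
      have h1 := vecOf_of_mem hl.2 (h.sublist.subset hb)
      have h2 := vecOf_of_mem hls.2 hb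
      rw [hba] at h1 h2
      omega
    · intro hc
      rw [vecOf_of_mem hl.2 ha, vecOf_of_mem hls.2 hc] at he
      omega
  refine ⟨fun e => vecOf lC e - vecOf Ls e, ?_, ?_, ?_⟩
  · funext e
    have := hle e
    simp only [Pi.add_apply]
    omega
  · intro e he
    obtain ⟨a, ha, hae, h1, h2, h3⟩ := hZ e he
    obtain ⟨z, hz, hz'⟩ := (h.rejected a ha).resolve_left h3
    refine ⟨a, ha, hae, by dsimp only; omega, h2, z, ?_, hz'⟩
    rw [← hae, Sym2.mem_iff]; exact hz
  · rw [hl.length_eq, hls.length_eq, ← Finset.card_union_of_disjoint]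
    · congr 1
      ext e
      have := hle e
      simp only [Finset.mem_filter, Finset.mem_univ, true_and, Finset.mem_union]
      omega
    · rw [Finset.disjoint_filter]
      intro e _ h1 h2
      obtain ⟨_, _, _, _, h3, _⟩ := hZ e h2
      exact h1 h3

end Prune

/-! ### Pruning a coarsening loses little norm -/

section Prune

variable {I : Params}

/-- The support of a word vector. -/
def wsupp (X : WordVec I) : Finset (Sym2 (Fin I.n)) := Finset.univ.filter fun e => X e ≠ 0

theorem mem_wsupp {X : WordVec I} {e : Sym2 (Fin I.n)} : e ∈ wsupp X ↔ X e ≠ 0 := by simp [wsupp]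

theorem norm_eq_sum_wsupp (X : WordVec I) : norm X.toReal = ∑ e ∈ wsupp X, X.toReal e := by
  symm
  refine Finset.sum_subset (Finset.subset_univ _) fun e _ he => ?_
  rw [mem_wsupp, not_not] at he
  exact toReal_eq_zero.2 he

theorem card_mul_le_norm {X : WordVec I} (h : ∀ e, X e ≠ 0 → I.d ≤ X e) :
    (wsupp X).card * I.delta ≤ norm X.toReal := by
  rw [norm_eq_sum_wsupp, ← nsmul_eq_mul]
  refine Finset.card_nsmul_le_sum _ _ _ fun e he => ?_
  have := h e (mem_wsupp.1 he)
  have h1 := (toReal_lt_delta (X := X) (e := e) 1).not.2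
  simp only [Nat.cast_one, one_mul, not_lt] at h1
  exact h1 this

theorem norm_le_card_mul {X : WordVec I} (h : ∀ e, X e < 2 * I.d) :
    norm X.toReal ≤ (wsupp X).card * (2 * I.delta) := by
  rw [norm_eq_sum_wsupp, ← nsmul_eq_mul]
  refine Finset.sum_le_card_nsmul _ _ _ fun e _ => ?_
  have := (toReal_lt_delta (X := X) (e := e) 2).2 (h e)
  exact_mod_cast this.le

/-- A rejected edge has an end whose degree in the coarsening exceeds s by about 3ε(1 - s). Wherever
s is not close to 1, this is more than the free slack ε, so the excess shows up in the sum bounded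
by (C2). Wherever s is bounded below, the loss is charged to s itself, and the degrees sum to at
most 2‖x‖. The second part bounds the time to read the coarsening by the size of the new phase. -/
theorem prune (hf : I.Fine) {X : WordVec I} (hX : Frac X) {lC Ls : List (Entry I)}
    (hC : Coarse X lC) (hG : Greedy X lC Ls) :
    norm (small X).toReal ≤ norm (vecOf Ls).toReal +
        20 * (I.eps + I.delta) * (norm (small X).toReal + 1) ∧
      lC.length ≤ 2 * Ls.length := by
  obtain ⟨Z, hZ, hZe, hcard⟩ := hG.rest hC.entries
  have hε := eps_pos I
  have hδ := delta_pos I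
  have hε1 := hf.eps_lt
  have hδ1 := hf.delta_lt
  set ε := I.eps
  set δ := I.delta
  set x := (small X).toReal
  set x' := (vecOf lC).toReal
  have hx' : x' = (vecOf Ls).toReal + Z.toReal := by rw [← toReal_add, ← hZ]
  have hq : (0 : ℝ) < 2 ^ I.F := by positivity
  -- The summands of (C2), to which excess degrees are charged.
  let y : Fin I.n → ℝ := fun v => max 0 (|degree x v - degree x' v| - ε)
  have hy0 : ∀ v, 0 ≤ y v := fun v => le_max_left _ _
  have hysum : ∑ v, y v ≤ ε * norm x + ε := hC.coarsening.vertex_slack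
  have hs0 : ∀ v, 0 ≤ degree x v := fun v => degree_nonneg (toReal_nonneg _) v
  have hs1 : ∀ v, degree x v ≤ 1 := fun v => (isFracMatching_toReal.2 hX.small).degree_le v
  have hN0 : 0 ≤ norm x := norm_nonneg' (toReal_nonneg _)
  have hZ2 : ∀ e, Z e < 2 * I.d := by
    intro e
    by_cases h0 : Z e = 0
    · have := I.d_pos; omega
    · obtain ⟨a, ha, -, h1, -⟩ := hZe e h0
      rw [h1]; exact (hC.bounds ha).2.2
  have hZ1 : ∀ e, Z e ≠ 0 → I.d ≤ Z e := by
    intro e h0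
    obtain ⟨a, ha, -, h1, -⟩ := hZe e h0
    rw [h1]; exact (hC.bounds ha).2.1
  -- The blocking vertices; every rejected edge has an end among them.
  let B : Finset (Fin I.n) := Finset.univ.filter fun v =>
    ∃ e, v ∈ e ∧ staticCap X v < wdeg (vecOf Ls) v + Z e
  have hB : ∀ v ∈ B, 2 * ε - 3 * ε * degree x v - ε * δ < y v ∧
      degree Z.toReal v ≤ y v - 2 * ε + 3 * ε * degree x v + ε * δ + 2 * δ := by
    intro v hv
    simp only [B, Finset.mem_filter, Finset.mem_univ, true_and] at hv
    obtain ⟨e, hve, he⟩ := hv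
    obtain ⟨u, rfl⟩ := hve
    have h1 := (staticCap_real X hX v).2
    have h2 : (staticCap X v : ℝ) / 2 ^ I.F < degree (vecOf Ls).toReal v + Z.toReal s(v, u) := by
      rw [degree_toReal, WordVec.toReal, ← add_div, div_lt_div_iff_of_pos_right hq]
      exact_mod_cast he
    have h3 : Z.toReal s(v, u) ≤ degree Z.toReal v :=
      Finset.single_le_sum (f := fun u => Z.toReal s(v, u)) (fun _ _ => toReal_nonneg _ _)
        (Finset.mem_univ u)
    have h4 : Z.toReal s(v, u) < 2 * δ := by
      have := (toReal_lt_delta (X := Z) (e := s(v, u)) 2).2 (hZ2 _)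
      exact_mod_cast this
    have h5 : degree x' v = degree (vecOf Ls).toReal v + degree Z.toReal v := by
      rw [hx', degree_add']
    have h6 : |degree x v - degree x' v| - ε ≤ y v := le_max_right _ _
    have h7 := neg_abs_le (degree x v - degree x' v)
    constructor <;> nlinarith
  -- c = δ/ε turns a charge of δ into a multiple of a summand `y v` that is at least ε.
  obtain ⟨c, hc0, hc⟩ : ∃ c : ℝ, 0 < c ∧ c * ε = δ := ⟨δ / ε, by positivity, by field_simp⟩
  have hB' : ∀ v ∈ B, degree Z.toReal v ≤ y v * (1 + 2 * c) + (3 * ε + 8 * δ) * degree x v := by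
    intro v hv
    obtain ⟨h1, h2⟩ := hB v hv
    have h3 : ε * δ ≤ ε * (1 / 2000) := by gcongr; linarith
    -- The stray 2δ is the value of the blocked edge itself. It is charged to the degree if that is
    -- at least 1/4; otherwise 2ε - 3ε/4 - εδ ≥ ε gives `y v` at least ε, and it is charged there.
    rcases le_or_gt (1 / 4) (degree x v) with h | h
    · have : 2 * δ ≤ 8 * δ * degree x v := by nlinarith
      have : 0 ≤ y v * (2 * c) := by have := hy0 v; positivity
      nlinarith
    · have h4 : ε ≤ y v := by nlinarith
      have h5 : δ ≤ c * y v := by rw [← hc]; gcongr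
      have : 0 ≤ 8 * δ * degree x v := by have := hs0 v; positivity
      nlinarith
  have hnormZ : norm Z.toReal ≤ 18 * (ε + δ) * (norm x + 1) := by
    calc norm Z.toReal ≤ ∑ v ∈ B, degree Z.toReal v := by
          refine norm_le_sum_degree (toReal_nonneg _) B fun e he => ?_
          obtain ⟨a, ha, -, h1, -, z, hz, hz'⟩ := hZe e fun h => he (toReal_eq_zero.2 h)
          refine ⟨z, ?_, hz⟩
          simp only [B, Finset.mem_filter, Finset.mem_univ, true_and]
          exact ⟨e, hz, by rwa [h1]⟩
      _ ≤ ∑ v ∈ B, (y v * (1 + 2 * c) + (3 * ε + 8 * δ) * degree x v) := Finset.sum_le_sum hB'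
      _ ≤ ∑ v, (y v * (1 + 2 * c) + (3 * ε + 8 * δ) * degree x v) := by
          refine Finset.sum_le_sum_of_subset_of_nonneg (Finset.subset_univ _) fun v _ _ => ?_
          have := hy0 v
          have := hs0 v
          positivity
      _ = (∑ v, y v) * (1 + 2 * c) + (3 * ε + 8 * δ) * ∑ v, degree x v := by
          rw [Finset.sum_add_distrib, ← Finset.sum_mul, ← Finset.mul_sum]
      _ ≤ (ε * norm x + ε) * (1 + 2 * c) + (3 * ε + 8 * δ) * (2 * norm x) := by
          gcongr
          exact sum_degree_le (toReal_nonneg _)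
      _ = (ε + 2 * (c * ε)) * (norm x + 1) + (6 * ε + 16 * δ) * norm x := by ring
      _ ≤ 18 * (ε + δ) * (norm x + 1) := by rw [hc]; nlinarith [mul_nonneg hε.le hN0]
  have hnorm : norm x' = norm (vecOf Ls).toReal + norm Z.toReal := by rw [hx', norm_add']
  have h1 := hC.coarsening.global_slack
  have h2 := le_abs_self (norm x - norm x')
  have hmain : norm x ≤ norm (vecOf Ls).toReal + 20 * (ε + δ) * (norm x + 1) := by
    have : 0 ≤ δ * (norm x + 1) := by positivity
    have : 0 ≤ ε * (norm x + 1) := by positivity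
    change |norm x - norm x'| ≤ ε * norm x + ε at h1
    nlinarith
  refine ⟨hmain, ?_⟩
  -- If something was rejected, a blocking vertex forces ‖x‖ to be about 1/4 at least, and then the
  -- additive error is relative as well.
  by_cases hZ0 : wsupp Z = ∅
  · have : (wsupp Z).card = 0 := by rw [hZ0]; rfl
    unfold wsupp at this
    omega
  obtain ⟨e, he⟩ := Finset.nonempty_iff_ne_empty.2 hZ0
  obtain ⟨a, ha, -, h3, -, z, hz, hz'⟩ := hZe e (mem_wsupp.1 he)
  have hzB : z ∈ B := by
    simp only [B, Finset.mem_filter, Finset.mem_univ, true_and]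
    exact ⟨e, hz, by rwa [h3]⟩
  have h4 : y z ≤ ε * norm x + ε := (Finset.single_le_sum (fun v _ => hy0 v) (Finset.mem_univ z)).trans hysum
  have h5 : degree x z ≤ norm x := degree_le_norm (toReal_nonneg _) z
  have h6 := (hB z hzB).1
  -- At a blocking vertex `y z` exceeds 2ε - 3εs - εδ with s ≤ ‖x‖, while (C2) bounds it by ε‖x‖ +
  -- ε.
  have h7 : 1 - δ ≤ 4 * norm x := by
    by_contra hcon
    push Not at hcon
    have : ε * (norm x + 1) < ε * (2 - 3 * norm x - δ) := by gcongr; linarith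
    have : 3 * ε * degree x z ≤ 3 * ε * norm x := by gcongr
    linarith
  have h8 := card_mul_le_norm hZ1
  have h9 := norm_le_card_mul (X := vecOf Ls) fun e => by
    by_cases h0 : vecOf Ls e = 0
    · have := I.d_pos; omega
    · have hls := hC.entries.sublist hG.sublist
      obtain ⟨a, ha, rfl⟩ := exists_of_vecOf_ne_zero h0
      rw [vecOf_of_mem hls.2 ha]
      exact (hC.bounds (hG.sublist.subset ha)).2.2
  have hLs : (wsupp (vecOf Ls)).card = Ls.length := ((hC.entries.sublist hG.sublist).length_eq).symm
  have hlen : lC.length = Ls.length + (wsupp Z).card := hcard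
  rw [hLs] at h9
  -- Rejected entries are at least δ and chosen ones below 2δ, so comparing norms compares numbers
  -- of entries.
  have h10 : ((wsupp Z).card : ℝ) * δ ≤ Ls.length * δ := by
    have h11 : (ε + δ) * (norm x + 1) ≤ 1 / 1000 * (norm x + 1) := by gcongr; linarith
    nlinarith
  have h12 : ((wsupp Z).card : ℝ) ≤ Ls.length := le_of_mul_le_mul_right h10 hδ
  have h13 : (wsupp Z).card ≤ Ls.length := by exact_mod_cast h12
  omega

end Prune

/-! ### The invariant at the beginning of a phase -/

section Phase

variable {I : Params}

/-- The part of `P` on the edges whose value in `X` is below `2δ`. -/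
def lowPart (X P : WordVec I) : WordVec I := fun e => if X e < 2 * I.d then P e else 0

/-- The part of `P` on the other edges. -/
def highPart (X P : WordVec I) : WordVec I := fun e => if X e < 2 * I.d then 0 else P e

/-- The largest values that the large edges may have in the vector of the rounding algorithm. -/
def largeGoal (X : WordVec I) : WordVec I := fun e => largeWord I (X e)

/-- How much the large edges fall short of their goals. -/
def shortfall (X P : WordVec I) : WordVec I := highPart X (largeGoal X - P)

theorem low_add_high (X P : WordVec I) : lowPart X P + highPart X P = P := by
  funext e
  simp only [lowPart, highPart, Pi.add_apply]
  split_ifs <;> simp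

theorem lowPart_self (X : WordVec I) : lowPart X X = small X := rfl

theorem high_goal {X P : WordVec I} (h : ∀ e, 2 * I.d ≤ X e → P e ≤ largeWord I (X e)) :
    highPart X (largeGoal X) = highPart X P + shortfall X P := by
  funext e
  simp only [shortfall, highPart, Pi.add_apply, Pi.sub_apply, largeGoal]
  split_ifs with h1
  · rfl
  · have := h e (not_lt.1 h1)
    omega

/-- For k at least 2δ the precision gives εk at least one unit, so rounding down the subtracted 4εk
still leaves at least 3εk. -/
theorem largeWord_real (hf : I.Fine) {k : ℕ} (hk : 2 * I.d ≤ k) :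
    (1 - 4 * I.eps) * (k / 2 ^ I.F) ≤ (largeWord I k : ℝ) / 2 ^ I.F ∧
      (largeWord I k : ℝ) / 2 ^ I.F ≤ (1 - 3 * I.eps) * (k / 2 ^ I.F) := by
  have hq : (0 : ℝ) < 2 ^ I.F := by positivity
  have hfl : k * I.e * 4 / 2 ^ I.F ≤ k := by
    refine Nat.div_le_of_le_mul ?_
    have := hf.1
    calc k * I.e * 4 = (I.e * 4) * k := by ring
      _ ≤ 2 ^ I.F * k := Nat.mul_le_mul_right _ (by omega)
  have h1 : ((k * I.e * 4 / 2 ^ I.F : ℕ) : ℝ) * 2 ^ I.F ≤ k * I.e * 4 := by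
    exact_mod_cast Nat.div_mul_le_self _ _
  have h2 : (k * I.e * 4 : ℝ) < ((k * I.e * 4 / 2 ^ I.F : ℕ) + 1) * 2 ^ I.F := by
    have := Nat.lt_mul_div_succ (k * I.e * 4) (show 0 < 2 ^ I.F by positivity)
    rw [mul_comm (2 ^ I.F)] at this
    exact_mod_cast this
  have h3 : (2 ^ I.F : ℝ) ≤ k * I.e := by
    have h4 := I.precision
    have h5 : I.e * I.d ≤ k * I.e := by nlinarith
    exact_mod_cast h4.trans h5
  have h6 : (largeWord I k : ℝ) = k - ((k * I.e * 4 / 2 ^ I.F : ℕ) : ℝ) := by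
    unfold largeWord
    rw [Nat.cast_sub hfl]
  rw [h6, ← mul_div_assoc, ← mul_div_assoc]
  have h7 : I.eps * 2 ^ I.F = I.e := by unfold Params.eps; field_simp
  constructor
  · gcongr
    rw [← mul_le_mul_iff_left₀ hq]
    have : (1 - 4 * I.eps) * k * 2 ^ I.F = k * 2 ^ I.F - 4 * k * (I.eps * 2 ^ I.F) := by ring
    rw [this, h7, sub_mul]
    linarith
  · gcongr
    rw [← mul_le_mul_iff_left₀ hq]
    have : (1 - 3 * I.eps) * k * 2 ^ I.F = k * 2 ^ I.F - 3 * k * (I.eps * 2 ^ I.F) := by ring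
    rw [this, h7, sub_mul]
    linarith

/-- This is what the threshold 2δ, instead of δ, is for: shrinking cannot push a large edge below
the promise of the rounding algorithm. -/
theorem delta_le_largeWord (hf : I.Fine) {k : ℕ} (hk : 2 * I.d ≤ k) : I.d ≤ largeWord I k := by
  have h1 := (largeWord_real hf hk).1
  have hq : (0 : ℝ) < 2 ^ I.F := by positivity
  rw [← mul_div_assoc, div_le_div_iff_of_pos_right hq] at h1
  have h2 := hf.eps_lt
  have h3 : (2 * I.d : ℝ) ≤ k := by exact_mod_cast hk
  have h4 : (I.d : ℝ) ≤ largeWord I k := by nlinarith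
  exact_mod_cast h4

/-- The large edges at a vertex share what the small part leaves of 1, and each is shrunk by at
least 3ε. This complements `staticCap_real`. -/
theorem high_goal_degree (hf : I.Fine) {X : WordVec I} (hX : Frac X) (v : Fin I.n) :
    degree (highPart X (largeGoal X)).toReal v ≤
      (1 - 3 * I.eps) * (1 - degree (small X).toReal v) := by
  have h1 : degree X.toReal v = degree (small X).toReal v + degree (highPart X X).toReal v := by
    rw [← degree_add', ← toReal_add, ← lowPart_self, low_add_high]
  have h2 := (isFracMatching_toReal.2 hX).degree_le v
  have h3 : degree (highPart X (largeGoal X)).toReal v ≤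
      (1 - 3 * I.eps) * degree (highPart X X).toReal v := by
    rw [degree, degree, Finset.mul_sum]
    refine Finset.sum_le_sum fun u _ => ?_
    simp only [highPart, WordVec.toReal, largeGoal]
    split_ifs with h
    · simp
    · exact (largeWord_real hf (not_lt.1 h)).2
  have h4 := hf.eps_lt
  nlinarith

theorem high_goal_norm (hf : I.Fine) (X : WordVec I) :
    (1 - 4 * I.eps) * norm (highPart X X).toReal ≤ norm (highPart X (largeGoal X)).toReal := by
  rw [norm, norm, Finset.mul_sum]
  refine Finset.sum_le_sum fun e _ => ?_
  simp only [highPart, WordVec.toReal, largeGoal]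
  split_ifs with h
  · simp
  · exact (largeWord_real hf (not_lt.1 h)).1

/-- The relation between the input vector `X` and the vector `P` of the rounding algorithm after
`k` updates in a phase that started with `m0` edges in the support of `P`. -/
structure PhaseInv (X P : WordVec I) (m0 k : ℕ) : Prop where
  supp : ∀ e, P e ≠ 0 → X e ≠ 0
  frac : Frac P
  ge : ∀ e, P e ≠ 0 → I.d ≤ P e
  card : m0 ≤ k + (wsupp P).card
  count : k = 0 ∧ (m0 = 0 → X = 0) ∨ k * 2 ^ I.F < m0 * I.e
  low_le : ∀ e, X e < 2 * I.d → P e ≤ 2 * I.d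
  high_le : ∀ e, 2 * I.d ≤ X e → P e ≤ largeWord I (X e)
  low_norm : norm (small X).toReal ≤ norm (lowPart X P).toReal +
    20 * (I.eps + I.delta) * (norm (small X).toReal + 1) + 5 * I.delta * k
  blame : ∃ (s : Fin I.n → ℝ) (κ : Fin I.n → ℕ) (b : Sym2 (Fin I.n) → Fin I.n),
    ∑ v, κ v ≤ 2 * k ∧
    (∀ v, degree (lowPart X P).toReal v ≤ s v + 3 * I.eps * (1 - s v) + I.delta) ∧
    (∀ v, s v ≤ degree (small X).toReal v + 2 * I.delta * κ v) ∧
    (∀ e, shortfall X P e ≠ 0 → b e ∈ e) ∧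
    ∀ v, ∑ e with b e = v, (shortfall X P).toReal e ≤ 4 * I.delta * κ v

/-- At the start every large edge meets its goal, so nothing is blamed, and s is the current degree
of the small part. The bounds for static and large edges add up to exactly 1 at each vertex. The
slack δ in the bound of the low part is there for the fallback edge. -/
theorem Rebuilt.phaseInv (hf : I.Fine) {X : WordVec I} (hX : Frac X) {lC L : List (Entry I)}
    (hC : Coarse X lC) (h : Rebuilt X lC L) :
    PhaseInv X (vecOf L) L.length 0 ∧ lC.length ≤ 2 * L.length := by
  obtain ⟨Ls, Lb, hG, hL, hcase⟩ := h.parts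
  obtain ⟨hp1, hp2⟩ := prune hf hX hC hG
  have hls := hC.entries.sublist hG.sublist
  have hd := I.d_pos
  have hδ := delta_pos I
  have hε := eps_pos I
  have hε1 := hf.eps_lt
  have hδ1 := hf.delta_lt
  have hq : (0 : ℝ) < 2 ^ I.F := by positivity
  have hLs : ∀ e, vecOf Ls e ≠ 0 → X e ≠ 0 ∧ X e < 2 * I.d ∧ I.d ≤ vecOf Ls e ∧
      vecOf Ls e < 2 * I.d := by
    intro e he
    obtain ⟨a, ha, rfl⟩ := exists_of_vecOf_ne_zero he
    have h1 := (hC.smallEntries hf).supp a (hG.sublist.subset ha)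
    have h2 := hC.bounds (hG.sublist.subset ha)
    rw [vecOf_of_mem hls.2 ha]
    exact ⟨h1.1, h1.2, h2.2⟩
  have hs0 : ∀ v, 0 ≤ degree (small X).toReal v := fun v => degree_nonneg (toReal_nonneg _) v
  have hs1 : ∀ v, degree (small X).toReal v ≤ 1 := fun v =>
    (isFracMatching_toReal.2 hX.small).degree_le v
  have hfit : ∀ v, degree (vecOf Ls).toReal v ≤
      degree (small X).toReal v + 3 * I.eps * (1 - degree (small X).toReal v) := by
    intro v
    refine le_trans ?_ (staticCap_real X hX v).1
    rw [degree_toReal]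
    have : (wdeg (vecOf Ls) v : ℝ) ≤ staticCap X v := by exact_mod_cast hG.fits v
    gcongr
  have key : (∀ e, 2 * I.d ≤ X e → vecOf L e = largeWord I (X e)) ∧
      (∀ e, X e < 2 * I.d → (vecOf L e ≠ 0 → X e ≠ 0 ∧ I.d ≤ vecOf L e) ∧ vecOf L e ≤ 2 * I.d) ∧
      (∀ v, degree (lowPart X (vecOf L)).toReal v ≤ degree (small X).toReal v +
        3 * I.eps * (1 - degree (small X).toReal v) + I.delta) ∧
      norm (vecOf Ls).toReal ≤ norm (lowPart X (vecOf L)).toReal ∧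
      (∀ v, wdeg (vecOf L) v ≤ 2 ^ I.F) ∧ (L.length = 0 → X = 0) ∧ lC.length ≤ 2 * L.length := by
    rcases hcase with ⟨rfl, hne⟩ | ⟨rfl, rfl, hcase⟩
    · have hlb : IsEntryList I Lb := h.entries.sublist (List.sublist_append_right _ _)
      have hb : ∀ e, 2 * I.d ≤ X e → vecOf Lb e = largeWord I (X e) := by
        intro e he
        induction e with | _ u v =>
        have key : ∀ a b : Fin I.n, a < b → 2 * I.d ≤ X s(a, b) →
            vecOf Lb s(a, b) = largeWord I (X s(a, b)) := by
          intro a b hab hx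
          obtain ⟨x, hx1, rfl, rfl⟩ := hL.mem a b hab hx
          rw [vecOf_of_mem hlb.2 hx1, (hL.val x hx1).2]
        rcases lt_trichotomy u v with h | rfl | h
        · exact key u v h he
        · exact absurd (hX.1 _ (show X s(u, u) ≠ 0 by omega)) (SimpleGraph.irrefl I.G)
        · rw [Sym2.eq_swap] at he ⊢
          exact key v u h he
      have hb0 : ∀ e, X e < 2 * I.d → vecOf Lb e = 0 := by
        intro e he
        by_contra hc
        obtain ⟨a, ha, rfl⟩ := exists_of_vecOf_ne_zero hc
        have := (hL.val a ha).1
        omega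
      have hs0' : ∀ e, 2 * I.d ≤ X e → vecOf Ls e = 0 := by
        intro e he
        by_contra hc
        have := (hLs e hc).2.1
        omega
      have hlow : lowPart X (vecOf (Ls ++ Lb)) = vecOf Ls := by
        funext e
        rw [vecOf_append]
        simp only [lowPart, Pi.add_apply]
        split_ifs with he
        · rw [hb0 e he, add_zero]
        · rw [hs0' e (not_lt.1 he)]
      have hhigh : highPart X (vecOf (Ls ++ Lb)) = highPart X (largeGoal X) := by
        funext e
        rw [vecOf_append]
        simp only [highPart, Pi.add_apply, largeGoal]
        split_ifs with he
        · rfl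
        · rw [hb e (not_lt.1 he), hs0' e (not_lt.1 he), zero_add]
      refine ⟨fun e he => ?_, fun e he => ?_, fun v => ?_, ?_, fun v => ?_, ?_, ?_⟩
      · rw [vecOf_append, Pi.add_apply, hb e he, hs0' e he, zero_add]
      · rw [vecOf_append, Pi.add_apply, hb0 e he, add_zero]
        refine ⟨fun h0 => ⟨(hLs e h0).1, (hLs e h0).2.2.1⟩, ?_⟩
        by_cases h0 : vecOf Ls e = 0
        · omega
        · exact (hLs e h0).2.2.2.le
      · rw [hlow]
        have := hfit v
        linarith
      · rw [hlow]
      -- s + 3ε(1 - s) + (1 - 3ε)(1 - s) = 1.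
      · have h1 : degree (vecOf (Ls ++ Lb)).toReal v ≤ 1 := by
          rw [← low_add_high X (vecOf (Ls ++ Lb)), toReal_add, degree_add', hlow, hhigh]
          have h2 := hfit v
          have h3 := high_goal_degree hf hX v
          nlinarith
        rw [degree_toReal, div_le_one hq] at h1
        exact_mod_cast h1
      · intro h0
        exact absurd (List.length_eq_zero_iff.1 h0) hne
      · rw [List.length_append]; omega
    · have hX2 : ∀ e, X e < 2 * I.d := by
        intro e
        by_contra hc
        push Not at hc
        induction e with | _ u v =>
        rcases lt_trichotomy u v with h | rfl | h
        · obtain ⟨a, ha, -⟩ := hL.mem u v h hc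
          simp at ha
        · exact absurd (hX.1 _ (show X s(u, u) ≠ 0 by omega)) (SimpleGraph.irrefl I.G)
        · rw [Sym2.eq_swap] at hc
          obtain ⟨a, ha, -⟩ := hL.mem v u h hc
          simp at ha
      have hlow : lowPart X (vecOf L) = vecOf L := by
        funext e
        exact if_pos (hX2 e)
      -- Nothing chosen means that the coarsening itself is empty, by the second part of `prune`.
      have hN0 : lC.length = 0 := by simpa using hp2
      have hnil : norm (vecOf ([] : List (Entry I))).toReal = 0 := by
        simp [norm, WordVec.toReal]
      have hs : ∀ v, 0 ≤ 3 * I.eps * (1 - degree (small X).toReal v) := fun v => by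
        have := hs1 v
        have : 0 ≤ 1 - degree (small X).toReal v := by linarith
        positivity
      rw [hlow, hnil]
      have hd2 : I.d ≤ 2 ^ I.F := I.d_le
      rcases hcase with ⟨rfl, rfl⟩ | ⟨u, v, huv, hx, rfl⟩
      · refine ⟨fun e he => absurd (hX2 e) (by omega), fun e _ => ⟨fun h0 => absurd rfl h0, by simp⟩,
          fun v => ?_, hnil.ge, fun v => by simp [wdeg_zero], fun _ => rfl, by omega⟩
        have h1 := hs v
        have h2 := hs0 v
        have h3 : degree (vecOf ([] : List (Entry I))).toReal v = 0 := by
          rw [degree_toReal, vecOf_nil, wdeg_zero]; simp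
        rw [h3]
        linarith
      · have hV : vecOf [(u, v, I.d)] = Function.update (0 : WordVec I) s(u, v) I.d :=
          vecOf_concat (l := []) (a := (u, v, I.d)) rfl
        have hwd : ∀ z, wdeg (vecOf [(u, v, I.d)]) z ≤ I.d := fun z => by
          rw [hV, wdeg_update _ huv.ne, wdeg_zero]
          simp
          split_ifs <;> omega
        refine ⟨fun e he => absurd (hX2 e) (by omega), fun e _ => ?_, fun z => ?_,
          norm_nonneg' (toReal_nonneg _), fun z => (hwd z).trans hd2, fun h0 => by simp at h0,
          by omega⟩
        · rw [hV]
          by_cases he : e = s(u, v)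
          · subst he; simp [hx]; omega
          · simp [he]
        · have h1 := hs z
          have h2 := hs0 z
          have h3 : degree (vecOf [(u, v, I.d)]).toReal z ≤ I.delta := by
            rw [degree_toReal, Params.delta]
            have : (wdeg (vecOf [(u, v, I.d)]) z : ℝ) ≤ I.d := by exact_mod_cast hwd z
            gcongr
          linarith
  obtain ⟨k1, k2, k3, k4, k5, k6, k7⟩ := key
  have hsupp : ∀ e, vecOf L e ≠ 0 → X e ≠ 0 := fun e he => by
    by_cases hx : X e < 2 * I.d
    · exact ((k2 e hx).1 he).1
    · omega
  have hshort : shortfall X (vecOf L) = 0 := by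
    funext e
    simp only [shortfall, highPart, Pi.sub_apply, largeGoal]
    split_ifs with he
    · rfl
    · rw [k1 e (not_lt.1 he)]; simp
  refine ⟨⟨hsupp, ⟨fun e he => hX.1 e (hsupp e he), k5⟩, fun e he => ?_, ?_, .inl ⟨rfl, k6⟩,
    fun e he => (k2 e he).2, fun e he => (k1 e he).le, ?_, ?_⟩, k7⟩
  · by_cases hx : X e < 2 * I.d
    · exact ((k2 e hx).1 he).2
    · rw [k1 e (not_lt.1 hx)]; exact delta_le_largeWord hf (not_lt.1 hx)
  · rw [h.entries.length_eq, zero_add]; rfl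
  · simp only [Nat.cast_zero, mul_zero, add_zero]
    linarith
  -- The blame function must name a vertex even for edges without shortfall, which needs one to
  -- exist.
  · by_cases hn : Nonempty (Fin I.n)
    · refine ⟨fun v => degree (small X).toReal v, fun _ => 0, fun _ => hn.some, by simp, k3,
        fun v => by simp, fun e he => absurd (by rw [hshort]; rfl) he, fun v => ?_⟩
      rw [hshort]
      simp [WordVec.toReal]
    · refine ⟨fun v => absurd ⟨v⟩ hn, fun v => absurd ⟨v⟩ hn, fun e => absurd ?_ hn, ?_, ?_, ?_, ?_, ?_⟩
      · exact e.inductionOn fun a _ => ⟨a⟩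
      · have : IsEmpty (Fin I.n) := not_nonempty_iff.1 hn
        simp
      · exact fun v => absurd ⟨v⟩ hn
      · exact fun v => absurd ⟨v⟩ hn
      · exact fun e he => absurd (by rw [hshort]; rfl) he
      · exact fun v => absurd ⟨v⟩ hn

end Phase

/-! ### Updates preserve the invariant; quality of the rounding -/

section Phase

variable {I : Params}

theorem toReal_update (X : WordVec I) (e : Sym2 (Fin I.n)) (k : ℕ) :
    WordVec.toReal (Function.update X e k) = Function.update X.toReal e ((k : ℝ) / 2 ^ I.F) := by
  funext a
  by_cases h : a = e
  · subst h; simp [WordVec.toReal]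
  · simp [WordVec.toReal, h]

/-- The last clause is the point: a value short of its goal means that an end is full up to δ. The δ
covers the case in which the room was below δ and the edge was dropped. -/
theorem patchWord_cases (hf : I.Fine) {P : WordVec I} (hP : Frac P) (u v : Fin I.n) {k : ℕ}
    (hk : 2 * I.d ≤ k) :
    patchWord P u v k ≤ largeWord I k ∧ wdeg P u - P s(u, v) + patchWord P u v k ≤ 2 ^ I.F ∧
      wdeg P v - P s(u, v) + patchWord P u v k ≤ 2 ^ I.F ∧
      (patchWord P u v k ≠ 0 → I.d ≤ patchWord P u v k) ∧
      (patchWord P u v k < largeWord I k →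
        2 ^ I.F ≤ wdeg P u - P s(u, v) + patchWord P u v k + I.d ∨
        2 ^ I.F ≤ wdeg P v - P s(u, v) + patchWord P u v k + I.d) := by
  have h1 := hP.2 u
  have h2 := hP.2 v
  have h3 := delta_le_largeWord hf hk
  have hv : patchWord P u v k = if min (min (largeWord I k) (2 ^ I.F - (wdeg P u - P s(u, v))))
      (2 ^ I.F - (wdeg P v - P s(u, v))) < I.d then 0 else
        min (min (largeWord I k) (2 ^ I.F - (wdeg P u - P s(u, v))))
          (2 ^ I.F - (wdeg P v - P s(u, v))) := by
    rw [patchWord, if_neg (by omega)]; rfl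
  rw [hv]
  have ha : wdeg P u - P s(u, v) ≤ 2 ^ I.F := by omega
  have hb : wdeg P v - P s(u, v) ≤ 2 ^ I.F := by omega
  generalize largeWord I k = g at *
  generalize wdeg P u - P s(u, v) = a at *
  generalize wdeg P v - P s(u, v) = b at *
  split_ifs with hc
  · refine ⟨?_, ?_, ?_, ?_, ?_⟩ <;> omega
  · refine ⟨?_, ?_, ?_, ?_, ?_⟩ <;> omega

/-- An edge that becomes small gets weight zero, and a large edge is not in the low part. So within
a phase the low part can only lose edges. -/
theorem lowPart_update (X P : WordVec I) (u v : Fin I.n) (k : ℕ) :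
    lowPart (Function.update X s(u, v) k) (Function.update P s(u, v) (patchWord P u v k)) =
      Function.update (lowPart X P) s(u, v) 0 := by
  funext e
  by_cases he : e = s(u, v)
  · subst he
    simp only [lowPart, Function.update_self, patchWord]
    split_ifs <;> rfl
  · simp [lowPart, he]

theorem shortfall_update (X P : WordVec I) (e : Sym2 (Fin I.n)) (k val : ℕ) :
    shortfall (Function.update X e k) (Function.update P e val) =
      Function.update (shortfall X P) e (if k < 2 * I.d then 0 else largeWord I k - val) := by
  funext a
  by_cases he : a = e
  · subst he
    simp [shortfall, highPart, largeGoal]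
  · simp [shortfall, highPart, largeGoal, he]

/-- The heart of the norm bound is the blame function. Each large edge with a shortfall blames one
of its ends. Here s is the small degree at the start of the phase and κ counts the updates at each
vertex, so s exceeds the current small degree by at most 2δκ. When an update is cut at `z`, the
degree of `P` at `z` is at least 1 - δ. Its low part is at most s + 3ε(1 - s) + δ, and the goals of
the large edges sum to at most (1 - 3ε)(1 - s + 2δκ). Hence the whole shortfall at `z` is at most
2δκ + 2δ, thus at most 4δκ as κ ≥ 1. As the κ sum to at most twice the number of updates, the total
shortfall stays O(δ) per update. -/
theorem PhaseInv.update (hf : I.Fine) {X P : WordVec I} {m0 k : ℕ} (h : PhaseInv X P m0 k)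
    {u v : Fin I.n} (huv : u ≠ v) {j : ℕ} (hX' : Frac (Function.update X s(u, v) j))
    (hk : ¬ PhaseEnds I k m0) :
    PhaseInv (Function.update X s(u, v) j)
      (Function.update P s(u, v) (patchWord P u v j)) m0 (k + 1) := by
  set e₀ := s(u, v) with he₀
  set val := patchWord P u v j with hval
  have hd := I.d_pos
  have hδ := delta_pos I
  have hε := eps_pos I
  have hε1 := hf.eps_lt
  have hδ1 := hf.delta_lt
  have hq : (0 : ℝ) < 2 ^ I.F := by positivity
  have hval0 : j < 2 * I.d → val = 0 := fun hj => if_pos hj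
  have hpw := fun hj : 2 * I.d ≤ j => patchWord_cases hf h.frac u v hj
  have hle : ∀ z : Fin I.n, z = u ∨ z = v → P e₀ ≤ wdeg P z := by
    rintro z (rfl | rfl)
    · exact le_wdeg P z v
    · exact le_wdeg' P u z
  have hfrac : Frac (Function.update P e₀ val) := by
    refine ⟨fun e he => ?_, fun z => ?_⟩
    · by_cases hee : e = e₀
      · subst hee
        rw [Function.update_self] at he
        refine hX'.1 _ ?_
        rw [Function.update_self]
        by_contra hj
        exact he (hval0 (by omega))
      · rw [Function.update_of_ne hee] at he
        exact h.frac.1 e he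
    · rw [wdeg_update _ huv]
      have hz := h.frac.2 z
      split_ifs with hzz
      · rcases lt_or_ge j (2 * I.d) with hj | hj
        · rw [hval0 hj]; omega
        · obtain ⟨-, h1, h2, -⟩ := hpw hj
          rcases hzz with rfl | rfl
          · exact h1
          · exact h2
      · exact hz
  have hhigh : ∀ e, 2 * I.d ≤ Function.update X e₀ j e →
      Function.update P e₀ val e ≤ largeWord I (Function.update X e₀ j e) := by
    intro e
    by_cases hee : e = e₀
    · subst hee
      simp only [Function.update_self]
      exact fun hj => (hpw hj).1
    · simp only [Function.update_of_ne hee]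
      exact h.high_le e
  refine ⟨fun e => ?_, hfrac, fun e => ?_, ?_, .inr ?_, fun e => ?_, hhigh, ?_, ?_⟩
  · by_cases hee : e = e₀
    · subst hee
      simp only [Function.update_self]
      intro h1 h2
      exact h1 (hval0 (by omega))
    · simp only [Function.update_of_ne hee]
      exact h.supp e
  · by_cases hee : e = e₀
    · subst hee
      simp only [Function.update_self]
      intro h1
      rcases lt_or_ge j (2 * I.d) with hj | hj
      · exact absurd (hval0 hj) h1
      · exact (hpw hj).2.2.2.1 h1
    · simp only [Function.update_of_ne hee]
      exact h.ge e
  · have h1 : wsupp P ⊆ insert e₀ (wsupp (Function.update P e₀ val)) := by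
      intro e he
      rw [Finset.mem_insert, mem_wsupp]
      by_cases hee : e = e₀
      · exact .inl hee
      · right
        rw [Function.update_of_ne hee]
        exact mem_wsupp.1 he
    have h2 := (Finset.card_le_card h1).trans (Finset.card_insert_le _ _)
    have := h.card
    omega
  · exact not_not.1 hk
  · by_cases hee : e = e₀
    · subst hee
      simp only [Function.update_self]
      intro hj
      rw [hval0 hj]; omega
    · simp only [Function.update_of_ne hee]
      exact h.low_le e
  -- An update can add 2δ to the small part of the input and remove 2δ from the low part of `P`; 5δ
  -- per update covers both.
  · rw [lowPart_update, toReal_update, norm_update, small_update, toReal_update, norm_update]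
    have h1 := h.low_norm
    have h2 : (lowPart X P).toReal e₀ ≤ 2 * I.delta := by
      have : lowPart X P e₀ ≤ 2 * I.d := by
        unfold lowPart
        split_ifs with h3
        · exact h.low_le _ h3
        · omega
      have h4 : (lowPart X P e₀ : ℝ) ≤ 2 * I.d := by exact_mod_cast this
      unfold WordVec.toReal Params.delta
      rw [← mul_div_assoc]
      gcongr
    have h3 : ((if j < 2 * I.d then j else 0 : ℕ) : ℝ) / 2 ^ I.F ≤ 2 * I.delta := by
      have : (if j < 2 * I.d then j else 0) ≤ 2 * I.d := by split_ifs <;> omega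
      have h4 : ((if j < 2 * I.d then j else 0 : ℕ) : ℝ) ≤ 2 * I.d := by exact_mod_cast this
      unfold Params.delta
      rw [← mul_div_assoc]
      gcongr
    have h4 := toReal_nonneg (small X) e₀
    generalize (small X).toReal e₀ = a at *
    generalize ((if j < 2 * I.d then j else 0 : ℕ) : ℝ) / 2 ^ I.F = c at *
    generalize (lowPart X P).toReal e₀ = p at *
    have h5 : 0 ≤ 1 - 20 * (I.eps + I.delta) := by linarith
    have h6 : (1 - 20 * (I.eps + I.delta)) * (norm (small X).toReal - a + c) ≤
        (1 - 20 * (I.eps + I.delta)) * (norm (small X).toReal + 2 * I.delta) := by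
      gcongr; linarith
    push_cast
    have h7 : (1 - 20 * (I.eps + I.delta)) * (2 * I.delta) ≤ 1 * (2 * I.delta) := by
      gcongr; linarith
    simp only [zero_div]
    linarith
  · obtain ⟨s, κ, b, b1, b2, b3, b4, b5⟩ := h.blame
    -- Both ends of the updated edge count the update, so the total grows by 2.
    let κ' : Fin I.n → ℕ := fun t => κ t + ((if t = u then 1 else 0) + if t = v then 1 else 0)
    have hκ : ∀ t, κ t ≤ κ' t := fun t => Nat.le_add_right _ _
    have hκr : ∀ t, (κ t : ℝ) ≤ κ' t := fun t => by exact_mod_cast hκ t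
    have hκ1 : ∀ t, t = u ∨ t = v → (1 : ℝ) ≤ κ' t := by
      intro t ht
      have : 1 ≤ κ' t := by
        simp only [κ']
        rcases ht with rfl | rfl
        · rw [if_pos rfl]; omega
        · rw [if_pos (rfl : t = t)]; omega
      exact_mod_cast this
    have c1 : ∑ t, κ' t ≤ 2 * (k + 1) := by
      simp only [κ', Finset.sum_add_distrib, Finset.sum_ite_eq', Finset.mem_univ, if_true]
      omega
    have c2 : ∀ t, degree (lowPart (Function.update X e₀ j) (Function.update P e₀ val)).toReal t ≤
        s t + 3 * I.eps * (1 - s t) + I.delta := by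
      intro t
      refine le_trans (degree_mono (fun e => ?_) t) (b2 t)
      rw [lowPart_update, toReal_update]
      by_cases hee : e = e₀
      · rw [hee, Function.update_self]; simp [toReal_nonneg]
      · rw [Function.update_of_ne hee]
    have c3 : ∀ t, s t ≤ degree (small (Function.update X e₀ j)).toReal t + 2 * I.delta * κ' t := by
      intro t
      refine (b3 t).trans ?_
      have h0 : wdeg (small (Function.update X e₀ j)) t = if t = u ∨ t = v then
          wdeg (small X) t - small X e₀ + (if j < 2 * I.d then j else 0) else wdeg (small X) t := by
        rw [small_update, wdeg_update _ huv]
      rw [degree_toReal, degree_toReal]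
      by_cases ht : t = u ∨ t = v
      · rw [if_pos ht] at h0
        have h1 : small X e₀ ≤ 2 * I.d := by
          unfold small
          split_ifs <;> omega
        have h2 : (wdeg (small X) t : ℝ) ≤ wdeg (small (Function.update X e₀ j)) t + 2 * I.d := by
          have : wdeg (small X) t ≤ wdeg (small (Function.update X e₀ j)) t + 2 * I.d := by omega
          exact_mod_cast this
        have h3 : (κ t : ℝ) + 1 ≤ κ' t := by
          have : κ t + 1 ≤ κ' t := by
            simp only [κ']
            rcases ht with rfl | rfl
            · rw [if_pos rfl]; omega
            · rw [if_pos (rfl : t = t)]; omega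
          exact_mod_cast this
        have h4 : (wdeg (small X) t : ℝ) / 2 ^ I.F ≤
            wdeg (small (Function.update X e₀ j)) t / 2 ^ I.F + 2 * I.delta := by
          unfold Params.delta
          rw [← mul_div_assoc, ← add_div]
          gcongr
        have h5 : 2 * I.delta * (κ t + 1) ≤ 2 * I.delta * κ' t := by gcongr
        linarith
      · rw [if_neg ht] at h0
        rw [h0]
        have := hκr t
        gcongr
    have hshort := shortfall_update X P e₀ j val
    set S' := shortfall (Function.update X e₀ j) (Function.update P e₀ val) with hS'
    have hS'of : ∀ e, e ≠ e₀ → S' e = shortfall X P e := fun e he => by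
      rw [hshort, Function.update_of_ne he]
    -- Without a shortfall at the updated edge, shortfalls only decrease and the old blame function
    -- remains valid.
    by_cases hnew : S' e₀ = 0
    · have hle' : ∀ e, S' e ≤ shortfall X P e := by
        intro e
        by_cases hee : e = e₀
        · rw [hee, hnew]; exact Nat.zero_le _
        · rw [hS'of e hee]
      refine ⟨s, κ', b, c1, c2, c3, fun e he => b4 e ?_, fun t => ?_⟩
      · have := hle' e; omega
      · refine (Finset.sum_le_sum fun e _ => toReal_mono hle' e).trans ((b5 t).trans ?_)
        have := hκr t
        gcongr
    · have hj : 2 * I.d ≤ j := by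
        by_contra hc
        rw [hshort, Function.update_self, if_pos (by omega)] at hnew
        exact hnew rfl
      rw [hshort, Function.update_self, if_neg (by omega)] at hnew
      -- `z` is the end at which the new value was cut; the updated edge blames it.
      obtain ⟨z, hz, hfull⟩ : ∃ z, (z = u ∨ z = v) ∧
          2 ^ I.F ≤ wdeg (Function.update P e₀ val) z + I.d := by
        rcases (hpw hj).2.2.2.2 (by omega) with h1 | h1
        · exact ⟨u, .inl rfl, by rw [wdeg_update _ huv, if_pos (.inl rfl)]; exact h1⟩
        · exact ⟨v, .inr rfl, by rw [wdeg_update _ huv, if_pos (.inr rfl)]; exact h1⟩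
      have hb : ∀ e, S' e ≠ 0 → Function.update b e₀ z e ∈ e := by
        intro e he
        by_cases hee : e = e₀
        · rw [hee, Function.update_self, he₀, Sym2.mem_iff]; exact hz
        · rw [Function.update_of_ne hee]
          exact b4 e (by rwa [← hS'of e hee])
      refine ⟨s, κ', Function.update b e₀ z, c1, c2, c3, hb, fun t => ?_⟩
      -- At `z` the old bound is not reused: all shortfall blamed on `z` sits on edges at `z`, so
      -- the degree estimate bounds it afresh. Other vertices gain no blame.
      by_cases htz : t = z
      · subst htz
        have h1 : ∑ e with Function.update b e₀ t e = t, S'.toReal e ≤ degree S'.toReal t := by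
          rw [degree_eq_sum, Finset.sum_filter, Finset.sum_filter]
          refine Finset.sum_le_sum fun e _ => ?_
          by_cases h0 : S' e = 0
          · have : S'.toReal e = 0 := toReal_eq_zero.2 h0
            simp [this]
          · have h2 := hb e h0
            split_ifs with h3 h4 h4
            · exact le_rfl
            · rw [h3] at h2; exact absurd h2 h4
            · exact toReal_nonneg _ _
            · exact le_rfl
        have h2 : degree (highPart (Function.update X e₀ j) (largeGoal (Function.update X e₀ j))).toReal t
            = degree (highPart (Function.update X e₀ j) (Function.update P e₀ val)).toReal t +
              degree S'.toReal t := by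
          rw [high_goal hhigh, toReal_add, degree_add']
        have h3 := high_goal_degree hf hX' t
        have h4 : degree (WordVec.toReal (Function.update P e₀ val)) t =
            degree (lowPart (Function.update X e₀ j) (Function.update P e₀ val)).toReal t +
              degree (highPart (Function.update X e₀ j) (Function.update P e₀ val)).toReal t := by
          rw [← degree_add', ← toReal_add, low_add_high]
        have h5 : 1 ≤ degree (WordVec.toReal (Function.update P e₀ val)) t + I.delta := by
          rw [degree_toReal, Params.delta, ← add_div, one_le_div hq]
          exact_mod_cast hfull
        have h6 := c2 t
        have h7 := c3 t
        have h8 := hκ1 t hz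
        have h9 : (1 - 3 * I.eps) * (1 - degree (small (Function.update X e₀ j)).toReal t) ≤
            (1 - 3 * I.eps) * (1 - s t + 2 * I.delta * κ' t) := by
          have : 0 ≤ 1 - 3 * I.eps := by linarith
          gcongr
          linarith
        have h10 : (1 - 3 * I.eps) * (2 * I.delta * κ' t) ≤ 1 * (2 * I.delta * κ' t) := by
          gcongr
          linarith
        have h11 : I.delta * 1 ≤ I.delta * κ' t := by gcongr
        linarith
      · have h1 : ∑ e with Function.update b e₀ z e = t, S'.toReal e ≤
            ∑ e with b e = t, (shortfall X P).toReal e := by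
          rw [Finset.sum_filter, Finset.sum_filter]
          refine Finset.sum_le_sum fun e _ => ?_
          by_cases hee : e = e₀
          · rw [hee, Function.update_self, if_neg (Ne.symm htz)]
            split_ifs
            · exact toReal_nonneg _ _
            · exact le_rfl
          · rw [Function.update_of_ne hee]
            unfold WordVec.toReal
            rw [hS'of e hee]
        refine h1.trans ((b5 t).trans ?_)
        have := hκr t
        gcongr

/-- The vector of the rounding algorithm is almost as large as the input vector. -/
theorem PhaseInv.norm_le (hf : I.Fine) {X P : WordVec I} {m0 k : ℕ} (h : PhaseInv X P m0 k) :
    norm X.toReal ≤ norm P.toReal + 100 * (I.eps + I.delta) * (norm X.toReal + 1) := by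
  have hδ := delta_pos I
  have hε := eps_pos I
  have hε1 := hf.eps_lt
  have hδ1 := hf.delta_lt
  obtain ⟨s, κ, b, b1, -, -, -, b5⟩ := h.blame
  have hs : norm (shortfall X P).toReal ≤ 8 * I.delta * k := by
    rw [norm, ← Finset.sum_fiberwise_of_maps_to (s := Finset.univ) (t := Finset.univ) (g := b)
      (fun _ _ => Finset.mem_univ _)]
    refine (Finset.sum_le_sum fun v _ => b5 v).trans ?_
    rw [← Finset.mul_sum]
    have : ((∑ v, κ v : ℕ) : ℝ) ≤ 2 * k := by exact_mod_cast b1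
    push_cast at this
    calc 4 * I.delta * ∑ v, (κ v : ℝ) ≤ 4 * I.delta * (2 * k) := by gcongr
      _ = 8 * I.delta * k := by ring
  have h1 : norm X.toReal = norm (small X).toReal + norm (highPart X X).toReal := by
    rw [← norm_add', ← toReal_add, ← lowPart_self, low_add_high]
  have h2 : norm P.toReal = norm (lowPart X P).toReal + norm (highPart X P).toReal := by
    rw [← norm_add', ← toReal_add, low_add_high]
  have h3 : norm (highPart X (largeGoal X)).toReal =
      norm (highPart X P).toReal + norm (shortfall X P).toReal := by
    rw [high_goal h.high_le, toReal_add, norm_add']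
  have h4 := high_goal_norm hf X
  have h5 := h.low_norm
  have h6 := card_mul_le_norm h.ge
  have hP0 : 0 ≤ norm P.toReal := norm_nonneg' (toReal_nonneg _)
  have hS0 : 0 ≤ norm (small X).toReal := norm_nonneg' (toReal_nonneg _)
  have hH0 : 0 ≤ norm (highPart X X).toReal := norm_nonneg' (toReal_nonneg _)
  -- From k < εm and m ≤ k + |supp P| with small ε, k is at most 2ε|supp P|, and each edge of `P`
  -- has value at least δ.
  have h7 : I.delta * k ≤ 2 * I.eps * norm P.toReal := by
    rcases h.count with ⟨rfl, -⟩ | hk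
    · simp only [Nat.cast_zero, mul_zero]; positivity
    · have hq : (0 : ℝ) < 2 ^ I.F := by positivity
      have h8 : (k : ℝ) < m0 * I.eps := by
        unfold Params.eps
        rw [← mul_div_assoc, lt_div_iff₀ hq]
        exact_mod_cast hk
      have h9 : (m0 : ℝ) ≤ k + (wsupp P).card := by exact_mod_cast h.card
      have h10 : (k : ℝ) ≤ 2 * I.eps * (wsupp P).card := by nlinarith
      calc I.delta * k ≤ I.delta * (2 * I.eps * (wsupp P).card) := by gcongr
        _ = 2 * I.eps * ((wsupp P).card * I.delta) := by ring
        _ ≤ 2 * I.eps * norm P.toReal := by gcongr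
  by_cases hle : norm X.toReal ≤ norm P.toReal
  · have : 0 ≤ norm X.toReal := norm_nonneg' (toReal_nonneg _)
    have : 0 ≤ 100 * (I.eps + I.delta) * (norm X.toReal + 1) := by positivity
    linarith
  · have h8 : 2 * I.eps * norm P.toReal ≤ 2 * I.eps * norm X.toReal := by
      have := le_of_not_ge hle
      gcongr
    have h9 : 0 ≤ (I.eps + I.delta) * norm (highPart X X).toReal := by positivity
    have h10 : 0 ≤ I.eps * norm (small X).toReal := by positivity
    have h11 : 0 ≤ I.delta * norm (small X).toReal := by positivity
    have h12 : 0 ≤ I.delta * norm (highPart X X).toReal := by positivity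
    nlinarith

/-- Each update removes at most one edge from the support, and a running phase has fewer updates
than initial edges. The initial support is empty only for a zero input, thanks to the fallback edge.
-/
theorem PhaseInv.ne_zero {X P : WordVec I} {m0 k : ℕ} (h : PhaseInv X P m0 k)
    (hX : X ≠ 0) : ∃ e, P e ≠ 0 := by
  have hlt : k < m0 := by
    rcases h.count with ⟨rfl, h0⟩ | hk
    · exact Nat.pos_of_ne_zero fun h1 => hX (h0 h1)
    · by_contra hc
      have := Nat.mul_le_mul (not_lt.1 hc) I.e_lt.le
      omega
  have := h.card
  obtain ⟨e, he⟩ := Finset.card_pos.1 (show 0 < (wsupp P).card by omega)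
  exact ⟨e, mem_wsupp.1 he⟩

/-- For ‖x‖ ≥ 1 the additive error is absorbed into the relative one. For ‖x‖ < 1 the matching is
nonempty because its size is at least (1 - ε)‖P‖ > 0, and one edge exceeds the norm of the input. -/
theorem PhaseInv.rounding (hf : I.Fine) {X P : WordVec I} {m0 k : ℕ} (h : PhaseInv X P m0 k)
    {M : Finset (Sym2 (Fin I.n))} (hM : IsApproxRounding I.eps P.toReal M) {K : ℝ} (hK : 2000 ≤ K) :
    IsApproxRounding (K * (I.eps + I.delta)) X.toReal M := by
  have hδ := delta_pos I
  have hε := eps_pos I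
  have hε1 := hf.eps_lt
  refine ⟨fun e he => ?_, hM.matching, ?_⟩
  · have h1 : P e ≠ 0 := fun h0 => (hM.support e he).ne' (toReal_eq_zero.2 h0)
    exact lt_of_le_of_ne (toReal_nonneg _ _) fun h0 => h.supp e h1 (toReal_eq_zero.1 h0.symm)
  have hN0 : 0 ≤ norm X.toReal := norm_nonneg' (toReal_nonneg _)
  have hη : 0 ≤ (K - 2000) * (I.eps + I.delta) * norm X.toReal := by
    have : 0 ≤ K - 2000 := by linarith
    positivity
  have h1 := h.norm_le hf
  have h2 := hM.size
  rcases le_or_gt 1 (norm X.toReal) with hN | hN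
  · have h3 : (1 - I.eps) * (norm X.toReal - 100 * (I.eps + I.delta) * (norm X.toReal + 1)) ≤
        (1 - I.eps) * norm P.toReal := by
      have : 0 ≤ 1 - I.eps := by linarith
      gcongr
      linarith
    have h4 : (I.eps + I.delta) * 1 ≤ (I.eps + I.delta) * norm X.toReal := by gcongr
    have h5 : 0 ≤ I.eps * ((I.eps + I.delta) * (norm X.toReal + 1)) := by positivity
    have h6 : 0 ≤ I.delta * norm X.toReal := by positivity
    nlinarith
  · by_cases hX : X = 0
    · have : norm X.toReal = 0 := by rw [hX]; simp [norm, WordVec.toReal]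
      rw [this, mul_zero]
      positivity
    · obtain ⟨e, he⟩ := h.ne_zero hX
      have h3 : 0 < norm P.toReal :=
        lt_of_lt_of_le (lt_of_le_of_ne (toReal_nonneg _ _) fun h0 => he (toReal_eq_zero.1 h0.symm))
          (Finset.single_le_sum (f := P.toReal) (fun e _ => toReal_nonneg _ e) (Finset.mem_univ e))
      have h4 : 0 < (M.card : ℝ) := lt_of_lt_of_le (mul_pos (by linarith) h3) h2
      have h5 : (1 : ℝ) ≤ M.card := by
        have : 0 < M.card := by exact_mod_cast h4
        exact_mod_cast this
      have h6 : 0 ≤ 2000 * (I.eps + I.delta) * norm X.toReal := by positivity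
      nlinarith

/-- A rounding of the zero vector is empty, and coarse parameters make K(ε + δ) at least 1, so the
required size is not positive. -/
theorem trivial_rounding (hf : ¬ I.Fine) {X : WordVec I} {M : Finset (Sym2 (Fin I.n))} {η : ℝ}
    (hM : IsApproxRounding η (0 : WordVec I).toReal M) {K : ℝ} (hK : 2000 ≤ K) :
    IsApproxRounding (K * (I.eps + I.delta)) X.toReal M := by
  have hM0 : M = ∅ := by
    rw [Finset.eq_empty_iff_forall_notMem]
    intro e he
    have := hM.support e he
    simp [WordVec.toReal] at this
  subst hM0
  refine ⟨by simp, by simp, ?_⟩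
  have hδ := delta_pos I
  have hε := eps_pos I
  have hq : (0 : ℝ) < 2 ^ I.F := by positivity
  have h1 : 1 ≤ 2000 * (I.eps + I.delta) := by
    have h2 : 1 ≤ 2000 * I.eps ∨ 1 ≤ 2000 * I.delta := by
      by_contra hc
      push Not at hc
      refine hf ⟨?_, ?_⟩
      · have := hc.1
        unfold Params.eps at this
        rw [← mul_div_assoc, div_lt_one hq] at this
        exact_mod_cast this
      · have := hc.2
        unfold Params.delta at this
        rw [← mul_div_assoc, div_lt_one hq] at this
        exact_mod_cast this
    rcases h2 with h2 | h2 <;> linarith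
  have h2 : 2000 * (I.eps + I.delta) ≤ K * (I.eps + I.delta) := by gcongr
  have hN0 : 0 ≤ norm X.toReal := norm_nonneg' (toReal_nonneg _)
  simp only [Finset.card_empty, Nat.cast_zero]
  nlinarith

end Phase

/-! ## One operation of the combined machine -/

section Step

open Prog DynMatching.Part

variable {I : Params}

/-- The operation that is passed on to the coarsening algorithm. -/
def Op.coarse : Op I → Op I
  | .start l => .start (l.filter fun a => a.2.2 < 2 * I.d)
  | .update u v k => .update u v (if k < 2 * I.d then k else 0)

/-- The promise that the input vector is a fractional matching. -/
def FracPromise (I : Params) (X : WordVec I) : Prop := IsFracMatching I.G X.toReal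

/-- The promise that the input vector is a fractional matching with values at least `δ`. -/
def HeavyPromise (I : Params) (X : WordVec I) : Prop :=
  IsFracMatching I.G X.toReal ∧ ∀ e, X.toReal e ≠ 0 → I.delta ≤ X.toReal e

theorem heavyPromise {P : WordVec I} (hP : Frac P) (h : ∀ e, P e ≠ 0 → I.d ≤ P e) :
    HeavyPromise I P := by
  refine ⟨isFracMatching_toReal.2 hP, fun e he => ?_⟩
  have h1 := (toReal_lt_delta (X := P) (e := e) 1).not.2
  simp only [Nat.cast_one, one_mul, not_lt] at h1
  exact h1 (h e fun h0 => he (toReal_eq_zero.2 h0))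

/-- Truncation commutes with single updates and, on initial lists, with filtering, and it preserves
fractional matchings. Hence the coarsening algorithm always receives legal operations. -/
theorem Legal.coarse {x : Option (WordVec I)} {op : Op I} {X : WordVec I}
    (h : Legal (FracPromise I) x op X) :
    Legal (FracPromise I) (x.map small) op.coarse (small X) := by
  cases h with
  | start l hl h =>
    have h' := small_vecOf hl
    rw [h']
    refine .start _ _ (hl.sublist List.filter_sublist) ?_
    rw [← h']
    exact isFracMatching_toReal.2 (isFracMatching_toReal.1 h).small
  | update Y hx u v k huv hG h =>
    subst hx
    rw [small_update]
    refine .update _ _ rfl u v _ huv hG ?_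
    rw [← small_update]
    exact isFracMatching_toReal.2 (isFracMatching_toReal.1 h).small

theorem State.readOutput_reg (o : State) (L : List (Entry I)) {x : ℕ} (hx : x < 50)
    (hx' : x ≠ 19) : (o.readOutput L).reg x = o.reg x := by
  rw [State.readOutput, State.scrub_reg _ hx]
  simp [State.writeEntries, State.writeList, State.setReg, hx']

theorem State.readOutput_len (o : State) (L : List (Entry I)) :
    (o.readOutput L).reg 19 = L.length := by
  rw [State.readOutput, State.scrub_reg _ (by norm_num)]
  simp [State.writeEntries, State.writeList, State.setReg]

theorem State.readOutput_mem (o : State) (L : List (Entry I)) {b : ℕ} (hb : 9 ≤ b) :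
    (o.readOutput L).mem b = o.mem b := by
  have h6 : b ≠ 6 := by omega
  have h7 : b ≠ 7 := by omega
  have h8 : b ≠ 8 := by omega
  simp [State.readOutput, State.scrub, State.temps, State.writeEntries, State.writeList,
    State.setReg, h6, h7, h8]

theorem State.readOutput_list (o : State) (L : List (Entry I)) :
    ListAt 6 7 8 L (o.readOutput L) := by
  intro i hi
  simp [State.readOutput, State.scrub, State.temps, State.writeEntries, State.writeList,
    State.setReg, hi]

theorem Data.readOutput {X P : WordVec I} {o : State} (h : Data X P o) (L : List (Entry I)) :
    Data X P (o.readOutput L) :=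
  h.of_eq (o.readOutput_reg L (by norm_num) (by norm_num))
    (o.readOutput_reg L (by norm_num) (by norm_num)) fun _ h1 _ => o.readOutput_mem L (by omega)

theorem Consts.readOutput {o : State} (h : Consts I o) (L : List (Entry I)) :
    Consts I (o.readOutput L) :=
  h.of_eq fun _ h1 _ _ _ _ => o.readOutput_reg L (by omega) (by omega)

theorem Data.scrub {X P : WordVec I} {o : State} (h : Data X P o) : Data X P o.scrub :=
  h.of_eq (o.scrub_reg (by norm_num)) (o.scrub_reg (by norm_num)) fun _ _ _ => rfl

theorem Consts.scrub {o : State} (h : Consts I o) : Consts I o.scrub :=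
  h.of_eq fun _ h1 _ _ _ _ => o.scrub_reg (by omega)

/-- The own data between operations, where `x` is the current vector and `p` that of the rounding
algorithm. -/
inductive OwnInv : Option (WordVec I) → Option (WordVec I) → State → Prop
  | blank : OwnInv none none State.blank
  | fine {X P o} (hf : I.Fine) (hX : Frac X) (hc : Consts I o) (hD : Data X P o)
      (hP : PhaseInv X P (o.reg 12) (o.reg 13)) (h11 : o.reg 11 ≤ o.reg 12 + o.reg 13)
      (h12 : o.reg 12 ≤ I.n * I.n) : OwnInv (some X) (some P) o
  | rough {X o} (hf : ¬ I.Fine) (hX : Frac X) (hc : Consts I o) (hD : Data (0 : WordVec I) 0 o)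
      (h10 : o.reg 10 = 0) (h11 : o.reg 11 = 0) (h12 : o.reg 12 = 0) (h13 : o.reg 13 = 0) :
      OwnInv (some X) (some 0) o

/-- The bookkeeping of `U` updates, of total size `S` of the initializations, of total size `SR` of
those of the rounding algorithm, and of `W` own steps. -/
structure Ledger (x : Option (WordVec I)) (o : State) (U S SR W : ℕ) : Prop where
  work : W + 60 * (o.reg 10 + o.reg 11) ≤ 1000 * (U + S + SR)
  starts : ∃ E b, b ≤ max 1 (o.reg 12) ∧ E + b ≤ U + S ∧
    (∀ X, x = some X → E + (wsupp X).card ≤ U + S ∧ E + 1 ≤ U + S) ∧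
    I.e * SR + 2 ^ I.F * o.reg 13 ≤ 2 ^ I.F * U + I.e * (E + b)

theorem ledger_blank : Ledger (I := I) none State.blank 0 0 0 0 :=
  ⟨by simp [State.blank], 0, 0, by simp, by simp, by simp, by simp [State.blank]⟩

/-- In `starts`, one may think of E as the updates and start sizes before the last initialization
and of b as the initial size of the running phase. Completed phases are paid by their updates at
rate 1/ε, and E + b covers the rest. -/
theorem Ledger.startSize_le {x : Option (WordVec I)} {o : State} {U S SR W : ℕ}
    (h : Ledger x o U S SR W) : I.e * SR ≤ 2 ^ I.F * U + I.e * (U + S) := by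
  obtain ⟨E, b, -, h1, -, h2⟩ := h.starts
  have := Nat.mul_le_mul_left I.e h1
  omega

/-- A run of one operation of the combined machine consists of a run of one operation of each
algorithm and of `k` own steps. -/
def StepExec (C R : Alg) (op rop : Op I) (o o' : State) (lC : List (Entry I)) (k : ℕ) : Prop :=
  ∀ (ω : Tape I.w) (c c' r r' : State) (kc kr : ℕ),
    Exec I.w (subTape coarse ω) (C.code op.coarse) (op.coarse.pass c) c' kc →
    outEntries c' = lC.map (fun a => ((a.1 : ℕ), (a.2.1 : ℕ), a.2.2)) →
    Exec I.w (subTape Part.round ω) (R.code rop) (rop.pass r) r' kr →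
    Exec I.w ω ((combine C R).code op) (op.pass (join (parts o c r))) (join (parts o' c' r'))
      (k + kc + kr)

/-- The effect of an operation on the own data, given the output `lC` of the coarsening
algorithm: the operation `rop` is passed on to the rounding algorithm. -/
structure OwnStep (C R : Alg) (x p : Option (WordVec I)) (o : State) (op : Op I) (X : WordVec I)
    (lC : List (Entry I)) (rop : Op I) (P : WordVec I) (o' : State) (k : ℕ) : Prop where
  exec : StepExec C R op rop o o' lC k
  legal : Legal (HeavyPromise I) p rop P
  inv : OwnInv (some X) (some P) o'
  updates : rop.updates ≤ op.updates
  ledger : ∀ U S SR W, Ledger x o U S SR W → Ledger (some X) o' (U + op.updates)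
    (S + op.startSize) (SR + rop.startSize) (W + k)

theorem PhaseInv.count_le {X P : WordVec I} {m0 k : ℕ} (h : PhaseInv X P m0 k) : k ≤ m0 := by
  rcases h.count with ⟨rfl, -⟩ | hk
  · exact Nat.zero_le _
  · by_contra hc
    have := Nat.mul_le_mul (not_le.1 hc).le I.e_lt.le
    omega

/-- An initialization may come first, or follow operations with fine or with coarse parameters. All
it needs to know is which old data to erase. -/
theorem OwnInv.exists_data {x p : Option (WordVec I)} {o : State} (h : OwnInv x p o) :
    ∃ X P, Data X P o ∧ Frac X ∧ (∀ e, P e ≠ 0 → e ∈ I.G.edgeSet) ∧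
      o.reg 11 ≤ 4 * (I.n + 2) ^ 2 ∧
      (¬ I.Fine → P = 0 ∧ o.reg 11 = 0 ∧ o.reg 12 = 0 ∧ o.reg 13 = 0) := by
  cases h with
  | blank =>
    exact ⟨0, 0, data_blank, frac_zero, fun e h => absurd rfl h, Nat.zero_le _,
      fun _ => ⟨rfl, rfl, rfl, rfl⟩⟩
  | @fine X P o hf hX hc hD hP h11 h12 =>
    refine ⟨X, P, hD, hX, hP.frac.1, ?_, fun h => absurd hf h⟩
    have := hP.count_le
    nlinarith
  | rough hf hX hc hD h10 h11 h12 h13 =>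
    exact ⟨0, 0, hD, frac_zero, fun e h => absurd rfl h, by omega, fun _ => ⟨rfl, h11, h12, h13⟩⟩

end Step

/-! ### The cost and effect of an initialization -/

section StepProof

open Prog DynMatching.Part

variable {I : Params}

theorem wsupp_vecOf {l : List (Entry I)} (hl : IsEntryList I l) :
    (wsupp (vecOf l)).card = l.length := hl.length_eq.symm

theorem PhaseInv.length_le {X : WordVec I} {L : List (Entry I)} {m k : ℕ}
    (hE : IsEntryList I L) (h : PhaseInv X (vecOf L) m k) : L.length ≤ (wsupp X).card := by
  rw [← wsupp_vecOf hE]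
  exact Finset.card_le_card fun e he => mem_wsupp.2 (h.supp e (mem_wsupp.1 he))

theorem Coarse.length_le {X : WordVec I} {lC : List (Entry I)} (h : Coarse X lC) :
    lC.length ≤ (wsupp X).card := by
  rw [← wsupp_vecOf h.entries]
  refine Finset.card_le_card fun e he => ?_
  rw [mem_wsupp] at he ⊢
  obtain ⟨a, ha, rfl⟩ := exists_of_vecOf_ne_zero he
  intro h0
  exact (h.bounds ha).1 (by simp [small, h0])

theorem card_wsupp_update_le (X : WordVec I) (e : Sym2 (Fin I.n)) (k : ℕ) :
    (wsupp (Function.update X e k)).card ≤ (wsupp X).card + 1 := by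
  refine (Finset.card_le_card (t := insert e (wsupp X)) fun a ha => ?_).trans
    (Finset.card_insert_le _ _)
  rw [mem_wsupp] at ha
  rw [Finset.mem_insert, mem_wsupp]
  by_cases h : a = e
  · exact .inl h
  · rw [Function.update_of_ne h] at ha; exact .inr ha

theorem State.setReg_reg (o : State) {x y : ℕ} (k : ℕ) (h : y ≠ x) :
    (o.setReg x k).reg y = o.reg y := by simp [State.setReg, h]

theorem Op.pass_parts (op : Op I) (o c r : State) :
    op.pass (join (parts o c r)) = join (parts (op.pass o) c r) := by
  rw [Op.pass_join, parts_own]; rfl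

/-- For coarse parameters the rounding algorithm is kept at the zero vector: an empty list is passed
on. -/
theorem rebuild_rough {o : State} (hf : ¬ I.Fine) (hc : Consts I o) (ω : Tape I.w) :
    Exec I.w ω rebuild o (o.setReg 11 0) 2 := by
  have h14 : o.reg 14 = 0 := by rw [hc.r14, if_neg hf]
  have := Exec.const (w := I.w) (ω := ω) o 11 0
  rw [Nat.zero_mod] at this
  exact .branch_false h14 this

/-- The new phase at the end of an operation. -/
theorem newPhase_step (hf : I.Fine) {X P : WordVec I} {o : State} (hc : Consts I o)
    (hD : Data X P o) (hX : Frac X) (hP : ∀ e, P e ≠ 0 → e ∈ I.G.edgeSet)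
    (b : o.reg 11 ≤ 8 * (I.n + 2) ^ 2) {lC : List (Entry I)} (hC : Coarse X lC) (R : Alg) :
    ∃ o' k L, IsEntryList I L ∧ OwnInv (some X) (some (vecOf L)) o' ∧
      k + 60 * (o'.reg 10 + o'.reg 11) ≤ 60 * (o.reg 10 + o.reg 11) + 250 * L.length + 150 ∧
      o'.reg 12 = L.length ∧ o'.reg 13 = 0 ∧ L.length ≤ (wsupp X).card ∧
      (∀ p, Legal (HeavyPromise I) p (.start L) (vecOf L)) ∧
      ∀ (ω : Tape I.w) (c r r' : State) (kr : ℕ),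
        outEntries c = lC.map (fun a => ((a.1 : ℕ), (a.2.1 : ℕ), a.2.2)) →
        Exec I.w (subTape Part.round ω) R.start ((Op.start L).pass r) r' kr →
        Exec I.w ω (newPhase R) (join (parts o c r)) (join (parts o' c r')) (k + kr) := by
  obtain ⟨o', k, L, hx, hk, h10, hR, hc', hD', hL, h11, h12, h13⟩ := rebuild_spec hf
    (hc.readOutput lC) (hD.readOutput lC) hX hP
    (by rwa [o.readOutput_reg lC (by norm_num) (by norm_num)]) (hC.smallEntries hf)
    (o.readOutput_list lC) (o.readOutput_len lC)
  rw [o.readOutput_reg lC (by norm_num) (by norm_num),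
    o.readOutput_reg lC (by norm_num) (by norm_num)] at hk
  rw [o.readOutput_reg lC (by norm_num) (by norm_num)] at h10
  obtain ⟨hI, hlen⟩ := hR.phaseInv hf hX hC
  have hLn := hR.entries.length_le
  have hs : ∀ x < 50, o'.scrub.reg x = o'.reg x := fun x hx => o'.scrub_reg hx
  refine ⟨o'.scrub, 15 * lC.length + k + 15 * L.length + 54, L, hR.entries,
    .fine hf hX hc'.scrub hD'.scrub ?_ ?_ ?_, ?_, ?_, ?_, hI.length_le hR.entries,
    fun _ => .start _ _ hR.entries (heavyPromise hI.frac hI.ge), ?_⟩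
  · rw [hs 12 (by norm_num), hs 13 (by norm_num), h12, h13]; exact hI
  · rw [hs 12 (by norm_num), hs 13 (by norm_num), hs 11 (by norm_num), h11, h12, h13]; omega
  · rw [hs 12 (by norm_num), h12]; exact hLn
  · rw [hs 10 (by norm_num), hs 11 (by norm_num), h11]; omega
  · rw [hs 12 (by norm_num), h12]
  · rw [hs 13 (by norm_num), h13]
  · intro ω c r r' kr hout hr
    exact newPhase_exec hout (I.lt_word (by have := hC.entries.length_le; nlinarith)) I.one_lt_word
      hx hc' h11 hL (I.lt_word (by nlinarith)) hr

/-- The own step of an initialization. -/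
theorem ownStep_start (C R : Alg) {x p : Option (WordVec I)} {o : State} (h : OwnInv x p o)
    {l : List (Entry I)} (hl : IsEntryList I l) (hF : Frac (vecOf l)) {lC : List (Entry I)}
    (hC : Coarse (vecOf l) lC) :
    ∃ rop P o' k, OwnStep C R x p o (.start l) (vecOf l) lC rop P o' k := by
  obtain ⟨X, P, hD, hX, hP, b11, hrough⟩ := h.exists_data
  obtain ⟨o₁, k₁, x₁, l₁, hc₁, hD₁, h16, hL₁, h10, h11, hr₁, h12, h13⟩ :=
    startCode_spec hD hX b11 hl hF
  have hln := hl.length_le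
  set lf := l.filter fun a => a.2.2 < 2 * I.d with hlf
  have hfl : lf.length ≤ l.length := List.length_filter_le _ _
  have hs : ∀ x < 50, o₁.scrub.reg x = o₁.reg x := fun x hx => o₁.scrub_reg hx
  have hfirst : ∀ (ω : Tape I.w) (c c' r : State) (kc : ℕ),
      Exec I.w (subTape coarse ω) C.start ((Op.start lf).pass c) c' kc →
      ∀ (k' : ℕ) (σ : State), Exec I.w ω (newPhase R) (join (parts o₁.scrub c' r)) σ k' →
      Exec I.w ω (combine C R).start ((Op.start l).pass (join (parts o c r))) σ
        (k₁ + ((15 * lf.length + 29) + (kc + k'))) := by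
    intro ω c c' r kc hcx k' σ hσ
    have y1 := (x₁ (subTape own ω)).rename (parts ((Op.start l).pass o) c r) rfl
    rw [parts_own, ← Op.pass_parts] at y1
    have y2 := passStart_exec (w := I.w) (ω := ω) (parts o₁ c r) (j := coarse) (a := 3) (x := 16)
      (by decide) (by norm_num) hc₁ h16 (I.lt_word (by nlinarith)) I.one_lt_word hL₁
    rw [parts_coarse, clean_parts] at y2
    have y3 := hcx.rename (parts o₁.scrub ((Op.start lf).pass c) r) rfl
    rw [parts_coarse] at y3
    exact .seq y1 (.seq y2 (.seq y3 hσ))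
  by_cases hf : I.Fine
  · rw [if_pos hf] at hD₁
    obtain ⟨o', k, L, hE, hO, hk, e12, e13, hLX, hleg, hex⟩ := newPhase_step hf hc₁.scrub hD₁.scrub hF
      hP (by rw [hs 11 (by norm_num)]; nlinarith) hC R
    rw [hs 10 (by norm_num), hs 11 (by norm_num)] at hk
    rw [wsupp_vecOf hl] at hLX
    refine ⟨.start L, vecOf L, o', k₁ + (15 * lf.length + 29) + k, ?_, ?_, hO, le_rfl, ?_⟩
    · intro ω c c' r r' kc kr hcx hout hrx
      have := hfirst ω c c' r kc hcx _ _ (hex ω c' r r' kr hout hrx)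
      rw [show k₁ + (15 * lf.length + 29) + k + kc + kr =
        k₁ + (15 * lf.length + 29 + (kc + (k + kr))) by ring]
      exact this
    · exact hleg p
    · rintro U S SR W ⟨hw, E, b, hb, hEb, -, hst⟩
      -- All earlier charges, including those for the interrupted phase, move into E; the new phase
      -- is covered by the start size of this initialization.
      refine ⟨?_, U + S, max 1 L.length, by rw [e12], ?_, ?_, ?_⟩
      · simp only [Op.updates, Op.startSize]; omega
      · simp only [Op.updates, Op.startSize]; omega
      · rintro _ ⟨⟩
        rw [wsupp_vecOf hl]
        simp only [Op.updates, Op.startSize]; omega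
      · simp only [Op.updates, Op.startSize, e13]
        have := Nat.mul_le_mul_left I.e hEb
        rw [add_zero, Nat.mul_add, Nat.mul_add I.e (U + S)]
        omega
  · rw [if_neg hf] at hD₁
    obtain ⟨rfl, e11, e12, e13⟩ := hrough hf
    obtain ⟨f10, f11⟩ := hr₁ hf
    have hreb := fun ω => rebuild_rough hf (hc₁.scrub.readOutput lC) ω
    set o₂ := (o₁.scrub.readOutput lC).setReg 11 0 with ho₂
    have g : ∀ y, y < 30 → y ≠ 11 → y ≠ 19 → o₂.reg y = o₁.reg y := fun y h1 h2 h3 => by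
      rw [ho₂, State.setReg_reg _ _ h2, State.readOutput_reg _ _ (by omega) h3,
        hs y (by omega)]
    have g11 : o₂.reg 11 = 0 := by simp [ho₂, State.setReg]
    have hc₂ : Consts I o₂ := hc₁.of_eq fun y h1 _ h2 _ _ => g y (by omega) h2 (by omega)
    have hs' : ∀ x < 50, o₂.scrub.reg x = o₂.reg x := fun x hx => o₂.scrub_reg hx
    have hD₂ : Data (0 : WordVec I) 0 o₂ := (hD₁.scrub.readOutput lC).of_eq
      (by simp [ho₂, State.setReg])
      (by rw [g11, State.readOutput_reg _ _ (by norm_num) (by norm_num), hs 11 (by norm_num), f11, e11])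
      fun _ _ _ => rfl
    have hO : OwnInv (some (vecOf l)) (some 0) o₂.scrub := by
      refine .rough hf hF hc₂.scrub hD₂.scrub ?_ ?_ ?_ ?_
      · rw [hs' 10 (by norm_num), g 10 (by norm_num) (by norm_num) (by norm_num), f10]
      · rw [hs' 11 (by norm_num), g11]
      · rw [hs' 12 (by norm_num), g 12 (by norm_num) (by norm_num) (by norm_num), h12, e12]
      · rw [hs' 13 (by norm_num), g 13 (by norm_num) (by norm_num) (by norm_num), h13, e13]
    refine ⟨.start [], 0, o₂.scrub, k₁ + (15 * lf.length + 29) + (15 * lC.length + 2 + 54), ?_, ?_,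
      hO, le_rfl, ?_⟩
    · intro ω c c' r r' kc kr hcx hout hrx
      have := newPhase_exec (M := ([] : List (Entry I))) hout
        (I.lt_word (by have := hC.entries.length_le; nlinarith)) I.one_lt_word hreb hc₂ g11
        (fun i hi => by simp at hi) (by simp) hrx
      have := hfirst ω c c' r kc hcx _ _ this
      rw [show k₁ + (15 * lf.length + 29) + (15 * lC.length + 2 + 54) + kc + kr =
        k₁ + (15 * lf.length + 29 +
          (kc + (15 * lC.length + 2 + 15 * ([] : List (Entry I)).length + 54 + kr))) by
        simp only [List.length_nil]; ring]
      exact this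
    · exact .start _ [] ⟨by simp, by simp⟩ (heavyPromise frac_zero fun e h => absurd rfl h)
    -- The output of the coarsening algorithm is read here too, though not used; its length is at
    -- most the support size of the input.
    · have hCl := hC.length_le
      rw [wsupp_vecOf hl] at hCl
      rintro U S SR W ⟨hw, E, b, hb, hEb, -, hst⟩
      have k10 : o₂.scrub.reg 10 = 0 := by cases hO with
        | fine h => exact absurd h hf
        | rough => assumption
      have k11 : o₂.scrub.reg 11 = 0 := by rw [hs' 11 (by norm_num), g11]
      have k13 : o₂.scrub.reg 13 = 0 := by
        rw [hs' 13 (by norm_num), g 13 (by norm_num) (by norm_num) (by norm_num), h13, e13]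
      -- The empty initialization still counts as size 1.
      refine ⟨?_, U + S, 1, by simp, ?_, ?_, ?_⟩
      · simp only [Op.updates, Op.startSize, k10, k11, List.length_nil]; omega
      · simp only [Op.updates, Op.startSize]; omega
      · rintro _ ⟨⟩
        rw [wsupp_vecOf hl]
        simp only [Op.updates, Op.startSize]; omega
      · simp only [Op.updates, Op.startSize, k13, List.length_nil, max_eq_left zero_le_one]
        have := Nat.mul_le_mul_left I.e hEb
        rw [add_zero, Nat.mul_add, Nat.mul_add I.e (U + S)]
        omega

end StepProof

/-! ### The cost and effect of an update -/

section UpdateProof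

open Prog DynMatching.Part

variable {I : Params}

/-- A phase that ends has seen enough updates to pay for its start at rate 1/ε. The convention that
an empty start counts 1 is harmless because ε ≤ 1. -/
theorem PhaseEnds.mul_le {k m b : ℕ} (h : PhaseEnds I k m) (hb : b ≤ max 1 m) :
    I.e * b ≤ 2 ^ I.F * (k + 1) := by
  have h1 := I.e_lt.le
  rcases le_max_iff.1 hb with hb | hb
  · calc I.e * b ≤ 2 ^ I.F * 1 := Nat.mul_le_mul h1 hb
      _ ≤ _ := Nat.mul_le_mul_left _ (by omega)
  · calc I.e * b ≤ I.e * m := Nat.mul_le_mul_left _ hb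
      _ = m * I.e := mul_comm _ _
      _ ≤ (k + 1) * 2 ^ I.F := not_lt.1 h
      _ = _ := mul_comm _ _

/-- The own step of an update. -/
theorem ownStep_update (C R : Alg) {X : WordVec I} {p : Option (WordVec I)} {o : State}
    (h : OwnInv (some X) p o) {u v : Fin I.n} {j : ℕ} (huv : u < v) (hG : I.G.Adj u v)
    (hF : Frac (Function.update X s(u, v) j)) {lC : List (Entry I)}
    (hC : Coarse (Function.update X s(u, v) j) lC) :
    ∃ rop P o' k, OwnStep C R (some X) p o (.update u v j) (Function.update X s(u, v) j) lC rop P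
      o' k := by
  have hj : j ≤ 2 ^ I.F := by
    have := hF.le s(u, v)
    rwa [Function.update_self] at this
  have hcard := card_wsupp_update_le X s(u, v) j
  have hfirst : ∀ {o₁ : State} {k₁ : ℕ},
      (∀ ω : Tape I.w, Exec I.w ω updateCode ((Op.update u v j).pass o) o₁ k₁) →
      o₁.reg 5 = u → o₁.reg 6 = v → o₁.reg 17 = (if j < 2 * I.d then j else 0) →
      ∀ (ω : Tape I.w) (c c' r : State) (kc : ℕ),
      Exec I.w (subTape coarse ω) C.update
        ((Op.update u v (if j < 2 * I.d then j else 0)).pass c) c' kc →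
      ∀ (k' : ℕ) (σ : State), Exec I.w ω (.branch (own.reg 15) (newPhase R)
        (block [passEdge Part.round 18, R.update.rename Part.round])) (join (parts o₁ c' r)) σ k' →
      Exec I.w ω (combine C R).update ((Op.update u v j).pass (join (parts o c r))) σ
        (k₁ + (3 + (kc + k'))) := by
    intro o₁ k₁ x₁ h5 h6 h17 ω c c' r kc hcx k' σ hσ
    have y1 := (x₁ (subTape own ω)).rename (parts ((Op.update u v j).pass o) c r) rfl
    rw [parts_own, ← Op.pass_parts] at y1
    have y2 := passEdge_exec (w := I.w) (ω := ω) (parts o₁ c r) (j := coarse) (x := 17)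
      (by decide) h5 h6 h17
    rw [parts_coarse] at y2
    have y3 := hcx.rename
      (parts o₁ ((Op.update u v (if j < 2 * I.d then j else 0)).pass c) r) rfl
    rw [parts_coarse] at y3
    exact .seq y1 (.seq y2 (.seq y3 hσ))
  have hpatch : ∀ {o₁ : State} {k₁ k'' : ℕ},
      (∀ ω : Tape I.w, Exec I.w ω updateCode ((Op.update u v j).pass o) o₁ k₁) →
      o₁.reg 5 = u → o₁.reg 6 = v → o₁.reg 17 = (if j < 2 * I.d then j else 0) →
      o₁.reg 15 = 0 → o₁.reg 18 = k'' →
      StepExec C R (.update u v j) (.update u v k'') o o₁ lC (k₁ + 7) := by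
    intro o₁ k₁ k'' x₁ h5 h6 h17 h15 h18 ω c c' r r' kc kr hcx hout hrx
    have y4 := passEdge_exec (w := I.w) (ω := ω) (parts o₁ c' r) (j := Part.round) (x := 18)
      (by decide) h5 h6 h18
    rw [parts_round] at y4
    have y5 := hrx.rename (parts o₁ c' ((Op.update u v k'').pass r)) rfl
    rw [parts_round] at y5
    have := hfirst x₁ h5 h6 h17 ω c c' r kc hcx _ _
      (.branch_false (by rw [join_reg]; exact h15) (.seq y4 y5))
    rw [show k₁ + 7 + kc + kr = k₁ + (3 + (kc + (3 + kr + 1))) by ring]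
    exact this
  cases h with
  | @fine X P o hf hX hc hD hP h11 h12 =>
    have hk := hP.count_le
    obtain ⟨o₁, k₁, x₁, l₁, hc₁, h5, h6, h17, e12, -, hfine⟩ := updateCode_spec hc hD hX hP.frac huv hj
      (by nlinarith) (by nlinarith) (by nlinarith)
    obtain ⟨e10, e11, e13, hends, hcont⟩ := hfine hf
    by_cases hpe : PhaseEnds I (o.reg 13) (o.reg 12)
    · obtain ⟨h15, hD₁⟩ := hends hpe
      obtain ⟨o', k, L, hE, hO, hk', f12, f13, hLX, hleg, hex⟩ := newPhase_step hf hc₁ hD₁ hF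
        hP.frac.1 (by nlinarith) hC R
      refine ⟨.start L, vecOf L, o', k₁ + 4 + k, ?_, hleg _, hO, Nat.zero_le _, ?_⟩
      · intro ω c c' r r' kc kr hcx hout hrx
        have := hfirst x₁ h5 h6 h17 ω c c' r kc hcx _ _
          (.branch_true (by rw [join_reg, parts, h15]; exact one_ne_zero) (hex ω c' r r' kr hout hrx))
        rw [show k₁ + 4 + k + kc + kr = k₁ + (3 + (kc + (k + kr + 1))) by ring]
        exact this
      · rintro U S SR W ⟨hw, E, b, hb, hEb, hE', hst⟩
        obtain ⟨g1, g2⟩ := hE' X rfl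
        -- The finished phase is paid by its updates through `PhaseEnds.mul_le`, which frees its b.
        -- The new b fits because the support of the input is bounded by what was inserted since the
        -- last initialization.
        refine ⟨?_, E, max 1 L.length, by rw [f12], ?_, ?_, ?_⟩
        · simp only [Op.updates, Op.startSize]; omega
        · simp only [Op.updates, Op.startSize]; omega
        · rintro _ ⟨⟩
          simp only [Op.updates, Op.startSize]; omega
        · simp only [Op.updates, Op.startSize, f13]
          have h1 := hpe.mul_le hb
          simp only [Nat.mul_add, mul_one, Nat.add_zero, mul_zero] at *
          omega
    · obtain ⟨h15, h18, hD₁⟩ := hcont hpe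
      have hP' := hP.update hf huv.ne hF hpe
      rw [← e13, ← e12] at hP'
      have hO := OwnInv.fine hf hF hc₁ hD₁ hP' (by omega) (by omega)
      refine ⟨.update u v (patchWord P u v j), _, o₁, k₁ + 7, hpatch x₁ h5 h6 h17 h15 h18,
        .update _ P rfl u v _ huv hG (heavyPromise hP'.frac hP'.ge), hO, le_rfl, ?_⟩
      rintro U S SR W ⟨hw, E, b, hb, hEb, hE', hst⟩
      obtain ⟨g1, g2⟩ := hE' X rfl
      refine ⟨?_, E, b, by rwa [e12], ?_, ?_, ?_⟩
      · simp only [Op.updates, Op.startSize]; omega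
      · simp only [Op.updates, Op.startSize]; omega
      · rintro _ ⟨⟩
        simp only [Op.updates, Op.startSize]; omega
      · simp only [Op.updates, Op.startSize, e13, Nat.mul_add, mul_one, Nat.add_zero] at *
        omega
  | rough hf hX hc hD h10 h11 h12 h13 =>
    obtain ⟨o₁, k₁, x₁, l₁, hc₁, h5, h6, h17, e12, hrough, -⟩ := updateCode_spec (P := 0) hc hD
      frac_zero frac_zero huv hj (by omega) (by omega) (by omega)
    obtain ⟨hD₁, h15, h18, e10, e11, e13⟩ := hrough hf
    have hO : OwnInv (some (Function.update X s(u, v) j)) (some 0) o₁ :=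
      .rough hf hF hc₁ hD₁ (by omega) (by omega) (by omega) (by omega)
    have h00 : Function.update (0 : WordVec I) s(u, v) 0 = 0 :=
      Function.update_eq_self s(u, v) (0 : WordVec I)
    have hleg := Legal.update (promise := HeavyPromise I) (some 0) 0 rfl u v 0 huv hG (by
      rw [h00]
      exact heavyPromise frac_zero fun e h => absurd rfl h)
    rw [h00] at hleg
    refine ⟨.update u v 0, 0, o₁, k₁ + 7, hpatch x₁ h5 h6 h17 h15 h18, hleg, hO, le_rfl, ?_⟩
    rintro U S SR W ⟨hw, E, b, hb, hEb, hE', hst⟩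
    obtain ⟨g1, g2⟩ := hE' X rfl
    refine ⟨?_, E, b, by rwa [e12], ?_, ?_, ?_⟩
    · simp only [Op.updates, Op.startSize]; omega
    · simp only [Op.updates, Op.startSize]; omega
    · rintro _ ⟨⟩
      simp only [Op.updates, Op.startSize]; omega
    · simp only [Op.updates, Op.startSize, e13, h13, Nat.mul_add, mul_one, Nat.add_zero] at *
      omega

theorem exists_ownStep (C R : Alg) {x p : Option (WordVec I)} {o : State} (h : OwnInv x p o)
    {op : Op I} {X : WordVec I} (hX : Legal (FracPromise I) x op X) {lC : List (Entry I)}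
    (hC : Coarse X lC) : ∃ rop P o' k, OwnStep C R x p o op X lC rop P o' k := by
  cases hX with
  | start l hl hF => exact ownStep_start C R h hl (isFracMatching_toReal.1 hF) hC
  | update Y hx u v j huv hG hF =>
    subst hx
    exact ownStep_update C R h huv hG (isFracMatching_toReal.1 hF) hC

end UpdateProof

/-! ## The random words of the components -/

section Tapes

open ProbabilityTheory

instance (w : ℕ) : IsProbabilityMeasure (tapeMeasure w) := by
  unfold tapeMeasure; infer_instance

/-- The sources of random words of the components, as those of the combined machine. -/
def wordName : Part × (ℕ × ℕ) ≃ ℕ × ℕ where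
  toFun a := (srcName.symm (a.1, a.2.1), a.2.2)
  invFun a := ((srcName a.1).1, (srcName a.1).2, a.2)
  left_inv a := by simp
  right_inv a := by simp

theorem measurable_subTape {w : ℕ} (i : Part) : Measurable (subTape (w := w) i) :=
  measurable_pi_lambda _ fun _ => measurable_pi_apply _

/-- Renaming the sources by `wordName` and currying turns the product over all words into a product
over the three components. -/
theorem map_subTape (w : ℕ) :
    (tapeMeasure w).map (fun ω i => subTape i ω) =
      Measure.infinitePi fun _ : Part => tapeMeasure w := by
  have h := Measure.infinitePi_map_piCongrLeft
    (fun _ : ℕ × ℕ => (PMF.uniformOfFintype (Fin (2 ^ w))).toMeasure) wordName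
  have h' := Measure.infinitePi_map_curry
    (fun (_ : Part) (_ : ℕ × ℕ) => (PMF.uniformOfFintype (Fin (2 ^ w))).toMeasure)
  unfold tapeMeasure
  rw [← h', ← h, Measure.map_map (measurable_pi_lambda _ fun i => measurable_subTape i) (by fun_prop)]
  congr 1
  funext f i a
  have : (i, a) = wordName.symm (srcName.symm (i, a.1), a.2) := by simp [wordName]
  simp [subTape, MeasurableEquiv.piCongrLeft, MeasurableEquiv.curry, Equiv.piCongrLeft,
    Equiv.piCongrLeft', ← this]

/-- The random words of the two algorithms are independent. -/
theorem measurePreserving_subTape (w : ℕ) :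
    MeasurePreserving (fun ω => (subTape .coarse ω, subTape .round ω)) (tapeMeasure w)
      ((tapeMeasure w).prod (tapeMeasure w)) := by
  refine ⟨(measurable_subTape _).prodMk (measurable_subTape _), ?_⟩
  have h1 : IndepFun (fun s : Part → Tape w => s .coarse) (fun s => s .round)
      (Measure.infinitePi fun _ : Part => tapeMeasure w) :=
    (iIndepFun_infinitePi (P := fun _ : Part => tapeMeasure w) (X := fun _ => id)
      fun _ => measurable_id).indepFun (by decide)
  rw [indepFun_iff_map_prod_eq_prod_map_map (measurable_pi_apply _).aemeasurable
      (measurable_pi_apply _).aemeasurable,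
    Measure.infinitePi_map_eval, Measure.infinitePi_map_eval, ← map_subTape,
    Measure.map_map (by fun_prop) (measurable_pi_lambda _ fun i => measurable_subTape i)] at h1
  exact h1

end Tapes

/-! ## The joint run of the three algorithms -/

section Coupling

variable {I : Params}

theorem Legal.unique {promise : WordVec I → Prop} {x : Option (WordVec I)} {op : Op I}
    {X Y : WordVec I} (hX : Legal promise x op X) (hY : Legal promise x op Y) : X = Y := by
  cases hX with
  | start => cases hY; rfl
  | update A hA =>
    cases hY with
    | update B hB => rw [Option.some.inj (hA.symm.trans hB)]

/-- The relation between a vector and a correct output of a rounding algorithm. -/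
def RoundOk (I : Params) (η : ℝ) (X : WordVec I) (o : List (ℕ × ℕ)) : Prop :=
  ∃ l : List (Fin I.n × Fin I.n), (∀ a ∈ l, a.1 < a.2) ∧ l.Nodup ∧
    o = l.map (fun a => ((a.1 : ℕ), (a.2 : ℕ))) ∧
    IsApproxRounding η X.toReal (l.map fun a => s(a.1, a.2)).toFinset

theorem entries_injective : Function.Injective
    (List.map fun a : Entry I => ((a.1 : ℕ), (a.2.1 : ℕ), a.2.2)) :=
  List.map_injective_iff.2 fun a b h => by
    simp only [Prod.mk.injEq] at h
    exact Prod.ext (Fin.ext h.1) (Prod.ext (Fin.ext h.2.1) h.2.2)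

/-- The snapshot before the first operation. -/
def Snapshot.blank : Snapshot I := ⟨none, State.blank, [], 0, 0, 0⟩

/-- The snapshot after an operation. -/
def Snapshot.next (r : Snapshot I) (op : Op I) (X : WordVec I) (σ : State) (c : ℕ) : Snapshot I :=
  ⟨some X, σ, σ :: r.hist, r.cost + c, r.updates + op.updates, r.startSize + op.startSize⟩

/-- A joint snapshot of the combined machine, the coarsening algorithm and the rounding algorithm,
with the own data of the combined machine and the number of its own steps. -/
structure Joint (I : Params) where
  own : State
  work : ℕ
  whole : Snapshot I
  coarse : Snapshot I
  round : Snapshot I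

/-- The chosen effect of an operation on the own data. -/
structure OwnChoice (I : Params) where
  op : Op I
  vec : WordVec I
  own : State
  work : ℕ

instance : Nonempty (OwnChoice I) := ⟨⟨.start [], 0, State.blank, 0⟩⟩

variable (C R : Alg) (adv : Adversary I)

/-- The effect of the operation `op` on the own data. -/
noncomputable def Joint.choice (J : Joint I) (op : Op I) (X : WordVec I) (lC : List (Entry I)) :
    OwnChoice I :=
  Classical.epsilon fun s =>
    OwnStep C R J.whole.vec J.round.vec J.own op X lC s.op s.vec s.own s.work

/-- The joint snapshot after an operation, with the new states and the numbers of steps of the two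
algorithms. -/
noncomputable def Joint.next (J : Joint I) (op : Op I) (X : WordVec I) (lC : List (Entry I))
    (c : State) (kc : ℕ) (r : State) (kr : ℕ) : Joint I where
  own := (J.choice C R op X lC).own
  work := J.work + (J.choice C R op X lC).work
  whole := J.whole.next op X (join (parts (J.choice C R op X lC).own c r))
    ((J.choice C R op X lC).work + kc + kr)
  coarse := J.coarse.next op.coarse (small X) c kc
  round := J.round.next (J.choice C R op X lC).op (J.choice C R op X lC).vec r kr

/-- The first half of the joint run of an operation: the coarsening algorithm halts with output
`lC`. -/
structure HalfStep (ωC : Tape I.w) (J : Joint I) (op : Op I) (X : WordVec I)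
    (lC : List (Entry I)) (c : State) (kc : ℕ) : Prop where
  chosen : adv J.whole.hist = some op
  legal : Legal (FracPromise I) J.whole.vec op X
  exec : Exec I.w ωC (C.code op.coarse) (op.coarse.pass J.coarse.state) c kc
  out : outEntries c = lC.map fun a => ((a.1 : ℕ), (a.2.1 : ℕ), a.2.2)
  coarse : Coarse X lC

/-- The second half: the rounding algorithm halts with a correct output. -/
structure RoundStep (ωR : Tape I.w) (J : Joint I) (op : Op I) (X : WordVec I)
    (lC : List (Entry I)) (r : State) (kr : ℕ) : Prop where
  exec : Exec I.w ωR (R.code (J.choice C R op X lC).op)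
    ((J.choice C R op X lC).op.pass J.round.state) r kr
  ok : RoundOk I I.eps (J.choice C R op X lC).vec (outEdges r)

/-- The joint snapshots for the random words `ωC` and `ωR` of the two algorithms. -/
inductive Coupled (ωC ωR : Tape I.w) : Joint I → Prop
  | start : Coupled ωC ωR ⟨State.blank, 0, .blank, .blank, .blank⟩
  | step {J op X lC c kc r kr} (hJ : Coupled ωC ωR J) (hC : HalfStep C adv ωC J op X lC c kc)
      (hR : RoundStep C R ωR J op X lC r kr) : Coupled ωC ωR (J.next C R op X lC c kc r kr)

variable {C R adv} {ωC ωR : Tape I.w}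

/-- The relation between the components of a joint snapshot. -/
structure Joint.Inv (J : Joint I) : Prop where
  own : OwnInv J.whole.vec J.round.vec J.own
  vec : J.coarse.vec = J.whole.vec.map small
  state : J.whole.state = join (parts J.own J.coarse.state J.round.state)
  ledger : Ledger J.whole.vec J.own J.whole.updates J.whole.startSize J.round.startSize J.work
  cost : J.whole.cost = J.work + J.coarse.cost + J.round.cost
  coarse_updates : J.coarse.updates = J.whole.updates
  coarse_start : J.coarse.startSize ≤ J.whole.startSize
  round_updates : J.round.updates ≤ J.whole.updates
  coarse_length : J.coarse.hist.length = J.whole.hist.length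
  round_length : J.round.hist.length = J.whole.hist.length
  out : ∀ P, J.round.vec = some P → RoundOk I I.eps P (outEdges J.round.state)

theorem Joint.Inv.ownStep {J : Joint I} (h : J.Inv) {op : Op I} {X : WordVec I}
    {lC : List (Entry I)} {c : State} {kc : ℕ} (hC : HalfStep C adv ωC J op X lC c kc) (R : Alg) :
    OwnStep C R J.whole.vec J.round.vec J.own op X lC (J.choice C R op X lC).op
      (J.choice C R op X lC).vec (J.choice C R op X lC).own (J.choice C R op X lC).work := by
  obtain ⟨rop, P, o', k, hs⟩ := exists_ownStep C R h.own hC.legal hC.coarse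
  exact Classical.epsilon_spec (p := fun s : OwnChoice I =>
    OwnStep C R J.whole.vec J.round.vec J.own op X lC s.op s.vec s.own s.work) ⟨⟨rop, P, o', k⟩, hs⟩

theorem Op.coarse_updates (op : Op I) : op.coarse.updates = op.updates := by cases op <;> rfl

theorem Op.coarse_startSize_le (op : Op I) : op.coarse.startSize ≤ op.startSize := by
  cases op with
  | start l => exact max_le_max le_rfl (List.length_filter_le _ _)
  | update => exact le_rfl

/-- One induction collects what the three runs have in common: the own data are valid, the states
fit together, and the ledger pays for all starts. -/
theorem Coupled.inv {J : Joint I} (h : Coupled C R adv ωC ωR J) : J.Inv := by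
  induction h with
  | start =>
    refine ⟨.blank, rfl, ?_, ledger_blank, rfl, rfl, le_rfl, le_rfl, rfl, rfl, fun P h => by cases h⟩
    change State.blank = _
    rw [← join_blank]
    congr 1
    funext i
    cases i <;> rfl
  | @step J op X lC c kc r kr hJ hC hR ih =>
    have hs := ih.ownStep hC R
    refine ⟨hs.inv, rfl, rfl, hs.ledger _ _ _ _ ih.ledger, ?_, ?_, ?_, ?_, ?_, ?_, ?_⟩
    · simp only [Joint.next, Snapshot.next, ih.cost]; ring
    · simp only [Joint.next, Snapshot.next, ih.coarse_updates, Op.coarse_updates]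
    · exact Nat.add_le_add ih.coarse_start op.coarse_startSize_le
    · exact Nat.add_le_add ih.round_updates hs.updates
    · exact congrArg (· + 1) ih.coarse_length
    · exact congrArg (· + 1) ih.round_length
    · rintro P ⟨⟩
      exact hR.ok

theorem Coupled.length {J : Joint I} (h : Coupled C R adv ωC ωR J) :
    J.coarse.hist.length = J.whole.hist.length ∧ J.round.hist.length = J.whole.hist.length :=
  ⟨h.inv.coarse_length, h.inv.round_length⟩

/-- The joint run is a run of the combined machine. -/
theorem Coupled.reach {ω : Tape I.w} {J : Joint I}
    (h : Coupled C R adv (subTape .coarse ω) (subTape .round ω) J) :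
    Reach I (combine C R) (FracPromise I) adv ω J.whole := by
  induction h with
  | start => exact .start
  | @step J op X lC c kc r kr hJ hC hR ih =>
    have hs := hJ.inv.ownStep hC R
    refine .step ih hC.chosen hC.legal ?_
    rw [hJ.inv.state]
    exact hs.exec ω _ _ _ _ _ _ hC.exec hC.out hR.exec

/-- The adversary fixes the operation, determinism for given random words fixes the state, and the
output list can be read off the state. -/
theorem HalfStep.unique {J : Joint I} {op op' : Op I} {X X' : WordVec I} {lC lC' : List (Entry I)}
    {c c' : State} {kc kc' : ℕ} (h : HalfStep C adv ωC J op X lC c kc)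
    (h' : HalfStep C adv ωC J op' X' lC' c' kc') :
    op = op' ∧ X = X' ∧ lC = lC' ∧ c = c' ∧ kc = kc' := by
  obtain rfl := Option.some.inj (h.chosen.symm.trans h'.chosen)
  obtain rfl := h.legal.unique h'.legal
  obtain ⟨rfl, rfl⟩ := h.exec.unique h'.exec
  exact ⟨rfl, rfl, entries_injective (h.out.symm.trans h'.out), rfl, rfl⟩

/-- There is at most one joint snapshot after a given number of operations. -/
theorem Coupled.unique {J J' : Joint I} (h : Coupled C R adv ωC ωR J)
    (h' : Coupled C R adv ωC ωR J') (hl : J.whole.hist.length = J'.whole.hist.length) : J = J' := by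
  induction h generalizing J' with
  | start =>
    cases h' with
    | start => rfl
    | step => cases hl
  | step hJ hC hR ih =>
    cases h' with
    | start => cases hl
    | step hJ' hC' hR' =>
      obtain rfl := ih hJ' (Nat.succ.inj hl)
      obtain ⟨rfl, rfl, rfl, rfl, rfl⟩ := hC.unique hC'
      obtain ⟨rfl, rfl⟩ := hR.exec.unique hR'.exec
      rfl

end Coupling

/-! ## What the adversaries see -/

section Views

variable {I : Params} {β : Type} {out : State → β}

/-- Two states look the same to an adversary. -/
def AdversaryKind.SameState (out : State → β) : AdversaryKind → State → State → Prop
  | .oblivious, _, _ => True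
  | .outputAdaptive, σ, σ' => out σ = out σ'
  | .adaptive, σ, σ' => σ = σ'

/-- Two histories look the same to an adversary. -/
def AdversaryKind.Same (out : State → β) : AdversaryKind → List State → List State → Prop
  | .oblivious, h, h' => h.length = h'.length
  | .outputAdaptive, h, h' => h.map out = h'.map out
  | .adaptive, h, h' => h = h'

variable {kind : AdversaryKind} {h h' h'' : List State}

theorem AdversaryKind.Same.refl (kind : AdversaryKind) (h : List State) : kind.Same out h h := by
  cases kind <;> rfl

theorem AdversaryKind.Same.symm (H : kind.Same out h h') : kind.Same out h' h := by
  cases kind <;> exact Eq.symm H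

theorem AdversaryKind.Same.trans (H : kind.Same out h h') (H' : kind.Same out h' h'') :
    kind.Same out h h'' := by
  cases kind <;> exact Eq.trans H H'

theorem AdversaryKind.Same.length (H : kind.Same out h h') : h.length = h'.length := by
  cases kind with
  | oblivious => exact H
  | outputAdaptive => simpa using congrArg List.length H
  | adaptive => exact congrArg List.length H

theorem AdversaryKind.same_cons {σ σ' : State} :
    kind.Same out (σ :: h) (σ' :: h') ↔ kind.SameState out σ σ' ∧ kind.Same out h h' := by
  cases kind <;> simp [Same, SameState]

theorem AdversaryKind.Admits.eq {adv : Adversary I} (H : kind.Admits out adv)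
    (hs : kind.Same out h h') : adv h = adv h' := by
  cases kind with
  | oblivious => exact H _ _ hs
  | outputAdaptive => exact H _ _ hs
  | adaptive => exact congrArg adv hs

theorem AdversaryKind.admits_of_same {adv : Adversary I}
    (H : ∀ h h', kind.Same out h h' → adv h = adv h') : kind.Admits out adv := by
  cases kind with
  | oblivious => exact H
  | outputAdaptive => exact H
  | adaptive => trivial

end Views

/-! ## The adversaries of the two algorithms -/

section Adversaries

variable {I : Params} {C R : Alg} {adv : Adversary I} {kind : AdversaryKind}
  {ωC ωC' ωR ωR' : Tape I.w}

/-- An output-adaptive adversary sees only the matching, which belongs to the rounding algorithm;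
only the adaptive one needs equal own data. -/
theorem sameState_join {o o' c c' r r' : State} (ho : kind ≠ .oblivious → o = o')
    (hc : kind.SameState outEntries c c') (hr : kind.SameState outEdges r r') :
    kind.SameState outEdges (join (parts o c r)) (join (parts o' c' r')) := by
  cases kind with
  | oblivious => trivial
  | outputAdaptive =>
    change outEdges _ = outEdges _
    rw [outEdges_join, outEdges_join]
    exact hr
  | adaptive =>
    obtain rfl := ho (by simp)
    cases hc
    cases hr
    rfl

theorem AdversaryKind.SameState.refl {β : Type} {out : State → β} (kind : AdversaryKind)
    (σ : State) : kind.SameState out σ σ := by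
  cases kind <;> trivial

/-- For given random words of the coarsening algorithm, the operations and the input of the
rounding algorithm depend only on what its adversary sees. -/
theorem Coupled.same_of_round (hadv : kind.Admits outEdges adv) {J J' : Joint I}
    (h : Coupled C R adv ωC ωR J) (h' : Coupled C R adv ωC ωR' J')
    (hs : kind.Same outEdges J.round.hist J'.round.hist) :
    J.own = J'.own ∧ J.whole.vec = J'.whole.vec ∧ J.coarse = J'.coarse ∧
      J.round.vec = J'.round.vec ∧ kind.Same outEdges J.whole.hist J'.whole.hist := by
  induction h generalizing J' with
  | start =>
    cases h' with
    | start => exact ⟨rfl, rfl, rfl, rfl, hs⟩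
    | step => exact absurd hs.length (by simp [Joint.next, Snapshot.next, Snapshot.blank])
  | @step J op X lC c kc r kr hJ hC hR ih =>
    cases h' with
    | start => exact absurd hs.length (by simp [Joint.next, Snapshot.next, Snapshot.blank])
    | @step J' op' X' lC' c' kc' r' kr' hJ' hC' hR' =>
      obtain ⟨hr, hs⟩ := AdversaryKind.same_cons.1 hs
      obtain ⟨e1, e2, e3, e4, e5⟩ := ih hJ' hs
      have hchosen := hC.chosen
      have hlegal := hC.legal
      have hexec := hC.exec
      rw [hadv.eq e5] at hchosen
      rw [e2] at hlegal
      rw [e3] at hexec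
      obtain ⟨rfl, rfl, rfl, rfl, rfl⟩ :=
        HalfStep.unique ⟨hchosen, hlegal, hexec, hC.out, hC.coarse⟩ hC'
      -- Besides the operation and the coarsening, the choice reads only the own data and the two
      -- current vectors, which agree.
      have hch : J.choice C R op X lC = J'.choice C R op X lC := by
        unfold Joint.choice; rw [e1, e2, e4]
      refine ⟨?_, rfl, ?_, ?_, AdversaryKind.same_cons.2 ⟨sameState_join ?_ (.refl _ _) hr, e5⟩⟩
      · simp only [Joint.next, hch]
      · simp only [Joint.next, e3]
      · simp only [Joint.next, Snapshot.next, hch]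
      · intro _; rw [hch]

/-- For given random words of the rounding algorithm, the operations depend only on what the
adversary of the coarsening algorithm sees. -/
theorem Coupled.same_of_coarse (hadv : kind.Admits outEdges adv) {J J' : Joint I}
    (h : Coupled C R adv ωC ωR J) (h' : Coupled C R adv ωC' ωR J')
    (hs : kind.Same outEntries J.coarse.hist J'.coarse.hist) :
    J.whole.vec = J'.whole.vec ∧ kind.Same outEdges J.whole.hist J'.whole.hist ∧
      (kind ≠ .oblivious → J.own = J'.own ∧ J.round = J'.round) := by
  induction h generalizing J' with
  | start =>
    cases h' with
    | start => exact ⟨rfl, .refl _ _, fun _ => ⟨rfl, rfl⟩⟩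
    | step => exact absurd hs.length (by simp [Joint.next, Snapshot.next, Snapshot.blank])
  | @step J op X lC c kc r kr hJ hC hR ih =>
    cases h' with
    | start => exact absurd hs.length (by simp [Joint.next, Snapshot.next, Snapshot.blank])
    | @step J' op' X' lC' c' kc' r' kr' hJ' hC' hR' =>
      obtain ⟨hc, hs⟩ := AdversaryKind.same_cons.1 hs
      obtain ⟨e1, e2, e3⟩ := ih hJ' hs
      have hchosen := hC.chosen
      have hlegal := hC.legal
      rw [hadv.eq e2, hC'.chosen] at hchosen
      obtain rfl := Option.some.inj hchosen
      rw [e1] at hlegal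
      obtain rfl := hlegal.unique hC'.legal
      -- Against an oblivious adversary the two coarsenings may differ, and the rounding runs with
      -- them; then only the sequence of operations has to agree. Otherwise the visible output fixes
      -- the coarsening, and with `ωR` fixed the rounding run too.
      have key : kind ≠ .oblivious → J.choice C R op' X lC = J'.choice C R op' X lC' ∧
          r = r' ∧ kr = kr' := by
        intro hk
        obtain ⟨f1, f2⟩ := e3 hk
        have hout : outEntries c = outEntries c' := by
          cases kind with
          | oblivious => exact absurd rfl hk
          | outputAdaptive => exact hc
          | adaptive => exact congrArg outEntries hc
        rw [hC.out, hC'.out] at hout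
        obtain rfl := entries_injective hout
        have hch : J.choice C R op' X lC = J'.choice C R op' X lC := by
          unfold Joint.choice; rw [e1, f1, f2]
        have hr := hR.exec
        rw [hch, f2] at hr
        exact ⟨hch, hr.unique hR'.exec⟩
      refine ⟨rfl, AdversaryKind.same_cons.2 ⟨sameState_join ?_ hc ?_, e2⟩, fun hk => ⟨?_, ?_⟩⟩
      · intro hk; rw [(key hk).1]
      · by_cases hk : kind = .oblivious
        · subst hk; trivial
        · rw [(key hk).2.1]; exact .refl _ _
      · simp only [Joint.next, (key hk).1]
      · simp only [Joint.next, (key hk).1, (key hk).2.1, (key hk).2.2, (e3 hk).2]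

variable (C R adv kind)

/-- The operation that the adversary of the coarsening algorithm may choose, for given random words
of the rounding algorithm. -/
def CoarseMove (ωR : Tape I.w) (h : List State) (op : Op I) : Prop :=
  ∃ ωC J X, Coupled C R adv ωC ωR J ∧ kind.Same outEntries h J.coarse.hist ∧
    adv J.whole.hist = some op ∧ Legal (FracPromise I) J.whole.vec op X

open Classical in
/-- The adversary of the coarsening algorithm, for given random words of the rounding algorithm. -/
noncomputable def coarseAdv (ωR : Tape I.w) : Adversary I := fun h =>
  if H : ∃ op, CoarseMove C R adv kind ωR h op then some H.choose.coarse else none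

/-- The operation that the adversary of the rounding algorithm may choose, for given random words
of the coarsening algorithm. -/
def RoundMove (ωC : Tape I.w) (h : List State) (rop : Op I) : Prop :=
  ∃ ωR J op X lC c kc, Coupled C R adv ωC ωR J ∧ kind.Same outEdges h J.round.hist ∧
    HalfStep C adv ωC J op X lC c kc ∧ rop = (J.choice C R op X lC).op

open Classical in
/-- The adversary of the rounding algorithm, for given random words of the coarsening algorithm. -/
noncomputable def roundAdv (ωC : Tape I.w) : Adversary I := fun h =>
  if H : ∃ rop, RoundMove C R adv kind ωC h rop then some H.choose else none

variable {C R adv kind}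

/-- The move is selected among all joint runs that look the same to an adversary of this kind, so it
depends on the history only through that view. -/
theorem coarseAdv_admits : kind.Admits outEntries (coarseAdv C R adv kind ωR) := by
  refine AdversaryKind.admits_of_same fun h h' hs => ?_
  have : CoarseMove C R adv kind ωR h = CoarseMove C R adv kind ωR h' := by
    funext op
    refine propext ⟨?_, ?_⟩
    · rintro ⟨ωC, J, X, h1, h2, h3⟩; exact ⟨ωC, J, X, h1, hs.symm.trans h2, h3⟩
    · rintro ⟨ωC, J, X, h1, h2, h3⟩; exact ⟨ωC, J, X, h1, hs.trans h2, h3⟩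
  unfold coarseAdv
  rw [this]

theorem roundAdv_admits : kind.Admits outEdges (roundAdv C R adv kind ωC) := by
  refine AdversaryKind.admits_of_same fun h h' hs => ?_
  have : RoundMove C R adv kind ωC h = RoundMove C R adv kind ωC h' := by
    funext op
    refine propext ⟨?_, ?_⟩
    · rintro ⟨ωR, J, a, b, c, d, e, h1, h2, h3⟩
      exact ⟨ωR, J, a, b, c, d, e, h1, hs.symm.trans h2, h3⟩
    · rintro ⟨ωR, J, a, b, c, d, e, h1, h2, h3⟩
      exact ⟨ωR, J, a, b, c, d, e, h1, hs.trans h2, h3⟩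
  unfold roundAdv
  rw [this]

/-- All joint runs with the same view have the same next operation, so the arbitrary selection is
forced to be the right one. -/
theorem CoarseMove.choose (hadv : kind.Admits outEdges adv) {J : Joint I}
    (hJ : Coupled C R adv ωC ωR J) {op : Op I}
    (h : CoarseMove C R adv kind ωR J.coarse.hist op) :
    adv J.whole.hist = some op ∧ ∃ X, Legal (FracPromise I) J.whole.vec op X := by
  obtain ⟨ωC', J', X, h1, h2, h3, h4⟩ := h
  obtain ⟨e1, e2, -⟩ := hJ.same_of_coarse hadv h1 h2
  exact ⟨by rw [hadv.eq e2, h3], X, by rwa [e1]⟩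

theorem coarseAdv_eq (hadv : kind.Admits outEdges adv) {J : Joint I}
    (hJ : Coupled C R adv ωC ωR J) {op : Op I} {X : WordVec I} (hop : adv J.whole.hist = some op)
    (hX : Legal (FracPromise I) J.whole.vec op X) :
    coarseAdv C R adv kind ωR J.coarse.hist = some op.coarse := by
  have H : ∃ op, CoarseMove C R adv kind ωR J.coarse.hist op :=
    ⟨op, ωC, J, X, hJ, .refl _ _, hop, hX⟩
  have h1 := (H.choose_spec.choose hadv hJ).1
  rw [hop] at h1
  rw [coarseAdv, dif_pos H, ← Option.some.inj h1]

theorem exists_of_coarseAdv (hadv : kind.Admits outEdges adv) {J : Joint I}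
    (hJ : Coupled C R adv ωC ωR J) {cop : Op I}
    (h : coarseAdv C R adv kind ωR J.coarse.hist = some cop) :
    ∃ op X, adv J.whole.hist = some op ∧ Legal (FracPromise I) J.whole.vec op X ∧
      cop = op.coarse := by
  unfold coarseAdv at h
  split_ifs at h with H
  obtain ⟨h1, X, h2⟩ := H.choose_spec.choose hadv hJ
  exact ⟨_, X, h1, h2, (Option.some.inj h).symm⟩

theorem RoundMove.choose (hadv : kind.Admits outEdges adv) {J : Joint I}
    (hJ : Coupled C R adv ωC ωR J) {rop : Op I}
    (h : RoundMove C R adv kind ωC J.round.hist rop) :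
    ∃ op X lC c kc, HalfStep C adv ωC J op X lC c kc ∧ rop = (J.choice C R op X lC).op := by
  obtain ⟨ωR', J', op, X, lC, c, kc, h1, h2, h3, rfl⟩ := h
  obtain ⟨e1, e2, e3, e4, e5⟩ := hJ.same_of_round hadv h1 h2
  refine ⟨op, X, lC, c, kc, ⟨?_, ?_, ?_, h3.out, h3.coarse⟩, ?_⟩
  · rw [hadv.eq e5, h3.chosen]
  · rw [e2]; exact h3.legal
  · rw [e3]; exact h3.exec
  · unfold Joint.choice; rw [e1, e2, e4]

theorem roundAdv_eq (hadv : kind.Admits outEdges adv) {J : Joint I}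
    (hJ : Coupled C R adv ωC ωR J) {op : Op I} {X : WordVec I} {lC : List (Entry I)} {c : State}
    {kc : ℕ} (hC : HalfStep C adv ωC J op X lC c kc) :
    roundAdv C R adv kind ωC J.round.hist = some (J.choice C R op X lC).op := by
  have H : ∃ rop, RoundMove C R adv kind ωC J.round.hist rop :=
    ⟨_, ωR, J, op, X, lC, c, kc, hJ, .refl _ _, hC, rfl⟩
  obtain ⟨op', X', lC', c', kc', h1, h2⟩ := H.choose_spec.choose hadv hJ
  obtain ⟨rfl, rfl, rfl, rfl, rfl⟩ := hC.unique h1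
  rw [roundAdv, dif_pos H, h2]

theorem exists_of_roundAdv (hadv : kind.Admits outEdges adv) {J : Joint I}
    (hJ : Coupled C R adv ωC ωR J) {rop : Op I}
    (h : roundAdv C R adv kind ωC J.round.hist = some rop) :
    ∃ op X lC c kc, HalfStep C adv ωC J op X lC c kc ∧ rop = (J.choice C R op X lC).op := by
  unfold roundAdv at h
  split_ifs at h with H
  obtain ⟨op, X, lC, c, kc, h1, h2⟩ := H.choose_spec.choose hadv hJ
  exact ⟨op, X, lC, c, kc, h1, (Option.some.inj h).symm.trans h2⟩

/-- The joint run contains a run of the coarsening algorithm. -/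
theorem Coupled.reach_coarse (hadv : kind.Admits outEdges adv) {J : Joint I}
    (h : Coupled C R adv ωC ωR J) :
    Reach I C (FracPromise I) (coarseAdv C R adv kind ωR) ωC J.coarse := by
  induction h with
  | start => exact .start
  | @step J op X lC c kc r kr hJ hC hR ih =>
    refine .step ih (coarseAdv_eq hadv hJ hC.chosen hC.legal) ?_ hC.exec
    rw [hJ.inv.vec]
    exact hC.legal.coarse

/-- The joint run contains a run of the rounding algorithm. -/
theorem Coupled.reach_round (hadv : kind.Admits outEdges adv) {J : Joint I}
    (h : Coupled C R adv ωC ωR J) :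
    Reach I R (HeavyPromise I) (roundAdv C R adv kind ωC) ωR J.round := by
  induction h with
  | start => exact .start
  | @step J op X lC c kc r kr hJ hC hR ih =>
    exact .step ih (roundAdv_eq hadv hJ hC) (hJ.inv.ownStep hC R).legal hR.exec

/-- The joint run is never stuck. -/
def Good (C R : Alg) (adv : Adversary I) (ωC ωR : Tape I.w) : Prop :=
  ∀ J op X, Coupled C R adv ωC ωR J → adv J.whole.hist = some op →
    Legal (FracPromise I) J.whole.vec op X →
    ∃ lC c kc r kr, HalfStep C adv ωC J op X lC c kc ∧ RoundStep C R ωR J op X lC r kr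

/-- Every run of the combined machine comes from a joint run. -/
theorem exists_coupled_whole {ω : Tape I.w}
    (hG : Good C R adv (subTape .coarse ω) (subTape .round ω)) {s : Snapshot I}
    (h : Reach I (combine C R) (FracPromise I) adv ω s) :
    ∃ J, Coupled C R adv (subTape .coarse ω) (subTape .round ω) J ∧ J.whole = s := by
  induction h with
  | start => exact ⟨_, .start, rfl⟩
  | @step s op X σ k hs hop hX hσ ih =>
    obtain ⟨J, hJ, rfl⟩ := ih
    obtain ⟨lC, c, kc, r, kr, hC, hR⟩ := hG J op X hJ hop hX
    refine ⟨_, hJ.step hC hR, ?_⟩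
    have hx := (hJ.inv.ownStep hC R).exec ω _ _ _ _ _ _ hC.exec hC.out hR.exec
    rw [← hJ.inv.state] at hx
    obtain ⟨rfl, rfl⟩ := hσ.unique hx
    rfl

/-- Every run of the coarsening algorithm comes from a joint run. -/
theorem exists_coupled_coarse (hadv : kind.Admits outEdges adv) (hG : Good C R adv ωC ωR)
    {s : Snapshot I} (h : Reach I C (FracPromise I) (coarseAdv C R adv kind ωR) ωC s) :
    ∃ J, Coupled C R adv ωC ωR J ∧ J.coarse = s := by
  induction h with
  | start => exact ⟨_, .start, rfl⟩
  | @step s cop X σ k hs hop hX hσ ih =>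
    obtain ⟨J, hJ, rfl⟩ := ih
    obtain ⟨op, Y, h1, h2, rfl⟩ := exists_of_coarseAdv hadv hJ hop
    obtain ⟨lC, c, kc, r, kr, hC, hR⟩ := hG J op Y hJ h1 h2
    refine ⟨_, hJ.step hC hR, ?_⟩
    obtain ⟨rfl, rfl⟩ := hσ.unique hC.exec
    have hY := h2.coarse
    rw [← hJ.inv.vec] at hY
    obtain rfl := hX.unique hY
    rfl

/-- Every run of the rounding algorithm comes from a joint run. -/
theorem exists_coupled_round (hadv : kind.Admits outEdges adv) (hG : Good C R adv ωC ωR)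
    {s : Snapshot I} (h : Reach I R (HeavyPromise I) (roundAdv C R adv kind ωC) ωR s) :
    ∃ J, Coupled C R adv ωC ωR J ∧ J.round = s := by
  induction h with
  | start => exact ⟨_, .start, rfl⟩
  | @step s rop P σ k hs hop hX hσ ih =>
    obtain ⟨J, hJ, rfl⟩ := ih
    obtain ⟨op, X, lC, c, kc, hC, rfl⟩ := exists_of_roundAdv hadv hJ hop
    obtain ⟨lC', c', kc', r, kr, hC', hR⟩ := hG J op X hJ hC.chosen hC.legal
    obtain ⟨-, -, rfl, rfl, rfl⟩ := hC.unique hC'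
    refine ⟨_, hJ.step hC hR, ?_⟩
    obtain ⟨rfl, rfl⟩ := hσ.unique hR.exec
    obtain rfl := hX.unique (hJ.inv.ownStep hC R).legal
    rfl

end Adversaries

/-! ## The joint run almost surely goes on -/

section AlmostSure

open Filter Topology

variable {I : Params} {C R : Alg} {adv : Adversary I} {kind : AdversaryKind} {ωC ωR : Tape I.w}

theorem HalfStep.eventually {J : Joint I} {op : Op I} {X : WordVec I} {lC : List (Entry I)}
    {c : State} {kc : ℕ} (h : HalfStep C adv ωC J op X lC c kc) :
    ∀ᶠ ω in 𝓝 ωC, HalfStep C adv ω J op X lC c kc := by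
  filter_upwards [h.exec.eventually] with ω hω using ⟨h.chosen, h.legal, hω, h.out, h.coarse⟩

theorem RoundStep.eventually {J : Joint I} {op : Op I} {X : WordVec I} {lC : List (Entry I)}
    {r : State} {kr : ℕ} (h : RoundStep C R ωR J op X lC r kr) :
    ∀ᶠ ω in 𝓝 ωR, RoundStep C R ω J op X lC r kr := by
  filter_upwards [h.exec.eventually] with ω hω using ⟨hω, h.ok⟩

theorem Coupled.eventually {J : Joint I} (h : Coupled C R adv ωC ωR J) :
    ∀ᶠ z in 𝓝 (ωC, ωR), Coupled C R adv z.1 z.2 J := by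
  induction h with
  | start => exact .of_forall fun _ => .start
  | step hJ hC hR ih =>
    filter_upwards [ih, continuous_fst.continuousAt.eventually hC.eventually,
      continuous_snd.continuousAt.eventually hR.eventually] with z h1 h2 h3 using .step h1 h2 h3

variable (C R adv)

/-- The random words for which operation number `t` is invoked. -/
def Invoked (t : ℕ) : Set (Tape I.w × Tape I.w) :=
  {z | ∃ J op X, Coupled C R adv z.1 z.2 J ∧ J.whole.hist.length = t ∧
    adv J.whole.hist = some op ∧ Legal (FracPromise I) J.whole.vec op X}

/-- The random words for which the coarsening algorithm completes operation number `t`. -/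
def HalfDone (t : ℕ) : Set (Tape I.w × Tape I.w) :=
  {z | ∃ J op X lC c kc, Coupled C R adv z.1 z.2 J ∧ J.whole.hist.length = t ∧
    HalfStep C adv z.1 J op X lC c kc}

/-- The random words for which both algorithms complete operation number `t`. -/
def Done (t : ℕ) : Set (Tape I.w × Tape I.w) :=
  {z | ∃ J op X lC c kc r kr, Coupled C R adv z.1 z.2 J ∧ J.whole.hist.length = t ∧
    HalfStep C adv z.1 J op X lC c kc ∧ RoundStep C R z.2 J op X lC r kr}

theorem isOpen_invoked (t : ℕ) : IsOpen (Invoked C R adv t) := by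
  rw [isOpen_iff_eventually]
  rintro z ⟨J, op, X, h1, h2⟩
  filter_upwards [h1.eventually] with z' h using ⟨J, op, X, h, h2⟩

theorem isOpen_halfDone (t : ℕ) : IsOpen (HalfDone C R adv t) := by
  rw [isOpen_iff_eventually]
  rintro z ⟨J, op, X, lC, c, kc, h1, h2, h3⟩
  filter_upwards [h1.eventually, continuous_fst.continuousAt.eventually h3.eventually]
    with z' h h' using ⟨J, op, X, lC, c, kc, h, h2, h'⟩

theorem isOpen_done (t : ℕ) : IsOpen (Done C R adv t) := by
  rw [isOpen_iff_eventually]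
  rintro z ⟨J, op, X, lC, c, kc, r, kr, h1, h2, h3, h4⟩
  filter_upwards [h1.eventually, continuous_fst.continuousAt.eventually h3.eventually,
    continuous_snd.continuousAt.eventually h4.eventually]
    with z' h h' h'' using ⟨J, op, X, lC, c, kc, r, kr, h, h2, h', h''⟩

variable {C R adv}

/-- For fixed words of the rounding algorithm, correctness against `coarseAdv` makes the bad set of
`ωC` null. Tonelli's theorem then makes it null in the product. -/
theorem ae_halfDone {tU tI : ℝ} (hadv : kind.Admits outEdges adv)
    (hC : IsDynCoarsening I C kind I.eps I.delta tU tI) (t : ℕ) :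
    ∀ᵐ z ∂(tapeMeasure I.w).prod (tapeMeasure I.w), z ∈ Invoked C R adv t → z ∈ HalfDone C R adv t := by
  -- A difference of open sets, hence measurable, as Tonelli's theorem requires.
  have hm : MeasurableSet (Invoked C R adv t \ HalfDone C R adv t) :=
    (isOpen_invoked C R adv t).measurableSet.diff (isOpen_halfDone C R adv t).measurableSet
  have h0 : ((tapeMeasure I.w).prod (tapeMeasure I.w))
      (Invoked C R adv t \ HalfDone C R adv t) = 0 := by
    rw [Measure.prod_apply_symm hm, lintegral_eq_zero_of_ae_eq_zero]
    refine .of_forall fun ωR => ?_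
    refine measure_mono_null ?_ (ae_iff.1 (hC.correct _ (coarseAdv_admits (C := C) (R := R)
      (adv := adv) (ωR := ωR))))
    rintro ωC ⟨⟨J, op, X, h1, h2, h3, h4⟩, hn⟩ hgood
    have hreach := h1.reach_coarse hadv
    have hop := coarseAdv_eq hadv h1 h3 h4
    have hX : Legal (FracPromise I) J.coarse.vec op.coarse (small X) := by
      rw [h1.inv.vec]; exact h4.coarse
    obtain ⟨σ, k, hx⟩ := (hgood _ hreach).2 _ _ hop hX
    obtain ⟨l, hl1, hl2, hl3⟩ := (hgood _ (hreach.step hop hX hx)).1 _ rfl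
    exact hn ⟨J, op, X, l, σ, k, h1, h2, h3, h4, hx, hl2, hl1, hl3⟩
  filter_upwards [measure_eq_zero_iff_ae_notMem.1 h0] with z hz h
  by_contra hn
  exact hz ⟨h, hn⟩

/-- The same argument with the roles exchanged: the words of the coarsening algorithm are fixed. -/
theorem ae_done {tU tI : ℝ} (hadv : kind.Admits outEdges adv)
    (hR : IsDynRounding I R kind I.eps I.delta tU tI) (t : ℕ) :
    ∀ᵐ z ∂(tapeMeasure I.w).prod (tapeMeasure I.w), z ∈ HalfDone C R adv t → z ∈ Done C R adv t := by
  have hm : MeasurableSet (HalfDone C R adv t \ Done C R adv t) :=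
    (isOpen_halfDone C R adv t).measurableSet.diff (isOpen_done C R adv t).measurableSet
  have h0 : ((tapeMeasure I.w).prod (tapeMeasure I.w))
      (HalfDone C R adv t \ Done C R adv t) = 0 := by
    rw [Measure.prod_apply hm, lintegral_eq_zero_of_ae_eq_zero]
    refine .of_forall fun ωC => ?_
    refine measure_mono_null ?_ (ae_iff.1 (hR.correct _ (roundAdv_admits (C := C) (R := R)
      (adv := adv) (ωC := ωC))))
    rintro ωR ⟨⟨J, op, X, lC, c, kc, h1, h2, h3⟩, hn⟩ hgood
    have hreach := h1.reach_round hadv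
    have hop := roundAdv_eq hadv h1 h3
    have hX := (h1.inv.ownStep h3 R).legal
    obtain ⟨σ, k, hx⟩ := (hgood _ hreach).2 _ _ hop hX
    exact hn ⟨J, op, X, lC, c, kc, σ, k, h1, h2, h3, hx,
      (hgood _ (hreach.step hop hX hx)).1 _ rfl⟩
  filter_upwards [measure_eq_zero_iff_ae_notMem.1 h0] with z hz h
  by_contra hn
  exact hz ⟨h, hn⟩

/-- The events for the single operations are countably many, and determinism identifies the joint
snapshot reached after a given number of operations. -/
theorem ae_good {tUC tIC tUR tIR : ℝ} (hadv : kind.Admits outEdges adv)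
    (hC : IsDynCoarsening I C kind I.eps I.delta tUC tIC)
    (hR : IsDynRounding I R kind I.eps I.delta tUR tIR) :
    ∀ᵐ z ∂(tapeMeasure I.w).prod (tapeMeasure I.w), Good C R adv z.1 z.2 := by
  filter_upwards [ae_all_iff.2 (ae_halfDone (R := R) hadv hC), ae_all_iff.2 (ae_done (C := C) hadv hR)]
    with z hz1 hz2 J op X hJ hop hX
  obtain ⟨J', op', X', lC, c, kc, r, kr, h1, h2, h3, h4⟩ :=
    hz2 _ (hz1 J.whole.hist.length ⟨J, op, X, hJ, rfl, hop, hX⟩)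
  obtain rfl := hJ.unique h1 h2.symm
  obtain rfl := Option.some.inj (hop.symm.trans h3.chosen)
  obtain rfl := hX.unique h3.legal
  exact ⟨lC, c, kc, r, kr, h3, h4⟩

end AlmostSure

/-! ## Running times -/

section Time

open Filter Topology

variable {I : Params} {C R : Alg} {adv : Adversary I} {kind : AdversaryKind}

variable (C R adv) in
/-- The supremum of a quantity over the joint run of the first `T` operations. -/
noncomputable def runSup (T : ℕ) (f : Joint I → ENNReal) (z : Tape I.w × Tape I.w) : ENNReal :=
  ⨆ (J : Joint I) (_ : Coupled C R adv z.1 z.2 J ∧ J.whole.hist.length ≤ T), f J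

/-- A joint snapshot that is reached stays reached for nearby random words, so the supremum is lower
semicontinuous even though it ranges over uncountably many snapshots. -/
theorem measurable_runSup (T : ℕ) (f : Joint I → ENNReal) : Measurable (runSup C R adv T f) := by
  refine LowerSemicontinuous.measurable (lowerSemicontinuous_iSup fun J => ?_)
  intro z y (hy : y < ⨆ _, f J)
  change ∀ᶠ x in 𝓝 z, y < ⨆ _, f J
  by_cases h : Coupled C R adv z.1 z.2 J ∧ J.whole.hist.length ≤ T
  · rw [iSup_pos h] at hy
    filter_upwards [h.1.eventually] with z' hz'
    rwa [iSup_pos ⟨hz', h.2⟩]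
  · rw [iSup_neg h] at hy
    exact absurd hy not_lt_zero

theorem le_runSup {T : ℕ} (f : Joint I → ENNReal) {z : Tape I.w × Tape I.w} {J : Joint I}
    (hJ : Coupled C R adv z.1 z.2 J) (hT : J.whole.hist.length ≤ T) : f J ≤ runSup C R adv T f z :=
  le_iSup₂_of_le J ⟨hJ, hT⟩ le_rfl

theorem runSup_le {T : ℕ} {f : Joint I → ENNReal} {z : Tape I.w × Tape I.w} {b : ENNReal}
    (h : ∀ J, Coupled C R adv z.1 z.2 J → J.whole.hist.length ≤ T → f J ≤ b) :
    runSup C R adv T f z ≤ b :=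
  iSup₂_le fun J hJ => h J hJ.1 hJ.2

/-- Integrate first over the words of the coarsening algorithm: for fixed `ωR` its runs against
`coarseAdv` are exactly those occurring in joint runs, up to a null set. -/
theorem coarse_time {tU tI : ℝ} (hadv : kind.Admits outEdges adv)
    (hC : IsDynCoarsening I C kind I.eps I.delta tU tI)
    (hG : ∀ᵐ z ∂(tapeMeasure I.w).prod (tapeMeasure I.w), Good C R adv z.1 z.2) (T : ℕ) :
    ∫⁻ z, runSup C R adv T (fun J => J.coarse.cost) z ∂(tapeMeasure I.w).prod (tapeMeasure I.w) ≤
      ∫⁻ z, runSup C R adv T (fun J => ENNReal.ofReal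
        (tU * J.coarse.updates + tI * J.coarse.startSize)) z
        ∂(tapeMeasure I.w).prod (tapeMeasure I.w) := by
  rw [lintegral_prod_symm _ (measurable_runSup T _).aemeasurable,
    lintegral_prod_symm _ (measurable_runSup T _).aemeasurable]
  have hG' := Measure.ae_ae_of_ae_prod (Measure.measurePreserving_swap.quasiMeasurePreserving.ae hG)
  refine lintegral_mono_ae ?_
  filter_upwards [hG'] with ωR hωR
  refine le_trans (lintegral_mono fun ωC => ?_) ((hC.time (coarseAdv C R adv kind ωR)
    coarseAdv_admits T).trans (lintegral_mono_ae ?_))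
  · refine runSup_le fun J hJ hT => ?_
    have hl := hJ.length.1
    exact le_iSup₂_of_le J.coarse ⟨hJ.reach_coarse hadv, by omega⟩ le_rfl
  · filter_upwards [hωR] with ωC hgood
    refine iSup₂_le fun s hs => ?_
    obtain ⟨J, hJ, rfl⟩ := exists_coupled_coarse hadv hgood hs.1
    have hl := hJ.length.1
    exact le_runSup (z := (ωC, ωR))
      (fun J => ENNReal.ofReal (tU * J.coarse.updates + tI * J.coarse.startSize)) hJ (by omega)

theorem round_time {tU tI : ℝ} (hadv : kind.Admits outEdges adv)
    (hR : IsDynRounding I R kind I.eps I.delta tU tI)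
    (hG : ∀ᵐ z ∂(tapeMeasure I.w).prod (tapeMeasure I.w), Good C R adv z.1 z.2) (T : ℕ) :
    ∫⁻ z, runSup C R adv T (fun J => J.round.cost) z ∂(tapeMeasure I.w).prod (tapeMeasure I.w) ≤
      ∫⁻ z, runSup C R adv T (fun J => ENNReal.ofReal
        (tU * J.round.updates + tI * J.round.startSize)) z
        ∂(tapeMeasure I.w).prod (tapeMeasure I.w) := by
  rw [lintegral_prod _ (measurable_runSup T _).aemeasurable,
    lintegral_prod _ (measurable_runSup T _).aemeasurable]
  refine lintegral_mono_ae ?_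
  filter_upwards [Measure.ae_ae_of_ae_prod hG] with ωC hωC
  refine le_trans (lintegral_mono fun ωR => ?_) ((hR.time (roundAdv C R adv kind ωC)
    roundAdv_admits T).trans (lintegral_mono_ae ?_))
  · refine runSup_le fun J hJ hT => ?_
    have hl := hJ.length.2
    exact le_iSup₂_of_le J.round ⟨hJ.reach_round hadv, by omega⟩ le_rfl
  · filter_upwards [hωC] with ωR hgood
    refine iSup₂_le fun s hs => ?_
    obtain ⟨J, hJ, rfl⟩ := exists_coupled_round hadv hgood hs.1
    have hl := hJ.length.2
    exact le_runSup (z := (ωC, ωR))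
      (fun J => ENNReal.ofReal (tU * J.round.updates + tI * J.round.startSize)) hJ (by omega)

end Time

/-! ## The combined algorithm -/

section Main

variable {I : Params} {C R : Alg} {adv : Adversary I} {kind : AdversaryKind} {ωC ωR : Tape I.w}

theorem eps_lt_one (I : Params) : I.eps < 1 := by
  unfold Params.eps
  rw [div_lt_one (by positivity)]
  exact_mod_cast I.e_lt

/-- As ε ≤ 1, the additional U in the ledger is absorbed into a second copy of U/ε. -/
theorem Ledger.startSize_le_real {x : Option (WordVec I)} {o : State} {U S SR W : ℕ}
    (h : Ledger x o U S SR W) : (SR : ℝ) ≤ 2 * (I.eps⁻¹ * U) + S := by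
  have hq : (0 : ℝ) < 2 ^ I.F := by positivity
  have he : (0 : ℝ) < I.e := by exact_mod_cast I.e_pos
  have h1 : (I.e : ℝ) * SR ≤ 2 ^ I.F * U + I.e * (U + S) := by exact_mod_cast h.startSize_le
  have h2 : (I.e : ℝ) ≤ 2 ^ I.F := by exact_mod_cast I.e_lt.le
  have h3 : I.eps⁻¹ = 2 ^ I.F / I.e := by rw [Params.eps, inv_div]
  have h4 : (I.e : ℝ) * U ≤ 2 ^ I.F * U := by gcongr
  rw [h3, ← mul_le_mul_iff_right₀ he]
  have h5 : (I.e : ℝ) * (2 * (2 ^ I.F / I.e * U) + S) = 2 * (2 ^ I.F * U) + I.e * S := by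
    field_simp
  rw [h5]
  linarith

/-- The bounds for the numbers of steps in terms of the operations of the combined machine. -/
theorem Coupled.bounds {J : Joint I} (h : Coupled C R adv ωC ωR J) {tUC tIC tUR tIR : ℝ}
    (h1 : 1 ≤ tUC) (h2 : 1 ≤ tIC) (h3 : 1 ≤ tUR) (h4 : 1 ≤ tIR) {b : ℝ}
    (hb : b = 3000 * (tUC + tUR + I.eps⁻¹ * tIR) * J.whole.updates +
      3000 * (tIR + tIC) * J.whole.startSize) :
    tUC * J.coarse.updates + tIC * J.coarse.startSize ≤ b ∧
      tUR * J.round.updates + tIR * J.round.startSize ≤ b ∧ (J.work : ℝ) ≤ b := by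
  have hi := h.inv
  have hS := hi.ledger.startSize_le_real
  have hW : (J.work : ℝ) ≤ 1000 * (J.whole.updates + J.whole.startSize + J.round.startSize) := by
    have := hi.ledger.work
    exact_mod_cast (Nat.le_add_right _ _).trans this
  have hcs : (J.coarse.startSize : ℝ) ≤ J.whole.startSize := by exact_mod_cast hi.coarse_start
  have hru : (J.round.updates : ℝ) ≤ J.whole.updates := by exact_mod_cast hi.round_updates
  rw [hi.coarse_updates]
  have hε : 1 ≤ I.eps⁻¹ := (one_le_inv₀ (eps_pos I)).2 (eps_lt_one I).le
  set U : ℝ := (J.whole.updates : ℝ)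
  set S : ℝ := (J.whole.startSize : ℝ)
  have hU : 0 ≤ U := Nat.cast_nonneg _
  have hS0 : 0 ≤ S := Nat.cast_nonneg _
  set q := I.eps⁻¹
  have k1 : 0 ≤ tUC * U := by positivity
  have k2 : 0 ≤ tUR * U := by positivity
  have k3 : 0 ≤ q * tIR * U := by positivity
  have k4 : 0 ≤ tIR * S := by positivity
  have k5 : 0 ≤ tIC * S := by positivity
  have k6 : U ≤ q * tIR * U := le_mul_of_one_le_left hU (one_le_mul_of_one_le_of_one_le hε h4)
  have k7 : S ≤ tIR * S := le_mul_of_one_le_left hS0 h4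
  have k8 : q * U ≤ q * tIR * U := by
    rw [mul_right_comm]; exact le_mul_of_one_le_right (by positivity) h4
  have hb' : b = 3000 * (tUC * U + tUR * U + q * tIR * U) + 3000 * (tIR * S + tIC * S) := by
    rw [hb]; ring
  refine ⟨?_, ?_, ?_⟩
  · have : tIC * J.coarse.startSize ≤ tIC * S := by gcongr
    linarith
  · have e1 : tUR * J.round.updates ≤ tUR * U := by gcongr
    have e2 : tIR * J.round.startSize ≤ tIR * (2 * (q * U) + S) := by gcongr
    have e3 : tIR * (2 * (q * U) + S) = 2 * (q * tIR * U) + tIR * S := by ring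
    linarith
  · linarith

theorem Coupled.roundOk {J : Joint I} (h : Coupled C R adv ωC ωR J) {X : WordVec I}
    (hX : J.whole.vec = some X) {K : ℝ} (hK : 2000 ≤ K) :
    RoundOk I (K * (I.eps + I.delta)) X (outEdges J.whole.state) := by
  have hi := h.inv
  rw [hi.state, outEdges_join]
  have hown := hi.own
  rw [hX] at hown
  generalize hP : J.round.vec = p at hown
  cases hown with
  | fine hf _ _ _ hP' =>
    obtain ⟨l, h1, h2, h3, h4⟩ := hi.out _ hP
    exact ⟨l, h1, h2, h3, hP'.rounding hf h4 hK⟩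
  | rough hf =>
    obtain ⟨l, h1, h2, h3, h4⟩ := hi.out _ hP
    exact ⟨l, h1, h2, h3, trivial_rounding hf h4 hK⟩

theorem combine_solves {tUC tIC tUR tIR : ℝ} (h1 : 1 ≤ tUC) (h2 : 1 ≤ tIC) (h3 : 1 ≤ tUR)
    (h4 : 1 ≤ tIR) (hC : IsDynCoarsening I C kind I.eps I.delta tUC tIC)
    (hR : IsDynRounding I R kind I.eps I.delta tUR tIR) :
    Solves I (combine C R) kind (FracPromise I) outEdges
      (RoundOk I (9000 * (I.eps + I.delta))) (9000 * (tUC + tUR + I.eps⁻¹ * tIR))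
      (9000 * (tIR + tIC)) where
  correct adv hadv := by
    filter_upwards [(measurePreserving_subTape I.w).quasiMeasurePreserving.ae (ae_good hadv hC hR)]
      with ω hG s hs
    obtain ⟨J, hJ, rfl⟩ := exists_coupled_whole hG hs
    refine ⟨fun X hX => hJ.roundOk hX (by norm_num), fun op X hop hX => ?_⟩
    obtain ⟨lC, c, kc, r, kr, hc, hr⟩ := hG J op X hJ hop hX
    have hx := (hJ.inv.ownStep hc R).exec ω _ _ _ _ _ _ hc.exec hc.out hr.exec
    rw [← hJ.inv.state] at hx
    exact ⟨_, _, hx⟩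
  time adv hadv T := by
    have hG := ae_good hadv hC hR
    have hmp := measurePreserving_subTape I.w
    -- A common bound for the own steps and for the budgets of the two algorithms; adding the three
    -- gives the factor 3 · 3000 = 9000.
    let b : Joint I → ℝ := fun J => 3000 * (tUC + tUR + I.eps⁻¹ * tIR) * J.whole.updates +
      3000 * (tIR + tIC) * J.whole.startSize
    let g : Joint I → ENNReal := fun J => ENNReal.ofReal (b J)
    let fC : Joint I → ENNReal := fun J => J.coarse.cost
    let fR : Joint I → ENNReal := fun J => J.round.cost
    let fW : Joint I → ENNReal := fun J => J.work
    set μ := (tapeMeasure I.w).prod (tapeMeasure I.w)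
    have hbound : ∀ (z : Tape I.w × Tape I.w) (f : Joint I → ℝ),
        (∀ J, Coupled C R adv z.1 z.2 J → f J ≤ b J) →
        runSup C R adv T (fun J => ENNReal.ofReal (f J)) z ≤ runSup C R adv T g z :=
      fun z f hf => runSup_le fun J hJ hT => (ENNReal.ofReal_le_ofReal (hf J hJ)).trans
        (le_runSup g hJ hT)
    have hA : ∫⁻ z, runSup C R adv T fC z ∂μ ≤ ∫⁻ z, runSup C R adv T g z ∂μ :=
      (coarse_time hadv hC hG T).trans <| lintegral_mono fun z => hbound z _ fun J hJ =>
        (hJ.bounds h1 h2 h3 h4 rfl).1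
    have hB : ∫⁻ z, runSup C R adv T fR z ∂μ ≤ ∫⁻ z, runSup C R adv T g z ∂μ :=
      (round_time hadv hR hG T).trans <| lintegral_mono fun z => hbound z _ fun J hJ =>
        (hJ.bounds h1 h2 h3 h4 rfl).2.1
    have hW : ∫⁻ z, runSup C R adv T fW z ∂μ ≤ ∫⁻ z, runSup C R adv T g z ∂μ := by
      refine lintegral_mono fun z => ?_
      have := hbound z (fun J => J.work) fun J hJ => (hJ.bounds h1 h2 h3 h4 rfl).2.2
      simpa only [ENNReal.ofReal_natCast] using this
    calc _ ≤ ∫⁻ ω, runSup C R adv T (fun J => J.whole.cost)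
          (subTape .coarse ω, subTape .round ω) ∂tapeMeasure I.w := by
          refine lintegral_mono_ae ?_
          filter_upwards [hmp.quasiMeasurePreserving.ae hG] with ω hgood
          refine iSup₂_le fun s hs => ?_
          obtain ⟨J, hJ, rfl⟩ := exists_coupled_whole hgood hs.1
          exact le_runSup (z := (subTape .coarse ω, subTape .round ω))
            (fun J => (J.whole.cost : ENNReal)) hJ hs.2
      _ = ∫⁻ z, runSup C R adv T (fun J => J.whole.cost) z ∂μ :=
          hmp.lintegral_comp (measurable_runSup T _)
      -- The supremum of a sum is at most the sum of the suprema.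
      _ ≤ ∫⁻ z, (runSup C R adv T fW z + runSup C R adv T fC z) + runSup C R adv T fR z ∂μ := by
          refine lintegral_mono fun z => runSup_le fun J hJ hT => ?_
          rw [hJ.inv.cost]
          push_cast
          exact add_le_add (add_le_add (le_runSup fW hJ hT) (le_runSup fC hJ hT))
            (le_runSup fR hJ hT)
      _ = (∫⁻ z, runSup C R adv T fW z ∂μ + ∫⁻ z, runSup C R adv T fC z ∂μ) +
          ∫⁻ z, runSup C R adv T fR z ∂μ := by
          rw [lintegral_add_right _ (measurable_runSup T _),
            lintegral_add_right _ (measurable_runSup T _)]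
      _ ≤ (∫⁻ z, runSup C R adv T g z ∂μ + ∫⁻ z, runSup C R adv T g z ∂μ) +
          ∫⁻ z, runSup C R adv T g z ∂μ := add_le_add (add_le_add hW hA) hB
      _ = ∫⁻ z, 3 * runSup C R adv T g z ∂μ := by
          rw [lintegral_const_mul _ (measurable_runSup T _)]
          ring
      _ = ∫⁻ ω, 3 * runSup C R adv T g (subTape .coarse ω, subTape .round ω) ∂tapeMeasure I.w :=
          (hmp.lintegral_comp ((measurable_runSup T _).const_mul 3)).symm
      -- Every joint run projects to a run of the combined machine, so this direction holds for all
      -- random words.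
      _ ≤ _ := by
          refine lintegral_mono fun ω => ?_
          simp only [runSup, ENNReal.mul_iSup]
          refine iSup₂_le fun J hJ => le_iSup₂_of_le J.whole ⟨hJ.1.reach, hJ.2⟩ ?_
          rw [show (3 : ENNReal) = ENNReal.ofReal 3 by norm_num, ← ENNReal.ofReal_mul (by norm_num)]
          refine ENNReal.ofReal_le_ofReal (le_of_eq ?_)
          simp only [b]
          ring

end Main

end DynMatching

open DynMatching in
theorem lemma4p1 :
    ∃ K : ℝ, 0 < K ∧ ∀ C R : Alg, ∃ Rstar : Alg,
      (C.Deterministic → R.Deterministic → Rstar.Deterministic) ∧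
      ∀ (I : Params) (kind : AdversaryKind) (tUC tIC tUR tIR : ℝ),
        1 ≤ tUC → 1 ≤ tIC → 1 ≤ tUR → 1 ≤ tIR →
        IsDynCoarsening I C kind I.eps I.delta tUC tIC →
        IsDynRounding I R kind I.eps I.delta tUR tIR →
        IsDynRounding I Rstar kind (K * (I.eps + I.delta)) 0
          (K * (tUC + tUR + I.eps⁻¹ * tIR)) (K * (tIR + tIC)) := by
  -- The running time dictates this constant; the quality of the matching needs only 2000.
  refine ⟨9000, by norm_num, fun C R => ⟨combine C R, combine_deterministic, ?_⟩⟩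
  intro I kind tUC tIC tUR tIR h1 h2 h3 h4 hC hR
  have hpromise : (fun X : WordVec I => IsFracMatching I.G X.toReal ∧
      ∀ e, X.toReal e ≠ 0 → 0 ≤ X.toReal e) = FracPromise I := by
    funext X
    exact propext ⟨fun h => h.1, fun h => ⟨h, fun e _ => h.nonneg e⟩⟩
  have h := combine_solves h1 h2 h3 h4 hC hR
  rw [← hpromise] at h
  exact h
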